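/- **Setting.** Let $\Theta\subseteq\mathbb{R}^d$ be convex with $\ell_2$-diameter at most $D$, let $\Pi$ be a set of decisions and $x_\pi\in\mathbb{R}^d$, $\|x_\pi\|_2\le 1$ ($\pi\in\Pi$). Let $\mathcal{M}=\{M_\theta:\theta\in\Theta\}$, where $M_\theta(\pi)=\mathcal{N}(\langle\theta,x_\pi\rangle,1)$ is the reward law of decision $\pi$. Assume that all means $f^{M}(\pi)=\mathbb{E}_{r\sim M(\pi)}[r]$, $M\in\mathcal M$, lie in $[0,1]$, that the true model $M^\star$ lies in $\mathcal{M}$, and that its optimal decision is unique. Let $\varepsilon\in(0,1/2]$, and let $\triangle_{\mathcal X}$ denote the probability distributions on $\mathcal X$. For a model $M$ let $\boldsymbol\pi_M$ be its set of optimal decisions, $\Delta^M(\pi)=\sup_{\pi'}f^M(\pi')-f^M(\pi)$, and let $\Delta^M_{\min}$ be the infimum of the positive values of $\Delta^M$ if $|\boldsymbol\pi_M|=1$, and $0$ otherwise. Let $\mathrm{Alt}(M)=\{M'\in\mathcal M:\boldsymbol\pi_M\cap\boldsymbol\pi_{M'}=\emptyset\}$ and $\mathrm{Alt}(\pi)=\{M\in\mathcal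 M:\pi\notin\boldsymbol\pi_M\}$. For $\eta:\Pi\to[0,\infty)$ put $\Delta^M(\eta)=\sum_\pi\eta(\pi)\Delta^M(\pi)$ and $I^M(\eta)=\inf_{M'\in\mathrm{Alt}(M)}\sum_\pi\eta(\pi)\,\mathrm{KL}(M(\pi)\|M'(\pi))$. * $g^M=\inf\{\Delta^M(\eta): I^M(\eta)\ge1\}$ is the Graves–Lai coefficient, and $g^\star=g^{M^\star}$. * $n^M_\epsilon$ is the least $n\ge 0$ such that every $\eta$ with $\Delta^M(\eta)\le(1+\epsilon)g^M$ and $I^M(\eta)\ge1-\epsilon$ satisfies $I^M(\eta')\ge1-2\epsilon$, where $\eta'=n$ on $\boldsymbol\pi_M$ and $\eta'=\eta$ elsewhere ($\infty$ if there is none). * For $\lambda\in\triangle_\Pi$, $\mathcal M^{\rm gl}_\epsilon(\lambda;\bar n)$ is the set of $M\in\mathcal M$ for which some real $n$ with $0<n\le\bar n$ satisfies $\Delta^M(\lambda)\le(1+\epsilon)g^M/n$ and $I^M(\lambda)\ge(1-\epsilon)/n$; and $\mathcal M^{\rm gl}_\epsilon(\lambda)=\mathcal M^{\rm gl}_\epsilon(\lambda;\infty)$.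 * For $\mathcal M_0\subseteq\mathcal M$, with $\sup\emptyset=0$ and $1/0=\infty$, $$\mathsf{AEC}_\epsilon(\mathcal M_0)=\sup_{\xi\in\triangle_{\mathcal M_0}}\ \inf_{\lambda,\omega\in\triangle_\Pi}\ \sup_{M\in\mathcal M_0\setminus\mathcal M^{\rm gl}_\epsilon(\lambda)}\frac1{\mathbb E_{\bar M\sim\xi}\mathbb E_{\pi\sim\omega}[\mathrm{KL}(\bar M(\pi)\|M(\pi))]}.$$ * $\mathcal M_{x,y}=\{M\in\mathcal M:\Delta^M_{\min}\ge x,\ n^M_{\varepsilon/36}\le y\}$. Write $\Delta^\star_{\min}=\Delta^{M^\star}_{\min}$, $n^\star_{\varepsilon/36}=n^{M^\star}_{\varepsilon/36}$, $\Delta_\star=\min\{\Delta^\star_{\min},1/n^\star_{\varepsilon/36}\}$ and $\mathcal M^\star=\mathcal M_{\Delta_\star,1/\Delta_\star}$. **The algorithm $\mathsf{AE}_\star^2$** (with growth parameters $\alpha_q=\frac14$, $\alpha_n=\frac18$, $\alpha_{\mathcal M}=\frac12$ and tempered aggregation as estimation oracle). Put $\delta=\varepsilon/(4+2\varepsilon)$,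 $q^s=1-s^{-1/4}$, $\mathsf n^s=s^{1/8}$. Explore rounds are counted by $s=1,2,\dots$; epoch $\ell\ge1$ consists of the explore rounds $s_\ell:=2^{\ell-1}\le s<2^\ell$. For each epoch, $\Delta^\ell=\inf\{\Delta\ge0:\mathsf{AEC}_{\delta/2}(\mathcal M_{\Delta,1/\Delta})\le s_\ell^{1/2}\}$; $\mathcal M^\ell$ is the set of $M\in\mathcal M_{\Delta^\ell,1/\Delta^\ell}$ with $n^M_{\varepsilon/36}+\frac1{\Delta^M_{\min}}+\frac{4g^M}{\Delta^M_{\min}}+\frac{2n^M_{\varepsilon/36}}{g^M}+\frac4{\Delta^M_{\min}\delta}\le\sqrt{\mathsf n^{s_\ell}}$; and $\mathcal M^\ell_{\rm cov}$ is a smallest $(2^{-\ell},2^{-5\ell})$-cover of $\mathcal M^\ell$. Here $\mathcal C$ is a $(\rho,\mu)$-cover of $\mathcal N$ if $\mathcal C\subseteq\mathcal N$ is finite and there is an event $E$ such that $\Pr_{r\sim M(\pi)}[r\notin E]\le\mu$ for all $M\in\mathcal N$ and all $\pi$, and every $M\in\mathcal N$ has an $M'\in\mathcal C$ with $|\log\mathbb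 P_{M,\pi}(r)-\log\mathbb P_{M',\pi}(r)|\le\rho$ for all $\pi$ and all $r\in E$ that have positive density under some model of $\mathcal N$ (where $\mathbb P_{M,\pi}$ is the density of $M(\pi)$). The estimate $\xi^{s}$ is the distribution on $\mathcal M^\ell_{\rm cov}$ with $\xi^{s}(M)\propto\prod_i\mathbb P_{M,\pi^i}(r^i)^{1/2}$, where $\ell$ is the epoch of explore round $\max\{s-1,1\}$ and $i$ runs over the explore rounds $i<s$ of epoch $\ell$ (uniform if there are none, and the point mass at a fixed model of $\mathcal M$ if $\mathcal M^\ell_{\rm cov}=\emptyset$); $\hat M^s=\mathbb E_{M\sim\xi^s}[M]$. In each round $t=1,2,\dots$, if some $\hat\pi\in\boldsymbol\pi_{\hat M^s}$ satisfies $\sum_{i<s}\mathbb E_{\hat M\sim\xi^i}\big[\log\frac{\mathbb P_{\hat M,\pi^i}(r^i)}{\mathbb P_{M,\pi^i}(r^i)}\big]\ge\log(t\log t)$ for all $M\in\mathrm{Alt}(\hat\pi)$, then such a $\hat\pi$ is played. (For $t=1$ the condition holds.) Otherwise $\pi^s\sim q^s\lambda^s+(1-q^s)\omega^s$ is played, where,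 with $\ell$ the epoch of $s$, $$(\lambda^s,\omega^s)\in\arg\min_{\lambda,\omega\in\triangle_\Pi}\ \sup_{M\in\mathcal M^\ell\setminus\mathcal M^{\rm gl}_\delta(\lambda;\mathsf n^s)}\frac1{\mathbb E_{\hat M\sim\xi^s}\mathbb E_{\pi\sim\omega}[\mathrm{KL}(\hat M(\pi)\|M(\pi))]},$$ the reward $r^s$ is observed, and $s$ increases by one. All choices left open (ties, covers) are arbitrary functions of the past explore data and of $t$. With $p^t$ the distribution of the decision of round $t$ given the past, the regret is $\mathrm{Reg}(T)=\sum_{t\le T}\mathbb E_{\pi\sim p^t}[\Delta^{M^\star}(\pi)]$. **Claim.** Suppose $\Delta^\star_{\min}>0$ and $n^\star_{\varepsilon/36}<\infty$. There are constants $c,p$ and $C,k$ depending only on the diameter bound $D$ such that: 1. $$\mathsf{AEC}_\varepsilon(\mathcal M^\star)\le c\cdot\frac{d^3}{\varepsilon^2}\Big(\frac1{\Delta^\star_{\min}}+n^\star_{\varepsilon/36}\Big)^{8}\Big(1+\log\big(1+d+\tfrac1\varepsilon+\tfrac1{\Delta^\star_{\min}}+n^\star_{\varepsilon/36}\big)\Big)^{p}.$$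 2. If moreover $g^\star>0$, then for all $T\ge3$, under $M^\star$, $\mathsf{AE}_\star^2$ satisfies $$\mathbb E[\mathrm{Reg}(T)]\le(1+\varepsilon)\,g^\star\log T+C\Big(1+d+\tfrac1\varepsilon+\tfrac1{\Delta^\star_{\min}}+n^\star_{\varepsilon/36}+\log\log T\Big)^{k}\log^{6/7}T.$$ -/

import Mathlib

open MeasureTheory ProbabilityTheory
open scoped ENNReal NNReal

noncomputable section

namespace GLBandit

universe u

variable {𝒜 : Type u}

/-! ### Models, optimal decisions, gaps -/

/-- A bandit model on the decision set `𝒜`: `M π r` is the density, with respect to Lebesgue measure,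
of the reward `r` of decision `π`. -/
abbrev Model (𝒜 : Type u) : Type u := 𝒜 → ℝ → ℝ

/-- The reward distribution `M(π)`. -/
def law (M : Model 𝒜) (π : 𝒜) : Measure ℝ :=
  volume.withDensity fun r => ENNReal.ofReal (M π r)

/-- The mean reward `f^M(π)`. -/
def mean (M : Model 𝒜) (π : 𝒜) : ℝ := ∫ r, r ∂(law M π)

/-- The set of optimal decisions of `M`. -/
def optSet (M : Model 𝒜) : Set 𝒜 := {π | ∀ π', mean M π' ≤ mean M π}

/-- The suboptimality gap `Δ^M(π)`. -/
def gap (M : Model 𝒜) (π : 𝒜) : ℝ≥0∞ := ENNReal.ofReal ((⨆ π', mean M π') - mean M π)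

open Classical in
/-- The minimum gap: the infimum of the positive gaps if the optimal decision is unique, and `0`
otherwise. (It is `∞` if there is only one decision.) -/
def minGap (M : Model 𝒜) : ℝ≥0∞ :=
  if ∃! π, π ∈ optSet M then ⨅ (π : 𝒜) (_ : 0 < gap M π), gap M π else 0

/-- The Kullback-Leibler divergence between `M(π)` and `M'(π)`. -/
def kl (M M' : Model 𝒜) (π : 𝒜) : ℝ≥0∞ := InformationTheory.klDiv (law M π) (law M' π)

/-- `∑ w(π) Δ^M(π)`, for an allocation or a distribution `w` on decisions. -/
def cost (M : Model 𝒜) (w : 𝒜 → ℝ≥0∞) : ℝ≥0∞ := ∑' π, w π * gap M π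

/-- `∑ w(π) KL(M(π) ‖ M'(π))`, for an allocation or a distribution `w` on decisions. -/
def info (w : 𝒜 → ℝ≥0∞) (M M' : Model 𝒜) : ℝ≥0∞ := ∑' π, w π * kl M M' π

/-! ### The Graves-Lai program -/

/-- The alternatives to the model `M`: models of the class sharing no optimal decision with `M`. -/
def alt (𝓜 : Set (Model 𝒜)) (M : Model 𝒜) : Set (Model 𝒜) :=
  {M' ∈ 𝓜 | optSet M ∩ optSet M' = ∅}

/-- The models of the class for which the decision `π` is not optimal. -/
def altDec (𝓜 : Set (Model 𝒜)) (π : 𝒜) : Set (Model 𝒜) := {M ∈ 𝓜 | π ∉ optSet M}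

/-- The Graves-Lai coefficient `g^M` of `M` in the class `𝓜`. -/
def glc (𝓜 : Set (Model 𝒜)) (M : Model 𝒜) : ℝ≥0∞ :=
  ⨅ (η : 𝒜 → ℝ≥0) (_ : ∀ M' ∈ alt 𝓜 M, 1 ≤ info (fun π => (η π : ℝ≥0∞)) M M'),
    cost M (fun π => (η π : ℝ≥0∞))

open Classical in
/-- The information content `n_ε^M` of the optimal decisions of `M`: the least `n` such that every
`ε`-optimal allocation stays feasible up to `2ε` when its weight on the optimal decisions is replaced
by `n` (`∞` if there is no such `n`). -/
def optInfo (𝓜 : Set (Model 𝒜)) (ε : ℝ) (M : Model 𝒜) : ℝ≥0∞ :=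
  ⨅ (n : ℝ≥0) (_ : ∀ η : 𝒜 → ℝ≥0,
      cost M (fun π => (η π : ℝ≥0∞)) ≤ ENNReal.ofReal (1 + ε) * glc 𝓜 M →
      (∀ M' ∈ alt 𝓜 M, ENNReal.ofReal (1 - ε) ≤ info (fun π => (η π : ℝ≥0∞)) M M') →
      ∀ M' ∈ alt 𝓜 M, ENNReal.ofReal (1 - 2 * ε) ≤
        info (fun π => if π ∈ optSet M then (n : ℝ≥0∞) else (η π : ℝ≥0∞)) M M'),
    (n : ℝ≥0∞)

/-- The models for which the normalized allocation `w` is `ε`-optimal for the Graves-Lai program, with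
a normalization factor `n ≤ nmax`. -/
def glSetLE (𝓜 : Set (Model 𝒜)) (ε : ℝ) (w : PMF 𝒜) (nmax : ℝ≥0∞) : Set (Model 𝒜) :=
  {M ∈ 𝓜 | ∃ n : ℝ≥0, 0 < n ∧ (n : ℝ≥0∞) ≤ nmax ∧
    cost M w ≤ ENNReal.ofReal (1 + ε) * glc 𝓜 M / n ∧
    ∀ M' ∈ alt 𝓜 M, ENNReal.ofReal (1 - ε) / n ≤ info w M M'}

/-- The models for which the normalized allocation `w` is `ε`-optimal for the Graves-Lai program. -/
def glSet (𝓜 : Set (Model 𝒜)) (ε : ℝ) (w : PMF 𝒜) : Set (Model 𝒜) := glSetLE 𝓜 ε w ∞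

/-! ### The Allocation-Estimation Coefficient -/

/-- The Allocation-Estimation Coefficient (with randomized estimators) of `M₀`, relative to the class
`𝓜`: the supremum, over the probability distributions `ξ` on `M₀`, of
`inf_{w, ω} sup_{M ∈ M₀ ∖ M^gl_ε(w)} 1 / E_{M' ∼ ξ} E_{π ∼ ω} KL(M'(π) ‖ M(π))`. -/
def aec (𝓜 : Set (Model 𝒜)) (ε : ℝ) (M₀ : Set (Model 𝒜)) : ℝ≥0∞ :=
  ⨆ ξ : ProbabilityMeasure M₀, ⨅ (w : PMF 𝒜) (ω : PMF 𝒜), ⨆ M ∈ M₀ \ glSet 𝓜 ε w,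
    (∫⁻ M' : M₀, info ω M'.1 M ∂(ξ : Measure M₀))⁻¹

/-- `𝓜_{x,y}`: the models with minimum gap at least `x` and `n_{ε/36}^M` at most `y`. -/
def regular (𝓜 : Set (Model 𝒜)) (ε : ℝ) (x y : ℝ≥0∞) : Set (Model 𝒜) :=
  {M ∈ 𝓜 | x ≤ minGap M ∧ optInfo 𝓜 (ε / 36) M ≤ y}

/-- `Δ_⋆ = min {Δ_min^⋆, 1 / n^⋆_{ε/36}}`. -/
def gapStar (𝓜 : Set (Model 𝒜)) (ε : ℝ) (Mstar : Model 𝒜) : ℝ≥0∞ :=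
  min (minGap Mstar) (optInfo 𝓜 (ε / 36) Mstar)⁻¹

/-- The class `M^⋆` of the models that are at least as regular as the true model `Mstar`. -/
def starClass (𝓜 : Set (Model 𝒜)) (ε : ℝ) (Mstar : Model 𝒜) : Set (Model 𝒜) :=
  regular 𝓜 ε (gapStar 𝓜 ε Mstar) (gapStar 𝓜 ε Mstar)⁻¹

/-! ### Covers and the estimation oracle -/

/-- `C` is a `(ρ, μ)`-cover of `N`: it is contained in `N` and, on an event `E` whose complement has
probability at most `μ` under all models of `N`, each log-likelihood of `N` is within `ρ` of one
of `C`. -/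
def IsCover (N : Set (Model 𝒜)) (ρ μ : ℝ) (C : Finset (Model 𝒜)) : Prop :=
  (C : Set (Model 𝒜)) ⊆ N ∧ ∃ E : Set ℝ, MeasurableSet E ∧
    (∀ M ∈ N, ∀ π, law M π Eᶜ ≤ ENNReal.ofReal μ) ∧
    ∀ M ∈ N, ∃ M' ∈ C, ∀ π, ∀ r ∈ E, (∃ M'' ∈ N, 0 < M'' π r) →
      |Real.log (M π r) - Real.log (M' π r)| ≤ ρ

open Classical in
/-- The weight of the model `M` after the observations `D` in tempered aggregation over `C`:
`exp (½ ∑ log P_M(r))`, times the indicator of `C`. -/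
def temperedWeight (C : Finset (Model 𝒜)) (D : List (𝒜 × ℝ)) (M : Model 𝒜) : ℝ≥0∞ :=
  if M ∈ C then (D.map fun z => ENNReal.ofReal (Real.sqrt (M z.1 z.2))).prod else 0

open Classical in
/-- Tempered aggregation over the finite class `C`, started from the uniform distribution. The model
`M₀` is what is returned if `C` is empty. -/
def tempered (C : Finset (Model 𝒜)) (M₀ : Model 𝒜) (D : List (𝒜 × ℝ)) : PMF (Model 𝒜) :=
  if h : ∑' M, temperedWeight C D M ≠ 0 ∧ ∑' M, temperedWeight C D M ≠ ∞ then
    PMF.normalize (temperedWeight C D) h.1 h.2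
  else PMF.pure M₀

/-- The mixture model `E_{M ∼ ξ}[M]`. -/
def mixModel (ξ : PMF (Model 𝒜)) : Model 𝒜 := fun π r => ∑' M, (ξ M).toReal * M π r

/-- The mixture `q w + (1 - q) ω` of two distributions. -/
def mix (q : ℝ≥0) (hq : q ≤ 1) (w ω : PMF 𝒜) : PMF 𝒜 :=
  ⟨fun π => (q : ℝ≥0∞) * w π + ((1 - q : ℝ≥0) : ℝ≥0∞) * ω π, by
    have h : ∑' π, ((q : ℝ≥0∞) * w π + ((1 - q : ℝ≥0) : ℝ≥0∞) * ω π) = 1 := by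
      rw [ENNReal.tsum_add, ENNReal.tsum_mul_left, ENNReal.tsum_mul_left, w.tsum_coe, ω.tsum_coe,
        mul_one, mul_one, ← ENNReal.coe_add, add_tsub_cancel_of_le hq, ENNReal.coe_one]
    exact h ▸ ENNReal.summable.hasSum⟩

/-! ### The algorithm -/

/-- The epoch of explore round `s`: epoch `ℓ` consists of the rounds `2^(ℓ-1) ≤ s < 2^ℓ`. -/
def epoch (s : ℕ) : ℕ := Nat.log 2 s + 1

/-- The first explore round of epoch `ℓ`. -/
def epochStart (ℓ : ℕ) : ℕ := 2 ^ (ℓ - 1)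

/-- `n^s = s^(1/8)`. -/
def nCap (s : ℕ) : ℝ≥0∞ := (s : ℝ≥0∞) ^ (1 / 8 : ℝ)

/-- The internal tolerance `δ = ε / (4 + 2ε)`. -/
def tol (ε : ℝ) : ℝ := ε / (4 + 2 * ε)

/-- `Δ^ℓ`: the least `x` such that the Allocation-Estimation Coefficient of `𝓜_{x,1/x}` with tolerance
`δ/2` is at most `s^(1/2)`, where `s` is the first explore round of epoch `ℓ`. -/
def epochGap (𝓜 : Set (Model 𝒜)) (ε : ℝ) (ℓ : ℕ) : ℝ≥0∞ :=
  sInf {x : ℝ≥0∞ | aec 𝓜 (tol ε / 2) (regular 𝓜 ε x x⁻¹) ≤ (epochStart ℓ : ℝ≥0∞) ^ (1 / 2 : ℝ)}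

/-- The active set `M^ℓ` of epoch `ℓ`. -/
def activeSet (𝓜 : Set (Model 𝒜)) (ε : ℝ) (ℓ : ℕ) : Set (Model 𝒜) :=
  {M ∈ regular 𝓜 ε (epochGap 𝓜 ε ℓ) (epochGap 𝓜 ε ℓ)⁻¹ |
    optInfo 𝓜 (ε / 36) M + 1 / minGap M + 4 * glc 𝓜 M / minGap M
      + 2 * optInfo 𝓜 (ε / 36) M / glc 𝓜 M + 4 / (minGap M * ENNReal.ofReal (tol ε))
      ≤ (nCap (epochStart ℓ)) ^ (1 / 2 : ℝ)}

/-- The randomized estimate `ξ^s` computed from the data `D` of the explore rounds `1, …, s-1`: the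
oracle is run over the cover of the epoch of round `s-1` (the first epoch if `s = 1`) on the data of
that epoch. -/
def estimate (cover : ℕ → Finset (Model 𝒜)) (M₀ : Model 𝒜) (D : List (𝒜 × ℝ)) : PMF (Model 𝒜) :=
  tempered (cover (epoch (max D.length 1))) M₀
    (D.drop (epochStart (epoch (max D.length 1)) - 1))

/-- The quantity `sup_{M ∈ M^ℓ ∖ M^gl_δ(w; n^s)} 1 / E_{M' ∼ ξ} E_{π ∼ ω} KL(M'(π) ‖ M(π))`
that the allocations of explore round `s`, in epoch `ℓ`, minimize. -/
def exploreValue (𝓜 : Set (Model 𝒜)) (ε : ℝ) (s : ℕ) (ξ : PMF (Model 𝒜)) (w ω : PMF 𝒜) : ℝ≥0∞ :=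
  ⨆ M ∈ activeSet 𝓜 ε (epoch s) \ glSetLE 𝓜 (tol ε) w (nCap s),
    (∑' M', ξ M' * info ω M' M)⁻¹

/-- The likelihood ratio `∑_{i<s} E_{M' ∼ ξ^i} log (P_{M'}(r^i) / P_M(r^i))` of the explore rounds. -/
def logRatio (cover : ℕ → Finset (Model 𝒜)) (M₀ : Model 𝒜) (D : List (𝒜 × ℝ)) (M : Model 𝒜) : ℝ :=
  ∑ i : Fin D.length, ∑' M' : Model 𝒜, (estimate cover M₀ (D.take i) M').toReal *
    Real.log (M' (D.get i).1 (D.get i).2 / M (D.get i).1 (D.get i).2)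

/-- The exploit test of round `t` for the decision `π`, with explore data `D`. -/
def ExploitTest (𝓜 : Set (Model 𝒜)) (cover : ℕ → Finset (Model 𝒜)) (M₀ : Model 𝒜)
    (t : ℕ) (D : List (𝒜 × ℝ)) (π : 𝒜) : Prop :=
  π ∈ optSet (mixModel (estimate cover M₀ D)) ∧
    ∀ M ∈ altDec 𝓜 π, Real.log (t * Real.log t) ≤ logRatio cover M₀ D M

/-- An instance of the algorithm AE⋆² on the class `𝓜` with tolerance `ε`: the choices that its
pseudocode leaves open, with the properties that the pseudocode asks for. -/
structure AEStar (𝓜 : Set (Model 𝒜)) (ε : ℝ) where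
  /-- The estimate used while the active set is empty. -/
  base : Model 𝒜
  base_mem : base ∈ 𝓜
  /-- A smallest `(2^(-ℓ), 2^(-5ℓ))`-cover of the active set of each epoch `ℓ ≥ 1`. -/
  cover : ℕ → Finset (Model 𝒜)
  isCover : ∀ ℓ, 1 ≤ ℓ →
    IsCover (activeSet 𝓜 ε ℓ) ((2 : ℝ) ^ (-(ℓ : ℤ))) ((2 : ℝ) ^ (-(5 * ℓ : ℤ))) (cover ℓ)
  cover_card_le : ∀ ℓ, 1 ≤ ℓ → ∀ C : Finset (Model 𝒜),
    IsCover (activeSet 𝓜 ε ℓ) ((2 : ℝ) ^ (-(ℓ : ℤ))) ((2 : ℝ) ^ (-(5 * ℓ : ℤ))) C →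
    (cover ℓ).card ≤ C.card
  /-- The decision played if the exploit test of round `t` succeeds with explore data `D`. -/
  exploit : ℕ → List (𝒜 × ℝ) → Option 𝒜
  exploit_some : ∀ t D π, exploit t D = some π → ExploitTest 𝓜 cover base t D π
  exploit_none : ∀ t D, exploit t D = none → ∀ π, ¬ ExploitTest 𝓜 cover base t D π
  /-- The minimizing allocations of the explore round with previous explore data `D`. -/
  alloc : List (𝒜 × ℝ) → PMF 𝒜 × PMF 𝒜
  alloc_le : ∀ D w ω,
    exploreValue 𝓜 ε (D.length + 1) (estimate cover base D) (alloc D).1 (alloc D).2 ≤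
      exploreValue 𝓜 ε (D.length + 1) (estimate cover base D) w ω

namespace AEStar

variable {𝓜 : Set (Model 𝒜)} {ε : ℝ} (A : AEStar 𝓜 ε)

/-- One round of bookkeeping: the number of past rounds and the data of the past explore rounds are
updated with the decision and the reward of the new round. -/
def step (st : ℕ × List (𝒜 × ℝ)) (z : 𝒜 × ℝ) : ℕ × List (𝒜 × ℝ) :=
  match A.exploit (st.1 + 1) st.2 with
  | some _ => (st.1 + 1, st.2)
  | none => (st.1 + 1, st.2 ++ [z])

/-- The data of the explore rounds in a history. -/
def exploreData {t : ℕ} (h : Fin t → 𝒜 × ℝ) : List (𝒜 × ℝ) :=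
  ((List.ofFn h).foldl A.step (0, [])).2

/-- The distribution `p^s = q^s λ^s + (1 - q^s) ω^s`, `q^s = 1 - s^(-1/4)`, of the explore round
`s` with previous explore data `D`. -/
def exploreDist (D : List (𝒜 × ℝ)) : PMF 𝒜 :=
  mix (1 - ((D.length + 1 : ℕ) : ℝ≥0) ^ (-(1 / 4) : ℝ)) tsub_le_self (A.alloc D).1 (A.alloc D).2

/-- The distribution of the decision of round `t + 1`, given the history of the rounds `1, …, t`. -/
def policy (t : ℕ) (h : Fin t → 𝒜 × ℝ) : PMF 𝒜 :=
  match A.exploit (t + 1) (A.exploreData h) with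
  | some π => PMF.pure π
  | none => A.exploreDist (A.exploreData h)

end AEStar

/-! ### Interaction and regret -/

/-- `P` is the law of the sequence of decisions and rewards when the decisions are drawn by the
algorithm `p` and the rewards are drawn by the model `M`: given the history of the rounds `1, …, t`,
the next decision has law `p t`, and given it, the reward has law `M(π)`. -/
def IsInteraction [MeasurableSpace 𝒜] (M : Model 𝒜) (p : (t : ℕ) → (Fin t → 𝒜 × ℝ) → PMF 𝒜)
    (P : Measure (ℕ → 𝒜 × ℝ)) : Prop :=
  IsProbabilityMeasure P ∧
  ∃ (κ : (t : ℕ) → Kernel (Fin t → 𝒜 × ℝ) 𝒜) (ρ : Kernel 𝒜 ℝ),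
    (∀ t h, κ t h = (p t h).toMeasure) ∧ (∀ π, ρ π = law M π) ∧
    ∀ t, P.map (fun ω => ((fun i : Fin t => ω i), ω t)) =
      (P.map fun ω => (fun i : Fin t => ω i)) ⊗ₘ
        (κ t ⊗ₖ Kernel.prodMkLeft (Fin t → 𝒜 × ℝ) ρ)

/-- The expected regret over `T` rounds, for the true model `M`. -/
def regret [MeasurableSpace 𝒜] (M : Model 𝒜) (p : (t : ℕ) → (Fin t → 𝒜 × ℝ) → PMF 𝒜)
    (P : Measure (ℕ → 𝒜 × ℝ)) (T : ℕ) : ℝ≥0∞ :=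
  ∑ t ∈ Finset.range T, ∫⁻ ω, cost M (p t fun i : Fin t => ω i) ∂P

/-! ### Linear bandits -/

/-- The linear bandit model with unit-variance Gaussian noise: `M(π) = N(⟨θ, x_π⟩, 1)`. -/
def linearModel {d : ℕ} (x : 𝒜 → EuclideanSpace ℝ (Fin d)) (θ : EuclideanSpace ℝ (Fin d)) :
    Model 𝒜 :=
  fun π r => gaussianPDFReal (inner ℝ θ (x π)) 1 r

/-- The linear bandit class with parameter set `Θ` and arms `x_π`. -/
def linearClass {d : ℕ} (x : 𝒜 → EuclideanSpace ℝ (Fin d)) (Θ : Set (EuclideanSpace ℝ (Fin d))) :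
    Set (Model 𝒜) :=
  linearModel x '' Θ

/-- The standing assumptions on a linear bandit instance with true model `Mstar`: `Θ` is convex with
diameter at most `D`, the arms lie in the unit ball, the true model is in the class, all mean rewards
are in `[0,1]`, and the optimal decision of the true model is unique. -/
structure IsLinearInstance {d : ℕ} (D : ℝ) (x : 𝒜 → EuclideanSpace ℝ (Fin d))
    (Θ : Set (EuclideanSpace ℝ (Fin d))) (Mstar : Model 𝒜) : Prop where
  convex : Convex ℝ Θ
  dist_le : ∀ θ ∈ Θ, ∀ θ' ∈ Θ, dist θ θ' ≤ D
  norm_le : ∀ π, ‖x π‖ ≤ 1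
  mem : Mstar ∈ linearClass x Θ
  mean_mem : ∀ M ∈ linearClass x Θ, ∀ π, mean M π ∈ Set.Icc (0 : ℝ) 1
  unique_opt : ∃! π, π ∈ optSet Mstar

end GLBandit

end

open GLBandit

/-! The bound on the coefficient rests on the geometry of linear bandits. The divergence of
unit-variance Gaussians is half the squared difference of means, so it obeys a triangle inequality
up to a factor 2. A design `ω` that nearly maximizes the determinant of its covariance turns a small
`info ω M M₀` into uniformly close means, at the price of a factor of order `d`
(`IsLinearInstance.exists_design`). Models that are `Tame` at scale `R` and whose means differ by at
most `ε / (1000 * R)` share their optimal decision, and one near-optimal allocation serves them all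
(`Tame.exists_mem_glSetLE`). This gives a dichotomy for every distribution `ξ`
(`IsLinearInstance.exists_explore`): either every tame model has average divergence at least `1 / V`
from `ξ` under `ω`, or the models below `1 / V` are all close to one of them and a single allocation
solves them. The value is thus at most `V = 10 ^ 8 * d * R ^ 2 / ε ^ 2`. A multiple of the design is
feasible for the Graves-Lai program, so the coefficient is at most `96 * d / y ^ 2` when the gap is
at least `y`; this allows `R` of order `d / y ^ 3` and gives `d ^ 3 / (ε ^ 2 * y ^ 6)`, with a
smaller exponent than claimed and no logarithm.

For the regret, a wrong decision in an exploit round means that the test held for the true model.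
The exponential of its `logRatio` is a supermartingale started at 1, so these rounds cost at most
the sum of `1 / (t log t)`, of order `log log T`. An explore round is `Good` if its allocation
nearly solves the true model and the estimate has the right optimal decision. By the dichotomy and
the convexity of `Θ`, a bad round `s` has estimation error at least of order `s ^ (-3/8)`, and
tempered aggregation bounds the total error (`AEStar.prefixSum_estErr_le`). At the last good round
the exploit test failed, so some alternative still has a small log-likelihood ratio and the
information collected about it is little more than `log T` (`AEStar.prefixSum_roundInfo_le`). A good
round costs about the Graves-Lai coefficient per unit of this information, plus `s ^ (-1/4)`, and
yields information of order `s ^ (-1/8)`. The number `S` of explore rounds therefore satisfies `S ^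
(7/8) ≲ log T`, and the sum of `s ^ (-1/4)`, of order `S ^ (3/4)`, becomes `log ^ (6/7) T`.

Expectations are handled without a good event. All deviations are measured by one nonnegative
supermartingale `AEStar.potential`: on every path the explore regret is the leading term plus a
multiple of the cube of the logarithm of its running maximum `m`. The cube is at most a multiple of
`√m`, which is dominated by a supermartingale of initial value at most 2
(`IsSupermart.sqrt_runMax`). `AEStar.regret_le_of_supermart` combines this with the exploit rounds.
-/

noncomputable section

namespace GLBandit

universe u

section

variable {𝒜 : Type u}

/-! ### Gaussian log-likelihood ratios -/

/-- The log-likelihood ratio between the unit-variance Gaussians with means `a` and `b`. -/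
def llrG (a b r : ℝ) : ℝ := (a - b) * (r - b) - (a - b) ^ 2 / 2

lemma measurable_llrG (a b : ℝ) : Measurable (llrG a b) := by
  unfold llrG; fun_prop

lemma gaussianPDFReal_eq_mul_exp_llrG (a b r : ℝ) :
    gaussianPDFReal a 1 r = gaussianPDFReal b 1 r * Real.exp (llrG a b r) := by
  simp only [gaussianPDFReal, llrG, mul_assoc, ← Real.exp_add]
  congr 2
  push_cast
  ring

lemma log_gaussianPDFReal_div (a b r : ℝ) :
    Real.log (gaussianPDFReal a 1 r / gaussianPDFReal b 1 r) = llrG a b r := by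
  rw [gaussianPDFReal_eq_mul_exp_llrG a b r, mul_div_assoc, mul_comm, div_mul_cancel₀, Real.log_exp]
  exact (gaussianPDFReal_pos b 1 r one_ne_zero).ne'

lemma gaussianReal_eq_withDensity (a b : ℝ) :
    gaussianReal a 1 = (gaussianReal b 1).withDensity fun r => ENNReal.ofReal (Real.exp (llrG a b r)) := by
  rw [gaussianReal_of_var_ne_zero _ one_ne_zero, gaussianReal_of_var_ne_zero _ one_ne_zero,
    ← withDensity_mul _ (measurable_gaussianPDF _ _)
      (measurable_llrG a b).exp.ennreal_ofReal]
  congr 1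
  ext r
  simp only [gaussianPDF, Pi.mul_apply]
  rw [← ENNReal.ofReal_mul (gaussianPDFReal_nonneg _ _ _), ← gaussianPDFReal_eq_mul_exp_llrG]

lemma integrable_id_gaussianReal (a : ℝ) : Integrable (fun r => r) (gaussianReal a 1) := by
  exact (memLp_id_gaussianReal (μ := a) (v := 1) 1).integrable (by simp)

lemma klDiv_gaussianReal (a b : ℝ) :
    InformationTheory.klDiv (gaussianReal a 1) (gaussianReal b 1)
      = ENNReal.ofReal ((a - b) ^ 2 / 2) := by
  have hac : gaussianReal a 1 ≪ gaussianReal b 1 := by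
    rw [gaussianReal_eq_withDensity a b]; exact withDensity_absolutelyContinuous _ _
  have h1 : llr (gaussianReal a 1) (gaussianReal b 1) =ᵐ[gaussianReal a 1] llrG a b := by
    have h := Measure.rnDeriv_withDensity (gaussianReal b 1)
      (measurable_llrG a b).exp.ennreal_ofReal
    rw [← gaussianReal_eq_withDensity a b] at h
    filter_upwards [hac.ae_le h] with r hr
    rw [llr, hr, ENNReal.toReal_ofReal (Real.exp_pos _).le, Real.log_exp]
  have hi := integrable_id_gaussianReal a
  have h2 : Integrable (llrG a b) (gaussianReal a 1) := by
    unfold llrG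
    exact ((hi.sub (integrable_const b)).const_mul _).sub (integrable_const _)
  have h3 : ∫ r, llrG a b r ∂(gaussianReal a 1) = (a - b) ^ 2 / 2 := by
    unfold llrG
    have hi' : Integrable (fun r => r - b) (gaussianReal a 1) := hi.sub (integrable_const b)
    rw [integral_sub (hi'.const_mul _) (integrable_const _),
      integral_const_mul, integral_sub hi (integrable_const b), integral_id_gaussianReal]
    simp
    ring
  have hne := InformationTheory.klDiv_ne_top hac (h2.congr h1.symm)
  rw [← ENNReal.ofReal_toReal hne, InformationTheory.toReal_klDiv_of_measure_eq hac (by simp),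
    integral_congr_ae h1, h3]

/-- The factor `α * (α - 1)` drives every supermartingale below: `α = 1` gives mean one, `α` in `(0,
1)` a contraction in the squared distance of the means, `α = -1` a controlled growth. -/
lemma lintegral_exp_llrG (a b α : ℝ) :
    ∫⁻ r, ENNReal.ofReal (Real.exp (α * llrG a b r)) ∂(gaussianReal b 1)
      = ENNReal.ofReal (Real.exp (α * (α - 1) * (a - b) ^ 2 / 2)) := by
  have he : ∀ r, Real.exp (α * llrG a b r)
      = Real.exp (-(α * (a - b) * b + α * (a - b) ^ 2 / 2)) * Real.exp ((α * (a - b)) * r) := by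
    intro r; rw [← Real.exp_add, llrG]; congr 1; ring
  have hm : ∫ r, Real.exp ((α * (a - b)) * r) ∂(gaussianReal b 1)
      = Real.exp (b * (α * (a - b)) + (α * (a - b)) ^ 2 / 2) := by
    have := congrFun (mgf_fun_id_gaussianReal (μ := b) (v := 1)) (α * (a - b))
    simpa [mgf] using this
  rw [← ofReal_integral_eq_lintegral_ofReal]
  · congr 1
    simp_rw [he]
    rw [integral_const_mul, hm, ← Real.exp_add]
    congr 1; ring
  · simp_rw [he]
    exact (integrable_exp_mul_gaussianReal _).const_mul _
  · exact Filter.Eventually.of_forall fun r => (Real.exp_pos _).le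

/-- The function `exp |r - b|` is at most the sum of `exp (r - b)` and `exp (b - r)`, which are `√e`
times the likelihood ratios of the means `b + 1` and `b - 1`. The shift by 2 absorbs the factor
`2√e`. -/
lemma lintegral_exp_abs_sub_le (b : ℝ) :
    ∫⁻ r, ENNReal.ofReal (Real.exp (|r - b| - 2)) ∂(gaussianReal b 1) ≤ 1 := by
  have h1 : ∀ r, ENNReal.ofReal (Real.exp (|r - b| - 2)) ≤
      ENNReal.ofReal (Real.exp (-(3 / 2))) * ENNReal.ofReal (Real.exp (1 * llrG (b + 1) b r))
      + ENNReal.ofReal (Real.exp (-(3 / 2))) * ENNReal.ofReal (Real.exp (1 * llrG (b - 1) b r)) := by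
    intro r
    rw [← ENNReal.ofReal_mul (Real.exp_pos _).le, ← ENNReal.ofReal_mul (Real.exp_pos _).le,
      ← ENNReal.ofReal_add (by positivity) (by positivity), ← Real.exp_add, ← Real.exp_add]
    apply ENNReal.ofReal_le_ofReal
    unfold llrG
    rcases abs_cases (r - b) with ⟨h, _⟩ | ⟨h, _⟩ <;> rw [h]
    · refine le_trans (le_of_eq ?_) (le_add_of_nonneg_right (Real.exp_pos _).le)
      congr 1; ring
    · refine le_trans (le_of_eq ?_) (le_add_of_nonneg_left (Real.exp_pos _).le)
      congr 1; ring
  refine (lintegral_mono h1).trans ?_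
  rw [lintegral_add_left (by have := measurable_llrG (b + 1) b; fun_prop),
    lintegral_const_mul _ (by have := measurable_llrG (b + 1) b; fun_prop),
    lintegral_const_mul _ (by have := measurable_llrG (b - 1) b; fun_prop),
    lintegral_exp_llrG, lintegral_exp_llrG]
  have : Real.exp (-(3 / 2)) ≤ 1 / 2 := by
    rw [Real.exp_neg, one_div]
    refine inv_anti₀ (by norm_num) ?_
    have := Real.add_one_le_exp (3 / 2 : ℝ)
    linarith
  simp only [sub_self, mul_zero, zero_mul, zero_div, Real.exp_zero, ENNReal.ofReal_one, mul_one]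
  rw [← ENNReal.ofReal_add (by positivity) (by positivity), ← ENNReal.ofReal_one]
  exact ENNReal.ofReal_le_ofReal (by linarith)

/-! ### Classes of Gaussian models -/

/-- The models of the class have unit-variance Gaussian rewards with means in `[0, 1]`. -/
def GaussClass (𝓜 : Set (Model 𝒜)) : Prop :=
  ∀ M ∈ 𝓜, (∀ π, M π = gaussianPDFReal (mean M π) 1) ∧ ∀ π, mean M π ∈ Set.Icc (0 : ℝ) 1

lemma law_of_eq {M : Model 𝒜} {π : 𝒜} {a : ℝ} (h : M π = gaussianPDFReal a 1) :
    law M π = gaussianReal a 1 := by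
  rw [gaussianReal_of_var_ne_zero _ one_ne_zero, law, h]; rfl

lemma law_linearModel {d : ℕ} (x : 𝒜 → EuclideanSpace ℝ (Fin d)) (θ : EuclideanSpace ℝ (Fin d))
    (π : 𝒜) : law (linearModel x θ) π = gaussianReal (inner ℝ θ (x π)) 1 :=
  law_of_eq rfl

lemma mean_linearModel {d : ℕ} (x : 𝒜 → EuclideanSpace ℝ (Fin d)) (θ : EuclideanSpace ℝ (Fin d))
    (π : 𝒜) : mean (linearModel x θ) π = inner ℝ θ (x π) := by
  rw [mean, law_linearModel, integral_id_gaussianReal]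

lemma IsLinearInstance.gaussClass {d : ℕ} {D : ℝ} {x : 𝒜 → EuclideanSpace ℝ (Fin d)}
    {Θ : Set (EuclideanSpace ℝ (Fin d))} {Mstar : Model 𝒜} (h : IsLinearInstance D x Θ Mstar) :
    GaussClass (linearClass x Θ) := by
  refine fun M hM => ⟨fun π => ?_, h.mean_mem M hM⟩
  obtain ⟨θ, _, rfl⟩ := hM
  rw [mean_linearModel]; rfl

variable {𝓜 : Set (Model 𝒜)} {M M' M₀ : Model 𝒜}

lemma GaussClass.law_eq (h𝓜 : GaussClass 𝓜) (hM : M ∈ 𝓜) (π : 𝒜) :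
    law M π = gaussianReal (mean M π) 1 := law_of_eq ((h𝓜 M hM).1 π)

lemma GaussClass.kl_eq (h𝓜 : GaussClass 𝓜) (hM : M ∈ 𝓜) (hM' : M' ∈ 𝓜) (π : 𝒜) :
    kl M M' π = ENNReal.ofReal ((mean M π - mean M' π) ^ 2 / 2) := by
  rw [kl, h𝓜.law_eq hM, h𝓜.law_eq hM', klDiv_gaussianReal]

lemma GaussClass.abs_sub_le_one (h𝓜 : GaussClass 𝓜) (hM : M ∈ 𝓜) (hM' : M' ∈ 𝓜) (π : 𝒜) :
    |mean M π - mean M' π| ≤ 1 := by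
  have h1 := (h𝓜 M hM).2 π
  have h2 := (h𝓜 M' hM').2 π
  rw [abs_le]; constructor <;> linarith [h1.1, h1.2, h2.1, h2.2]

lemma GaussClass.sq_le_one (h𝓜 : GaussClass 𝓜) (hM : M ∈ 𝓜) (hM' : M' ∈ 𝓜) (π : 𝒜) :
    (mean M π - mean M' π) ^ 2 ≤ 1 :=
  (sq_le_one_iff_abs_le_one _).2 (h𝓜.abs_sub_le_one hM hM' π)

lemma GaussClass.kl_le (h𝓜 : GaussClass 𝓜) (hM : M ∈ 𝓜) (hM' : M' ∈ 𝓜) (π : 𝒜) :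
    kl M M' π ≤ ENNReal.ofReal (1 / 2) := by
  rw [h𝓜.kl_eq hM hM']
  exact ENNReal.ofReal_le_ofReal (by linarith [h𝓜.sq_le_one hM hM' π])

/-! ### Gaps -/

lemma ciSup_mean_of_mem_optSet {p : 𝒜} (h : p ∈ optSet M) : ⨆ π', mean M π' = mean M p := by
  have : Nonempty 𝒜 := ⟨p⟩
  exact le_antisymm (ciSup_le h) (le_ciSup ⟨mean M p, by rintro _ ⟨q, rfl⟩; exact h q⟩ p)

lemma gap_of_mem_optSet {p : 𝒜} (h : p ∈ optSet M) (π : 𝒜) :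
    gap M π = ENNReal.ofReal (mean M p - mean M π) := by
  rw [gap, ciSup_mean_of_mem_optSet h]

lemma gap_eq_zero_of_mem {p : 𝒜} (h : p ∈ optSet M) : gap M p = 0 := by
  rw [gap_of_mem_optSet h, sub_self, ENNReal.ofReal_zero]

lemma existsUnique_of_minGap_pos (h : 0 < minGap M) : ∃ p, optSet M = {p} := by
  by_contra hc
  rw [minGap, if_neg] at h
  · exact lt_irrefl _ h
  · rintro ⟨p, hp, hu⟩
    exact hc ⟨p, Set.eq_singleton_iff_unique_mem.2 ⟨hp, hu⟩⟩

lemma minGap_le_gap {p π : 𝒜} (h : optSet M = {p}) (hπ : π ≠ p) : minGap M ≤ gap M π := by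
  have hp : p ∈ optSet M := h ▸ Set.mem_singleton p
  have hu : ∃! π, π ∈ optSet M := ⟨p, hp, fun q hq => by rw [h] at hq; exact hq⟩
  rw [minGap, if_pos hu]
  refine iInf₂_le π ?_
  rw [gap_of_mem_optSet hp, ENNReal.ofReal_pos, sub_pos]
  refine lt_of_le_of_ne (hp π) fun he => hπ ?_
  have : π ∈ optSet M := fun q => he ▸ hp q
  rwa [h] at this

lemma GaussClass.gap_le_one (h𝓜 : GaussClass 𝓜) (hM : M ∈ 𝓜) (π : 𝒜) : gap M π ≤ 1 := by
  have : Nonempty 𝒜 := ⟨π⟩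
  rw [gap, ← ENNReal.ofReal_one]
  refine ENNReal.ofReal_le_ofReal ?_
  have := (ciSup_le fun q => ((h𝓜 M hM).2 q).2 : ⨆ π', mean M π' ≤ 1)
  linarith [((h𝓜 M hM).2 π).1]

lemma GaussClass.minGap_le_one [Nontrivial 𝒜] (h𝓜 : GaussClass 𝓜) (hM : M ∈ 𝓜) :
    minGap M ≤ 1 := by
  by_cases h : 0 < minGap M
  · obtain ⟨p, hp⟩ := existsUnique_of_minGap_pos h
    obtain ⟨q, hq⟩ := exists_ne p
    exact (minGap_le_gap hp hq).trans (h𝓜.gap_le_one hM q)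
  · simp only [not_lt, nonpos_iff_eq_zero] at h
    simp [h]

/-- Close models with sufficiently large minimum gaps have the same optimal decision. -/
lemma optSet_eq_of_close {p p₀ : 𝒜} (hp : optSet M = {p}) (hp₀ : optSet M₀ = {p₀}) {g x : ℝ}
    (hx : ENNReal.ofReal x ≤ minGap M) (hg : 2 * g < x)
    (hc : ∀ π, |mean M π - mean M₀ π| ≤ g) : p = p₀ := by
  by_contra hne
  have h1 := hx.trans (minGap_le_gap hp (Ne.symm hne))
  have hpm : p ∈ optSet M := hp ▸ Set.mem_singleton p
  have hpm0 : p₀ ∈ optSet M₀ := hp₀ ▸ Set.mem_singleton p₀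
  have hg0 : 0 ≤ g := (abs_nonneg _).trans (hc p)
  rw [gap_of_mem_optSet hpm, ENNReal.ofReal_le_ofReal_iff'] at h1
  have h2 := hpm0 p
  have h3 := abs_le.1 (hc p)
  have h4 := abs_le.1 (hc p₀)
  rcases h1 with h1 | h1 <;> linarith [h3.1, h3.2, h4.1, h4.2]

/-! ### Allocations -/

lemma info_mono {w w' : 𝒜 → ℝ≥0∞} (h : ∀ π, w π ≤ w' π) (M M' : Model 𝒜) :
    info w M M' ≤ info w' M M' := ENNReal.tsum_le_tsum fun π => mul_le_mul_left (h π) _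

lemma cost_const_mul (c : ℝ≥0∞) (w : 𝒜 → ℝ≥0∞) (M : Model 𝒜) :
    cost M (fun π => c * w π) = c * cost M w := by
  simp only [cost, mul_assoc, ENNReal.tsum_mul_left]

lemma info_const_mul (c : ℝ≥0∞) (w : 𝒜 → ℝ≥0∞) (M M' : Model 𝒜) :
    info (fun π => c * w π) M M' = c * info w M M' := by
  simp only [info, mul_assoc, ENNReal.tsum_mul_left]

lemma GaussClass.info_le (h𝓜 : GaussClass 𝓜) (hM : M ∈ 𝓜) (hM' : M' ∈ 𝓜) (w : 𝒜 → ℝ≥0∞) :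
    info w M M' ≤ (∑' π, w π) * ENNReal.ofReal (1 / 2) := by
  rw [info, ← ENNReal.tsum_mul_right]
  exact ENNReal.tsum_le_tsum fun π => mul_le_mul_right (h𝓜.kl_le hM hM' π) _

lemma mem_alt_iff {p : 𝒜} (hp : optSet M = {p}) : M' ∈ alt 𝓜 M ↔ M' ∈ 𝓜 ∧ p ∉ optSet M' := by
  simp only [alt, Set.mem_ofPred_eq, hp, Set.singleton_inter_eq_empty]

lemma alt_eq_of_optSet_eq (h : optSet M = optSet M₀) : alt 𝓜 M = alt 𝓜 M₀ := by
  simp only [alt, h]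

lemma glc_le_cost {η : 𝒜 → ℝ≥0} (h : ∀ M' ∈ alt 𝓜 M, 1 ≤ info (fun π => (η π : ℝ≥0∞)) M M') :
    glc 𝓜 M ≤ cost M fun π => (η π : ℝ≥0∞) := iInf₂_le η h

/-- The mass of an allocation off the optimal decision is bounded by its cost. -/
lemma tsum_off_le {p : 𝒜} (hp : optSet M = {p}) (h0 : 0 < minGap M) (w : 𝒜 → ℝ≥0∞) (hw : w p = 0) :
    ∑' π, w π ≤ cost M w / minGap M := by
  classical
  -- Gaps are finite, so an infinite minimum gap leaves `p` as the only decision.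
  by_cases ht : minGap M = ∞
  · have h2 : ∀ π, w π = 0 := by
      intro π
      by_cases hπ : π = p
      · rw [hπ, hw]
      · have h1 := minGap_le_gap hp hπ
        rw [ht, top_le_iff] at h1
        exact absurd h1 (by simp [gap])
    simp [h2]
  rw [ENNReal.le_div_iff_mul_le (Or.inl h0.ne') (Or.inl ht), cost, ← ENNReal.tsum_mul_right]
  refine ENNReal.tsum_le_tsum fun π => ?_
  by_cases hπ : π = p
  · rw [hπ, hw, zero_mul, zero_mul]
  · exact mul_le_mul_right (minGap_le_gap hp hπ) _

end

section

variable {𝒜 : Type u}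

/-! ### Approximate optimal designs -/

/-- The matrix determinant lemma for a rank-one update; it expresses the effect on the determinant
of adding one vector to a design. -/
lemma det_add_smul_vecMulVec {d : ℕ} {B : Matrix (Fin d) (Fin d) ℝ} (hB : B.det ≠ 0) (c : ℝ)
    (y : Fin d → ℝ) :
    (B + c • Matrix.vecMulVec y y).det = B.det * (1 + c * (y ⬝ᵥ B⁻¹.mulVec y)) := by
  have h := Matrix.det_add_replicateCol_mul_replicateRow (ι := Unit) (isUnit_iff_ne_zero.2 hB)
    (c • y) y
  rw [← Matrix.vecMulVec_eq, Matrix.smul_vecMulVec] at h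
  rw [h]
  congr 1
  rw [Matrix.det_unique, Matrix.add_apply, Matrix.one_apply_eq, Matrix.mul_assoc,
    Matrix.replicateCol_smul, Matrix.mul_smul, Matrix.mul_smul, Matrix.smul_apply, smul_eq_mul,
    ← Matrix.replicateCol_mulVec, Matrix.replicateRow_mul_replicateCol_apply]

lemma dotProduct_sum_vecMulVec {d : ℕ} {ι : Type*} [Fintype ι] (w : ι → ℝ) (z : ι → Fin d → ℝ)
    (v u : Fin d → ℝ) :
    v ⬝ᵥ (∑ k, w k • Matrix.vecMulVec (z k) (z k)).mulVec u
      = ∑ k, w k * ((v ⬝ᵥ z k) * (u ⬝ᵥ z k)) := by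
  rw [Matrix.sum_mulVec, dotProduct_sum]
  refine Finset.sum_congr rfl fun k _ => ?_
  rw [Matrix.smul_mulVec, dotProduct_smul, Matrix.vecMulVec_mulVec, smul_eq_mul]
  rw [dotProduct_comm u (z k)]
  simp [dotProduct_smul, mul_comm]

/-- A design that nearly maximizes the determinant of its covariance nearly minimizes the worst
prediction variance. -/
lemma exists_design_of_det_pos {d : ℕ} (hd : 0 < d) (S : Set (Fin d → ℝ))
    (hS : ∀ y ∈ S, ∀ i, |y i| ≤ 1)
    (hdet : ∃ B ∈ convexHull ℝ ((fun y => Matrix.vecMulVec y y) '' S), 0 < B.det) :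
    ∃ (ι : Type) (_ : Fintype ι) (w : ι → ℝ) (z : ι → Fin d → ℝ), (∀ k, 0 ≤ w k) ∧ ∑ k, w k = 1 ∧
      (∀ k, z k ∈ S) ∧
      ∀ v, ∀ y ∈ S, (v ⬝ᵥ y) ^ 2 ≤ 6 * d * ∑ k, w k * (v ⬝ᵥ z k) ^ 2 := by
  set H := convexHull ℝ ((fun y => Matrix.vecMulVec y y) '' S) with hH
  have hent : ∀ B ∈ H, ∀ i j, |B i j| ≤ 1 := by
    have : H ⊆ {B | ∀ i j, |B i j| ≤ 1} := by
      refine convexHull_min ?_ ?_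
      · rintro _ ⟨y, hy, rfl⟩ i j
        change |y i * y j| ≤ 1
        rw [abs_mul]
        exact mul_le_one₀ (hS y hy i) (abs_nonneg _) (hS y hy j)
      · intro B hB C hC a b ha hb hab i j
        rw [Matrix.add_apply, Matrix.smul_apply, Matrix.smul_apply, smul_eq_mul, smul_eq_mul]
        calc |a * B i j + b * C i j| ≤ a * |B i j| + b * |C i j| := by
              refine (abs_add_le _ _).trans ?_
              rw [abs_mul, abs_mul, abs_of_nonneg ha, abs_of_nonneg hb]
          _ ≤ a * 1 + b * 1 := by gcongr; exacts [hB i j, hC i j]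
          _ = 1 := by rw [mul_one, mul_one, hab]
    exact fun B hB => this hB
  have hbdd : BddAbove (Matrix.det '' H) := by
    refine ⟨(Fintype.card (Fin d)).factorial • (1 : ℝ) ^ Fintype.card (Fin d), ?_⟩
    rintro _ ⟨B, hB, rfl⟩
    exact (le_abs_self _).trans
      (Matrix.det_le (abv := AbsoluteValue.abs) (x := (1 : ℝ)) fun i j => hent B hB i j)
  obtain ⟨B₀, hB₀, hpos₀⟩ := hdet
  set s := sSup (Matrix.det '' H) with hs
  have hs0 : 0 < s := hpos₀.trans_le (le_csSup hbdd ⟨B₀, hB₀, rfl⟩)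
  obtain ⟨_, ⟨B, hB, rfl⟩, hBs⟩ := exists_lt_of_lt_csSup
    ((Set.nonempty_of_mem hB₀).image Matrix.det)
    (show s / 2 < sSup (Matrix.det '' H) by linarith)
  have hBpos : 0 < B.det := by linarith
  -- `B` is within a factor 2 of the supremum. Moving mass `t = 1 / (2d)` to `y` loses at most the
  -- factor `(1 - t) ^ d ≥ 1/2`, so the gain `1 + t / (1 - t) * (y ⬝ᵥ B⁻¹ y)` cannot exceed 4.
  have hu : ∀ y ∈ S, y ⬝ᵥ B⁻¹.mulVec y ≤ 6 * d := by
    intro y hy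
    have hd1 : (1 : ℝ) ≤ d := by exact_mod_cast hd
    set t : ℝ := 1 / (2 * d) with ht
    have ht0 : 0 < t := by positivity
    have htd : t * d = 1 / 2 := by rw [ht]; field_simp
    have ht2 : t ≤ 1 / 2 := by nlinarith
    have h1 : (1 - t) • B + t • Matrix.vecMulVec y y ∈ H :=
      (convex_convexHull ℝ _) hB (subset_convexHull ℝ _ ⟨y, hy, rfl⟩) (by linarith) ht0.le (by ring)
    have h2 : (1 - t) • B + t • Matrix.vecMulVec y y
        = (1 - t) • (B + (t / (1 - t)) • Matrix.vecMulVec y y) := by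
      rw [smul_add, smul_smul, mul_div_cancel₀]
      linarith
    have h3 := le_csSup hbdd (Set.mem_image_of_mem Matrix.det h1)
    rw [h2, Matrix.det_smul, det_add_smul_vecMulVec hBpos.ne', Fintype.card_fin, ← hs] at h3
    have h4 : 1 / 2 ≤ (1 - t) ^ d := by
      have := one_add_mul_le_pow (show (-2 : ℝ) ≤ -t by linarith) d
      rw [← sub_eq_add_neg] at this
      nlinarith
    by_contra hcon
    push Not at hcon
    have h5 : t ≤ t / (1 - t) := by
      rw [le_div_iff₀ (by linarith)]; nlinarith
    have h6 : 4 < 1 + t / (1 - t) * (y ⬝ᵥ B⁻¹.mulVec y) := by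
      have : t * (6 * d) < t / (1 - t) * (y ⬝ᵥ B⁻¹.mulVec y) :=
        mul_lt_mul' h5 hcon (by positivity) (by linarith)
      nlinarith
    have h7 : 1 / 2 * (B.det * 4) < (1 - t) ^ d * (B.det * (1 + t / (1 - t) * (y ⬝ᵥ B⁻¹.mulVec y))) :=
      mul_lt_mul' h4 (mul_lt_mul_of_pos_left h6 hBpos) (by positivity) (by linarith)
    linarith
  obtain ⟨ι, hι, w, Z, hw0, hw1, hZ, hsum⟩ := mem_convexHull_iff_exists_fintype.1 hB
  choose z hz hzZ using hZ
  refine ⟨ι, hι, w, z, hw0, hw1, hz, fun v y hy => ?_⟩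
  have hBsum : B = ∑ k, w k • Matrix.vecMulVec (z k) (z k) := by
    rw [← hsum]; exact Finset.sum_congr rfl fun k _ => by rw [← hzZ k]
  set u := B⁻¹.mulVec y with hudef
  have hBu : B.mulVec u = y := by
    rw [hudef, Matrix.mulVec_mulVec, Matrix.mul_nonsing_inv _ (isUnit_iff_ne_zero.2 hBpos.ne'),
      Matrix.one_mulVec]
  have e1 : v ⬝ᵥ y = ∑ k, w k * ((v ⬝ᵥ z k) * (u ⬝ᵥ z k)) := by
    rw [← dotProduct_sum_vecMulVec, ← hBsum, hBu]
  have e2 : ∑ k, w k * (u ⬝ᵥ z k) ^ 2 = y ⬝ᵥ u := by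
    simp_rw [pow_two]
    rw [← dotProduct_sum_vecMulVec, ← hBsum, hBu, dotProduct_comm]
  -- Cauchy-Schwarz for the form `B`, applied to `v` and `u = B⁻¹ y`.
  have h8 := Finset.sum_sq_le_sum_mul_sum_of_sq_le_mul Finset.univ
    (r := fun k => w k * ((v ⬝ᵥ z k) * (u ⬝ᵥ z k))) (f := fun k => w k * (v ⬝ᵥ z k) ^ 2)
    (g := fun k => w k * (u ⬝ᵥ z k) ^ 2)
    (fun k _ => mul_nonneg (hw0 k) (sq_nonneg _)) (fun k _ => mul_nonneg (hw0 k) (sq_nonneg _))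
    (fun k _ => le_of_eq (by ring))
  rw [← e1, e2] at h8
  refine h8.trans ?_
  rw [mul_comm]
  exact mul_le_mul_of_nonneg_right (hu y hy)
    (Finset.sum_nonneg fun k _ => mul_nonneg (hw0 k) (sq_nonneg _))

/-- Approximate optimal design for a family of vectors in the unit ball. -/
lemma exists_design {d : ℕ} [Nonempty 𝒜] (x : 𝒜 → EuclideanSpace ℝ (Fin d)) (hx : ∀ π, ‖x π‖ ≤ 1)
    {ρ : ℝ} (hρ : 0 < ρ) :
    ∃ w : PMF 𝒜, w.support.Finite ∧ ∀ (v : EuclideanSpace ℝ (Fin d)) (π : 𝒜),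
      ENNReal.ofReal (inner ℝ v (x π) ^ 2) ≤
        ENNReal.ofReal (6 * d) * (∑' π', w π' * ENNReal.ofReal (inner ℝ v (x π') ^ 2)
          + ENNReal.ofReal (ρ * ‖v‖ ^ 2)) := by
  classical
  obtain ⟨π₀⟩ := ‹Nonempty 𝒜›
  rcases Nat.eq_zero_or_pos d with rfl | hd
  · refine ⟨PMF.pure π₀, by simp, fun v π => ?_⟩
    have : v = 0 := Subsingleton.elim _ _
    simp [this]
  set σ : ℝ := min (Real.sqrt ρ) 1 with hσ
  have hσ0 : 0 < σ := lt_min (Real.sqrt_pos.2 hρ) one_pos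
  have hσ2 : σ ^ 2 ≤ ρ := by
    calc σ ^ 2 ≤ (Real.sqrt ρ) ^ 2 := by gcongr; exact min_le_left _ _
      _ = ρ := Real.sq_sqrt hρ.le
  -- The arms need not span the space. Small multiples of the basis vectors are added so that some
  -- design has positive determinant; as `σ ^ 2 ≤ ρ`, each contributes at most `ρ * ‖v‖ ^ 2`.
  let E : Fin d → Fin d → ℝ := fun i => σ • Pi.single i (1 : ℝ)
  let S : Set (Fin d → ℝ) := Set.range (fun π => (x π).ofLp) ∪ Set.range E
  have hS : ∀ y ∈ S, ∀ i, |y i| ≤ 1 := by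
    rintro y (⟨π, rfl⟩ | ⟨j, rfl⟩) i
    · exact (PiLp.norm_apply_le (x π) i).trans (hx π)
    · simp only [E, Pi.smul_apply, smul_eq_mul, Pi.single_apply]
      split_ifs
      · rw [mul_one, abs_of_pos hσ0]; exact min_le_right _ _
      · simp
  have hd0 : (0 : ℝ) < d := by exact_mod_cast hd
  have hdet : ∃ B ∈ convexHull ℝ ((fun y => Matrix.vecMulVec y y) '' S), 0 < B.det := by
    refine ⟨(σ ^ 2 / d) • (1 : Matrix (Fin d) (Fin d) ℝ), ?_, ?_⟩
    · refine mem_convexHull_of_exists_fintype (ι := Fin d) (fun _ => 1 / (d : ℝ))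
        (fun i => Matrix.vecMulVec (E i) (E i)) (fun _ => by positivity) ?_
        (fun i => ⟨E i, Or.inr ⟨i, rfl⟩, rfl⟩) ?_
      · simp [hd0.ne']
      · ext i j
        rw [Matrix.sum_apply]
        simp only [Matrix.smul_apply, Matrix.vecMulVec_apply, E, Pi.smul_apply, smul_eq_mul,
          Pi.single_apply, Matrix.one_apply]
        rw [Finset.sum_eq_single i]
        · by_cases hij : i = j
          · simp [hij]; ring
          · simp [hij, Ne.symm hij]
        · intro b _ hb; simp [hb.symm]
        · simp
    · rw [Matrix.det_smul, Matrix.det_one]; positivity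
  obtain ⟨ι, hι, w, z, hw0, hw1, hzS, hdes⟩ := exists_design_of_det_pos hd S hS hdet
  -- Atoms of the design that are artificial basis vectors are moved to the arbitrary decision `π₀`;
  -- the term `ρ * ‖v‖ ^ 2` pays for them.
  have hpick : ∀ k, ∃ π, ∀ v : EuclideanSpace ℝ (Fin d),
      (v.ofLp ⬝ᵥ z k) ^ 2 ≤ inner ℝ v (x π) ^ 2 + ρ * ‖v‖ ^ 2 := by
    intro k
    rcases hzS k with ⟨π, hπ⟩ | ⟨j, hj⟩
    · refine ⟨π, fun v => ?_⟩
      rw [← hπ]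
      have : v.ofLp ⬝ᵥ (x π).ofLp = inner ℝ v (x π) := by
        rw [PiLp.inner_apply]; simp [dotProduct, mul_comm]
      rw [this]
      exact le_add_of_nonneg_right (by positivity)
    · refine ⟨π₀, fun v => ?_⟩
      have : (v.ofLp ⬝ᵥ z k) ^ 2 ≤ ρ * ‖v‖ ^ 2 := by
        rw [← hj]
        simp only [E, dotProduct_smul, dotProduct_single, mul_one, smul_eq_mul, mul_pow]
        refine mul_le_mul hσ2 ?_ (sq_nonneg _) hρ.le
        rw [← sq_abs]
        have := PiLp.norm_apply_le v j
        rw [Real.norm_eq_abs] at this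
        gcongr
      exact this.trans (le_add_of_nonneg_left (sq_nonneg _))
  choose q hq using hpick
  have hsum1 : ∑ k, ENNReal.ofReal (w k) = 1 := by
    rw [← ENNReal.ofReal_sum_of_nonneg fun k _ => hw0 k, hw1, ENNReal.ofReal_one]
  let P : PMF ι := PMF.ofFintype (fun k => ENNReal.ofReal (w k)) hsum1
  refine ⟨P.map q, ?_, fun v π => ?_⟩
  · rw [PMF.support_map]; exact (Set.toFinite _).image _
  have hmap : ∑' π', (P.map q) π' * ENNReal.ofReal (inner ℝ v (x π') ^ 2)
      = ∑ k, ENNReal.ofReal (w k) * ENNReal.ofReal (inner ℝ v (x (q k)) ^ 2) := by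
    simp_rw [PMF.map_apply, ← ENNReal.tsum_mul_right]
    rw [ENNReal.tsum_comm, tsum_fintype]
    refine Finset.sum_congr rfl fun k _ => ?_
    rw [tsum_eq_single (q k)]
    · simp [P]
    · intro b hb; simp [hb]
  rw [hmap, ← Finset.sum_congr rfl fun k _ => ENNReal.ofReal_mul (hw0 k),
    ← ENNReal.ofReal_sum_of_nonneg fun k _ => mul_nonneg (hw0 k) (sq_nonneg _),
    ← ENNReal.ofReal_add (Finset.sum_nonneg fun k _ => mul_nonneg (hw0 k) (sq_nonneg _))
      (by positivity), ← ENNReal.ofReal_mul (by positivity)]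
  refine ENNReal.ofReal_le_ofReal ?_
  have h1 := hdes v.ofLp (x π).ofLp (Or.inl ⟨π, rfl⟩)
  have : v.ofLp ⬝ᵥ (x π).ofLp = inner ℝ v (x π) := by
    rw [PiLp.inner_apply]; simp [dotProduct, mul_comm]
  rw [this] at h1
  refine h1.trans ?_
  gcongr
  calc ∑ k, w k * (v.ofLp ⬝ᵥ z k) ^ 2
      ≤ ∑ k, w k * (inner ℝ v (x (q k)) ^ 2 + ρ * ‖v‖ ^ 2) :=
        Finset.sum_le_sum fun k _ => mul_le_mul_of_nonneg_left (hq k v) (hw0 k)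
    _ = _ := by simp_rw [mul_add]; rw [Finset.sum_add_distrib, ← Finset.sum_mul, hw1, one_mul]

end

section

variable {𝒜 : Type u} {𝓜 : Set (Model 𝒜)} {M M' M₀ : Model 𝒜}

/-! ### Near-optimal allocations -/

open Classical in
/-- The restriction of the weight `w` to the decisions other than `p`. -/
def offWeight (p : 𝒜) (w : 𝒜 → ℝ≥0∞) : 𝒜 → ℝ≥0∞ := fun π => if π = p then 0 else w π

lemma offWeight_self (p : 𝒜) (w : 𝒜 → ℝ≥0∞) : offWeight p w p = 0 := if_pos rfl

lemma offWeight_le (p : 𝒜) (w : 𝒜 → ℝ≥0∞) (π : 𝒜) : offWeight p w π ≤ w π := by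
  unfold offWeight; split_ifs <;> simp

lemma info_eq_add_off (p : 𝒜) (w : 𝒜 → ℝ≥0∞) (M M' : Model 𝒜) :
    info w M M' = w p * kl M M' p + info (offWeight p w) M M' := by
  classical
  rw [info, ENNReal.tsum_eq_add_tsum_ite p]
  congr 1
  refine tsum_congr fun π => ?_
  unfold offWeight
  split_ifs <;> simp

lemma tsum_eq_add_off (p : 𝒜) (w : 𝒜 → ℝ≥0∞) : ∑' π, w π = w p + ∑' π, offWeight p w π := by
  classical
  rw [ENNReal.tsum_eq_add_tsum_ite p]
  rfl

lemma cost_mono {w w' : 𝒜 → ℝ≥0∞} (h : ∀ π, w π ≤ w' π) (M : Model 𝒜) :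
    cost M w ≤ cost M w' := ENNReal.tsum_le_tsum fun π => mul_le_mul_left (h π) _

open Classical in
/-- The allocation with weight `c` on `p` and zero elsewhere. -/
def pointAlloc (p : 𝒜) (c : ℝ≥0) : 𝒜 → ℝ≥0 := fun π => if π = p then c else 0

lemma info_pointAlloc (p : 𝒜) (c : ℝ≥0) (M M' : Model 𝒜) :
    info (fun π => (pointAlloc p c π : ℝ≥0∞)) M M' = c * kl M M' p := by
  rw [info, tsum_eq_single p]
  · simp [pointAlloc]
  · intro π hπ; simp [pointAlloc, hπ]

lemma cost_pointAlloc {p : 𝒜} (hp : p ∈ optSet M) (c : ℝ≥0) :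
    cost M (fun π => (pointAlloc p c π : ℝ≥0∞)) = 0 := by
  rw [cost, tsum_eq_single p]
  · simp [gap_eq_zero_of_mem hp]
  · intro π hπ; simp [pointAlloc, hπ]

/-- Near-optimality is immediate from the infimum unless the coefficient vanishes, when a factor `1
+ κ` gives no room. In that case an allocation of cost below the minimum gap has mass at most 1 off
the optimal decision, hence information at most 1/2 from there. The optimal decision supplies the
other half, so doubling its weight alone is feasible at zero cost. -/
lemma GaussClass.exists_near_optimal (h𝓜 : GaussClass 𝓜) (hM : M ∈ 𝓜) (h0 : 0 < minGap M)
    (hg : glc 𝓜 M ≠ ∞) {κ : ℝ} (hκ : 0 < κ) :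
    ∃ η : 𝒜 → ℝ≥0, cost M (fun π => (η π : ℝ≥0∞)) ≤ ENNReal.ofReal (1 + κ) * glc 𝓜 M ∧
      ∀ M' ∈ alt 𝓜 M, 1 ≤ info (fun π => (η π : ℝ≥0∞)) M M' := by
  by_cases hz : glc 𝓜 M = 0
  · obtain ⟨p, hp⟩ := existsUnique_of_minGap_pos h0
    have hlt : glc 𝓜 M < minGap M := hz ▸ h0
    rw [glc, iInf_lt_iff] at hlt
    obtain ⟨η, hη⟩ := hlt
    obtain ⟨hfeas, hc⟩ := iInf_lt_iff.1 hη
    refine ⟨pointAlloc p (2 * η p), ?_, fun M' hM' => ?_⟩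
    · rw [cost_pointAlloc (hp ▸ Set.mem_singleton p)]; exact zero_le
    · have h1 := hfeas M' hM'
      rw [info_eq_add_off p] at h1
      have h2 : info (offWeight p fun π => (η π : ℝ≥0∞)) M M' ≤ ENNReal.ofReal (1 / 2) := by
        refine (h𝓜.info_le hM hM'.1 _).trans ?_
        refine mul_le_of_le_one_left' ((tsum_off_le hp h0 _ (offWeight_self _ _)).trans ?_)
        refine ENNReal.div_le_of_le_mul ?_
        rw [one_mul]
        exact (cost_mono (offWeight_le _ _) M).trans hc.le
      have h3 : ENNReal.ofReal (1 / 2) ≤ η p * kl M M' p := by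
        have h4 := h1.trans (add_le_add_right h2 _)
        rw [← tsub_le_iff_right] at h4
        refine le_trans ?_ h4
        rw [← ENNReal.ofReal_one, ← ENNReal.ofReal_sub _ (by norm_num)]
        norm_num
      rw [info_pointAlloc]
      push_cast
      rw [mul_assoc]
      calc (1 : ℝ≥0∞) = 2 * ENNReal.ofReal (1 / 2) := by
            rw [← ENNReal.ofReal_ofNat, ← ENNReal.ofReal_mul (by norm_num)]; norm_num
        _ ≤ _ := mul_le_mul_right h3 _
  · have hlt : glc 𝓜 M < ENNReal.ofReal (1 + κ) * glc 𝓜 M := by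
      calc glc 𝓜 M = 1 * glc 𝓜 M := (one_mul _).symm
        _ < _ := by
          refine ENNReal.mul_lt_mul_left hz hg ?_
          rw [ENNReal.one_lt_ofReal]; linarith
    nth_rewrite 1 [glc] at hlt
    obtain ⟨η, hη⟩ := iInf_lt_iff.1 hlt
    obtain ⟨hfeas, hc⟩ := iInf_lt_iff.1 hη
    exact ⟨η, hc.le, hfeas⟩

/-- A near-optimal allocation with prescribed weight on the optimal decision. -/
lemma GaussClass.exists_alloc (h𝓜 : GaussClass 𝓜) (hM : M ∈ 𝓜) {p : 𝒜} (hp : optSet M = {p})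
    (h0 : 0 < minGap M) (hg : glc 𝓜 M ≠ ∞) {e κ : ℝ} (hκ : 0 < κ) (hκe : κ ≤ e) {n : ℝ≥0}
    (hn : optInfo 𝓜 e M < n) :
    ∃ η : 𝒜 → ℝ≥0, η p = n ∧
      ∑' π, offWeight p (fun π => (η π : ℝ≥0∞)) π ≤
        ENNReal.ofReal (1 + κ) * glc 𝓜 M / minGap M ∧
      cost M (fun π => (η π : ℝ≥0∞)) ≤ ENNReal.ofReal (1 + κ) * glc 𝓜 M ∧
      ∀ M' ∈ alt 𝓜 M, ENNReal.ofReal (1 - 2 * e) ≤ info (fun π => (η π : ℝ≥0∞)) M M' := by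
  classical
  obtain ⟨η, hc, hf⟩ := h𝓜.exists_near_optimal hM h0 hg hκ
  rw [optInfo] at hn
  obtain ⟨m, hm⟩ := iInf_lt_iff.1 hn
  obtain ⟨hprop, hmn⟩ := iInf_lt_iff.1 hm
  -- The infimum defining `optInfo` need not be attained; some admissible `m < n` is used, and
  -- raising the weight from `m` to `n` only adds information.
  have h1 := hprop η
    (hc.trans (mul_le_mul_left (ENNReal.ofReal_le_ofReal (by linarith)) _))
    (fun M' hM' => (ENNReal.ofReal_le_one.2 (by linarith)).trans (hf M' hM'))
  have hpm : p ∈ optSet M := hp ▸ Set.mem_singleton p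
  have hmem : ∀ π, π ∈ optSet M ↔ π = p := fun π => by rw [hp, Set.mem_singleton_iff]
  let η' : 𝒜 → ℝ≥0 := fun π => if π = p then n else η π
  have hoff : offWeight p (fun π => (η' π : ℝ≥0∞)) = offWeight p (fun π => (η π : ℝ≥0∞)) := by
    ext π; simp only [offWeight, η']; split_ifs <;> rfl
  have hcost : cost M (fun π => (η' π : ℝ≥0∞)) ≤ cost M (fun π => (η π : ℝ≥0∞)) := by
    refine ENNReal.tsum_le_tsum fun π => ?_
    by_cases hπ : π = p
    · rw [hπ, gap_eq_zero_of_mem hpm, mul_zero, mul_zero]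
    · simp [η', hπ]
  refine ⟨η', if_pos rfl, ?_, hcost.trans hc, fun M' hM' => ?_⟩
  · rw [hoff]
    refine (tsum_off_le hp h0 _ (offWeight_self _ _)).trans ?_
    exact ENNReal.div_le_div_right ((cost_mono (offWeight_le _ _) M).trans hc) _
  · refine (h1 M' hM').trans (info_mono (fun π => ?_) _ _)
    by_cases hπ : π = p
    · simp only [hmem, hπ, if_true, η']; exact_mod_cast hmn.le
    · simp [hmem, hπ, η']

/-- A positive Graves-Lai coefficient is at least a quarter of the minimum gap. -/
lemma GaussClass.minGap_le_glc [Nontrivial 𝒜] (h𝓜 : GaussClass 𝓜) (hM : M ∈ 𝓜) (h0 : 0 < minGap M)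
    {e : ℝ} (he : 0 < e) (he8 : e ≤ 1 / 8) (hI : optInfo 𝓜 e M ≠ ∞) (hg : 0 < glc 𝓜 M) :
    minGap M ≤ 4 * glc 𝓜 M := by
  -- If the coefficient were below a quarter of the gap, an allocation with weight `n` on `p` would
  -- have mass at most 1/2 elsewhere, hence information at most 1/4 from there. Then `p` alone would
  -- give at least 1/2, so weight `2 * n` on it would be feasible for free and the coefficient would
  -- be zero.
  by_contra hcon
  push Not at hcon
  obtain ⟨p, hp⟩ := existsUnique_of_minGap_pos h0
  have hgap1 := h𝓜.minGap_le_one hM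
  have hgtop : glc 𝓜 M ≠ ∞ := by
    rintro h; rw [h] at hcon; simp at hcon
  obtain ⟨η, hηp, hoff, -, hf⟩ := h𝓜.exists_alloc hM hp h0 hgtop he le_rfl
    (n := (optInfo 𝓜 e M).toNNReal + 1) (by
      rw [ENNReal.coe_add, ENNReal.coe_toNNReal hI]
      exact ENNReal.lt_add_right hI (by simp))
  set n := (optInfo 𝓜 e M).toNNReal + 1
  have hmass : ∑' π, offWeight p (fun π => (η π : ℝ≥0∞)) π ≤ ENNReal.ofReal (1 / 2) := by
    refine hoff.trans (ENNReal.div_le_of_le_mul ?_)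
    calc ENNReal.ofReal (1 + e) * glc 𝓜 M ≤ ENNReal.ofReal 2 * glc 𝓜 M :=
          mul_le_mul_left (ENNReal.ofReal_le_ofReal (by linarith)) _
      _ = ENNReal.ofReal (1 / 2) * (4 * glc 𝓜 M) := by
          rw [← mul_assoc]; congr 1
          rw [← ENNReal.ofReal_ofNat 4, ← ENNReal.ofReal_mul (by norm_num)]; norm_num
      _ ≤ _ := mul_le_mul_right hcon.le _
  have hle : glc 𝓜 M ≤ cost M fun π => (pointAlloc p (2 * n) π : ℝ≥0∞) := by
    refine glc_le_cost fun M' hM' => ?_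
    have h1 := hf M' hM'
    rw [info_eq_add_off p, hηp] at h1
    have h2 : info (offWeight p fun π => (η π : ℝ≥0∞)) M M' ≤ ENNReal.ofReal (1 / 4) := by
      refine (h𝓜.info_le hM hM'.1 _).trans ((mul_le_mul_left hmass _).trans ?_)
      rw [← ENNReal.ofReal_mul (by norm_num)]; norm_num
    have h3 : ENNReal.ofReal (1 / 2) ≤ n * kl M M' p := by
      have h4 := h1.trans (add_le_add_right h2 _)
      rw [← tsub_le_iff_right, ← ENNReal.ofReal_sub _ (by norm_num)] at h4
      exact (ENNReal.ofReal_le_ofReal (by linarith)).trans h4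
    rw [info_pointAlloc]
    push_cast
    rw [mul_assoc]
    calc (1 : ℝ≥0∞) = 2 * ENNReal.ofReal (1 / 2) := by
          rw [← ENNReal.ofReal_ofNat, ← ENNReal.ofReal_mul (by norm_num)]; norm_num
      _ ≤ _ := mul_le_mul_right h3 _
  rw [cost_pointAlloc (hp ▸ Set.mem_singleton p)] at hle
  exact hg.ne' (nonpos_iff_eq_zero.1 hle)

/-! ### Allocations for close models -/

/-- For means in `[0, 1]` half the squared distance is 1-Lipschitz in each mean, so the information
moves by at most `g` per unit of mass. -/
lemma GaussClass.info_le_of_close (h𝓜 : GaussClass 𝓜) (hM : M ∈ 𝓜) (hM₀ : M₀ ∈ 𝓜) (hM' : M' ∈ 𝓜)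
    {g : ℝ} (hc : ∀ π, |mean M π - mean M₀ π| ≤ g) (w : 𝒜 → ℝ≥0∞) :
    info w M₀ M' ≤ info w M M' + (∑' π, w π) * ENNReal.ofReal g := by
  rw [info, info, ← ENNReal.tsum_mul_right, ← ENNReal.tsum_add]
  refine ENNReal.tsum_le_tsum fun π => ?_
  rw [← mul_add]
  refine mul_le_mul_right ?_ _
  have hg0 : 0 ≤ g := (abs_nonneg _).trans (hc π)
  rw [h𝓜.kl_eq hM hM', h𝓜.kl_eq hM₀ hM', ← ENNReal.ofReal_add (by positivity) hg0]
  refine ENNReal.ofReal_le_ofReal ?_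
  have h1 := abs_le.1 (hc π)
  have h2 := abs_le.1 (h𝓜.abs_sub_le_one hM hM' π)
  have h3 := abs_le.1 (h𝓜.abs_sub_le_one hM₀ hM' π)
  nlinarith [h1.1, h1.2, h2.1, h2.2, h3.1, h3.2]

/-- Each gap moves by at most `2 * g`. Off the common optimal decision the gaps of `M₀` are at least
`x`, so the additive error is multiplicative. -/
lemma cost_le_of_close {p : 𝒜} (hp : optSet M = {p}) (hp₀ : optSet M₀ = {p})
    {g x : ℝ} (hx : 0 < x) (hx₀ : ENNReal.ofReal x ≤ minGap M₀)
    (hc : ∀ π, |mean M π - mean M₀ π| ≤ g) (w : 𝒜 → ℝ≥0∞) :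
    cost M w ≤ ENNReal.ofReal (1 + 2 * g / x) * cost M₀ w := by
  rw [cost, cost, ← ENNReal.tsum_mul_left]
  refine ENNReal.tsum_le_tsum fun π => ?_
  rw [mul_left_comm]
  refine mul_le_mul_right ?_ _
  have hpm : p ∈ optSet M := hp ▸ Set.mem_singleton p
  have hpm₀ : p ∈ optSet M₀ := hp₀ ▸ Set.mem_singleton p
  have hg0 : 0 ≤ g := (abs_nonneg _).trans (hc π)
  by_cases hπ : π = p
  · rw [hπ, gap_eq_zero_of_mem hpm]; exact zero_le
  have h1 := hx₀.trans (minGap_le_gap hp₀ hπ)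
  rw [gap_of_mem_optSet hpm₀] at h1 ⊢
  rw [gap_of_mem_optSet hpm, ← ENNReal.ofReal_mul (by positivity)]
  refine ENNReal.ofReal_le_ofReal ?_
  have h2 : x ≤ mean M₀ p - mean M₀ π := by
    rcases ENNReal.ofReal_le_ofReal_iff'.1 h1 with h | h
    · exact h
    · linarith
  have h3 := abs_le.1 (hc π)
  have h4 := abs_le.1 (hc p)
  have h5 : 2 * g ≤ 2 * g / x * (mean M₀ p - mean M₀ π) := by
    rw [div_mul_eq_mul_div, le_div_iff₀ hx]; gcongr
  nlinarith [h3.1, h3.2, h4.1, h4.2]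

/-- Quantitative regularity of the model `M`: the gap is at least `1/R`, and the weights of
near-optimal allocations are of order `R`. -/
structure Tame (𝓜 : Set (Model 𝒜)) (ε R : ℝ) (M : Model 𝒜) : Prop where
  mem : M ∈ 𝓜
  le_minGap : ENNReal.ofReal (1 / R) ≤ minGap M
  optInfo_le : optInfo 𝓜 (ε / 36) M + 1 ≤ ENNReal.ofReal R
  glc_le : 2 * glc 𝓜 M ≤ ENNReal.ofReal R * minGap M

lemma Tame.one_le {ε R : ℝ} (h : Tame 𝓜 ε R M) : 1 ≤ R :=
  ENNReal.one_le_ofReal.1 (le_add_self.trans h.optInfo_le)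

lemma Tame.minGap_pos {ε R : ℝ} (h : Tame 𝓜 ε R M) : 0 < minGap M :=
  (ENNReal.ofReal_pos.2 (by have := h.one_le; positivity)).trans_le h.le_minGap

lemma Tame.glc_ne_top [Nontrivial 𝒜] {ε R : ℝ} (h𝓜 : GaussClass 𝓜) (h : Tame 𝓜 ε R M) :
    glc 𝓜 M ≠ ∞ := by
  intro ht
  have h1 := h.glc_le
  rw [ht, ENNReal.mul_top (by norm_num), top_le_iff] at h1
  exact ENNReal.mul_ne_top ENNReal.ofReal_ne_top
    ((h𝓜.minGap_le_one h.mem).trans_lt ENNReal.one_lt_top).ne h1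

/-- The weight on `p` is set to `R`, and the mass off `p` is at most twice the coefficient over the
gap, hence at most `R`. The loss `ε / 18` is `2 * (ε / 36)`, from the definition of `optInfo`. -/
lemma Tame.exists_alloc [Nontrivial 𝒜] {ε R : ℝ} (h𝓜 : GaussClass 𝓜) (h : Tame 𝓜 ε R M)
    (hε : 0 < ε) (hε2 : ε ≤ 1 / 2) {p : 𝒜} (hp : optSet M = {p}) :
    ∃ η : 𝒜 → ℝ≥0, 0 < ∑' π, (η π : ℝ≥0∞) ∧ ∑' π, (η π : ℝ≥0∞) ≤ ENNReal.ofReal (2 * R) ∧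
      cost M (fun π => (η π : ℝ≥0∞)) ≤ ENNReal.ofReal (1 + ε / 1000) * glc 𝓜 M ∧
      ∀ M' ∈ alt 𝓜 M, ENNReal.ofReal (1 - ε / 18) ≤ info (fun π => (η π : ℝ≥0∞)) M M' := by
  have hR := h.one_le
  obtain ⟨η, hηp, hoff, hc, hf⟩ := h𝓜.exists_alloc h.mem hp h.minGap_pos (h.glc_ne_top h𝓜)
    (e := ε / 36) (κ := ε / 1000) (by positivity) (by linarith) (n := R.toNNReal) (by
      have h1 : optInfo 𝓜 (ε / 36) M ≠ ∞ := by
        intro ht; have := h.optInfo_le; rw [ht] at this; simp at this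
      exact (ENNReal.lt_add_right h1 one_ne_zero).trans_le h.optInfo_le)
  refine ⟨η, ?_, ?_, hc, fun M' hM' => ?_⟩
  · rw [tsum_eq_add_off p, hηp]
    exact lt_of_lt_of_le (by simp; linarith) le_self_add
  · rw [tsum_eq_add_off p, hηp, two_mul, ENNReal.ofReal_add (by linarith) (by linarith)]
    refine add_le_add le_rfl (hoff.trans (ENNReal.div_le_of_le_mul (le_trans ?_ h.glc_le)))
    refine mul_le_mul_left ?_ _
    rw [← ENNReal.ofReal_ofNat 2]
    exact ENNReal.ofReal_le_ofReal (by linarith)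
  · refine le_trans (ENNReal.ofReal_le_ofReal ?_) (hf M' hM')
    linarith

/-- An allocation of mass `2 * R` for `M` loses at most `2 * R * (ε / (1000 * R)) = ε / 500` of
information when transferred to `M₀`; dividing by `1 - ε / 18 - ε / 500` restores feasibility. -/
lemma Tame.glc_le_of_close [Nontrivial 𝒜] {ε R : ℝ} (h𝓜 : GaussClass 𝓜) (h : Tame 𝓜 ε R M)
    (hM₀ : M₀ ∈ 𝓜) (hε : 0 < ε) (hε2 : ε ≤ 1 / 2) {p : 𝒜} (hp : optSet M = {p})
    (hp₀ : optSet M₀ = {p}) (hc : ∀ π, |mean M π - mean M₀ π| ≤ ε / (1000 * R)) :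
    glc 𝓜 M₀ ≤ ENNReal.ofReal ((1 + ε / 500) * (1 + ε / 1000) / (1 - ε / 18 - ε / 500))
      * glc 𝓜 M := by
  have hR := h.one_le
  obtain ⟨η, -, hmass, hcost, hf⟩ := h.exists_alloc h𝓜 hε hε2 hp
  have hdpos : 0 < 1 - ε / 18 - ε / 500 := by linarith
  set c : ℝ≥0 := (1 / (1 - ε / 18 - ε / 500)).toNNReal with hcdef
  have hc' : ∀ π, |mean M₀ π - mean M π| ≤ ε / (1000 * R) := fun π => by
    rw [abs_sub_comm]; exact hc π
  have hcoe : ∀ π, ((c * η π : ℝ≥0) : ℝ≥0∞) = (c : ℝ≥0∞) * η π := fun π => ENNReal.coe_mul _ _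
  have h1 : glc 𝓜 M₀ ≤ cost M₀ fun π => ((c * η π : ℝ≥0) : ℝ≥0∞) := by
    refine glc_le_cost fun M' hM' => ?_
    rw [alt_eq_of_optSet_eq (hp₀.trans hp.symm)] at hM'
    simp_rw [hcoe]
    rw [info_const_mul]
    have h2 := (hf M' hM').trans (h𝓜.info_le_of_close hM₀ h.mem hM'.1 hc' _)
    have h3 : (∑' π, (η π : ℝ≥0∞)) * ENNReal.ofReal (ε / (1000 * R)) ≤ ENNReal.ofReal (ε / 500) := by
      refine (mul_le_mul_left hmass _).trans ?_
      rw [← ENNReal.ofReal_mul (by positivity)]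
      refine ENNReal.ofReal_le_ofReal (le_of_eq ?_)
      field_simp; norm_num
    have h4 : ENNReal.ofReal (1 - ε / 18 - ε / 500) ≤ info (fun π => (η π : ℝ≥0∞)) M₀ M' := by
      rw [ENNReal.ofReal_sub _ (by positivity), tsub_le_iff_right]
      exact h2.trans (add_le_add_right h3 _)
    calc (1 : ℝ≥0∞) = c * ENNReal.ofReal (1 - ε / 18 - ε / 500) := by
          rw [hcdef]
          change _ = ENNReal.ofReal _ * _
          rw [← ENNReal.ofReal_mul (by positivity), div_mul_cancel₀ _ hdpos.ne', ENNReal.ofReal_one]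
      _ ≤ _ := mul_le_mul_right h4 _
  refine h1.trans ?_
  simp_rw [hcoe]
  rw [cost_const_mul]
  have h5 := cost_le_of_close hp₀ hp (x := 1 / R) (by positivity) h.le_minGap hc'
    (fun π => (η π : ℝ≥0∞))
  have h6 : 2 * (ε / (1000 * R)) / (1 / R) = ε / 500 := by field_simp; norm_num
  rw [h6] at h5
  calc (c : ℝ≥0∞) * cost M₀ (fun π => (η π : ℝ≥0∞))
      ≤ c * (ENNReal.ofReal (1 + ε / 500) * (ENNReal.ofReal (1 + ε / 1000) * glc 𝓜 M)) :=
        mul_le_mul_right (h5.trans (mul_le_mul_right hcost _)) _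
    _ = _ := by
        rw [← mul_assoc, ← mul_assoc, hcdef]
        change ENNReal.ofReal _ * _ * _ * _ = _
        rw [← ENNReal.ofReal_mul (by positivity), ← ENNReal.ofReal_mul (by positivity)]
        congr 2; ring

/-- A single normalized allocation is near-optimal for all models close to a given one. -/
lemma Tame.exists_mem_glSetLE [Nontrivial 𝒜] {ε R : ℝ} (h𝓜 : GaussClass 𝓜) (h : Tame 𝓜 ε R M₀)
    (hε : 0 < ε) (hε2 : ε ≤ 1 / 2) :
    ∃ w : PMF 𝒜, ∀ M, Tame 𝓜 ε R M → (∀ π, |mean M π - mean M₀ π| ≤ ε / (1000 * R)) →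
      M ∈ glSetLE 𝓜 (ε / 10) w (ENNReal.ofReal (2 * R)) := by
  have hR := h.one_le
  obtain ⟨p, hp₀⟩ := existsUnique_of_minGap_pos h.minGap_pos
  obtain ⟨η, hpos, hmass, hcost, hf⟩ := h.exists_alloc h𝓜 hε hε2 hp₀
  set m := ∑' π, (η π : ℝ≥0∞) with hm
  have hmtop : m ≠ ∞ := (hmass.trans_lt ENNReal.ofReal_lt_top).ne
  -- The normalization factor is the total mass `m ≤ 2 * R` of the allocation of `M₀`.
  let w : PMF 𝒜 := PMF.normalize (fun π => (η π : ℝ≥0∞)) hpos.ne' hmtop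
  have hw : (w : 𝒜 → ℝ≥0∞) = fun π => m⁻¹ * (η π : ℝ≥0∞) := by
    ext π; rw [PMF.normalize_apply, mul_comm]
  have hmN : ((m.toNNReal : ℝ≥0) : ℝ≥0∞) = m := ENNReal.coe_toNNReal hmtop
  refine ⟨w, fun M hM hc => ⟨hM.mem, m.toNNReal, ?_, ?_, ?_, fun M' hM' => ?_⟩⟩
  · rw [← ENNReal.coe_lt_coe, hmN]; exact_mod_cast hpos
  · rw [hmN]; exact hmass
  all_goals obtain ⟨q, hq⟩ := existsUnique_of_minGap_pos hM.minGap_pos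
  all_goals
    have hqp : q = p := by
      refine optSet_eq_of_close hq hp₀ hM.le_minGap ?_ hc
      rw [mul_div_assoc', div_lt_div_iff₀ (by positivity) (by positivity)]
      nlinarith
    subst hqp
  · rw [hmN, hw, cost_const_mul, mul_comm, ← ENNReal.div_eq_inv_mul.trans (mul_comm _ _)]
    refine ENNReal.div_le_div_right ?_ _
    have h5 := cost_le_of_close hq hp₀ (x := 1 / R) (by positivity) h.le_minGap hc
      (fun π => (η π : ℝ≥0∞))
    have h6 : 2 * (ε / (1000 * R)) / (1 / R) = ε / 500 := by field_simp; norm_num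
    rw [h6] at h5
    have hdpos : 0 < 1 - ε / 18 - ε / 500 := by linarith
    refine (h5.trans (mul_le_mul_right (hcost.trans (mul_le_mul_right
      (hM.glc_le_of_close h𝓜 h.mem hε hε2 hq hp₀ hc) _)) _)).trans ?_
    rw [← mul_assoc, ← mul_assoc, ← ENNReal.ofReal_mul (by positivity),
      ← ENNReal.ofReal_mul (by positivity)]
    refine mul_le_mul_left (ENNReal.ofReal_le_ofReal ?_) _
    rw [mul_div_assoc', div_le_iff₀ hdpos]
    -- The product appears twice: once for moving the cost of the allocation to `M`, once for
    -- comparing the two coefficients. The tolerance `ε / 10` leaves room for both and for the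
    -- rescaling.
    have h7 : (1 + ε / 500) * (1 + ε / 1000) ≤ 1 + ε / 250 := by nlinarith
    calc (1 + ε / 500) * (1 + ε / 1000) * ((1 + ε / 500) * (1 + ε / 1000))
        ≤ (1 + ε / 250) * (1 + ε / 250) := by gcongr
      _ ≤ _ := by nlinarith
  · have h2 := (hf M' (by rwa [alt_eq_of_optSet_eq (hp₀.trans hq.symm)])).trans
      (h𝓜.info_le_of_close hM.mem h.mem hM'.1 hc _)
    have h3 : (∑' π, (η π : ℝ≥0∞)) * ENNReal.ofReal (ε / (1000 * R)) ≤ ENNReal.ofReal (ε / 500) := by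
      refine (mul_le_mul_left hmass _).trans ?_
      rw [← ENNReal.ofReal_mul (by positivity)]
      refine ENNReal.ofReal_le_ofReal (le_of_eq ?_)
      field_simp; norm_num
    rw [hmN, hw, info_const_mul, ENNReal.div_eq_inv_mul]
    refine mul_le_mul_right ?_ _
    calc ENNReal.ofReal (1 - ε / 10) ≤ ENNReal.ofReal (1 - ε / 18 - ε / 500) :=
          ENNReal.ofReal_le_ofReal (by linarith)
      _ ≤ _ := by
          rw [ENNReal.ofReal_sub _ (by positivity), tsub_le_iff_right]
          exact h2.trans (add_le_add_right h3 _)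

lemma glSetLE_mono {e e' : ℝ} (he : e ≤ e') {w : PMF 𝒜} {n n' : ℝ≥0∞} (hn : n ≤ n') :
    glSetLE 𝓜 e w n ⊆ glSetLE 𝓜 e' w n' := by
  rintro M ⟨hM, m, hm0, hmn, hc, hi⟩
  refine ⟨hM, m, hm0, hmn.trans hn, hc.trans ?_, fun M' hM' => le_trans ?_ (hi M' hM')⟩
  · exact ENNReal.div_le_div_right
      (mul_le_mul_left (ENNReal.ofReal_le_ofReal (by linarith)) _) _
  · exact ENNReal.div_le_div_right (ENNReal.ofReal_le_ofReal (by linarith)) _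

end

section

variable {𝒜 : Type u} {𝓜 : Set (Model 𝒜)} {M M' M₀ : Model 𝒜}

/-! ### Exploration in linear bandits -/

/-- Pointwise this is `(a - c) ^ 2 ≤ 2 * ((b - a) ^ 2 + (b - c) ^ 2)`. -/
lemma GaussClass.info_triangle (h𝓜 : GaussClass 𝓜) (hM : M ∈ 𝓜) (hM₀ : M₀ ∈ 𝓜) (hM' : M' ∈ 𝓜)
    (w : 𝒜 → ℝ≥0∞) : info w M M₀ ≤ 2 * (info w M' M + info w M' M₀) := by
  rw [info, info, info, ← ENNReal.tsum_add, ← ENNReal.tsum_mul_left]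
  refine ENNReal.tsum_le_tsum fun π => ?_
  rw [← mul_add, mul_left_comm]
  refine mul_le_mul_right ?_ _
  rw [h𝓜.kl_eq hM hM₀, h𝓜.kl_eq hM' hM, h𝓜.kl_eq hM' hM₀,
    ← ENNReal.ofReal_add (by positivity) (by positivity), ← ENNReal.ofReal_ofNat 2,
    ← ENNReal.ofReal_mul (by positivity)]
  refine ENNReal.ofReal_le_ofReal ?_
  nlinarith [sq_nonneg (mean M π + mean M₀ π - 2 * mean M' π)]

variable {d : ℕ} {D : ℝ} {x : 𝒜 → EuclideanSpace ℝ (Fin d)} {Θ : Set (EuclideanSpace ℝ (Fin d))}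
  {Mstar : Model 𝒜}

lemma pos_of_minGap_pos [Nontrivial 𝒜] (hM : M ∈ linearClass x Θ) (h0 : 0 < minGap M) : 0 < d := by
  rcases Nat.eq_zero_or_pos d with rfl | hd
  · obtain ⟨θ, -, rfl⟩ := hM
    obtain ⟨p, hp⟩ := existsUnique_of_minGap_pos h0
    obtain ⟨q, hq⟩ := exists_ne p
    have : q ∈ optSet (linearModel x θ) := fun π => by
      rw [mean_linearModel, mean_linearModel, Subsingleton.elim (x π) (x q)]
    rw [hp] at this
    exact absurd this hq
  · exact hd

/-- Under a nearly optimal design, models with small divergence have uniformly close means. -/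
lemma IsLinearInstance.exists_design [Nonempty 𝒜] (h : IsLinearInstance D x Θ Mstar) (hD : 0 < D)
    {τ : ℝ} (hτ : 0 < τ) :
    ∃ ω : PMF 𝒜, ω.support.Finite ∧ ∀ M ∈ linearClass x Θ, ∀ M₀ ∈ linearClass x Θ, ∀ π,
      ENNReal.ofReal ((mean M π - mean M₀ π) ^ 2) ≤
        ENNReal.ofReal (12 * d) * (info ω M M₀ + ENNReal.ofReal τ) := by
  -- With this `ρ` the regularization term is at most `2 * τ`, because parameters differ by at most
  -- `D`. The divergence carries a factor 1/2, which turns `6 * d` into `12 * d`.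
  obtain ⟨ω, hfin, hω⟩ := GLBandit.exists_design x h.norm_le (ρ := 2 * τ / D ^ 2) (by positivity)
  refine ⟨ω, hfin, ?_⟩
  intro M hM M₀ hM₀ π
  have hkl := fun π => h.gaussClass.kl_eq hM hM₀ π
  obtain ⟨θ, hθ, rfl⟩ := hM
  obtain ⟨θ₀, hθ₀, rfl⟩ := hM₀
  have hmean : ∀ π, mean (linearModel x θ) π - mean (linearModel x θ₀) π
      = inner ℝ (θ - θ₀) (x π) := fun π => by
    rw [mean_linearModel, mean_linearModel, inner_sub_left]
  have hinfo : info ω (linearModel x θ) (linearModel x θ₀)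
      = ENNReal.ofReal (1 / 2) * ∑' π', ω π' * ENNReal.ofReal (inner ℝ (θ - θ₀) (x π') ^ 2) := by
    rw [info, ← ENNReal.tsum_mul_left]
    refine tsum_congr fun π' => ?_
    rw [hkl, hmean, mul_left_comm, ← ENNReal.ofReal_mul (by positivity)]
    congr 2; ring
  rw [hmean, hinfo]
  refine (hω (θ - θ₀) π).trans ?_
  have hn : ‖θ - θ₀‖ ^ 2 ≤ D ^ 2 := by
    have := h.dist_le θ hθ θ₀ hθ₀
    rw [dist_eq_norm] at this
    gcongr
  have h1 : 2 * τ / D ^ 2 * ‖θ - θ₀‖ ^ 2 ≤ 2 * τ := by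
    rw [div_mul_eq_mul_div, div_le_iff₀ (by positivity)]; gcongr
  have h2 : (12 * d : ℝ) = 6 * d * 2 := by ring
  rw [h2, ENNReal.ofReal_mul (p := 6 * (d : ℝ)) (by positivity), mul_assoc]
  refine mul_le_mul_right ?_ _
  rw [mul_add, ← mul_assoc, ← ENNReal.ofReal_mul (by norm_num), ← ENNReal.ofReal_mul (by norm_num),
    mul_one_div_cancel two_ne_zero, ENNReal.ofReal_one, one_mul]
  gcongr

/-- A multiple of the design is feasible. An alternative differs from `M` by at least `y / 2` at
some decision, since otherwise `p` would remain optimal; the design then gives it information at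
least `y ^ 2 / (96 * d)`. Gaps are at most 1, so the cost is at most the multiplier. -/
lemma IsLinearInstance.glc_le [Nontrivial 𝒜] (h : IsLinearInstance D x Θ Mstar) (hD : 0 < D)
    {y : ℝ} (hy : 0 < y) (hM : M ∈ linearClass x Θ) (hgap : ENNReal.ofReal y ≤ minGap M) :
    glc (linearClass x Θ) M ≤ ENNReal.ofReal (96 * d / y ^ 2) := by
  have h0 : 0 < minGap M := (ENNReal.ofReal_pos.2 hy).trans_le hgap
  have hd := pos_of_minGap_pos hM h0
  have hd' : (0 : ℝ) < d := by exact_mod_cast hd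
  have h𝓜 := h.gaussClass
  obtain ⟨p, hp⟩ := existsUnique_of_minGap_pos h0
  obtain ⟨ω, -, hω⟩ := h.exists_design hD (τ := y ^ 2 / (96 * d)) (by positivity)
  set c : ℝ≥0 := (96 * d / y ^ 2).toNNReal with hc
  have hcoe : ∀ π, (((fun π => c * (ω π).toNNReal) π : ℝ≥0) : ℝ≥0∞) = (c : ℝ≥0∞) * ω π := fun π => by
    rw [ENNReal.coe_mul, ENNReal.coe_toNNReal (ω.apply_ne_top π)]
  refine (glc_le_cost (η := fun π => c * (ω π).toNNReal) fun M' hM' => ?_).trans ?_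
  · rw [funext hcoe, info_const_mul]
    have hM'c := (mem_alt_iff hp).1 hM'
    have hex : ∃ π, y / 2 ≤ |mean M π - mean M' π| := by
      by_contra hcon
      push Not at hcon
      refine hM'c.2 fun π => ?_
      by_cases hπ : π = p
      · rw [hπ]
      have hpm : p ∈ optSet M := hp ▸ Set.mem_singleton p
      have h1 := hgap.trans (minGap_le_gap hp hπ)
      rw [gap_of_mem_optSet hpm, ENNReal.ofReal_le_ofReal_iff'] at h1
      have h2 := abs_lt.1 (hcon p)
      have h3 := abs_lt.1 (hcon π)
      rcases h1 with h1 | h1 <;> linarith [h2.1, h2.2, h3.1, h3.2]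
    obtain ⟨π, hπ⟩ := hex
    have h1 := hω M hM M' hM'.1 π
    have h2 : ENNReal.ofReal (y ^ 2 / 4) ≤ ENNReal.ofReal ((mean M π - mean M' π) ^ 2) := by
      refine ENNReal.ofReal_le_ofReal ?_
      rw [← sq_abs (mean M π - mean M' π)]
      nlinarith
    have h3 := h2.trans h1
    rw [mul_add, ← ENNReal.ofReal_mul (by positivity), ← tsub_le_iff_right,
      ← ENNReal.ofReal_sub _ (by positivity)] at h3
    have e1 : y ^ 2 / 4 - 12 * d * (y ^ 2 / (96 * d)) = y ^ 2 / 8 := by field_simp; norm_num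
    rw [e1] at h3
    change (1 : ℝ≥0∞) ≤ ENNReal.ofReal _ * _
    have e2 : (96 * d / y ^ 2 : ℝ) = (8 / y ^ 2) * (12 * d) := by field_simp; norm_num
    rw [e2, ENNReal.ofReal_mul (by positivity), mul_assoc]
    calc (1 : ℝ≥0∞) = ENNReal.ofReal (8 / y ^ 2) * ENNReal.ofReal (y ^ 2 / 8) := by
          rw [← ENNReal.ofReal_mul (by positivity), ← ENNReal.ofReal_one]; congr 1; field_simp
      _ ≤ _ := mul_le_mul_right h3 _
  · rw [funext hcoe, cost_const_mul]
    change ENNReal.ofReal _ * _ ≤ _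
    refine mul_le_of_le_one_right' ?_
    calc cost M ω ≤ ∑' π, ω π * 1 := ENNReal.tsum_le_tsum fun π =>
          mul_le_mul_right (h𝓜.gap_le_one hM π) _
      _ = 1 := by simp [ω.tsum_coe]

/-- The exploration guarantee: there are an exploration distribution and an allocation such that each
tame model is either nearly solved by the allocation, or distinguished by the exploration. -/
lemma IsLinearInstance.exists_explore [Nontrivial 𝒜] (h : IsLinearInstance D x Θ Mstar) (hD : 0 < D)
    {ε R : ℝ} (hε : 0 < ε) (hε2 : ε ≤ 1 / 2) (hR : 0 < R) :
    ∃ ω : PMF 𝒜, ω.support.Finite ∧ ∀ J : Model 𝒜 → ℝ≥0∞,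
      (∀ M ∈ linearClass x Θ, ∀ M₀ ∈ linearClass x Θ, info ω M M₀ ≤ 2 * (J M + J M₀)) →
      ∃ w : PMF 𝒜, ∀ M, Tame (linearClass x Θ) ε R M →
        M ∈ glSetLE (linearClass x Θ) (ε / 10) w (ENNReal.ofReal (2 * R)) ∨
        (J M)⁻¹ ≤ ENNReal.ofReal (10 ^ 8 * d * R ^ 2 / ε ^ 2) := by
  rcases Nat.eq_zero_or_pos d with hd0 | hd
  · obtain ⟨π₀⟩ : Nonempty 𝒜 := inferInstance
    refine ⟨PMF.pure π₀, by simp, fun J _ => ⟨PMF.pure π₀, fun M hM => ?_⟩⟩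
    exact absurd (pos_of_minGap_pos hM.mem hM.minGap_pos) (by omega)
  have hd' : (0 : ℝ) < d := by exact_mod_cast hd
  -- The function `J` stands for the average divergence from an estimate, given by a measure on
  -- models or by a `PMF`. The design is fixed before `J`, so its finite support can be used to
  -- verify the hypothesis on `J`.
  set V : ℝ := 10 ^ 8 * d * R ^ 2 / ε ^ 2 with hV
  have hV0 : 0 < V := by positivity
  obtain ⟨ω, hfin, hω⟩ := h.exists_design hD (τ := 4 / V) (by positivity)
  refine ⟨ω, hfin, fun J hJ => ?_⟩
  -- Either some tame `M₀` is not distinguished from the estimate by `ω`, and then all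
  -- undistinguished models are close to it and share its allocation; or all tame models are
  -- distinguished and the allocation is irrelevant.
  by_cases hex : ∃ M₀, Tame (linearClass x Θ) ε R M₀ ∧ J M₀ < ENNReal.ofReal (1 / V)
  · obtain ⟨M₀, hM₀, hJ₀⟩ := hex
    obtain ⟨w, hw⟩ := hM₀.exists_mem_glSetLE h.gaussClass hε hε2
    refine ⟨w, fun M hM => ?_⟩
    by_cases hJM : J M < ENNReal.ofReal (1 / V)
    · left
      refine hw M hM fun π => ?_
      have h1 := hω M hM.mem M₀ hM₀.mem π
      have h2 : info ω M M₀ ≤ ENNReal.ofReal (4 / V) := by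
        refine (hJ M hM.mem M₀ hM₀.mem).trans ?_
        have e : (4 / V : ℝ) = 2 * (1 / V + 1 / V) := by ring
        rw [e, ENNReal.ofReal_mul (by norm_num), ENNReal.ofReal_add (by positivity) (by positivity),
          ENNReal.ofReal_ofNat]
        gcongr
      have h3 := h1.trans (mul_le_mul_right (add_le_add_left h2 _) _)
      rw [← ENNReal.ofReal_add (by positivity) (by positivity), ← ENNReal.ofReal_mul (by positivity),
        ENNReal.ofReal_le_ofReal_iff (by positivity)] at h3
      refine abs_le_of_sq_le_sq (h3.trans ?_) (by positivity)
      -- The constant `10 ^ 8` of `V` exceeds `96 * 1000 ^ 2`, which makes the right-hand side at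
      -- most `(ε / (1000 * R)) ^ 2`.
      have e2 : 12 * d * (4 / V + 4 / V) = 96 * ε ^ 2 / (10 ^ 8 * R ^ 2) := by
        rw [hV]; field_simp; norm_num
      rw [e2, div_pow, div_le_div_iff₀ (by positivity) (by positivity)]
      have : 0 < ε ^ 2 * R ^ 2 := by positivity
      nlinarith
    · right
      push Not at hJM
      rw [ENNReal.inv_le_iff_inv_le, ← ENNReal.ofReal_inv_of_pos hV0]
      simpa using hJM
  · push Not at hex
    obtain ⟨π₀⟩ : Nonempty 𝒜 := inferInstance
    refine ⟨PMF.pure π₀, fun M hM => Or.inr ?_⟩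
    rw [ENNReal.inv_le_iff_inv_le, ← ENNReal.ofReal_inv_of_pos hV0]
    simpa using hex M hM

/-! ### The Allocation-Estimation Coefficient of linear bandits -/

/-- Models carry the product σ-algebra of density values. The mean is a measurable function of two
of them, since the log-density at 1 minus that at 0 is the mean minus 1/2; finite support makes
`info` a finite sum. -/
lemma GaussClass.measurable_info (h𝓜 : GaussClass 𝓜) {N : Set (Model 𝒜)} (hN : N ⊆ 𝓜)
    (hM : M ∈ 𝓜) {ω : PMF 𝒜} (hω : ω.support.Finite) :
    Measurable fun M' : N => info ω M'.1 M := by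
  have h1 : (fun M' : N => info ω M'.1 M) = fun M' : N => ∑ π ∈ hω.toFinset, ω π *
      ENNReal.ofReal ((1 / 2 + Real.log (M'.1 π 1) - Real.log (M'.1 π 0) - mean M π) ^ 2 / 2) := by
    funext M'
    rw [info, tsum_eq_sum (s := hω.toFinset)]
    · refine Finset.sum_congr rfl fun π _ => ?_
      rw [h𝓜.kl_eq (hN M'.2) hM]
      have h2 := (h𝓜 M'.1 (hN M'.2)).1 π
      have h3 : mean M'.1 π = 1 / 2 + Real.log (M'.1 π 1) - Real.log (M'.1 π 0) := by
        set a := mean M'.1 π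
        rw [h2, gaussianPDFReal_eq_mul_exp_llrG a 0 1, gaussianPDFReal_eq_mul_exp_llrG a 0 0,
          Real.log_mul (gaussianPDFReal_pos _ _ _ one_ne_zero).ne' (Real.exp_pos _).ne',
          Real.log_mul (gaussianPDFReal_pos _ _ _ one_ne_zero).ne' (Real.exp_pos _).ne',
          Real.log_exp, Real.log_exp]
        have h4 : Real.log (gaussianPDFReal 0 1 1) - Real.log (gaussianPDFReal 0 1 0) = -1 / 2 := by
          rw [← Real.log_div (gaussianPDFReal_pos _ _ _ one_ne_zero).ne'
            (gaussianPDFReal_pos _ _ _ one_ne_zero).ne', gaussianPDFReal, gaussianPDFReal,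
            mul_div_mul_left _ _ (by positivity), ← Real.exp_sub, Real.log_exp]
          norm_num
        simp only [llrG]
        linarith
      rw [h3]
    · intro π hπ
      have : ω π = 0 := by simpa using hπ
      rw [this, zero_mul]
  rw [h1]
  refine Finset.measurable_sum _ fun π _ => Measurable.const_mul ?_ _
  have hm : ∀ r : ℝ, Measurable fun M' : N => M'.1 π r := fun r =>
    (measurable_pi_apply r).comp ((measurable_pi_apply π).comp measurable_subtype_coe)
  exact (((((hm 1).log.const_add _).sub (hm 0).log).sub_const _).pow_const 2 |>.div_const 2).ennreal_ofReal

/-- Averaging the triangle inequality over `ξ` shows that the expected information meets the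
condition on `J` in `exists_explore`. -/
lemma IsLinearInstance.aec_le [Nontrivial 𝒜] (h : IsLinearInstance D x Θ Mstar) (hD : 0 < D)
    {ε R e : ℝ} (hε : 0 < ε) (hε2 : ε ≤ 1 / 2) (hR : 0 < R) (he : ε / 10 ≤ e) {N : Set (Model 𝒜)}
    (hN : ∀ M ∈ N, Tame (linearClass x Θ) ε R M) :
    aec (linearClass x Θ) e N ≤ ENNReal.ofReal (10 ^ 8 * d * R ^ 2 / ε ^ 2) := by
  obtain ⟨ω, hfin, hω⟩ := h.exists_explore hD hε hε2 hR
  have hsub : N ⊆ linearClass x Θ := fun M hM => (hN M hM).mem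
  refine iSup_le fun ξ => ?_
  obtain ⟨w, hw⟩ := hω (fun M => ∫⁻ M' : N, info ω M'.1 M ∂(ξ : Measure N)) (by
    intro M hM M₀ hM₀
    calc info ω M M₀ = ∫⁻ _ : N, info ω M M₀ ∂(ξ : Measure N) := by simp
      _ ≤ ∫⁻ M' : N, 2 * (info ω M'.1 M + info ω M'.1 M₀) ∂(ξ : Measure N) :=
          lintegral_mono fun M' => h.gaussClass.info_triangle hM hM₀ (hsub M'.2) _
      _ = _ := by
          rw [lintegral_const_mul' _ _ (by norm_num),
            lintegral_add_left (h.gaussClass.measurable_info hsub hM hfin)])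
  refine iInf₂_le_of_le w ω (iSup₂_le fun M hM => ?_)
  rcases hw M (hN M hM.1) with h1 | h1
  · exact absurd (glSetLE_mono he le_top h1) hM.2
  · exact h1

/-- The scale of regularity of the class `regular _ ε y y⁻¹`. -/
lemma IsLinearInstance.tame_of_regular [Nontrivial 𝒜] (h : IsLinearInstance D x Θ Mstar) (hD : 0 < D)
    {ε y : ℝ} (hy : 0 < y) (hM : M ∈ regular (linearClass x Θ) ε (ENNReal.ofReal y)
      (ENNReal.ofReal y)⁻¹) :
    Tame (linearClass x Θ) ε (192 * d / y ^ 3) M := by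
  obtain ⟨hmem, hgap, hI⟩ := hM
  have h0 : 0 < minGap M := (ENNReal.ofReal_pos.2 hy).trans_le hgap
  have hd : (1 : ℝ) ≤ d := by exact_mod_cast pos_of_minGap_pos hmem h0
  have hy1 : y ≤ 1 := by
    have := hgap.trans (h.gaussClass.minGap_le_one hmem)
    rwa [ENNReal.ofReal_le_one] at this
  have hy2 : y ^ 2 ≤ 1 := pow_le_one₀ hy.le hy1
  have hy3 : y ^ 3 ≤ y := by nlinarith
  have hy3' : y ^ 3 ≤ 1 := hy3.trans hy1
  refine ⟨hmem, le_trans (ENNReal.ofReal_le_ofReal ?_) hgap, ?_, ?_⟩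
  · rw [one_div_div, div_le_iff₀ (by positivity)]; nlinarith
  · rw [← ENNReal.ofReal_inv_of_pos hy] at hI
    refine (add_le_add_left hI 1).trans ?_
    rw [← ENNReal.ofReal_one, ← ENNReal.ofReal_add (by positivity) zero_le_one]
    refine ENNReal.ofReal_le_ofReal ?_
    rw [le_div_iff₀ (by positivity), add_mul]
    have : y⁻¹ * y ^ 3 = y ^ 2 := by field_simp
    rw [this]; linarith
  · refine le_trans ?_ (mul_le_mul_right hgap _)
    rw [← ENNReal.ofReal_mul (by positivity)]
    refine (mul_le_mul_right (h.glc_le hD hy hmem hgap) _).trans ?_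
    rw [← ENNReal.ofReal_ofNat 2, ← ENNReal.ofReal_mul (by norm_num)]
    refine ENNReal.ofReal_le_ofReal (le_of_eq ?_)
    field_simp; norm_num

end

/-! ### The coefficient at the scale of the true model. -/

section

variable {𝒜 : Type u} {𝓜 : Set (Model 𝒜)} {M M' M₀ : Model 𝒜}
  {d : ℕ} {D : ℝ} {x : 𝒜 → EuclideanSpace ℝ (Fin d)} {Θ : Set (EuclideanSpace ℝ (Fin d))}
  {Mstar : Model 𝒜}

lemma alt_eq_empty [Subsingleton 𝒜] [Nonempty 𝒜] (M : Model 𝒜) : alt 𝓜 M = ∅ := by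
  obtain ⟨p⟩ := ‹Nonempty 𝒜›
  have h : ∀ M : Model 𝒜, p ∈ optSet M := fun M q => by rw [Subsingleton.elim q p]
  refine Set.eq_empty_iff_forall_notMem.2 fun M' hM' => ?_
  exact Set.notMem_empty p (hM'.2 ▸ (⟨h M, h M'⟩ : p ∈ optSet M ∩ optSet M'))

/-- With one decision there are no alternatives, every allocation solves every model, and the inner
supremum is empty. The case is separate because `minGap` is then `∞` and may give no real scale. -/
lemma aec_eq_zero [Subsingleton 𝒜] [Nonempty 𝒜] {N : Set (Model 𝒜)} (hN : N ⊆ 𝓜) (e : ℝ) :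
    aec 𝓜 e N = 0 := by
  obtain ⟨p⟩ := ‹Nonempty 𝒜›
  have h : ∀ M : Model 𝒜, ∀ q, q ∈ optSet M := fun M q r => by rw [Subsingleton.elim q r]
  refine nonpos_iff_eq_zero.1 (iSup_le fun ξ => iInf₂_le_of_le (PMF.pure p) (PMF.pure p) ?_)
  refine iSup₂_le fun M hM => absurd ?_ hM.2
  refine ⟨hN hM.1, 1, one_pos, le_top, ?_, fun M' hM' => ?_⟩
  · have : cost M (PMF.pure p) = 0 := by simp [cost, gap_eq_zero_of_mem (h M _)]
    rw [this]; exact zero_le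
  · rw [alt_eq_empty] at hM'; exact hM'.elim

/-- The gap scale of the true model is a positive real `y ≤ 1`, at least the inverse of
`1/Δ_min + n`. -/
lemma IsLinearInstance.gapStar_eq [Nontrivial 𝒜] (h : IsLinearInstance D x Θ Mstar) {ε : ℝ}
    (h0 : 0 < minGap Mstar) (hI : optInfo (linearClass x Θ) (ε / 36) Mstar ≠ ∞) :
    ∃ y : ℝ, 0 < y ∧ gapStar (linearClass x Θ) ε Mstar = ENNReal.ofReal y ∧
      1 ≤ 1 / y ∧
      1 / y ≤ (minGap Mstar)⁻¹.toReal + (optInfo (linearClass x Θ) (ε / 36) Mstar).toReal ∧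
      1 ≤ (minGap Mstar)⁻¹.toReal := by
  set n := optInfo (linearClass x Θ) (ε / 36) Mstar
  have hg1 := h.gaussClass.minGap_le_one h.mem
  have hgt : minGap Mstar ≠ ∞ := (hg1.trans_lt ENNReal.one_lt_top).ne
  have hpos : 0 < gapStar (linearClass x Θ) ε Mstar :=
    lt_min h0 (ENNReal.inv_pos.2 hI)
  have hle : gapStar (linearClass x Θ) ε Mstar ≤ 1 := (min_le_left _ _).trans hg1
  have htop : gapStar (linearClass x Θ) ε Mstar ≠ ∞ := (hle.trans_lt ENNReal.one_lt_top).ne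
  have hy0 : 0 < (gapStar (linearClass x Θ) ε Mstar).toReal := ENNReal.toReal_pos hpos.ne' htop
  refine ⟨_, hy0, (ENNReal.ofReal_toReal htop).symm, ?_, ?_, ?_⟩
  · rw [le_div_iff₀ hy0, one_mul]
    exact ENNReal.toReal_le_of_le_ofReal zero_le_one (by simpa using hle)
  · have hinv : (gapStar (linearClass x Θ) ε Mstar)⁻¹ ≤ (minGap Mstar)⁻¹ + n := by
      rw [gapStar]
      rcases min_choice (minGap Mstar) n⁻¹ with hc | hc <;> rw [hc]
      · exact le_self_add
      · rw [inv_inv]; exact le_add_self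
    rw [one_div, ← ENNReal.toReal_inv, ← ENNReal.toReal_add (by simpa using h0.ne') hI]
    exact ENNReal.toReal_mono (ENNReal.add_ne_top.2 ⟨by simpa using h0.ne', hI⟩) hinv
  · rw [← ENNReal.toReal_one]
    exact ENNReal.toReal_mono (by simpa using h0.ne') (ENNReal.one_le_inv.2 hg1)

/-- With `R = 192 * d / y ^ 3` the quantity `d * R ^ 2` is of order `d ^ 3 / y ^ 6`. In dimension
zero the class of regular models is empty. -/
lemma IsLinearInstance.aec_regular_le [Nontrivial 𝒜] (h : IsLinearInstance D x Θ Mstar) (hD : 0 < D)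
    {ε e y : ℝ} (hε : 0 < ε) (hε2 : ε ≤ 1 / 2) (he : ε / 10 ≤ e) (hy : 0 < y) :
    aec (linearClass x Θ) e (regular (linearClass x Θ) ε (ENNReal.ofReal y) (ENNReal.ofReal y)⁻¹) ≤
      ENNReal.ofReal (10 ^ 8 * 192 ^ 2 * ((d : ℝ) ^ 3 / ε ^ 2) * (1 / y) ^ 6) := by
  rcases Nat.eq_zero_or_pos d with hd | hd
  · refine le_trans (iSup_le fun ξ => ?_) zero_le
    obtain ⟨p⟩ : Nonempty 𝒜 := inferInstance
    refine iInf₂_le_of_le (PMF.pure p) (PMF.pure p) (iSup₂_le fun M hM => ?_)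
    exact absurd (pos_of_minGap_pos hM.1.1
      ((ENNReal.ofReal_pos.2 hy).trans_le hM.1.2.1)) (by omega)
  refine (h.aec_le hD hε hε2 (R := 192 * d / y ^ 3) (by positivity) he
    fun M hM => h.tame_of_regular hD hy hM).trans (ENNReal.ofReal_le_ofReal (le_of_eq ?_))
  field_simp

/-- The power 6 of `1 / y` is weakened to 8, which is legitimate as `1 / y ≥ 1`. -/
lemma IsLinearInstance.aec_starClass_le (h : IsLinearInstance D x Θ Mstar) (hD : 0 < D)
    {ε : ℝ} (hε : 0 < ε) (hε2 : ε ≤ 1 / 2) (h0 : 0 < minGap Mstar)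
    (hI : optInfo (linearClass x Θ) (ε / 36) Mstar ≠ ∞) :
    aec (linearClass x Θ) ε (starClass (linearClass x Θ) ε Mstar) ≤
      ENNReal.ofReal (10 ^ 8 * 192 ^ 2 * ((d : ℝ) ^ 3 / ε ^ 2)
        * ((minGap Mstar)⁻¹.toReal + (optInfo (linearClass x Θ) (ε / 36) Mstar).toReal) ^ 8) := by
  obtain ⟨p, -, -⟩ := h.unique_opt
  have : Nonempty 𝒜 := ⟨p⟩
  rcases subsingleton_or_nontrivial 𝒜 with hs | hn
  · rw [aec_eq_zero fun M hM => hM.1]; exact zero_le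
  obtain ⟨y, hy, hgy, hy1, hyb, -⟩ := h.gapStar_eq h0 hI
  rw [starClass, hgy]
  refine (h.aec_regular_le hD hε hε2 (by linarith) hy).trans (ENNReal.ofReal_le_ofReal ?_)
  refine mul_le_mul_of_nonneg_left ?_ (by positivity)
  calc (1 / y) ^ 6 ≤ (1 / y) ^ 8 := pow_le_pow_right₀ hy1 (by norm_num)
    _ ≤ _ := by gcongr

/-! ### The active sets -/

lemma epochStart_pos (ℓ : ℕ) : 0 < epochStart ℓ := by unfold epochStart; positivity

lemma epochStart_epoch_le {s : ℕ} (hs : s ≠ 0) : epochStart (epoch s) ≤ s := by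
  simpa [epochStart, epoch] using Nat.pow_log_le_self 2 hs

lemma nCap_eq (s : ℕ) : nCap s = ENNReal.ofReal ((s : ℝ) ^ (1 / 8 : ℝ)) := by
  rw [nCap, ← ENNReal.ofReal_natCast, ENNReal.ofReal_rpow_of_nonneg (by positivity) (by norm_num)]

lemma nCap_sqrt_eq (s : ℕ) : nCap s ^ (1 / 2 : ℝ) = ENNReal.ofReal ((s : ℝ) ^ (1 / 16 : ℝ)) := by
  rw [nCap_eq, ENNReal.ofReal_rpow_of_nonneg (by positivity) (by norm_num),
    ← Real.rpow_mul (by positivity)]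
  norm_num

lemma tol_ge {ε : ℝ} (hε : 0 < ε) (hε2 : ε ≤ 1 / 2) : ε / 5 ≤ tol ε := by
  rw [tol, div_le_div_iff₀ (by norm_num) (by linarith)]; nlinarith

lemma tol_le {ε : ℝ} (hε : 0 < ε) (hε2 : ε ≤ 1 / 2) : tol ε ≤ 1 / 8 := by
  rw [tol, div_le_div_iff₀ (by linarith) (by norm_num)]; nlinarith

/-- Each summand in the definition of `activeSet` yields one field of `Tame` at the scale `s ^
(1/16)`. The last summand, with gap and tolerance at most 1, forces the scale to be at least 2,
which later gives `2 * R ≤ R ^ 2`. -/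
lemma GaussClass.activeSet_tame [Nontrivial 𝒜] (h𝓜 : GaussClass 𝓜) {ε : ℝ} (hε : 0 < ε)
    (hε2 : ε ≤ 1 / 2) {ℓ : ℕ} (hM : M ∈ activeSet 𝓜 ε ℓ) :
    Tame 𝓜 ε ((epochStart ℓ : ℝ) ^ (1 / 16 : ℝ)) M ∧ 2 ≤ (epochStart ℓ : ℝ) ^ (1 / 16 : ℝ) := by
  obtain ⟨⟨hmem, -, -⟩, hsum⟩ := hM
  rw [nCap_sqrt_eq] at hsum
  set R := (epochStart ℓ : ℝ) ^ (1 / 16 : ℝ)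
  have hR0 : 0 < R := Real.rpow_pos_of_pos (by exact_mod_cast epochStart_pos ℓ) _
  have hg1 := h𝓜.minGap_le_one hmem
  have hgt : minGap M ≠ ∞ := (hg1.trans_lt ENNReal.one_lt_top).ne
  have h3 := le_self_add.trans hsum
  have h2 := le_self_add.trans h3
  have h1 := le_self_add.trans h2
  have hinv : 1 / minGap M ≤ ENNReal.ofReal R := le_add_self.trans h1
  have hg0 : minGap M ≠ 0 := by
    intro hz; rw [hz, ENNReal.div_zero one_ne_zero] at hinv; simp at hinv
  refine ⟨⟨hmem, ?_, ?_, ?_⟩, ?_⟩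
  · rw [one_div, ENNReal.ofReal_inv_of_pos hR0, ENNReal.inv_le_iff_inv_le, ← one_div]
    exact hinv
  · refine le_trans (add_le_add_right ?_ _) h1
    rw [one_div]; exact ENNReal.one_le_inv.2 hg1
  · have := (le_add_self.trans h2 : 4 * glc 𝓜 M / minGap M ≤ ENNReal.ofReal R)
    rw [ENNReal.div_le_iff hg0 hgt] at this
    refine le_trans (mul_le_mul_left ?_ _) this
    norm_num
  · have h4 := (le_add_self.trans hsum :
      4 / (minGap M * ENNReal.ofReal (tol ε)) ≤ ENNReal.ofReal R)
    have h5 : (4 : ℝ≥0∞) ≤ 4 / (minGap M * ENNReal.ofReal (tol ε)) := by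
      rw [ENNReal.le_div_iff_mul_le (Or.inr (by norm_num)) (Or.inr (by norm_num))]
      refine mul_le_of_le_one_right' (mul_le_one' hg1 ?_)
      exact ENNReal.ofReal_le_one.2 (by linarith [tol_le hε hε2])
    have h6 := h5.trans h4
    rw [← ENNReal.ofReal_ofNat, ENNReal.ofReal_le_ofReal_iff hR0.le] at h6
    linarith

/-- The value of the exploration problem is small. -/
lemma IsLinearInstance.exploreValue_alloc_le [Nontrivial 𝒜] (h : IsLinearInstance D x Θ Mstar)
    (hD : 0 < D) {ε : ℝ} (hε : 0 < ε) (hε2 : ε ≤ 1 / 2) (A : AEStar (linearClass x Θ) ε)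
    (L : List (𝒜 × ℝ))
    (hsupp : ∀ M, estimate A.cover A.base L M ≠ 0 → M ∈ linearClass x Θ) :
    exploreValue (linearClass x Θ) ε (L.length + 1) (estimate A.cover A.base L)
      (A.alloc L).1 (A.alloc L).2 ≤
      ENNReal.ofReal (10 ^ 8 * d * ((L.length + 1 : ℕ) : ℝ) ^ (1 / 8 : ℝ) / ε ^ 2) := by
  set s := L.length + 1 with hs
  set ξ := estimate A.cover A.base L
  set R := (epochStart (epoch s) : ℝ) ^ (1 / 16 : ℝ) with hR
  have hR0 : 0 < R := Real.rpow_pos_of_pos (by exact_mod_cast epochStart_pos _) _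
  have hR2 : R ^ 2 ≤ (s : ℝ) ^ (1 / 8 : ℝ) := by
    rw [hR, ← Real.rpow_natCast, ← Real.rpow_mul (by positivity)]
    norm_num only [Nat.cast_ofNat]
    refine Real.rpow_le_rpow (by positivity) ?_ (by norm_num)
    exact_mod_cast epochStart_epoch_le (by omega)
  obtain ⟨ω, hfin, hω⟩ := h.exists_explore hD hε hε2 hR0
  obtain ⟨w, hw⟩ := hω (fun M => ∑' M', ξ M' * info ω M' M) (by
    intro M hM M₀ hM₀
    calc info ω M M₀ = ∑' M', ξ M' * info ω M M₀ := by
          rw [ENNReal.tsum_mul_right, ξ.tsum_coe, one_mul]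
      _ ≤ ∑' M', (2 * (ξ M' * info ω M' M) + 2 * (ξ M' * info ω M' M₀)) := by
          refine ENNReal.tsum_le_tsum fun M' => ?_
          by_cases hz : ξ M' = 0
          · simp [hz]
          · refine (mul_le_mul_right (h.gaussClass.info_triangle hM hM₀ (hsupp M' hz) _) _).trans
              (le_of_eq ?_)
            ring
      _ = _ := by
          rw [ENNReal.tsum_add, ENNReal.tsum_mul_left, ENNReal.tsum_mul_left, mul_add])
  refine (A.alloc_le L w ω).trans (iSup₂_le fun M hM => ?_)
  obtain ⟨htame, h2R⟩ := h.gaussClass.activeSet_tame hε hε2 hM.1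
  rcases hw M htame with h1 | h1
  · refine absurd (glSetLE_mono ?_ ?_ h1) hM.2
    · linarith [tol_ge hε hε2]
    · rw [nCap_eq]
      -- The normalization factor `2 * R` is within the cap `s ^ (1/8)` because `2 * R ≤ R ^ 2`.
      exact ENNReal.ofReal_le_ofReal (le_trans (by nlinarith) hR2)
  · exact h1.trans (ENNReal.ofReal_le_ofReal (by gcongr))

/-- The true model is eventually active. -/
lemma IsLinearInstance.mem_activeSet [Nontrivial 𝒜] (h : IsLinearInstance D x Θ Mstar)
    (hD : 0 < D) {ε : ℝ} (hε : 0 < ε) (hε2 : ε ≤ 1 / 2) (h0 : 0 < minGap Mstar)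
    (hI : optInfo (linearClass x Θ) (ε / 36) Mstar ≠ ∞) (hg : 0 < glc (linearClass x Θ) Mstar)
    {B : ℝ} (hB : 1 + d + 1 / ε + (minGap Mstar)⁻¹.toReal
      + (optInfo (linearClass x Θ) (ε / 36) Mstar).toReal ≤ B) {ℓ : ℕ}
    (hℓ : (414 * B ^ 4) ^ 16 ≤ (epochStart ℓ : ℝ)) :
    Mstar ∈ activeSet (linearClass x Θ) ε ℓ := by
  obtain ⟨y, hy, hgy, hy1, hyb, hinv1⟩ := h.gapStar_eq h0 hI
  have h𝓜 := h.gaussClass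
  have hg1 := h𝓜.minGap_le_one h.mem
  have hgt : minGap Mstar ≠ ∞ := (hg1.trans_lt ENNReal.one_lt_top).ne
  set n := optInfo (linearClass x Θ) (ε / 36) Mstar with hn
  have hd1 : (1 : ℝ) ≤ d := by exact_mod_cast pos_of_minGap_pos h.mem h0
  have hn0 : 0 ≤ n.toReal := ENNReal.toReal_nonneg
  have hε1 : 0 < 1 / ε := by positivity
  have hB1 : 1 ≤ B := by linarith
  have hS0 : (0 : ℝ) < epochStart ℓ := by exact_mod_cast epochStart_pos ℓ
  set a := (minGap Mstar)⁻¹.toReal with ha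
  have haB : a ≤ B := by linarith
  have hinvE : (minGap Mstar)⁻¹ = ENNReal.ofReal a :=
    (ENNReal.ofReal_toReal (by simpa using h0.ne')).symm
  have hgapa : minGap Mstar = ENNReal.ofReal a⁻¹ := by
    rw [ENNReal.ofReal_inv_of_pos (by linarith), ← hinvE, inv_inv]
  have hinvB : (minGap Mstar)⁻¹ ≤ ENNReal.ofReal B := hinvE ▸ ENNReal.ofReal_le_ofReal haB
  have hnE : n = ENNReal.ofReal n.toReal := (ENNReal.ofReal_toReal hI).symm
  have hnB : n ≤ ENNReal.ofReal B := hnE ▸ ENNReal.ofReal_le_ofReal (by linarith)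
  -- The scale `gapStar` competes in the infimum defining `epochGap` as soon as its coefficient is
  -- below the square root of the epoch start. The tolerance `tol ε / 2` is at least `ε / 10`, the
  -- value served by `aec_regular_le`.
  have hepoch : epochGap (linearClass x Θ) ε ℓ ≤ gapStar (linearClass x Θ) ε Mstar := by
    refine sInf_le ?_
    change aec _ _ _ ≤ _
    rw [hgy]
    refine (h.aec_regular_le hD hε hε2 (by linarith [tol_ge hε hε2]) hy).trans ?_
    rw [← ENNReal.ofReal_natCast, ENNReal.ofReal_rpow_of_nonneg (by positivity) (by norm_num)]
    refine ENNReal.ofReal_le_ofReal ?_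
    rw [← Real.sqrt_eq_rpow]
    refine Real.le_sqrt_of_sq_le (le_trans ?_ hℓ)
    have e1 : (d : ℝ) ^ 3 / ε ^ 2 * (1 / y) ^ 6 ≤ B ^ 32 := by
      calc (d : ℝ) ^ 3 / ε ^ 2 * (1 / y) ^ 6 = (d : ℝ) ^ 3 * (1 / ε) ^ 2 * (1 / y) ^ 6 := by
            field_simp
        _ ≤ B ^ 3 * B ^ 2 * B ^ 6 := by gcongr <;> linarith
        _ = B ^ 11 := by ring
        _ ≤ B ^ 32 := pow_le_pow_right₀ hB1 (by norm_num)
    calc (10 ^ 8 * 192 ^ 2 * ((d : ℝ) ^ 3 / ε ^ 2) * (1 / y) ^ 6) ^ 2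
        = (10 ^ 8 * 192 ^ 2) ^ 2 * ((d : ℝ) ^ 3 / ε ^ 2 * (1 / y) ^ 6) ^ 2 := by ring
      _ ≤ 414 ^ 16 * (B ^ 32) ^ 2 := by
          refine mul_le_mul (by norm_num) ?_ (by positivity) (by norm_num)
          gcongr
      _ = _ := by ring
  refine ⟨⟨h.mem, hepoch.trans (min_le_left _ _), ?_⟩, ?_⟩
  · rw [ENNReal.le_inv_iff_le_inv]
    exact hepoch.trans (min_le_right _ _)
  · rw [nCap_sqrt_eq]
    -- The constant is `1 + 1 + 384 + 8 + 20`, one summand for each term in the definition of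
    -- `activeSet`.
    have hroot : 414 * B ^ 4 ≤ (epochStart ℓ : ℝ) ^ (1 / 16 : ℝ) := by
      have := Real.rpow_le_rpow (by positivity) hℓ (show (0 : ℝ) ≤ 1 / 16 by norm_num)
      rwa [← Real.rpow_natCast, ← Real.rpow_mul (by positivity), Nat.cast_ofNat,
        mul_one_div_cancel (by norm_num), Real.rpow_one] at this
    refine le_trans ?_ (ENNReal.ofReal_le_ofReal hroot)
    have t2 : 1 / minGap Mstar ≤ ENNReal.ofReal B := by rw [one_div]; exact hinvB
    have t3 : 4 * glc (linearClass x Θ) Mstar / minGap Mstar ≤ ENNReal.ofReal (384 * B ^ 4) := by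
      have := h.glc_le hD (y := a⁻¹) (by positivity) h.mem hgapa.ge
      rw [div_eq_mul_inv, hinvE]
      refine (mul_le_mul_left (mul_le_mul_right this _) _).trans ?_
      rw [← ENNReal.ofReal_ofNat 4, ← ENNReal.ofReal_mul (by norm_num),
        ← ENNReal.ofReal_mul (by positivity)]
      refine ENNReal.ofReal_le_ofReal ?_
      have : 4 * (96 * d / a⁻¹ ^ 2) * a = 384 * (d * a ^ 3) := by field_simp; norm_num
      rw [this]
      have : (d : ℝ) * a ^ 3 ≤ B * B ^ 3 := by gcongr; linarith
      nlinarith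
    have t4 : 2 * n / glc (linearClass x Θ) Mstar ≤ ENNReal.ofReal (8 * B ^ 2) := by
      refine ENNReal.div_le_of_le_mul ?_
      -- Positivity of the coefficient enters here: it upgrades to a lower bound by a quarter of the
      -- gap, so dividing by the coefficient is harmless.
      have h1 := h𝓜.minGap_le_glc h.mem h0 (e := ε / 36) (by positivity) (by linarith) hI hg
      calc 2 * n = 2 * n * ((minGap Mstar)⁻¹ * minGap Mstar) := by
            rw [ENNReal.inv_mul_cancel h0.ne' hgt, mul_one]
        _ ≤ 2 * ENNReal.ofReal B * (ENNReal.ofReal B * (4 * glc (linearClass x Θ) Mstar)) := by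
            gcongr
        _ = _ := by
            have : (8 * B ^ 2 : ℝ) = 2 * B * (B * 4) := by ring
            rw [this, ENNReal.ofReal_mul (by positivity), ENNReal.ofReal_mul (by positivity),
              ENNReal.ofReal_mul (by positivity), ENNReal.ofReal_ofNat, ENNReal.ofReal_ofNat]
            ring
    have t5 : 4 / (minGap Mstar * ENNReal.ofReal (tol ε)) ≤ ENNReal.ofReal (20 * B ^ 2) := by
      have htol : 0 < tol ε := by linarith [tol_ge hε hε2]
      rw [hgapa, ← ENNReal.ofReal_mul (by positivity), ← ENNReal.ofReal_ofNat 4,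
        ← ENNReal.ofReal_div_of_pos (by positivity)]
      refine ENNReal.ofReal_le_ofReal ?_
      rw [div_le_iff₀ (by positivity)]
      have h1 : 1 / 5 ≤ B * tol ε := by
        calc 1 / 5 = (1 / ε) * (ε / 5) := by field_simp
          _ ≤ B * tol ε := by
            refine mul_le_mul (by linarith) (tol_ge hε hε2) (by positivity) (by linarith)
      have h2 : 1 ≤ B * a⁻¹ := by
        rw [← div_eq_mul_inv, one_le_div (by linarith)]; exact haB
      have h3 : (1 / 5 : ℝ) * 1 ≤ (B * tol ε) * (B * a⁻¹) :=
        mul_le_mul h1 h2 (by norm_num) (by positivity)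
      nlinarith
    refine (add_le_add (add_le_add (add_le_add (add_le_add hnB t2) t3) t4) t5).trans ?_
    rw [← ENNReal.ofReal_add (by positivity) (by positivity),
      ← ENNReal.ofReal_add (by positivity) (by positivity),
      ← ENNReal.ofReal_add (by positivity) (by positivity),
      ← ENNReal.ofReal_add (by positivity) (by positivity)]
    refine ENNReal.ofReal_le_ofReal ?_
    have hb2 : B ≤ B ^ 4 := le_self_pow₀ hB1 (by norm_num)
    have hb3 : B ^ 2 ≤ B ^ 4 := pow_le_pow_right₀ hB1 (by norm_num)
    linarith

end

section

variable {𝒜 : Type u} {𝓜 : Set (Model 𝒜)} {M M' M₀ : Model 𝒜}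
  {d : ℕ} {D : ℝ} {x : 𝒜 → EuclideanSpace ℝ (Fin d)} {Θ : Set (EuclideanSpace ℝ (Fin d))}
  {Mstar : Model 𝒜}

/-! ### Nets and covers -/

/-- Bounded sets of `ℝᵈ` have proper finite nets of cardinality polynomial in the resolution. -/
lemma exists_net (S : Set (EuclideanSpace ℝ (Fin d))) (hD : 0 < D)
    (hS : ∀ θ ∈ S, ∀ θ' ∈ S, dist θ θ' ≤ D) {h : ℝ} (hh : 0 < h) :
    ∃ F : Finset (EuclideanSpace ℝ (Fin d)), (∀ θ ∈ F, θ ∈ S) ∧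
      (F.card : ℝ) ≤ (2 * D * (d + 1) / h + 5) ^ d ∧ ∀ θ ∈ S, ∃ θ' ∈ F, dist θ θ' ≤ h := by
  classical
  rcases S.eq_empty_or_nonempty with rfl | ⟨θ₀, hθ₀⟩
  · exact ⟨∅, by simp, by simp; positivity, by simp⟩
  set k : ℝ := (d + 1) / h with hk
  have hk0 : 0 < k := by positivity
  let cell : EuclideanSpace ℝ (Fin d) → Fin d → ℤ := fun θ i => ⌊θ i * k⌋
  set m : ℤ := ⌈D * k⌉ + 1 with hm
  let box : Finset (Fin d → ℤ) :=
    Fintype.piFinset fun i => Finset.Icc (cell θ₀ i - m) (cell θ₀ i + m)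
  have hcoord : ∀ θ ∈ S, ∀ θ' ∈ S, ∀ i, |θ i - θ' i| ≤ D := fun θ hθ θ' hθ' i => by
    have h1 := PiLp.norm_apply_le (θ - θ') i
    rw [← dist_eq_norm] at h1
    exact h1.trans (hS θ hθ θ' hθ')
  have hbox : ∀ θ ∈ S, cell θ ∈ box := by
    intro θ hθ
    rw [Fintype.mem_piFinset]
    intro i
    have h1 := abs_le.1 (hcoord θ hθ θ₀ hθ₀ i)
    have h2 : |θ i * k - θ₀ i * k| ≤ D * k := by
      rw [← sub_mul, abs_mul, abs_of_pos hk0]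
      exact mul_le_mul_of_nonneg_right (hcoord θ hθ θ₀ hθ₀ i) hk0.le
    have h3 := abs_le.1 h2
    have h4 := Int.floor_le (θ i * k)
    have h5 := Int.lt_floor_add_one (θ i * k)
    have h6 := Int.floor_le (θ₀ i * k)
    have h7 := Int.lt_floor_add_one (θ₀ i * k)
    have h8 := Int.le_ceil (D * k)
    rw [Finset.mem_Icc]
    constructor
    · rw [← Int.cast_le (R := ℝ)]; push_cast [cell, hm]; linarith [h3.1]
    · rw [← Int.cast_le (R := ℝ)]; push_cast [cell, hm]; linarith [h3.2]
  -- Each occupied cell of the grid of side `h / (d + 1)` is represented by a point of `S` itself,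
  -- so that the net is contained in `S`.
  have hrep : ∀ c : Fin d → ℤ, ∃ θ, (∃ θ' ∈ S, cell θ' = c) → θ ∈ S ∧ cell θ = c := by
    intro c
    by_cases hc : ∃ θ' ∈ S, cell θ' = c
    · obtain ⟨θ', h1, h2⟩ := hc; exact ⟨θ', fun _ => ⟨h1, h2⟩⟩
    · exact ⟨θ₀, fun h => absurd h hc⟩
  choose rep hrep using hrep
  refine ⟨(box.filter fun c => ∃ θ' ∈ S, cell θ' = c).image rep, ?_, ?_, ?_⟩
  · intro θ hθ
    obtain ⟨c, hc, rfl⟩ := Finset.mem_image.1 hθ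
    exact (hrep c (Finset.mem_filter.1 hc).2).1
  · have h1 : (((box.filter fun c => ∃ θ' ∈ S, cell θ' = c).image rep).card) ≤ box.card :=
      Finset.card_image_le.trans (Finset.card_filter_le _ _)
    have h2 : box.card = (2 * m + 1).toNat ^ d := by
      rw [Fintype.card_piFinset]
      simp only [Int.card_Icc]
      rw [Finset.prod_congr rfl fun i _ => by
        rw [show cell θ₀ i + m + 1 - (cell θ₀ i - m) = 2 * m + 1 by ring]]
      simp
    have h8 := Int.ceil_lt_add_one (D * k)
    have hm0 : 0 ≤ 2 * m + 1 := by
      have : 0 ≤ ⌈D * k⌉ := Int.ceil_nonneg (by positivity)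
      omega
    calc (((box.filter fun c => ∃ θ' ∈ S, cell θ' = c).image rep).card : ℝ)
        ≤ ((2 * m + 1).toNat : ℝ) ^ d := by rw [h2] at h1; exact_mod_cast h1
      _ ≤ _ := by
          gcongr
          have : ((2 * m + 1).toNat : ℝ) = ((2 * m + 1 : ℤ) : ℝ) := by
            exact_mod_cast congrArg (Int.cast (R := ℝ)) (Int.toNat_of_nonneg hm0)
          rw [this, hm]
          push_cast
          have e : 2 * D * (d + 1) / h = 2 * (D * k) := by rw [hk]; ring
          rw [e]; linarith
  · intro θ hθ
    have hc : ∃ θ' ∈ S, cell θ' = cell θ := ⟨θ, hθ, rfl⟩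
    refine ⟨rep (cell θ), Finset.mem_image_of_mem _ (Finset.mem_filter.2 ⟨hbox θ hθ, hc⟩), ?_⟩
    have h1 := (hrep _ hc).2
    have h2 : ∀ i, |θ i - rep (cell θ) i| ≤ h / (d + 1) := by
      intro i
      have h3 : ⌊rep (cell θ) i * k⌋ = ⌊θ i * k⌋ := congrFun h1 i
      have h4 := Int.abs_sub_lt_one_of_floor_eq_floor h3
      rw [← sub_mul, abs_mul, abs_of_pos hk0, ← lt_div_iff₀ hk0, abs_sub_comm] at h4
      refine h4.le.trans (le_of_eq ?_)
      rw [hk, one_div_div]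
    rw [EuclideanSpace.dist_eq]
    refine Real.sqrt_le_iff.2 ⟨hh.le, ?_⟩
    calc ∑ i, dist (θ i) (rep (cell θ) i) ^ 2 ≤ ∑ _i : Fin d, (h / (d + 1)) ^ 2 := by
          refine Finset.sum_le_sum fun i _ => ?_
          rw [Real.dist_eq]
          have := h2 i
          gcongr
      _ = h ^ 2 * (d / (d + 1) ^ 2) := by simp; field_simp
      _ ≤ h ^ 2 * 1 := by
          gcongr
          rw [div_le_one (by positivity)]
          nlinarith [(Nat.cast_nonneg d : (0 : ℝ) ≤ d)]
      _ = h ^ 2 := mul_one _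

lemma abs_llrG_le {a b r R : ℝ} (ha : a ∈ Set.Icc (0 : ℝ) 1) (hb : b ∈ Set.Icc (0 : ℝ) 1)
    (hr : |r| ≤ R) : |llrG a b r| ≤ |a - b| * (R + 1) := by
  have : llrG a b r = (a - b) * (r - (a + b) / 2) := by unfold llrG; ring
  rw [this, abs_mul]
  refine mul_le_mul_of_nonneg_left ?_ (abs_nonneg _)
  have h1 := abs_le.1 hr
  rw [abs_le]
  constructor <;> linarith [ha.1, ha.2, hb.1, hb.2, h1.1, h1.2]

/-- Markov's inequality for `exp (|r - a| - 2)`; the remaining unit of the shift 3 accounts for `a`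
in `[0, 1]`. -/
lemma gaussianReal_abs_gt_le {a : ℝ} (ha : a ∈ Set.Icc (0 : ℝ) 1) (R : ℝ) :
    gaussianReal a 1 (Set.Icc (-R) R)ᶜ ≤ ENNReal.ofReal (Real.exp (-(R - 3))) := by
  have hm : Measurable fun r : ℝ => ENNReal.ofReal (Real.exp (|r - a| - 2)) := by fun_prop
  have hsub : (Set.Icc (-R) R)ᶜ ⊆
      {r | ENNReal.ofReal (Real.exp (R - 3)) ≤ ENNReal.ofReal (Real.exp (|r - a| - 2))} := by
    intro r hr
    refine ENNReal.ofReal_le_ofReal (Real.exp_le_exp.2 ?_)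
    rw [Set.mem_compl_iff, Set.mem_Icc, not_and_or, not_le, not_le] at hr
    rcases hr with hr | hr
    · have := neg_abs_le (r - a); linarith [ha.1, ha.2]
    · have := le_abs_self (r - a); linarith [ha.1, ha.2]
  refine (measure_mono hsub).trans ?_
  refine (meas_ge_le_lintegral_div hm.aemeasurable (by simp [Real.exp_pos]) (by simp)).trans ?_
  refine (ENNReal.div_le_div_right (lintegral_exp_abs_sub_le a) _).trans (le_of_eq ?_)
  rw [one_div, ← ENNReal.ofReal_inv_of_pos (Real.exp_pos _), ← Real.exp_neg]

/-- The event is `|r| ≤ R` with `R = 5 * ℓ + 3`, whose complement has probability at most `exp (-5 *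
ℓ) ≤ 2 ^ (-5 * ℓ)`. On it the log-densities of two models differ by at most `R + 1` times their
distance in mean, so a net of radius `2 ^ (-ℓ) / (R + 1)` suffices. -/
lemma IsLinearInstance.exists_isCover (h : IsLinearInstance D x Θ Mstar) (hD : 0 < D)
    {N : Set (Model 𝒜)} (hN : N ⊆ linearClass x Θ) (ℓ : ℕ) :
    ∃ C : Finset (Model 𝒜), IsCover N ((2 : ℝ) ^ (-(ℓ : ℤ))) ((2 : ℝ) ^ (-(5 * ℓ : ℤ))) C ∧
      (C.card : ℝ) ≤ (2 * D * (d + 1) * (2 ^ ℓ * (5 * ℓ + 4)) + 5) ^ d := by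
  classical
  set R : ℝ := 5 * ℓ + 3 with hR
  have hR0 : 0 < R := by positivity
  set η : ℝ := 1 / (2 ^ ℓ * (5 * ℓ + 4)) with hη
  have hη0 : 0 < η := by positivity
  obtain ⟨F, hFS, hcard, hnet⟩ := exists_net {θ ∈ Θ | linearModel x θ ∈ N} hD
    (fun θ hθ θ' hθ' => h.dist_le θ hθ.1 θ' hθ'.1) hη0
  refine ⟨F.image (linearModel x), ⟨?_, Set.Icc (-R) R, measurableSet_Icc, ?_, ?_⟩, ?_⟩
  · intro M hM
    obtain ⟨θ, hθ, rfl⟩ := Finset.mem_image.1 hM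
    exact (hFS θ hθ).2
  · intro M hM π
    rw [h.gaussClass.law_eq (hN hM)]
    refine (gaussianReal_abs_gt_le (h.mean_mem M (hN hM) π) R).trans (ENNReal.ofReal_le_ofReal ?_)
    rw [hR, zpow_neg, add_sub_cancel_right, Real.exp_neg]
    refine inv_anti₀ (by positivity) ?_
    have h2 : (2 : ℝ) ≤ Real.exp 1 := by
      have := Real.add_one_le_exp (1 : ℝ); linarith
    calc (2 : ℝ) ^ (5 * (ℓ : ℤ)) = 2 ^ (5 * ℓ) := by exact_mod_cast zpow_natCast (2 : ℝ) (5 * ℓ)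
      _ ≤ Real.exp 1 ^ (5 * ℓ) := by gcongr
      _ = Real.exp (5 * ℓ) := by rw [← Real.exp_nat_mul]; push_cast; ring_nf
  · intro M hM
    obtain ⟨θ, hθ, rfl⟩ := hN hM
    obtain ⟨θ', hθ'F, hdist⟩ := hnet θ ⟨hθ, hM⟩
    refine ⟨linearModel x θ', Finset.mem_image_of_mem _ hθ'F, fun π r hr _ => ?_⟩
    have hθ' := hFS θ' hθ'F
    change |Real.log (gaussianPDFReal (inner ℝ θ (x π)) 1 r)
      - Real.log (gaussianPDFReal (inner ℝ θ' (x π)) 1 r)| ≤ _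
    rw [← Real.log_div (gaussianPDFReal_pos _ _ _ one_ne_zero).ne'
      (gaussianPDFReal_pos _ _ _ one_ne_zero).ne', log_gaussianPDFReal_div]
    have m1 := h.mean_mem _ (hN hM) π
    have m2 := h.mean_mem _ (hN hθ'.2) π
    rw [mean_linearModel] at m1 m2
    refine (abs_llrG_le m1 m2 (abs_le.2 hr)).trans ?_
    have h3 : |inner ℝ θ (x π) - inner ℝ θ' (x π)| ≤ η := by
      rw [← inner_sub_left]
      refine (abs_real_inner_le_norm _ _).trans ?_
      rw [← dist_eq_norm]
      calc dist θ θ' * ‖x π‖ ≤ η * 1 := mul_le_mul hdist (h.norm_le π) (norm_nonneg _) hη0.le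
        _ = η := mul_one _
    calc _ ≤ η * (R + 1) := by gcongr
      _ = (2 : ℝ) ^ (-(ℓ : ℤ)) := by
          rw [hη, hR, zpow_neg, zpow_natCast]; field_simp; ring
  · refine le_trans (by exact_mod_cast Finset.card_image_le) (hcard.trans (le_of_eq ?_))
    rw [hη, div_div_eq_mul_div, div_one]

/-- The logarithm of the size of the minimal covers of the active sets is linear in the epoch. -/
lemma IsLinearInstance.log_card_cover_le (h : IsLinearInstance D x Θ Mstar) (hD : 0 < D) {ε : ℝ}
    (A : AEStar (linearClass x Θ) ε) {ℓ : ℕ} (hℓ : 1 ≤ ℓ) :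
    Real.log (A.cover ℓ).card ≤ d * (2 * D + d + 14) * ℓ := by
  obtain ⟨C, hC, hcard⟩ := h.exists_isCover hD (N := activeSet (linearClass x Θ) ε ℓ)
    (fun M hM => hM.1.1) ℓ
  have h1 : ((A.cover ℓ).card : ℝ) ≤ (2 * D * (d + 1) * (2 ^ ℓ * (5 * ℓ + 4)) + 5) ^ d :=
    le_trans (by exact_mod_cast A.cover_card_le ℓ hℓ C hC) hcard
  have hℓ' : (1 : ℝ) ≤ ℓ := by exact_mod_cast hℓ
  have hd0 : (0 : ℝ) ≤ d := Nat.cast_nonneg d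
  rcases (Nat.zero_le (A.cover ℓ).card).eq_or_lt with h0 | h0
  · rw [← h0]; simp; positivity
  refine (Real.log_le_log (by exact_mod_cast h0) h1).trans ?_
  rw [Real.log_pow, mul_assoc (d : ℝ)]
  refine mul_le_mul_of_nonneg_left ?_ hd0
  have h2 : 2 * D * (d + 1) * (2 ^ ℓ * (5 * ℓ + 4)) + 5 ≤
      (2 * D + 5) * ((d + 1) * (2 ^ ℓ * (5 * ℓ + 4))) := by
    have h3 : (1 : ℝ) ≤ (d + 1) * (2 ^ ℓ * (5 * ℓ + 4)) := by
      refine one_le_mul_of_one_le_of_one_le (by linarith) ?_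
      exact one_le_mul_of_one_le_of_one_le (one_le_pow₀ (by norm_num)) (by linarith)
    nlinarith
  refine (Real.log_le_log (by positivity) h2).trans ?_
  rw [Real.log_mul (by positivity) (by positivity), Real.log_mul (by positivity) (by positivity),
    Real.log_mul (by positivity) (by positivity), Real.log_pow]
  have l1 := Real.log_le_sub_one_of_pos (show 0 < 2 * D + 5 by positivity)
  have l2 := Real.log_le_sub_one_of_pos (show (0 : ℝ) < d + 1 by positivity)
  have l3 := Real.log_le_sub_one_of_pos (show (0 : ℝ) < 2 by norm_num)
  have l4 := Real.log_le_sub_one_of_pos (show (0 : ℝ) < 5 * ℓ + 4 by positivity)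
  have l5 : (ℓ : ℝ) * Real.log 2 ≤ ℓ * 1 := by gcongr; linarith
  nlinarith [mul_nonneg hd0 (by linarith : (0 : ℝ) ≤ ℓ - 1), mul_nonneg hD.le (by linarith : (0 : ℝ) ≤ ℓ - 1)]

/-- The density is at most `1 / √(2π) ≤ 1/2` and the interval has length 1. Hence any event of
larger probability contains a point at distance more than 1/2 from `m`. -/
lemma gaussianReal_ball_le (a m : ℝ) :
    gaussianReal a 1 (Set.Icc (m - 1 / 2) (m + 1 / 2)) ≤ ENNReal.ofReal (1 / 2) := by
  rw [gaussianReal_apply _ one_ne_zero]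
  calc ∫⁻ r in Set.Icc (m - 1 / 2) (m + 1 / 2), gaussianPDF a 1 r
      ≤ ∫⁻ _ in Set.Icc (m - 1 / 2) (m + 1 / 2), ENNReal.ofReal (1 / 2) := by
        refine lintegral_mono fun r => ENNReal.ofReal_le_ofReal ?_
        rw [gaussianPDFReal]
        have h1 : (2 : ℝ) ≤ Real.sqrt (2 * Real.pi * (1 : ℝ≥0)) := by
          refine Real.le_sqrt_of_sq_le ?_
          have := Real.pi_gt_three
          push_cast; linarith
        have h2 : (Real.sqrt (2 * Real.pi * (1 : ℝ≥0)))⁻¹ ≤ 1 / 2 := by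
          rw [one_div]; exact inv_anti₀ (by norm_num) h1
        have h3 : Real.exp (-(r - a) ^ 2 / (2 * (1 : ℝ≥0))) ≤ 1 := by
          rw [Real.exp_le_one_iff]
          refine div_nonpos_of_nonpos_of_nonneg ?_ (by norm_num)
          nlinarith [sq_nonneg (r - a)]
        calc _ ≤ (1 / 2 : ℝ) * 1 := mul_le_mul h2 h3 (Real.exp_pos _).le (by norm_num)
          _ = 1 / 2 := mul_one _
    _ = ENNReal.ofReal (1 / 2) := by
        rw [setLIntegral_const, Real.volume_Icc]
        norm_num

/-- A model is uniformly close in mean to an element of a cover. -/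
lemma GaussClass.exists_mem_cover (h𝓜 : GaussClass 𝓜) {N : Set (Model 𝒜)} (hN : N ⊆ 𝓜)
    (hM : M ∈ N) {ρ μ : ℝ} (hμ : μ ≤ 1 / 32) {C : Finset (Model 𝒜)} (hC : IsCover N ρ μ C) :
    ∃ M' ∈ C, ∀ π, |mean M' π - mean M π| ≤ 2 * ρ := by
  obtain ⟨hCN, E, hE, hprob, hcov⟩ := hC
  obtain ⟨M', hM', hclose⟩ := hcov M hM
  refine ⟨M', hM', fun π => ?_⟩
  set a := mean M π with ha
  set b := mean M' π with hb
  have hMa := (h𝓜 M (hN hM)).1 π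
  have hMb := (h𝓜 M' (hN (hCN hM'))).1 π
  -- The log-likelihoods differ by `(a - b) * (r - (a + b) / 2)`, so one observation in `E` away
  -- from the midpoint converts closeness of likelihoods into closeness of means.
  have hex : ∃ r ∈ E, r ∉ Set.Icc ((a + b) / 2 - 1 / 2) ((a + b) / 2 + 1 / 2) := by
    by_contra hcon
    push Not at hcon
    have h1 := hprob M hM π
    rw [h𝓜.law_eq (hN hM)] at h1
    have h2 : gaussianReal a 1 E ≤ ENNReal.ofReal (1 / 2) :=
      (measure_mono hcon).trans (gaussianReal_ball_le _ _)
    have h3 := prob_add_prob_compl (μ := gaussianReal a 1) hE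
    have h4 : (1 : ℝ≥0∞) ≤ ENNReal.ofReal (1 / 2) + ENNReal.ofReal (1 / 32) := by
      rw [← h3]; exact add_le_add h2 (h1.trans (ENNReal.ofReal_le_ofReal hμ))
    rw [← ENNReal.ofReal_add (by norm_num) (by norm_num), ENNReal.one_le_ofReal] at h4
    norm_num at h4
  obtain ⟨r, hrE, hr⟩ := hex
  have h5 := hclose π r hrE ⟨M, hM, by rw [hMa]; exact gaussianPDFReal_pos _ _ _ one_ne_zero⟩
  rw [hMa, hMb, ← Real.log_div (gaussianPDFReal_pos _ _ _ one_ne_zero).ne'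
      (gaussianPDFReal_pos _ _ _ one_ne_zero).ne', log_gaussianPDFReal_div] at h5
  have e : llrG a b r = (a - b) * (r - (a + b) / 2) := by unfold llrG; ring
  rw [e, abs_mul] at h5
  have h6 : 1 / 2 ≤ |r - (a + b) / 2| := by
    rw [Set.mem_Icc, not_and_or, not_le, not_le] at hr
    rcases hr with hr | hr
    · rw [abs_of_neg (by linarith)]; linarith
    · rw [abs_of_pos (by linarith)]; linarith
  rw [abs_sub_comm]
  nlinarith [abs_nonneg (a - b)]

end

section

variable {𝒜 : Type u}

/-! ### Potentials for the interaction -/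

section Interaction

variable [MeasurableSpace 𝒜] [MeasurableSingletonClass 𝒜] {M : Model 𝒜}
  {p : (t : ℕ) → (Fin t → 𝒜 × ℝ) → PMF 𝒜} {P : Measure (ℕ → 𝒜 × ℝ)}

/-- No measurability of `f` is needed, since a `PMF` has countable support and points are
measurable. -/
lemma lintegral_toMeasure (q : PMF 𝒜) (f : 𝒜 → ℝ≥0∞) :
    ∫⁻ a, f a ∂q.toMeasure = ∑' a, q a * f a := by
  rw [← q.restrict_toMeasure_support, lintegral_countable _ q.support_countable]
  rw [← tsum_subtype_eq_of_support_subset (s := q.support)]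
  · refine tsum_congr fun a => ?_
    rw [q.toMeasure_apply_singleton _ (measurableSet_singleton _), mul_comm]
  · intro a ha
    rw [PMF.mem_support_iff]
    exact left_ne_zero_of_mul ha

lemma measurable_snoc (t : ℕ) :
    Measurable fun q : (Fin t → 𝒜 × ℝ) × (𝒜 × ℝ) => (Fin.snoc q.1 q.2 : Fin (t + 1) → 𝒜 × ℝ) := by
  refine measurable_pi_lambda _ fun i => ?_
  refine Fin.lastCases ?_ (fun j => ?_) i
  · simpa using measurable_snd
  · simp only [Fin.snoc_castSucc]
    exact (measurable_pi_apply j).comp measurable_fst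

/-- A measurable function of the history is bounded in expectation by the initial value of any
potential that dominates it and is nonincreasing in (iterated lower) conditional expectation. -/
lemma IsInteraction.lintegral_le_potential (hP : IsInteraction M p P)
    (hlaw : ∀ a, IsProbabilityMeasure (law M a)) (Φ : ∀ t, (Fin t → 𝒜 × ℝ) → ℝ≥0∞) (T : ℕ)
    (hΦ : ∀ t < T, ∀ h, ∑' a, p t h a * ∫⁻ r, Φ (t + 1) (Fin.snoc h (a, r)) ∂law M a ≤ Φ t h)
    (F : (Fin T → 𝒜 × ℝ) → ℝ≥0∞) (hF : Measurable F) (hFΦ : ∀ h, F h ≤ Φ T h) :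
    ∫⁻ ω, F (fun i => ω i) ∂P ≤ Φ 0 Fin.elim0 := by
  obtain ⟨hPp, κ, ρ, hκ, hρ, hlaws⟩ := hP
  have hκm : ∀ t, IsMarkovKernel (κ t) := fun t => ⟨fun h => by rw [hκ]; infer_instance⟩
  have hρm : IsMarkovKernel ρ := ⟨fun a => by rw [hρ]; exact hlaw a⟩
  induction T with
  | zero =>
    calc ∫⁻ ω, F (fun i => ω i) ∂P ≤ ∫⁻ _, Φ 0 Fin.elim0 ∂P := by
          refine lintegral_mono fun ω => ?_
          refine (hFΦ _).trans (le_of_eq ?_)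
          congr 1
          exact Subsingleton.elim _ _
      _ = Φ 0 Fin.elim0 := by simp
  | succ t ih =>
    -- The potential `Φ` need not be measurable. The induction replaces the measurable `F` by its
    -- conditional expectation, still bounded by `Φ`, and never integrates `Φ` over histories.
    set η := κ t ⊗ₖ Kernel.prodMkLeft (Fin t → 𝒜 × ℝ) ρ with hη
    have hFs : Measurable fun q : (Fin t → 𝒜 × ℝ) × (𝒜 × ℝ) => F (Fin.snoc q.1 q.2) :=
      hF.comp (measurable_snoc t)
    have hF' : Measurable fun h => ∫⁻ z, F (Fin.snoc h z) ∂η h :=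
      Measurable.lintegral_kernel_prod_right' hFs
    have hstep : ∀ h, ∫⁻ z, F (Fin.snoc h z) ∂η h ≤ Φ t h := by
      intro h
      have hm : Measurable fun z : 𝒜 × ℝ => F (Fin.snoc h z) :=
        hFs.comp (measurable_const.prodMk measurable_id)
      rw [hη, Kernel.lintegral_compProd _ _ _ hm, hκ, lintegral_toMeasure]
      refine le_trans (ENNReal.tsum_le_tsum fun a => mul_le_mul_right ?_ _)
        (hΦ t (Nat.lt_succ_self t) h)
      rw [Kernel.prodMkLeft_apply, hρ]
      exact lintegral_mono fun r => hFΦ _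
    have key := ih (fun s hs => hΦ s (hs.trans (Nat.lt_succ_self t)))
      (fun h => ∫⁻ z, F (Fin.snoc h z) ∂η h) hF' hstep
    refine le_trans (le_of_eq ?_) key
    have hr : Measurable fun ω : ℕ → 𝒜 × ℝ => (fun i : Fin t => ω i) := by fun_prop
    have hr2 : Measurable fun ω : ℕ → 𝒜 × ℝ => ((fun i : Fin t => ω i), ω t) := by fun_prop
    have e1 : ∀ ω : ℕ → 𝒜 × ℝ, (fun i : Fin (t + 1) => ω i)
        = Fin.snoc (α := fun _ => 𝒜 × ℝ) (fun i : Fin t => ω i) (ω t) := by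
      intro ω
      funext i
      refine Fin.lastCases ?_ (fun j => ?_) i <;> simp
    have : IsProbabilityMeasure (P.map fun ω => (fun i : Fin t => ω i)) :=
      Measure.isProbabilityMeasure_map hr.aemeasurable
    calc ∫⁻ ω, F (fun i => ω i) ∂P
        = ∫⁻ ω, F (Fin.snoc (fun i : Fin t => ω i) (ω t)) ∂P := by simp_rw [e1]
      _ = ∫⁻ q, F (Fin.snoc q.1 q.2) ∂(P.map fun ω => ((fun i : Fin t => ω i), ω t)) := by
          rw [lintegral_map hFs hr2]
      _ = ∫⁻ h, ∫⁻ z, F (Fin.snoc h z) ∂η h ∂(P.map fun ω => (fun i : Fin t => ω i)) := by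
          rw [hlaws t, Measure.lintegral_compProd hFs]
      _ = _ := by rw [lintegral_map hF' hr]

/-- The cumulative cost of the decisions along a history. -/
def cumCost (M : Model 𝒜) (p : (t : ℕ) → (Fin t → 𝒜 × ℝ) → PMF 𝒜) :
    (t : ℕ) → (Fin t → 𝒜 × ℝ) → ℝ≥0∞
  | 0, _ => 0
  | t + 1, h => cumCost M p t (Fin.init h) + cost M (p t (Fin.init h))

/-- Measurability comes from the kernels in `IsInteraction`: mean rewards are integrals against `ρ`
and expected costs are integrals against `κ t`. -/
lemma IsInteraction.measurable_cost (hP : IsInteraction M p P)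
    (hlaw : ∀ a, IsProbabilityMeasure (law M a)) (t : ℕ) :
    Measurable fun h => cost M (p t h) := by
  obtain ⟨hPp, κ, ρ, hκ, hρ, -⟩ := hP
  have hρm : IsMarkovKernel ρ := ⟨fun a => by rw [hρ]; exact hlaw a⟩
  have hmean : Measurable (mean M) := by
    have : mean M = fun a => ∫ r, r ∂ρ a := by funext a; rw [hρ, mean]
    rw [this]
    exact (StronglyMeasurable.integral_kernel (κ := ρ) stronglyMeasurable_id).measurable
  have hgap : Measurable (gap M) := (hmean.const_sub _).ennreal_ofReal
  have : (fun h => cost M (p t h)) = fun h => ∫⁻ a, gap M a ∂κ t h := by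
    funext h; rw [hκ, lintegral_toMeasure, cost]
  rw [this]
  exact hgap.lintegral_kernel

lemma IsInteraction.measurable_cumCost (hP : IsInteraction M p P)
    (hlaw : ∀ a, IsProbabilityMeasure (law M a)) (t : ℕ) : Measurable (cumCost M p t) := by
  induction t with
  | zero => exact measurable_const
  | succ t ih =>
    have hi : Measurable fun h : Fin (t + 1) → 𝒜 × ℝ => (Fin.init h : Fin t → 𝒜 × ℝ) :=
      measurable_pi_lambda _ fun i => measurable_pi_apply _
    exact (ih.comp hi).add ((hP.measurable_cost hlaw t).comp hi)

lemma IsInteraction.regret_eq (hP : IsInteraction M p P)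
    (hlaw : ∀ a, IsProbabilityMeasure (law M a)) (T : ℕ) :
    regret M p P T = ∫⁻ ω, cumCost M p T (fun i => ω i) ∂P := by
  induction T with
  | zero => simp [regret, cumCost]
  | succ t ih =>
    have hr : Measurable fun ω : ℕ → 𝒜 × ℝ => (fun i : Fin t => ω i) := by fun_prop
    rw [regret, Finset.sum_range_succ, ← regret, ih]
    exact (lintegral_add_left ((hP.measurable_cumCost hlaw t).comp hr) _).symm

end Interaction

/-! ### Supermartingales along the explore data -/

/-- `Ψ` is a nonnegative supermartingale along the data in which decisions are drawn from `q` and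
rewards from `M`. -/
structure IsSupermart (M : Model 𝒜) (q : List (𝒜 × ℝ) → PMF 𝒜) (Ψ : List (𝒜 × ℝ) → ℝ≥0∞) :
    Prop where
  measurable : ∀ L a, Measurable fun r : ℝ => Ψ (L ++ [(a, r)])
  le : ∀ L, ∑' a, q L a * ∫⁻ r, Ψ (L ++ [(a, r)]) ∂law M a ≤ Ψ L

namespace IsSupermart

variable {M : Model 𝒜} {q : List (𝒜 × ℝ) → PMF 𝒜} {Ψ Ψ' : List (𝒜 × ℝ) → ℝ≥0∞}

lemma add (h : IsSupermart M q Ψ) (h' : IsSupermart M q Ψ') :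
    IsSupermart M q fun L => Ψ L + Ψ' L := by
  refine ⟨fun L a => (h.measurable L a).add (h'.measurable L a), fun L => ?_⟩
  simp_rw [lintegral_add_left (h.measurable L _), mul_add]
  rw [ENNReal.tsum_add]
  exact add_le_add (h.le L) (h'.le L)

lemma const_mul (h : IsSupermart M q Ψ) (c : ℝ≥0∞) : IsSupermart M q fun L => c * Ψ L := by
  refine ⟨fun L a => (h.measurable L a).const_mul c, fun L => ?_⟩
  simp_rw [lintegral_const_mul c (h.measurable L _), mul_left_comm _ c]
  rw [ENNReal.tsum_mul_left]
  exact mul_le_mul_right (h.le L) c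

lemma const (hlaw : ∀ a, IsProbabilityMeasure (law M a)) (c : ℝ≥0∞) :
    IsSupermart M q fun _ => c := by
  refine ⟨fun L a => measurable_const, fun L => ?_⟩
  simp [ENNReal.tsum_mul_right, (q L).tsum_coe]

lemma sum {ι : Type*} {s : Finset ι} {Ψ : ι → List (𝒜 × ℝ) → ℝ≥0∞}
    (hlaw : ∀ a, IsProbabilityMeasure (law M a)) (h : ∀ i ∈ s, IsSupermart M q (Ψ i)) :
    IsSupermart M q fun L => ∑ i ∈ s, Ψ i L := by
  classical
  induction s using Finset.induction_on with
  | empty => simpa using const hlaw 0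
  | insert i s his ih =>
    simp_rw [Finset.sum_insert his]
    exact (h i (Finset.mem_insert_self i s)).add
      (ih fun j hj => h j (Finset.mem_insert_of_mem hj))

end IsSupermart

/-! ### Regret bound from potentials -/

namespace AEStar

variable {𝓜 : Set (Model 𝒜)} {ε : ℝ} (A : AEStar 𝓜 ε)

lemma foldl_step_fst (l : List (𝒜 × ℝ)) (st : ℕ × List (𝒜 × ℝ)) :
    (l.foldl A.step st).1 = st.1 + l.length := by
  induction l generalizing st with
  | nil => simp
  | cons z l ih =>
    rw [List.foldl_cons, ih, step]
    split <;> simp <;> omega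

lemma exploreData_snoc {t : ℕ} (h : Fin t → 𝒜 × ℝ) (z : 𝒜 × ℝ) :
    A.exploreData (Fin.snoc h z : Fin (t + 1) → 𝒜 × ℝ) =
      match A.exploit (t + 1) (A.exploreData h) with
      | some _ => A.exploreData h
      | none => A.exploreData h ++ [z] := by
  have e : List.ofFn (Fin.snoc h z : Fin (t + 1) → 𝒜 × ℝ) = List.ofFn h ++ [z] := by
    rw [List.ofFn_succ']
    simp
  have hf := A.foldl_step_fst (List.ofFn h) (0, [])
  rw [List.length_ofFn, zero_add] at hf
  rw [exploreData, e, List.foldl_append, List.foldl_cons, List.foldl_nil, step, hf]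
  rw [← exploreData]
  cases A.exploit (t + 1) (A.exploreData h) <;> rfl

/-- The data `L` may be the data of the explore rounds among the rounds `1, …, T`. -/
def Valid (T : ℕ) (L : List (𝒜 × ℝ)) : Prop :=
  L.length ≤ T ∧ ∀ k < L.length, ∃ t, 1 ≤ t ∧ t ≤ T ∧ A.exploit t (L.take k) = none

/-- Data are only appended, and only when the exploit test fails. Every proper prefix was therefore
the full data of a round with a failed test. -/
lemma valid_exploreData {t : ℕ} (h : Fin t → 𝒜 × ℝ) : A.Valid t (A.exploreData h) := by
  induction t with
  | zero => simp [exploreData, Valid]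
  | succ t ih =>
    obtain ⟨h', z, rfl⟩ : ∃ (h' : Fin t → 𝒜 × ℝ) (z : 𝒜 × ℝ), h = Fin.snoc h' z :=
      ⟨Fin.init h, h (Fin.last t), (Fin.snoc_init_self h).symm⟩
    obtain ⟨hl, hv⟩ := ih h'
    rw [exploreData_snoc]
    cases hex : A.exploit (t + 1) (A.exploreData h') with
    | some π => exact ⟨hl.trans t.le_succ, fun k hk => by
        obtain ⟨s, h1, h2, h3⟩ := hv k hk; exact ⟨s, h1, h2.trans t.le_succ, h3⟩⟩
    | none =>
      refine ⟨by simpa using hl, fun k hk => ?_⟩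
      rw [List.length_append, List.length_singleton] at hk
      rcases Nat.lt_succ_iff_lt_or_eq.1 hk with hk | hk
      · obtain ⟨s, h1, h2, h3⟩ := hv k hk
        exact ⟨s, h1, h2.trans t.le_succ, by rwa [List.take_append_of_le_length hk.le]⟩
      · refine ⟨t + 1, by omega, le_rfl, ?_⟩
        change A.exploit (t + 1) (List.take k (A.exploreData h' ++ [z])) = none
        rw [hk, List.take_left', hex]
        rfl

/-- The regret of the exploit rounds along a history. -/
def exploitCost (M : Model 𝒜) : (t : ℕ) → (Fin t → 𝒜 × ℝ) → ℝ≥0∞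
  | 0, _ => 0
  | t + 1, h => exploitCost M t (Fin.init h) +
      match A.exploit (t + 1) (A.exploreData (Fin.init h : Fin t → 𝒜 × ℝ)) with
      | some π => gap M π
      | none => 0

/-- The regret of the explore rounds with data `L`. -/
def exploreCost (M : Model 𝒜) (L : List (𝒜 × ℝ)) : ℝ≥0∞ :=
  ∑ i ∈ Finset.range L.length, cost M (A.exploreDist (L.take i))

lemma exploreCost_append (M : Model 𝒜) (L : List (𝒜 × ℝ)) (z : 𝒜 × ℝ) :
    A.exploreCost M (L ++ [z]) = A.exploreCost M L + cost M (A.exploreDist L) := by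
  rw [exploreCost, List.length_append, List.length_singleton, Finset.sum_range_succ, exploreCost]
  congr 1
  · refine Finset.sum_congr rfl fun i hi => ?_
    rw [List.take_append_of_le_length (Finset.mem_range.1 hi).le]
  · rw [List.take_left' rfl]

lemma cumCost_eq (M : Model 𝒜) {t : ℕ} (h : Fin t → 𝒜 × ℝ) :
    cumCost M A.policy t h = A.exploitCost M t h + A.exploreCost M (A.exploreData h) := by
  induction t with
  | zero => simp [cumCost, exploitCost, exploreCost, exploreData]
  | succ t ih =>
    obtain ⟨h', z, rfl⟩ : ∃ (h' : Fin t → 𝒜 × ℝ) (z : 𝒜 × ℝ), h = Fin.snoc h' z :=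
      ⟨Fin.init h, h (Fin.last t), (Fin.snoc_init_self h).symm⟩
    rw [cumCost, exploitCost, Fin.init_snoc, ih, exploreData_snoc, policy]
    cases hex : A.exploit (t + 1) (A.exploreData h') with
    | some π =>
      have : cost M (PMF.pure π) = gap M π := by
        rw [cost, tsum_eq_single π] <;> simp +contextual
      simp only [this]
      ring
    | none =>
      simp only [exploreCost_append]
      ring

variable [MeasurableSpace 𝒜] [MeasurableSingletonClass 𝒜] {M : Model 𝒜}
  {P : Measure (ℕ → 𝒜 × ℝ)}

/-- The regret is never stopped or split on events. In an exploit round the reserve `b t * Λ` pays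
for the gap; in an explore round `Ψ` and `Λ` do not increase in expectation; at time `T` the
pathwise bound converts `c + Ψ` into the explore regret. -/
lemma regret_le_of_supermart (hP : IsInteraction M A.policy P)
    (hlaw : ∀ a, IsProbabilityMeasure (law M a)) (T : ℕ) {Ψ Λ : List (𝒜 × ℝ) → ℝ≥0∞}
    (hΨ : IsSupermart M A.exploreDist Ψ) (hΛ : IsSupermart M A.exploreDist Λ)
    (b : ℕ → ℝ≥0∞) (c : ℝ≥0∞)
    (hexploit : ∀ t L π, A.exploit (t + 1) L = some π → gap M π ≤ b t * Λ L)
    (hexplore : ∀ L, A.Valid T L → A.exploreCost M L ≤ c + Ψ L) :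
    regret M A.policy P T ≤ c + Ψ [] + (∑ t ∈ Finset.range T, b t) * Λ [] := by
  rw [hP.regret_eq hlaw]
  -- Regret of past exploit rounds, plus the allowance for exploration, plus the reserve for the
  -- exploit rounds to come.
  let Φ : ∀ t, (Fin t → 𝒜 × ℝ) → ℝ≥0∞ := fun t h =>
    A.exploitCost M t h + (c + (Ψ (A.exploreData h)
      + (∑ u ∈ Finset.Ico t T, b u) * Λ (A.exploreData h)))
  have key := hP.lintegral_le_potential hlaw Φ T (fun t ht h => ?_) (cumCost M A.policy T)
    (hP.measurable_cumCost hlaw T) (fun h => ?_)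
  · refine key.trans (le_of_eq ?_)
    simp only [Φ, exploitCost, exploreData, List.ofFn_zero, List.foldl_nil, zero_add]
    rw [add_assoc, Finset.range_eq_Ico]
  · have hb : ∑ u ∈ Finset.Ico t T, b u = b t + ∑ u ∈ Finset.Ico (t + 1) T, b u :=
      Finset.sum_eq_sum_Ico_succ_bot ht b
    simp only [Φ, exploitCost, Fin.init_snoc, exploreData_snoc, policy]
    cases hex : A.exploit (t + 1) (A.exploreData h) with
    | some π =>
      simp only [lintegral_const, measure_univ, mul_one, ENNReal.tsum_mul_right, PMF.tsum_coe,
        one_mul]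
      rw [hb, add_mul]
      have := hexploit t _ π hex
      calc A.exploitCost M t h + gap M π + (c + (Ψ (A.exploreData h) +
              (∑ u ∈ Finset.Ico (t + 1) T, b u) * Λ (A.exploreData h)))
          ≤ A.exploitCost M t h + b t * Λ (A.exploreData h) + (c + (Ψ (A.exploreData h) +
              (∑ u ∈ Finset.Ico (t + 1) T, b u) * Λ (A.exploreData h))) := by gcongr
        _ = _ := by ring
    | none =>
      simp only [add_zero]
      have h1 := ((IsSupermart.const (q := A.exploreDist) hlaw (A.exploitCost M t h)).add
        ((IsSupermart.const hlaw c).add (hΨ.add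
          (hΛ.const_mul (∑ u ∈ Finset.Ico (t + 1) T, b u))))).le (A.exploreData h)
      refine h1.trans ?_
      refine add_le_add le_rfl (add_le_add le_rfl (add_le_add le_rfl (mul_le_mul_left ?_ _)))
      rw [hb]
      exact le_add_self
  · simp only [Φ, Finset.Ico_self, Finset.sum_empty, zero_mul, add_zero]
    rw [cumCost_eq]
    gcongr
    exact hexplore _ (A.valid_exploreData h)

end AEStar

end

section

variable {𝒜 : Type u}

/-! ### Running maxima of supermartingales -/

/-- The maximum of `1` and the values of `Ψ` on the prefixes of `L`. -/
def runMax (Ψ : List (𝒜 × ℝ) → ℝ) (L : List (𝒜 × ℝ)) : ℝ :=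
  (Finset.range (L.length + 1)).sup' ⟨0, by simp⟩ fun k => max 1 (Ψ (L.take k))

lemma one_le_runMax (Ψ : List (𝒜 × ℝ) → ℝ) (L : List (𝒜 × ℝ)) : 1 ≤ runMax Ψ L :=
  (le_max_left _ _).trans (Finset.le_sup' (fun k => max 1 (Ψ (L.take k)))
    (Finset.mem_range.2 (Nat.succ_pos L.length)))

lemma le_runMax (Ψ : List (𝒜 × ℝ) → ℝ) (L : List (𝒜 × ℝ)) {k : ℕ} (hk : k ≤ L.length) :
    Ψ (L.take k) ≤ runMax Ψ L :=
  (le_max_right _ _).trans (Finset.le_sup' (fun k => max 1 (Ψ (L.take k)))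
    (Finset.mem_range.2 (Nat.lt_succ_of_le hk)))

lemma runMax_nil {Ψ : List (𝒜 × ℝ) → ℝ} (h : Ψ [] ≤ 1) : runMax Ψ [] = 1 := by
  refine le_antisymm (Finset.sup'_le _ _ fun k _ => ?_) (one_le_runMax Ψ [])
  simpa using h

lemma runMax_append (Ψ : List (𝒜 × ℝ) → ℝ) (L : List (𝒜 × ℝ)) (z : 𝒜 × ℝ) :
    runMax Ψ (L ++ [z]) = max (runMax Ψ L) (Ψ (L ++ [z])) := by
  have htake : ∀ k ≤ L.length, (L ++ [z]).take k = L.take k := fun k hk =>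
    List.take_append_of_le_length hk
  have hall : (L ++ [z]).take (L.length + 1) = L ++ [z] := by
    rw [List.take_of_length_le]; simp
  apply le_antisymm
  · refine Finset.sup'_le _ _ fun k hk => ?_
    rw [Finset.mem_range, List.length_append, List.length_singleton] at hk
    refine max_le ((one_le_runMax Ψ L).trans (le_max_left _ _)) ?_
    rcases Nat.lt_succ_iff_lt_or_eq.1 hk with h | h
    · rw [htake k (Nat.lt_succ_iff.1 h)]
      exact (le_runMax Ψ L (Nat.lt_succ_iff.1 h)).trans (le_max_left _ _)
    · rw [h, hall]; exact le_max_right _ _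
  · refine max_le (Finset.sup'_le _ _ fun k hk => ?_) ?_
    · have hk' := Nat.lt_succ_iff.1 (Finset.mem_range.1 hk)
      refine max_le (one_le_runMax _ _) ?_
      rw [← htake k hk']
      exact le_runMax Ψ _ (by simp; omega)
    · have := le_runMax Ψ (L ++ [z]) (k := L.length + 1) (by simp)
      rwa [hall] at this

/-- The square root of the running maximum is dominated by a supermartingale. -/
lemma IsSupermart.sqrt_runMax {M : Model 𝒜} {q : List (𝒜 × ℝ) → PMF 𝒜}
    {Ψ : List (𝒜 × ℝ) → ℝ} (hlaw : ∀ a, IsProbabilityMeasure (law M a)) (hpos : ∀ L, 0 ≤ Ψ L)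
    (h : IsSupermart M q fun L => ENNReal.ofReal (Ψ L)) :
    IsSupermart M q fun L =>
      ENNReal.ofReal (Real.sqrt (runMax Ψ L) + Ψ L / Real.sqrt (runMax Ψ L)) := by
  have hmeas : ∀ L a, Measurable fun r : ℝ => Ψ (L ++ [(a, r)]) := fun L a => by
    have := (h.measurable L a).ennreal_toReal
    simpa [ENNReal.toReal_ofReal (hpos _)] using this
  refine ⟨fun L a => ?_, fun L => ?_⟩
  · simp_rw [runMax_append]
    have h1 : Measurable fun r : ℝ => Real.sqrt (max (runMax Ψ L) (Ψ (L ++ [(a, r)]))) :=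
      (measurable_const.max (hmeas L a)).sqrt
    exact (h1.add ((hmeas L a).div h1)).ennreal_ofReal
  · set m := runMax Ψ L with hm
    have hm1 : 1 ≤ m := one_le_runMax Ψ L
    set s := Real.sqrt m with hs
    have hs1 : 1 ≤ s := Real.one_le_sqrt.2 hm1
    have hs2 : s ^ 2 = m := Real.sq_sqrt (by linarith)
    have hpt : ∀ z, ENNReal.ofReal (Real.sqrt (runMax Ψ (L ++ [z]))
          + Ψ (L ++ [z]) / Real.sqrt (runMax Ψ (L ++ [z])))
        ≤ ENNReal.ofReal s + ENNReal.ofReal (1 / s) * ENNReal.ofReal (Ψ (L ++ [z])) := by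
      intro z
      rw [← ENNReal.ofReal_mul (by positivity), ← ENNReal.ofReal_add (by positivity)
        (mul_nonneg (by positivity) (hpos _))]
      refine ENNReal.ofReal_le_ofReal ?_
      rw [runMax_append, ← hm]
      rcases le_total (Ψ (L ++ [z])) m with hle | hle
      · rw [max_eq_left hle, ← hs, one_div_mul_eq_div]
      · rw [max_eq_right hle]
        set y := Real.sqrt (Ψ (L ++ [z])) with hy
        have hy2 : y ^ 2 = Ψ (L ++ [z]) := Real.sq_sqrt (hpos _)
        have hys : s ≤ y := Real.sqrt_le_sqrt hle
        have hy0 : 0 < y := by linarith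
        rw [← hy2]
        have e1 : y ^ 2 / y = y := by field_simp
        rw [e1, one_div_mul_eq_div]
        -- When `y ^ 2` becomes the new maximum the process equals `2 * y`, which lies below the
        -- tangent bound `s + y ^ 2 / s`; the latter is affine in the supermartingale.
        have : 0 ≤ (y - s) ^ 2 / s := by positivity
        have e2 : (y - s) ^ 2 / s = s + y ^ 2 / s - 2 * y := by field_simp; ring
        linarith
    have h1 := ((IsSupermart.const (q := q) hlaw (ENNReal.ofReal s)).add
      (h.const_mul (ENNReal.ofReal (1 / s)))).le L
    refine le_trans (ENNReal.tsum_le_tsum fun a => mul_le_mul_right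
      (lintegral_mono fun r => hpt _) _) (h1.trans (le_of_eq ?_))
    rw [← ENNReal.ofReal_mul (by positivity), ← ENNReal.ofReal_add (by positivity)
        (mul_nonneg (by positivity) (hpos _)), one_div_mul_eq_div]

/-! ### Expectations over distributions on decisions -/

/-- The expectation of `g` under `q`. -/
def pexp (q : PMF 𝒜) (g : 𝒜 → ℝ) : ℝ := ∑' a, (q a).toReal * g a

lemma summable_pexp (q : PMF 𝒜) {g : 𝒜 → ℝ} {C : ℝ} (hg : ∀ a, |g a| ≤ C) :
    Summable fun a => (q a).toReal * g a := by
  have h1 : Summable fun a => (q a).toReal :=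
    ENNReal.summable_toReal (by rw [q.tsum_coe]; exact ENNReal.one_ne_top)
  refine Summable.of_norm_bounded (h1.mul_right C) fun a => ?_
  rw [norm_mul, Real.norm_eq_abs, Real.norm_eq_abs, abs_of_nonneg ENNReal.toReal_nonneg]
  exact mul_le_mul_of_nonneg_left (hg a) ENNReal.toReal_nonneg

lemma pexp_const (q : PMF 𝒜) (c : ℝ) : pexp q (fun _ => c) = c := by
  rw [pexp, tsum_mul_right, ← ENNReal.tsum_toReal_eq fun a => q.apply_ne_top a, q.tsum_coe]
  simp

lemma pexp_add (q : PMF 𝒜) {g g' : 𝒜 → ℝ} {C C' : ℝ} (hg : ∀ a, |g a| ≤ C)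
    (hg' : ∀ a, |g' a| ≤ C') : pexp q (fun a => g a + g' a) = pexp q g + pexp q g' := by
  rw [pexp, pexp, pexp, ← (summable_pexp q hg).tsum_add (summable_pexp q hg')]
  simp_rw [mul_add]

lemma pexp_const_mul (q : PMF 𝒜) (c : ℝ) (g : 𝒜 → ℝ) :
    pexp q (fun a => c * g a) = c * pexp q g := by
  rw [pexp, pexp, ← tsum_mul_left]
  simp_rw [mul_left_comm]

lemma pexp_mono (q : PMF 𝒜) {g g' : 𝒜 → ℝ} {C C' : ℝ} (hg : ∀ a, |g a| ≤ C)
    (hg' : ∀ a, |g' a| ≤ C') (h : ∀ a, g a ≤ g' a) : pexp q g ≤ pexp q g' :=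
  (summable_pexp q hg).tsum_le_tsum (fun a => mul_le_mul_of_nonneg_left (h a) ENNReal.toReal_nonneg)
    (summable_pexp q hg')

lemma pexp_nonneg (q : PMF 𝒜) {g : 𝒜 → ℝ} (h : ∀ a, 0 ≤ g a) : 0 ≤ pexp q g :=
  tsum_nonneg fun a => mul_nonneg ENNReal.toReal_nonneg (h a)

lemma pexp_le_one (q : PMF 𝒜) {g : 𝒜 → ℝ} (h0 : ∀ a, 0 ≤ g a) (h : ∀ a, g a ≤ 1) :
    pexp q g ≤ 1 := by
  rw [← pexp_const q 1]
  exact pexp_mono q (C := 1) (C' := 1) (fun a => by rw [abs_of_nonneg (h0 a)]; exact h a)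
    (fun a => by simp) h

lemma tsum_mul_ofReal_eq (q : PMF 𝒜) {g : 𝒜 → ℝ} {C : ℝ} (h0 : ∀ a, 0 ≤ g a) (hC : ∀ a, g a ≤ C) :
    ∑' a, q a * ENNReal.ofReal (g a) = ENNReal.ofReal (pexp q g) := by
  rw [pexp, ENNReal.ofReal_tsum_of_nonneg
    (fun a => mul_nonneg ENNReal.toReal_nonneg (h0 a))
    (summable_pexp q fun a => by rw [abs_of_nonneg (h0 a)]; exact hC a)]
  refine tsum_congr fun a => ?_
  rw [ENNReal.ofReal_mul ENNReal.toReal_nonneg, ENNReal.ofReal_toReal (q.apply_ne_top a)]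

/-- One-step exponential inequality. -/
lemma tsum_lintegral_exp_le_one {M : Model 𝒜} (q : PMF 𝒜) {b : 𝒜 → ℝ → ℝ} {g : 𝒜 → ℝ} {C : ℝ}
    (hC : ∀ a, |g a| ≤ C) (hg : ∀ a, -1 ≤ g a)
    (hb : ∀ a, ∫⁻ r, ENNReal.ofReal (Real.exp (b a r)) ∂law M a ≤ ENNReal.ofReal (1 + g a)) :
    ∑' a, q a * ∫⁻ r, ENNReal.ofReal (Real.exp (b a r - pexp q g)) ∂law M a ≤ 1 := by
  set e := pexp q g with he
  have h1 : ∀ a, ∫⁻ r, ENNReal.ofReal (Real.exp (b a r - e)) ∂law M a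
      ≤ ENNReal.ofReal (Real.exp (-e)) * ENNReal.ofReal (1 + g a) := by
    intro a
    have : ∀ r, ENNReal.ofReal (Real.exp (b a r - e))
        = ENNReal.ofReal (Real.exp (-e)) * ENNReal.ofReal (Real.exp (b a r)) := fun r => by
      rw [← ENNReal.ofReal_mul (Real.exp_pos _).le, ← Real.exp_add]
      congr 2; ring
    simp_rw [this]
    rw [lintegral_const_mul' _ _ ENNReal.ofReal_ne_top]
    exact mul_le_mul_right (hb a) _
  refine (ENNReal.tsum_le_tsum fun a => mul_le_mul_right (h1 a) _).trans ?_
  simp_rw [mul_left_comm _ (ENNReal.ofReal (Real.exp (-e)))]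
  rw [ENNReal.tsum_mul_left, tsum_mul_ofReal_eq q (C := 1 + C) (fun a => by linarith [hg a])
    (fun a => by linarith [le_abs_self (g a), hC a]),
    pexp_add q (C := 1) (C' := C) (fun a => by simp) hC, pexp_const, ← he,
    ← ENNReal.ofReal_mul (Real.exp_pos _).le, ENNReal.ofReal_le_one]
  have h2 := Real.add_one_le_exp e
  calc Real.exp (-e) * (1 + e) ≤ Real.exp (-e) * Real.exp e :=
        mul_le_mul_of_nonneg_left (by linarith) (Real.exp_pos _).le
    _ = 1 := by rw [← Real.exp_add]; simp

/-! ### Additive functionals of the data -/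

/-- The sum of the increments `a` along the data. -/
def prefixSum (a : List (𝒜 × ℝ) → 𝒜 × ℝ → ℝ) (L : List (𝒜 × ℝ)) : ℝ :=
  ∑ i : Fin L.length, a (L.take i) (L.get i)

lemma prefixSum_nil (a : List (𝒜 × ℝ) → 𝒜 × ℝ → ℝ) : prefixSum a [] = 0 := by
  simp [prefixSum]

lemma prefixSum_append (a : List (𝒜 × ℝ) → 𝒜 × ℝ → ℝ) (L : List (𝒜 × ℝ)) (z : 𝒜 × ℝ) :
    prefixSum a (L ++ [z]) = prefixSum a L + a L z := by
  have e : ∀ L' : List (𝒜 × ℝ), prefixSum a L'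
      = ∑ i ∈ Finset.range L'.length, if h : i < L'.length then a (L'.take i) L'[i] else 0 := by
    intro L'
    rw [Finset.sum_range]
    exact Finset.sum_congr rfl fun i _ => by simp
  have hlen : Finset.range (L ++ [z]).length = Finset.range (L.length + 1) := by simp
  rw [e, e, hlen, Finset.sum_range_succ]
  congr 1
  · refine Finset.sum_congr rfl fun i hi => ?_
    have hi' := Finset.mem_range.1 hi
    rw [dif_pos hi', dif_pos (by simp; omega), List.take_append_of_le_length hi'.le,
      List.getElem_append_left hi']
  · rw [dif_pos (by simp)]
    simp

lemma isSupermart_exp_prefixSum {M : Model 𝒜} {q : List (𝒜 × ℝ) → PMF 𝒜}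
    {a : List (𝒜 × ℝ) → 𝒜 × ℝ → ℝ} (hm : ∀ L c, Measurable fun r : ℝ => a L (c, r))
    (ha : ∀ L, ∑' c, q L c * ∫⁻ r, ENNReal.ofReal (Real.exp (a L (c, r))) ∂law M c ≤ 1) :
    IsSupermart M q fun L => ENNReal.ofReal (Real.exp (prefixSum a L)) := by
  refine ⟨fun L c => ?_, fun L => ?_⟩
  · simp_rw [prefixSum_append]
    exact ((hm L c).const_add _).exp.ennreal_ofReal
  · have h1 : ∀ c, ∫⁻ r, ENNReal.ofReal (Real.exp (prefixSum a (L ++ [(c, r)]))) ∂law M c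
        = ENNReal.ofReal (Real.exp (prefixSum a L))
          * ∫⁻ r, ENNReal.ofReal (Real.exp (a L (c, r))) ∂law M c := by
      intro c
      rw [← lintegral_const_mul' _ _ ENNReal.ofReal_ne_top]
      refine lintegral_congr fun r => ?_
      rw [prefixSum_append, Real.exp_add, ENNReal.ofReal_mul (Real.exp_pos _).le]
    simp_rw [h1, mul_left_comm _ (ENNReal.ofReal (Real.exp (prefixSum a L)))]
    rw [ENNReal.tsum_mul_left]
    exact mul_le_of_le_one_right' (ha L)

end

section

variable {𝒜 : Type u} {𝓜 : Set (Model 𝒜)} {M M' M₀ Mstar : Model 𝒜}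

/-! ### Finitely supported distributions on models -/

/-- `ξ` is supported in the finite set `s` of models of the class `𝓜`. -/
structure FinSupp (𝓜 : Set (Model 𝒜)) (ξ : PMF (Model 𝒜)) (s : Finset (Model 𝒜)) : Prop where
  eq_zero : ∀ M ∉ s, ξ M = 0
  mem : ∀ M ∈ s, M ∈ 𝓜

namespace FinSupp

variable {ξ : PMF (Model 𝒜)} {s : Finset (Model 𝒜)}

lemma pexp_eq (h : FinSupp 𝓜 ξ s) (g : Model 𝒜 → ℝ) :
    pexp ξ g = ∑ M ∈ s, (ξ M).toReal * g M :=
  tsum_eq_sum fun M hM => by rw [h.eq_zero M hM]; simp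

lemma sum_eq_one (h : FinSupp 𝓜 ξ s) : ∑ M ∈ s, (ξ M).toReal = 1 := by
  have := h.pexp_eq fun _ => 1
  rw [pexp_const] at this
  simpa using this.symm

lemma mono (h : FinSupp 𝓜 ξ s) {g g' : Model 𝒜 → ℝ} (hg : ∀ M ∈ 𝓜, g M ≤ g' M) :
    pexp ξ g ≤ pexp ξ g' := by
  rw [h.pexp_eq, h.pexp_eq]
  exact Finset.sum_le_sum fun M hM => mul_le_mul_of_nonneg_left (hg M (h.mem M hM))
    ENNReal.toReal_nonneg

lemma congr (h : FinSupp 𝓜 ξ s) {g g' : Model 𝒜 → ℝ} (hg : ∀ M ∈ 𝓜, g M = g' M) :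
    pexp ξ g = pexp ξ g' :=
  le_antisymm (h.mono fun M hM => (hg M hM).le) (h.mono fun M hM => (hg M hM).ge)

lemma add (h : FinSupp 𝓜 ξ s) (g g' : Model 𝒜 → ℝ) :
    pexp ξ (fun M => g M + g' M) = pexp ξ g + pexp ξ g' := by
  simp only [h.pexp_eq, mul_add, Finset.sum_add_distrib]

lemma le_const (h : FinSupp 𝓜 ξ s) {g : Model 𝒜 → ℝ} {c : ℝ} (hg : ∀ M ∈ 𝓜, g M ≤ c) :
    pexp ξ g ≤ c := (h.mono hg).trans_eq (pexp_const ξ c)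

lemma exp_le (h : FinSupp 𝓜 ξ s) (g : Model 𝒜 → ℝ) :
    Real.exp (pexp ξ g) ≤ pexp ξ fun M => Real.exp (g M) := by
  rw [h.pexp_eq, h.pexp_eq]
  exact convexOn_exp.map_sum_le (fun M _ => ENNReal.toReal_nonneg) h.sum_eq_one
    fun M _ => Set.mem_univ _

lemma sq_le (h : FinSupp 𝓜 ξ s) (g : Model 𝒜 → ℝ) :
    pexp ξ g ^ 2 ≤ pexp ξ fun M => g M ^ 2 := by
  rw [h.pexp_eq, h.pexp_eq]
  exact (even_two.convexOn_pow (𝕜 := ℝ)).map_sum_le (fun M _ => ENNReal.toReal_nonneg) h.sum_eq_one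
    fun M _ => Set.mem_univ _

lemma exp_pos (h : FinSupp 𝓜 ξ s) (g : Model 𝒜 → ℝ) : 0 < pexp ξ fun M => Real.exp (g M) :=
  (Real.exp_pos _).trans_le (h.exp_le g)

lemma measurable (h : FinSupp 𝓜 ξ s) {g : Model 𝒜 → ℝ → ℝ} (hg : ∀ M, Measurable (g M)) :
    Measurable fun r => pexp ξ fun M => g M r := by
  simp only [h.pexp_eq]
  exact Finset.measurable_sum _ fun M _ => (hg M).const_mul _

end FinSupp

/-- The log-likelihood ratio of the observation `z` between `M` and the true model. -/
def llrM (Mstar M : Model 𝒜) (z : 𝒜 × ℝ) : ℝ := llrG (mean M z.1) (mean Mstar z.1) z.2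

/-- The squared distance between the mean rewards of `a`. -/
def sqd (Mstar : Model 𝒜) (a : 𝒜) (M : Model 𝒜) : ℝ := (mean M a - mean Mstar a) ^ 2

/-- The squared estimation error of the randomized estimate `ξ` for the decision `a`. -/
def err (Mstar : Model 𝒜) (ξ : PMF (Model 𝒜)) (a : 𝒜) : ℝ := pexp ξ (sqd Mstar a)

lemma measurable_llrM (Mstar M : Model 𝒜) (a : 𝒜) : Measurable fun r => llrM Mstar M (a, r) :=
  measurable_llrG (mean M a) (mean Mstar a)

lemma sqd_nonneg (a : 𝒜) : 0 ≤ sqd Mstar a M := sq_nonneg _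

lemma GaussClass.sqd_le_one (h𝓜 : GaussClass 𝓜) (hs : Mstar ∈ 𝓜) (hM : M ∈ 𝓜) (a : 𝒜) :
    sqd Mstar a M ≤ 1 := h𝓜.sq_le_one hM hs a

lemma GaussClass.kl_eq_sqd (h𝓜 : GaussClass 𝓜) (hs : Mstar ∈ 𝓜) (hM : M ∈ 𝓜) (a : 𝒜) :
    kl M Mstar a = ENNReal.ofReal (sqd Mstar a M / 2) := h𝓜.kl_eq hM hs a

lemma GaussClass.kl_eq_sqd' (h𝓜 : GaussClass 𝓜) (hs : Mstar ∈ 𝓜) (hM : M ∈ 𝓜) (a : 𝒜) :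
    kl Mstar M a = ENNReal.ofReal (sqd Mstar a M / 2) := by
  rw [h𝓜.kl_eq hs hM, sqd, ← neg_sub, neg_sq]

lemma GaussClass.info_eq_pexp (h𝓜 : GaussClass 𝓜) (hs : Mstar ∈ 𝓜) (hM : M ∈ 𝓜) (w : PMF 𝒜) :
    info w Mstar M = ENNReal.ofReal (pexp w fun a => sqd Mstar a M / 2) := by
  simp only [info, h𝓜.kl_eq_sqd' hs hM]
  exact tsum_mul_ofReal_eq w (C := 1) (fun a => by have := sqd_nonneg (Mstar := Mstar) (M := M) a; linarith)
    fun a => by have := h𝓜.sqd_le_one hs hM a; linarith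

lemma err_nonneg (ξ : PMF (Model 𝒜)) (a : 𝒜) : 0 ≤ err Mstar ξ a :=
  pexp_nonneg ξ fun _ => sq_nonneg _

section Moments

variable {ξ : PMF (Model 𝒜)} {s : Finset (Model 𝒜)}

lemma FinSupp.err_le_one (h : FinSupp 𝓜 ξ s) (h𝓜 : GaussClass 𝓜) (hs : Mstar ∈ 𝓜) (a : 𝒜) :
    err Mstar ξ a ≤ 1 := h.le_const fun _ hM => h𝓜.sqd_le_one hs hM a

lemma FinSupp.abs_err_le (h : FinSupp 𝓜 ξ s) (h𝓜 : GaussClass 𝓜) (hs : Mstar ∈ 𝓜) (a : 𝒜) :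
    |err Mstar ξ a| ≤ 1 := by
  rw [abs_of_nonneg (err_nonneg ξ a)]; exact h.err_le_one h𝓜 hs a

lemma GaussClass.log_div_eq_llrM (h𝓜 : GaussClass 𝓜) (hM : M ∈ 𝓜) (hM' : M' ∈ 𝓜)
    (z : 𝒜 × ℝ) :
    Real.log (M' z.1 z.2 / M z.1 z.2) = llrM Mstar M' z - llrM Mstar M z := by
  rw [(h𝓜 M' hM').1, (h𝓜 M hM).1, log_gaussianPDFReal_div, llrM, llrM]
  simp only [llrG]; ring

lemma GaussClass.lintegral_exp_llrM (h𝓜 : GaussClass 𝓜) (hs : Mstar ∈ 𝓜) (M : Model 𝒜) (α : ℝ)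
    (a : 𝒜) :
    ∫⁻ r, ENNReal.ofReal (Real.exp (α * llrM Mstar M (a, r))) ∂law Mstar a
      = ENNReal.ofReal (Real.exp (α * (α - 1) * sqd Mstar a M / 2)) := by
  rw [h𝓜.law_eq hs]
  exact lintegral_exp_llrG (mean M a) (mean Mstar a) α

lemma FinSupp.lintegral_pexp (h : FinSupp 𝓜 ξ s) (h𝓜 : GaussClass 𝓜) (hs : Mstar ∈ 𝓜) (α : ℝ)
    (a : 𝒜) :
    ∫⁻ r, ENNReal.ofReal (pexp ξ fun M => Real.exp (α * llrM Mstar M (a, r))) ∂law Mstar a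
      = ENNReal.ofReal (pexp ξ fun M => Real.exp (α * (α - 1) * sqd Mstar a M / 2)) := by
  simp only [h.pexp_eq]
  have h0 : ∀ M ∈ s, ∀ y : ℝ, 0 ≤ (ξ M).toReal * Real.exp y := fun M _ y =>
    mul_nonneg ENNReal.toReal_nonneg (Real.exp_pos _).le
  rw [ENNReal.ofReal_sum_of_nonneg fun M hM => h0 M hM _]
  simp_rw [ENNReal.ofReal_sum_of_nonneg fun M hM => h0 M hM _]
  rw [lintegral_finsetSum _ fun M _ =>
    (((measurable_llrM Mstar M a).const_mul α).exp.const_mul _).ennreal_ofReal]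
  refine Finset.sum_congr rfl fun M _ => ?_
  simp_rw [ENNReal.ofReal_mul (ENNReal.toReal_nonneg (a := ξ M))]
  rw [lintegral_const_mul' _ _ ENNReal.ofReal_ne_top, h𝓜.lintegral_exp_llrM hs]

lemma FinSupp.lintegral_exp_pexp_le (h : FinSupp 𝓜 ξ s) (h𝓜 : GaussClass 𝓜) (hs : Mstar ∈ 𝓜)
    (α : ℝ) (a : 𝒜) :
    ∫⁻ r, ENNReal.ofReal (Real.exp (α * pexp ξ fun M => llrM Mstar M (a, r))) ∂law Mstar a
      ≤ ENNReal.ofReal (pexp ξ fun M => Real.exp (α * (α - 1) * sqd Mstar a M / 2)) := by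
  rw [← h.lintegral_pexp h𝓜 hs]
  refine lintegral_mono fun r => ENNReal.ofReal_le_ofReal ?_
  rw [← pexp_const_mul]
  exact h.exp_le _

/-- The mean of a mixture is attained in a convex linear class. -/
lemma IsLinearInstance.exists_mean_mixModel {d : ℕ} {D : ℝ} {x : 𝒜 → EuclideanSpace ℝ (Fin d)}
    {Θ : Set (EuclideanSpace ℝ (Fin d))} (hI : IsLinearInstance D x Θ Mstar)
    (h : FinSupp (linearClass x Θ) ξ s) :
    ∃ M ∈ linearClass x Θ, (∀ a, mean M a = pexp ξ fun M' => mean M' a) ∧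
      optSet (mixModel ξ) = optSet M := by
  have h1 : ∀ M : Model 𝒜, ∃ θ, M ∈ s → θ ∈ Θ ∧ linearModel x θ = M := fun M => by
    by_cases hM : M ∈ s
    · obtain ⟨θ, hθ, h⟩ := h.mem M hM; exact ⟨θ, fun _ => ⟨hθ, h⟩⟩
    · exact ⟨0, fun h => absurd h hM⟩
  choose θ hθ using h1
  have hlin : ∀ a, mean (linearModel x (∑ M ∈ s, (ξ M).toReal • θ M)) a
      = pexp ξ fun M' => mean M' a := fun a => by
    rw [mean_linearModel, h.pexp_eq, sum_inner]
    refine Finset.sum_congr rfl fun M hM => ?_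
    rw [real_inner_smul_left, ← mean_linearModel, (hθ M hM).2]
  have hmix : ∀ a, mean (mixModel ξ) a = pexp ξ fun M' => mean M' a := fun a => by
    have hm : ∀ M ∈ s, M a = gaussianPDFReal (mean M a) 1 := fun M hM =>
      (hI.gaussClass M (h.mem M hM)).1 a
    have e : ∀ r, mixModel ξ a r = ∑ M ∈ s, (ξ M).toReal * gaussianPDFReal (mean M a) 1 r :=
      fun r => (h.pexp_eq fun M => M a r).trans (Finset.sum_congr rfl fun M hM => by rw [hm M hM])
    have hnn : ∀ r, 0 ≤ mixModel ξ a r := fun r => by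
      rw [e]
      exact Finset.sum_nonneg fun M _ =>
        mul_nonneg ENNReal.toReal_nonneg (gaussianPDFReal_nonneg _ _ _)
    have hmeas : Measurable (mixModel ξ a) := by
      have : mixModel ξ a = fun r => ∑ M ∈ s, (ξ M).toReal * gaussianPDFReal (mean M a) 1 r :=
        funext e
      rw [this]
      exact Finset.measurable_sum _ fun M _ => (measurable_gaussianPDFReal _ _).const_mul _
    have hint : ∀ M : Model 𝒜, Integrable (fun r => gaussianPDFReal (mean M a) 1 r * r) := fun M => by
      have := integrable_id_gaussianReal (mean M a)
      rw [gaussianReal_of_var_ne_zero _ one_ne_zero, integrable_withDensity_iff_integrable_smul'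
        (measurable_gaussianPDF _ _) (Filter.Eventually.of_forall fun r => gaussianPDF_lt_top)] at this
      simpa [toReal_gaussianPDF] using this
    have hval : ∀ M : Model 𝒜, ∫ r, gaussianPDFReal (mean M a) 1 r * r = mean M a := fun M => by
      have := integral_gaussianReal_eq_integral_smul (μ := mean M a) (v := 1) (f := fun r : ℝ => r)
        one_ne_zero
      rw [integral_id_gaussianReal] at this
      simpa using this.symm
    rw [mean, law, integral_withDensity_eq_integral_toReal_smul hmeas.ennreal_ofReal
      (Filter.Eventually.of_forall fun r => ENNReal.ofReal_lt_top), h.pexp_eq]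
    simp_rw [ENNReal.toReal_ofReal (hnn _), e, smul_eq_mul, Finset.sum_mul, mul_assoc]
    rw [integral_finsetSum _ fun M _ => (hint M).const_mul _]
    refine Finset.sum_congr rfl fun M _ => ?_
    rw [integral_const_mul, hval]
  -- The averaged parameter lies in `Θ` by convexity, and its linear model has the same means as the
  -- mixture, although the mixture itself is not Gaussian.
  refine ⟨_, ⟨_, hI.convex.sum_mem (fun M _ => ENNReal.toReal_nonneg) h.sum_eq_one
    fun M hM => (hθ M hM).1, rfl⟩, hlin, ?_⟩
  simp only [optSet, hlin, hmix]

end Moments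

/-! ### Tempered aggregation -/

/-- The cumulative log-likelihood ratio of the data `D`. -/
def sumLlr (Mstar M : Model 𝒜) (D : List (𝒜 × ℝ)) : ℝ := (D.map (llrM Mstar M)).sum

/-- The partition function of tempered aggregation over `C`. -/
def partition (Mstar : Model 𝒜) (C : Finset (Model 𝒜)) (D : List (𝒜 × ℝ)) : ℝ :=
  ∑ M ∈ C, Real.exp (1 / 2 * sumLlr Mstar M D)

lemma sumLlr_append (D : List (𝒜 × ℝ)) (z : 𝒜 × ℝ) :
    sumLlr Mstar M (D ++ [z]) = sumLlr Mstar M D + llrM Mstar M z := by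
  simp [sumLlr]

lemma partition_nil (C : Finset (Model 𝒜)) : partition Mstar C [] = C.card := by
  simp [partition, sumLlr]

lemma partition_pos {C : Finset (Model 𝒜)} (hC : C.Nonempty) (D : List (𝒜 × ℝ)) :
    0 < partition Mstar C D := Finset.sum_pos (fun _ _ => Real.exp_pos _) hC

lemma sumLlr_le_log_partition {C : Finset (Model 𝒜)} (hM : M ∈ C) (D : List (𝒜 × ℝ)) :
    1 / 2 * sumLlr Mstar M D ≤ Real.log (partition Mstar C D) := by
  rw [Real.le_log_iff_exp_le (partition_pos ⟨M, hM⟩ D)]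
  exact Finset.single_le_sum (f := fun M => Real.exp (1 / 2 * sumLlr Mstar M D))
    (fun _ _ => (Real.exp_pos _).le) hM

/-- The square root of the likelihood of `Mstar` is a factor common to all weights and cancels in
the normalization; `partition` can thus be expressed through log-likelihood ratios against `Mstar`.
-/
lemma GaussClass.temperedWeight_eq (h𝓜 : GaussClass 𝓜) (hs : Mstar ∈ 𝓜) {C : Finset (Model 𝒜)}
    (hC : ∀ M ∈ C, M ∈ 𝓜) (hM : M ∈ C) (D : List (𝒜 × ℝ)) :
    temperedWeight C D M = (D.map fun z => ENNReal.ofReal (Real.sqrt (Mstar z.1 z.2))).prod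
      * ENNReal.ofReal (Real.exp (1 / 2 * sumLlr Mstar M D)) := by
  rw [temperedWeight, if_pos hM]
  induction D with
  | nil => simp [sumLlr]
  | cons z D ih =>
    have e : sumLlr Mstar M (z :: D) = llrM Mstar M z + sumLlr Mstar M D := by simp [sumLlr]
    have e2 : Real.sqrt (M z.1 z.2)
        = Real.sqrt (Mstar z.1 z.2) * Real.exp (1 / 2 * llrM Mstar M z) := by
      rw [(h𝓜 M (hC M hM)).1, (h𝓜 Mstar hs).1, gaussianPDFReal_eq_mul_exp_llrG (mean M z.1)
        (mean Mstar z.1), Real.sqrt_mul (gaussianPDFReal_nonneg _ _ _), Real.sqrt_eq_rpow (Real.exp _),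
        ← Real.exp_mul, llrM, mul_comm (llrG _ _ _)]
    rw [List.map_cons, List.map_cons, List.prod_cons, List.prod_cons, ih, e, mul_add, Real.exp_add,
      ENNReal.ofReal_mul (Real.exp_pos _).le, e2, ENNReal.ofReal_mul (Real.sqrt_nonneg _)]
    ring

/-- Gaussian densities are positive and finite, so for nonempty `C` the normalization is legitimate
and the fallback model plays no role. -/
lemma GaussClass.tempered_apply (h𝓜 : GaussClass 𝓜) (hs : Mstar ∈ 𝓜) {C : Finset (Model 𝒜)}
    (hC : ∀ M ∈ C, M ∈ 𝓜) (hne : C.Nonempty) (hM : M ∈ C) (D : List (𝒜 × ℝ)) :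
    (tempered C M₀ D M).toReal = Real.exp (1 / 2 * sumLlr Mstar M D) / partition Mstar C D := by
  set c := (D.map fun z => ENNReal.ofReal (Real.sqrt (Mstar z.1 z.2))).prod with hc
  have hc0 : c ≠ 0 ∧ c ≠ ∞ := by
    rw [hc]
    clear_value c
    clear hc
    induction D with
    | nil => simp
    | cons z D ih =>
      rw [List.map_cons, List.prod_cons]
      have hp : 0 < Real.sqrt (Mstar z.1 z.2) := by
        rw [Real.sqrt_pos, (h𝓜 Mstar hs).1]; exact gaussianPDFReal_pos _ _ _ one_ne_zero
      exact ⟨mul_ne_zero (ENNReal.ofReal_pos.2 hp).ne' ih.1,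
        ENNReal.mul_ne_top ENNReal.ofReal_ne_top ih.2⟩
  have hsum : ∑' M, temperedWeight C D M = c * ENNReal.ofReal (partition Mstar C D) := by
    have h0 : ∀ M ∉ C, temperedWeight C D M = 0 := fun M hM => if_neg hM
    rw [tsum_eq_sum h0, partition,
      ENNReal.ofReal_sum_of_nonneg fun _ _ => (Real.exp_pos _).le, Finset.mul_sum]
    exact Finset.sum_congr rfl fun M hM => h𝓜.temperedWeight_eq hs hC hM D
  have hp := partition_pos (Mstar := Mstar) hne D
  have hcond : ∑' M, temperedWeight C D M ≠ 0 ∧ ∑' M, temperedWeight C D M ≠ ∞ := by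
    rw [hsum]
    exact ⟨mul_ne_zero hc0.1 (ENNReal.ofReal_pos.2 hp).ne',
      ENNReal.mul_ne_top hc0.2 ENNReal.ofReal_ne_top⟩
  rw [tempered, dif_pos hcond, PMF.normalize_apply, hsum, h𝓜.temperedWeight_eq hs hC hM,
    ENNReal.mul_inv (Or.inl hc0.1) (Or.inl hc0.2)]
  have : c * ENNReal.ofReal (Real.exp (1 / 2 * sumLlr Mstar M D))
      * (c⁻¹ * (ENNReal.ofReal (partition Mstar C D))⁻¹)
      = (c * c⁻¹) * (ENNReal.ofReal (Real.exp (1 / 2 * sumLlr Mstar M D))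
        * (ENNReal.ofReal (partition Mstar C D))⁻¹) := by ring
  rw [this, ENNReal.mul_inv_cancel hc0.1 hc0.2, one_mul, ENNReal.toReal_mul, ENNReal.toReal_inv,
    ENNReal.toReal_ofReal (Real.exp_pos _).le, ENNReal.toReal_ofReal hp.le]
  exact (div_eq_mul_inv _ _).symm

lemma finSupp_tempered {C : Finset (Model 𝒜)} (hC : ∀ M ∈ C, M ∈ 𝓜) (hM₀ : M₀ ∈ 𝓜)
    (D : List (𝒜 × ℝ)) : ∃ s, FinSupp 𝓜 (tempered C M₀ D) s := by
  classical
  refine ⟨insert M₀ C, fun M hM => ?_, fun M hM => ?_⟩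
  · rw [Finset.mem_insert, not_or] at hM
    rw [tempered]
    split_ifs with h
    · rw [PMF.normalize_apply, temperedWeight, if_neg hM.2, zero_mul]
    · rw [PMF.pure_apply, if_neg hM.1]
  · rcases Finset.mem_insert.1 hM with rfl | h
    exacts [hM₀, hC M h]

lemma FinSupp.tempered {C : Finset (Model 𝒜)} (hC : ∀ M ∈ C, M ∈ 𝓜) (h𝓜 : GaussClass 𝓜)
    (hs : Mstar ∈ 𝓜) (hne : C.Nonempty) (D : List (𝒜 × ℝ)) :
    FinSupp 𝓜 (GLBandit.tempered C M₀ D) C := by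
  refine ⟨fun M hM => ?_, hC⟩
  have hsum : ∑ M ∈ C, (GLBandit.tempered C M₀ D M).toReal = 1 := by
    rw [Finset.sum_congr rfl fun M hM => h𝓜.tempered_apply hs hC hne hM D, ← Finset.sum_div]
    exact div_self (partition_pos hne D).ne'
  have h1 := pexp_const (GLBandit.tempered C M₀ D) 1
  simp only [pexp, mul_one] at h1
  have hsm : Summable fun M => (GLBandit.tempered C M₀ D M).toReal :=
    ENNReal.summable_toReal (by rw [PMF.tsum_coe]; exact ENNReal.one_ne_top)
  classical
  have h2 := hsm.sum_le_tsum (insert M C) fun _ _ => ENNReal.toReal_nonneg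
  rw [Finset.sum_insert hM, hsum, h1] at h2
  have h3 : (GLBandit.tempered C M₀ D M).toReal = 0 :=
    le_antisymm (by linarith) ENNReal.toReal_nonneg
  exact ((ENNReal.toReal_eq_zero_iff _).1 h3).resolve_right (PMF.apply_ne_top _ _)

/-- The one-step exponential moment is a ratio of successive partition functions; its logarithms
telescope within an epoch. -/
lemma GaussClass.pexp_tempered_exp (h𝓜 : GaussClass 𝓜) (hs : Mstar ∈ 𝓜) {C : Finset (Model 𝒜)}
    (hC : ∀ M ∈ C, M ∈ 𝓜) (hne : C.Nonempty) (D : List (𝒜 × ℝ)) (z : 𝒜 × ℝ) :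
    pexp (tempered C M₀ D) (fun M => Real.exp (1 / 2 * llrM Mstar M z))
      = partition Mstar C (D ++ [z]) / partition Mstar C D := by
  rw [(FinSupp.tempered hC h𝓜 hs hne D).pexp_eq, partition, Finset.sum_div]
  refine Finset.sum_congr rfl fun M hM => ?_
  rw [h𝓜.tempered_apply hs hC hne hM, sumLlr_append, mul_add, Real.exp_add]
  ring

end

/-! ### Exponential supermartingales of the algorithm. -/

section

variable {𝒜 : Type u} {𝓜 : Set (Model 𝒜)} {M M' M₀ Mstar : Model 𝒜}

/-- A first-order bound `1 + g` on the conditional moment, averaged over decisions, is compensated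
by the exponential of the average of `g`. -/
lemma isSupermart_exp_increments {q : List (𝒜 × ℝ) → PMF 𝒜} {b : List (𝒜 × ℝ) → 𝒜 × ℝ → ℝ}
    {g : List (𝒜 × ℝ) → 𝒜 → ℝ} {C : ℝ} (hm : ∀ L a, Measurable fun r : ℝ => b L (a, r))
    (hC : ∀ L a, |g L a| ≤ C) (hg : ∀ L a, -1 ≤ g L a)
    (hb : ∀ L a, ∫⁻ r, ENNReal.ofReal (Real.exp (b L (a, r))) ∂law Mstar a
      ≤ ENNReal.ofReal (1 + g L a)) :
    IsSupermart Mstar q fun L =>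
      ENNReal.ofReal (Real.exp (prefixSum (fun D z => b D z - pexp (q D) (g D)) L)) :=
  isSupermart_exp_prefixSum (fun L a => (hm L a).sub_const _) fun L =>
    tsum_lintegral_exp_le_one (q L) (b := fun a r => b L (a, r)) (hC L) (hg L) (hb L)

lemma exp_le_one_add_two_mul {x : ℝ} (h0 : 0 ≤ x) (h1 : x ≤ 1) : Real.exp x ≤ 1 + 2 * x := by
  have := (abs_le.1 (Real.abs_exp_sub_one_sub_id_le (abs_le.2 ⟨by linarith, h1⟩))).2
  nlinarith

lemma exp_neg_le_one_sub {x : ℝ} (h0 : 0 ≤ x) (h1 : x ≤ 1) : Real.exp (-x) ≤ 1 - x * (1 - x) := by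
  have := (abs_le.1 (Real.abs_exp_sub_one_sub_id_le (x := -x) (abs_le.2 ⟨by linarith, by linarith⟩))).2
  nlinarith

namespace AEStar

variable {ε : ℝ} (A : AEStar 𝓜 ε)

/-- The randomized estimate from the data `L`. -/
def est (L : List (𝒜 × ℝ)) : PMF (Model 𝒜) := estimate A.cover A.base L

/-- Tempered aggregation over the cover of the epoch of the next explore round. -/
def nextEst (L : List (𝒜 × ℝ)) : PMF (Model 𝒜) :=
  tempered (A.cover (epoch (L.length + 1))) A.base
    (L.drop (epochStart (epoch (L.length + 1)) - 1))

lemma mem_of_mem_cover {ℓ : ℕ} (hℓ : 1 ≤ ℓ) {M : Model 𝒜} (hM : M ∈ A.cover ℓ) : M ∈ 𝓜 :=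
  ((A.isCover ℓ hℓ).1 hM).1.1

lemma one_le_epoch (s : ℕ) : 1 ≤ epoch s := Nat.le_add_left _ _

lemma exists_finSupp_est (L : List (𝒜 × ℝ)) : ∃ s, FinSupp 𝓜 (A.est L) s :=
  finSupp_tempered (fun _ hM => A.mem_of_mem_cover (one_le_epoch _) hM) A.base_mem _

lemma exists_finSupp_nextEst (L : List (𝒜 × ℝ)) : ∃ s, FinSupp 𝓜 (A.nextEst L) s :=
  finSupp_tempered (fun _ hM => A.mem_of_mem_cover (one_le_epoch _) hM) A.base_mem _

/-- The estimate of round `s` uses the cover of the epoch of round `s - 1`, whereas the aggregation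
analysis uses that of round `s`. They can differ only in the first round of an epoch. -/
lemma est_eq_nextEst {L : List (𝒜 × ℝ)} (hL : 1 ≤ L.length)
    (h : epoch (L.length + 1) = epoch L.length) : A.est L = A.nextEst L := by
  rw [est, nextEst, estimate, h, max_eq_left hL]

/-- The increments of the log-likelihood ratio of the estimates with respect to the true model,
negated and compensated. -/
def incrEst (Mstar : Model 𝒜) (D : List (𝒜 × ℝ)) (z : 𝒜 × ℝ) : ℝ :=
  -pexp (A.est D) (fun M => llrM Mstar M z)
    - pexp (A.exploreDist D) (fun a => 2 * err Mstar (A.est D) a)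

/-- The compensated increments of the log-likelihood ratio of the comparators `comp`. -/
def incrComp (Mstar : Model 𝒜) (comp : ℕ → Model 𝒜) (D : List (𝒜 × ℝ)) (z : 𝒜 × ℝ) : ℝ :=
  -llrM Mstar (comp (epoch (D.length + 1))) z
    - pexp (A.exploreDist D) (fun a => 2 * sqd Mstar a (comp (epoch (D.length + 1))))

/-- The compensated increments of the log-partition function, from the time `k` on. -/
def incrAgg (Mstar : Model 𝒜) (k : ℕ) (D : List (𝒜 × ℝ)) (z : 𝒜 × ℝ) : ℝ :=
  if k ≤ D.length then
    Real.log (pexp (A.nextEst D) fun M => Real.exp (1 / 2 * llrM Mstar M z))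
      - pexp (A.exploreDist D) (fun a => -(err Mstar (A.nextEst D) a / 10))
  else 0

/-- The increments of the absolute noise. -/
def incrNoise (Mstar : Model 𝒜) (_ : List (𝒜 × ℝ)) (z : 𝒜 × ℝ) : ℝ :=
  |z.2 - mean Mstar z.1| - 2

/-- The compensated increments of `κ` times the log-likelihood ratio of `M`. -/
def incrAlt (Mstar : Model 𝒜) (κ : ℝ) (M : Model 𝒜) (D : List (𝒜 × ℝ)) (z : 𝒜 × ℝ) : ℝ :=
  κ * llrM Mstar M z
    - pexp (A.exploreDist D) (fun a => -(κ * (1 - κ) * (1 - κ / 2) * (sqd Mstar a M / 2)))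

variable {A}

/-- Jensen's inequality moves the exponential inside the average over models, and the moment for `α
= -1` is `exp (sqd) ≤ 1 + 2 * sqd`. It bounds the likelihood lost by the estimates in terms of their
error. -/
lemma isSupermart_incrEst (h𝓜 : GaussClass 𝓜) (hs : Mstar ∈ 𝓜) :
    IsSupermart Mstar A.exploreDist fun L =>
      ENNReal.ofReal (Real.exp (prefixSum (A.incrEst Mstar) L)) := by
  refine isSupermart_exp_increments (b := fun D z => -pexp (A.est D) fun M => llrM Mstar M z)
    (g := fun D a => 2 * err Mstar (A.est D) a) (C := 2) (fun L a => ?_) (fun L a => ?_)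
    (fun L a => ?_) (fun L a => ?_) <;> obtain ⟨s, h⟩ := A.exists_finSupp_est L
  · exact (h.measurable fun M => measurable_llrM Mstar M a).neg
  · rw [abs_mul, abs_two]; linarith [h.abs_err_le h𝓜 hs a]
  · linarith [err_nonneg (Mstar := Mstar) (A.est L) a]
  · have := h.lintegral_exp_pexp_le h𝓜 hs (-1) a
    simp only [neg_one_mul] at this
    refine this.trans (ENNReal.ofReal_le_ofReal ?_)
    calc _ ≤ pexp (A.est L) (fun M => 1 + 2 * sqd Mstar a M) := by
          refine h.mono fun M hM => ?_
          refine le_trans (le_of_eq ?_)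
            (exp_le_one_add_two_mul (sqd_nonneg a) (h𝓜.sqd_le_one hs hM a))
          congr 1; ring
      _ = 1 + 2 * err Mstar (A.est L) a := by
          rw [h.add (fun _ => 1), pexp_const, pexp_const_mul]; rfl

/-- The same moment `α = -1`, for the single comparator of the current epoch. -/
lemma isSupermart_incrComp (h𝓜 : GaussClass 𝓜) (hs : Mstar ∈ 𝓜) {comp : ℕ → Model 𝒜}
    (hcomp : ∀ ℓ, comp ℓ ∈ 𝓜) :
    IsSupermart Mstar A.exploreDist fun L =>
      ENNReal.ofReal (Real.exp (prefixSum (A.incrComp Mstar comp) L)) := by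
  refine isSupermart_exp_increments
    (b := fun D z => -llrM Mstar (comp (epoch (D.length + 1))) z)
    (g := fun D a => 2 * sqd Mstar a (comp (epoch (D.length + 1)))) (C := 2) (fun L a => ?_)
    (fun L a => ?_) (fun L a => ?_) (fun L a => ?_) <;>
    have h0 := sqd_nonneg (Mstar := Mstar) (M := comp (epoch (L.length + 1))) a <;>
    have h1 := h𝓜.sqd_le_one hs (hcomp (epoch (L.length + 1))) a
  · exact (measurable_llrM Mstar _ a).neg
  · rw [abs_of_nonneg (by linarith)]; linarith
  · linarith
  · have := h𝓜.lintegral_exp_llrM hs (comp (epoch (L.length + 1))) (-1) a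
    simp only [neg_one_mul] at this
    rw [this]
    refine ENNReal.ofReal_le_ofReal (le_trans (le_of_eq ?_) (exp_le_one_add_two_mul h0 h1))
    congr 1; ring

/-- The moment for `α = 1/2` is `exp (-sqd / 8)`, at most `1 - sqd / 10` as `sqd ≤ 1`. This
contraction makes a large estimation error lower the partition function. -/
lemma isSupermart_incrAgg (h𝓜 : GaussClass 𝓜) (hs : Mstar ∈ 𝓜) (k : ℕ) :
    IsSupermart Mstar A.exploreDist fun L =>
      ENNReal.ofReal (Real.exp (prefixSum (A.incrAgg Mstar k) L)) := by
  refine isSupermart_exp_prefixSum (fun L a => ?_) fun L => ?_ <;>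
    obtain ⟨s, h⟩ := A.exists_finSupp_nextEst L <;> simp only [incrAgg] <;> split_ifs
  · exact (Real.measurable_log.comp (h.measurable fun M =>
      ((measurable_llrM Mstar M a).const_mul _).exp)).sub_const _
  · exact measurable_const
  · refine tsum_lintegral_exp_le_one (M := Mstar) (A.exploreDist L)
      (b := fun a r => Real.log (pexp (A.nextEst L) fun M => Real.exp (1 / 2 * llrM Mstar M (a, r))))
      (g := fun a => -(err Mstar (A.nextEst L) a / 10)) (C := 1) (fun a => ?_) (fun a => ?_)
      (fun a => ?_) <;> have h0 := err_nonneg (Mstar := Mstar) (A.nextEst L) a <;>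
      have h1 := h.err_le_one h𝓜 hs a
    · rw [abs_neg, abs_of_nonneg (by linarith)]; linarith
    · linarith
    · simp_rw [Real.exp_log (h.exp_pos _)]
      rw [h.lintegral_pexp h𝓜 hs]
      refine ENNReal.ofReal_le_ofReal ?_
      calc _ ≤ pexp (A.nextEst L) (fun M => 1 + (-(1 / 10)) * sqd Mstar a M) := by
            refine h.mono fun M hM => ?_
            have h2 := sqd_nonneg (Mstar := Mstar) (M := M) a
            have h3 := h𝓜.sqd_le_one hs hM a
            have := exp_neg_le_one_sub (x := sqd Mstar a M / 8) (by linarith) (by linarith)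
            have e : (1 / 2 * (1 / 2 - 1) * sqd Mstar a M / 2 : ℝ) = -(sqd Mstar a M / 8) := by ring
            rw [e]
            nlinarith
        _ = 1 + -(err Mstar (A.nextEst L) a / 10) := by
            rw [h.add (fun _ => 1), pexp_const, pexp_const_mul, err]; ring
  · have hlaw : ∀ a, IsProbabilityMeasure (law Mstar a) := fun a => by
      rw [h𝓜.law_eq hs]; infer_instance
    simp [PMF.tsum_coe]

lemma isSupermart_incrNoise (h𝓜 : GaussClass 𝓜) (hs : Mstar ∈ 𝓜) :
    IsSupermart Mstar A.exploreDist fun L =>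
      ENNReal.ofReal (Real.exp (prefixSum (incrNoise Mstar) L)) := by
  refine isSupermart_exp_prefixSum (fun L a => ?_) fun L => ?_
  · change Measurable fun r : ℝ => |r - mean Mstar a| - 2
    fun_prop
  · calc _ ≤ ∑' c, A.exploreDist L c * 1 := by
          refine ENNReal.tsum_le_tsum fun a => mul_le_mul_right ?_ _
          rw [h𝓜.law_eq hs]
          exact lintegral_exp_abs_sub_le _
      _ = 1 := by simp [PMF.tsum_coe]

/-- The moment for `α = κ` is `exp (-x)` with `x = κ * (1 - κ) * sqd / 2 ≤ κ / 2`, and `exp (-x) ≤ 1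
- x * (1 - x)` produces the factor `1 - κ / 2`. Small `κ` brings the compensator close to `κ` times
the information. -/
lemma isSupermart_incrAlt (h𝓜 : GaussClass 𝓜) (hs : Mstar ∈ 𝓜) {κ : ℝ} (hκ : 0 ≤ κ)
    (hκ1 : κ ≤ 1) (hM : M ∈ 𝓜) :
    IsSupermart Mstar A.exploreDist fun L =>
      ENNReal.ofReal (Real.exp (prefixSum (A.incrAlt Mstar κ M) L)) := by
  have h2 : 0 ≤ κ * (1 - κ) := mul_nonneg hκ (by linarith)
  have h3 : κ * (1 - κ) ≤ κ := by nlinarith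
  have h4 : 0 ≤ κ * (1 - κ) * (1 - κ / 2) := mul_nonneg h2 (by linarith)
  have h5 : κ * (1 - κ) * (1 - κ / 2) ≤ 1 := by nlinarith
  refine isSupermart_exp_increments
    (b := fun _ z => κ * llrM Mstar M z)
    (g := fun _ a => -(κ * (1 - κ) * (1 - κ / 2) * (sqd Mstar a M / 2))) (C := 1) (fun L a => ?_)
    (fun L a => ?_) (fun L a => ?_) (fun L a => ?_) <;>
    have h0 := sqd_nonneg (Mstar := Mstar) (M := M) a <;>
    have h1 := h𝓜.sqd_le_one hs hM a
  · exact (measurable_llrM Mstar _ a).const_mul _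
  · rw [abs_neg, abs_of_nonneg (by positivity)]; nlinarith
  · nlinarith
  · rw [h𝓜.lintegral_exp_llrM hs]
    refine ENNReal.ofReal_le_ofReal ?_
    have h6 : κ * (1 - κ) * sqd Mstar a M / 2 ≤ κ / 2 := by nlinarith
    have h7 : 0 ≤ κ * (1 - κ) * sqd Mstar a M / 2 := by positivity
    have := exp_neg_le_one_sub h7 (by linarith)
    have e : κ * (κ - 1) * sqd Mstar a M / 2 = -(κ * (1 - κ) * sqd Mstar a M / 2) := by ring
    rw [e]
    refine this.trans ?_
    nlinarith [mul_le_mul_of_nonneg_left h6 h7]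

lemma logRatio_eq (h𝓜 : GaussClass 𝓜) (hM : M ∈ 𝓜) (L : List (𝒜 × ℝ)) :
    logRatio A.cover A.base L M
      = prefixSum (fun D z => pexp (A.est D) fun M' => llrM Mstar M' z - llrM Mstar M z) L := by
  refine Finset.sum_congr rfl fun i _ => ?_
  obtain ⟨s, h⟩ := A.exists_finSupp_est (L.take i)
  exact h.congr fun M' hM' => h𝓜.log_div_eq_llrM hM hM' _

lemma llrM_self (z : 𝒜 × ℝ) : llrM Mstar Mstar z = 0 := by simp [llrM, llrG]

/-- Conditionally on the past, Jensen's inequality reduces the increment to averaged likelihood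
ratios, which have mean one (`α = 1`). This bounds the chance that the exploit test holds for the
true model. -/
lemma isSupermart_logRatio (h𝓜 : GaussClass 𝓜) (hs : Mstar ∈ 𝓜) :
    IsSupermart Mstar A.exploreDist fun L =>
      ENNReal.ofReal (Real.exp (logRatio A.cover A.base L Mstar)) := by
  simp only [logRatio_eq (Mstar := Mstar) h𝓜 hs, llrM_self, sub_zero]
  refine isSupermart_exp_prefixSum (fun L a => ?_) fun L => ?_ <;>
    obtain ⟨s, h⟩ := A.exists_finSupp_est L
  · exact h.measurable fun M => measurable_llrM Mstar M a
  · calc _ ≤ ∑' c, A.exploreDist L c * 1 := by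
          refine ENNReal.tsum_le_tsum fun a => mul_le_mul_right ?_ _
          have := h.lintegral_exp_pexp_le h𝓜 hs 1 a
          simp only [one_mul, sub_self, zero_mul, zero_div, Real.exp_zero, pexp_const,
            ENNReal.ofReal_one] at this
          exact this
      _ = 1 := by simp [PMF.tsum_coe]

/-- The mixture over the sets `net n`, `n < N`, of the exponential supermartingales of their
models. -/
def altMix (A : AEStar 𝓜 ε) (Mstar : Model 𝒜) (κ : ℝ) (net : ℕ → Finset (Model 𝒜)) (N : ℕ)
    (L : List (𝒜 × ℝ)) : ℝ :=
  ∑ n ∈ Finset.range N, ∑ M ∈ net n, 1 / (((n : ℝ) + 1) * (n + 2) * (net n).card)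
    * Real.exp (prefixSum (A.incrAlt Mstar κ M) L)

lemma altMix_nonneg (κ : ℝ) (net : ℕ → Finset (Model 𝒜)) (N : ℕ) (L : List (𝒜 × ℝ)) :
    0 ≤ altMix A Mstar κ net N L :=
  Finset.sum_nonneg fun _ _ => Finset.sum_nonneg fun _ _ => by positivity

/-- The weights `1 / ((n + 1) * (n + 2))` telescope to at most 1. -/
lemma altMix_nil_le (κ : ℝ) (net : ℕ → Finset (Model 𝒜)) (N : ℕ) :
    altMix A Mstar κ net N [] ≤ 1 := by
  have h1 : ∀ n : ℕ, ∑ M ∈ net n, 1 / (((n : ℝ) + 1) * (n + 2) * (net n).card)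
      * Real.exp (prefixSum (A.incrAlt Mstar κ M) []) ≤ 1 / ((n : ℝ) + 1) - 1 / (n + 2) := by
    intro n
    simp only [prefixSum_nil, Real.exp_zero, mul_one, Finset.sum_const, nsmul_eq_mul]
    have e : 1 / ((n : ℝ) + 1) - 1 / (n + 2) = 1 / (((n : ℝ) + 1) * (n + 2)) := by
      field_simp; ring
    rw [e]
    rcases Nat.eq_zero_or_pos (net n).card with h | h
    · rw [h]; simp; positivity
    · have : (0 : ℝ) < (net n).card := by exact_mod_cast h
      apply le_of_eq; field_simp
  have h2 : ∀ N : ℕ, ∑ n ∈ Finset.range N, (1 / ((n : ℝ) + 1) - 1 / (n + 2)) = 1 - 1 / (N + 1) := by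
    intro N
    induction N with
    | zero => simp
    | succ N ih => rw [Finset.sum_range_succ, ih]; push_cast; ring
  refine (Finset.sum_le_sum fun n _ => h1 n).trans ?_
  rw [h2]
  have : (0 : ℝ) ≤ 1 / (N + 1) := by positivity
  linarith

lemma isSupermart_altMix (h𝓜 : GaussClass 𝓜) (hs : Mstar ∈ 𝓜) {κ : ℝ} (hκ : 0 ≤ κ)
    (hκ1 : κ ≤ 1) {net : ℕ → Finset (Model 𝒜)} (hnet : ∀ n, ∀ M ∈ net n, M ∈ 𝓜) (N : ℕ) :
    IsSupermart Mstar A.exploreDist fun L => ENNReal.ofReal (altMix A Mstar κ net N L) := by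
  have hlaw : ∀ a, IsProbabilityMeasure (law Mstar a) := fun a => by
    rw [h𝓜.law_eq hs]; infer_instance
  have e : ∀ L, ENNReal.ofReal (altMix A Mstar κ net N L)
      = ∑ n ∈ Finset.range N, ∑ M ∈ net n,
        ENNReal.ofReal (1 / (((n : ℝ) + 1) * (n + 2) * (net n).card))
          * ENNReal.ofReal (Real.exp (prefixSum (A.incrAlt Mstar κ M) L)) := by
    intro L
    rw [altMix, ENNReal.ofReal_sum_of_nonneg fun _ _ =>
      Finset.sum_nonneg fun _ _ => by positivity]
    refine Finset.sum_congr rfl fun n _ => ?_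
    rw [ENNReal.ofReal_sum_of_nonneg fun _ _ => by positivity]
    refine Finset.sum_congr rfl fun M _ => ?_
    rw [ENNReal.ofReal_mul (by positivity)]
  simp only [e]
  exact IsSupermart.sum hlaw fun n _ => IsSupermart.sum hlaw fun M hM =>
    (isSupermart_incrAlt h𝓜 hs hκ hκ1 (hnet n M hM)).const_mul _

/-- A single component is below the mixture, so the price of a bound uniform over the nets and over
their index is the logarithm of the inverse weight. -/
lemma prefixSum_incrAlt_le {κ : ℝ} {net : ℕ → Finset (Model 𝒜)} {N n : ℕ} (hn : n < N)
    (hM : M ∈ net n) {L : List (𝒜 × ℝ)} {m : ℝ} (h : altMix A Mstar κ net N L ≤ m) :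
    prefixSum (A.incrAlt Mstar κ M) L
      ≤ Real.log m + Real.log (((n : ℝ) + 1) * (n + 2)) + Real.log (net n).card := by
  have hc : (0 : ℝ) < (net n).card := by exact_mod_cast Finset.card_pos.2 ⟨M, hM⟩
  have h1 : 1 / (((n : ℝ) + 1) * (n + 2) * (net n).card)
      * Real.exp (prefixSum (A.incrAlt Mstar κ M) L) ≤ m := by
    refine le_trans ?_ h
    refine le_trans (Finset.single_le_sum (f := fun M =>
      1 / (((n : ℝ) + 1) * (n + 2) * (net n).card)
      * Real.exp (prefixSum (A.incrAlt Mstar κ M) L)) (fun _ _ => by positivity) hM) ?_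
    exact Finset.single_le_sum (f := fun n : ℕ => ∑ M ∈ net n,
      1 / (((n : ℝ) + 1) * (n + 2) * (net n).card)
      * Real.exp (prefixSum (A.incrAlt Mstar κ M) L))
      (fun _ _ => Finset.sum_nonneg fun _ _ => by positivity) (Finset.mem_range.2 hn)
  have hm : 0 < m := lt_of_lt_of_le (by positivity) h1
  rw [← Real.log_mul hm.ne' (by positivity), ← Real.log_mul (by positivity) hc.ne',
    Real.le_log_iff_exp_le (by positivity)]
  rw [one_div_mul_eq_div, div_le_iff₀ (by positivity)] at h1
  linarith

/-- The average of the exponential supermartingales. -/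
def potential (A : AEStar 𝓜 ε) (Mstar : Model 𝒜) (comp : ℕ → Model 𝒜) (k : ℕ) (κ : ℝ)
    (net : ℕ → Finset (Model 𝒜)) (N : ℕ) (L : List (𝒜 × ℝ)) : ℝ :=
  1 / 5 * (Real.exp (prefixSum (A.incrEst Mstar) L)
    + (Real.exp (prefixSum (A.incrComp Mstar comp) L)
    + (Real.exp (prefixSum (A.incrAgg Mstar k) L)
    + (Real.exp (prefixSum (incrNoise Mstar) L)
    + altMix A Mstar κ net N L))))

variable {comp : ℕ → Model 𝒜} {k : ℕ} {κ : ℝ} {net : ℕ → Finset (Model 𝒜)} {N : ℕ}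

lemma potential_nonneg (L : List (𝒜 × ℝ)) : 0 ≤ potential A Mstar comp k κ net N L := by
  have := altMix_nonneg (A := A) (Mstar := Mstar) κ net N L
  unfold potential; positivity

lemma potential_nil_le : potential A Mstar comp k κ net N [] ≤ 1 := by
  have := altMix_nil_le (A := A) (Mstar := Mstar) κ net N
  simp only [potential, prefixSum_nil, Real.exp_zero]
  linarith

lemma isSupermart_potential (h𝓜 : GaussClass 𝓜) (hs : Mstar ∈ 𝓜) (hcomp : ∀ ℓ, comp ℓ ∈ 𝓜)
    (hκ : 0 ≤ κ) (hκ1 : κ ≤ 1) (hnet : ∀ n, ∀ M ∈ net n, M ∈ 𝓜) :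
    IsSupermart Mstar A.exploreDist fun L =>
      ENNReal.ofReal (potential A Mstar comp k κ net N L) := by
  have key := ((isSupermart_incrEst (A := A) h𝓜 hs).add ((isSupermart_incrComp h𝓜 hs hcomp).add
    ((isSupermart_incrAgg h𝓜 hs k).add ((isSupermart_incrNoise h𝓜 hs).add
      (isSupermart_altMix h𝓜 hs hκ hκ1 hnet N))))).const_mul (ENNReal.ofReal (1 / 5))
  convert key using 2 with L
  have := altMix_nonneg (A := A) (Mstar := Mstar) κ net N L
  rw [potential, ENNReal.ofReal_mul (by norm_num), ENNReal.ofReal_add, ENNReal.ofReal_add,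
    ENNReal.ofReal_add, ENNReal.ofReal_add] <;> positivity

/-- A bound on the average controls its five nonnegative components at once, with a factor 5 in
place of a union bound. -/
lemma le_of_potential_le {L : List (𝒜 × ℝ)} {m : ℝ}
    (h : potential A Mstar comp k κ net N L ≤ m) :
    prefixSum (A.incrEst Mstar) L ≤ Real.log (5 * m) ∧
    prefixSum (A.incrComp Mstar comp) L ≤ Real.log (5 * m) ∧
    prefixSum (A.incrAgg Mstar k) L ≤ Real.log (5 * m) ∧
    prefixSum (incrNoise Mstar) L ≤ Real.log (5 * m) ∧
    altMix A Mstar κ net N L ≤ 5 * m := by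
  have h0 := altMix_nonneg (A := A) (Mstar := Mstar) κ net N L
  unfold potential at h
  have h1 := Real.exp_pos (prefixSum (A.incrEst Mstar) L)
  have h2 := Real.exp_pos (prefixSum (A.incrComp Mstar comp) L)
  have h3 := Real.exp_pos (prefixSum (A.incrAgg Mstar k) L)
  have h4 := Real.exp_pos (prefixSum (incrNoise Mstar) L)
  have hm : 0 < 5 * m := by linarith
  refine ⟨?_, ?_, ?_, ?_, by linarith⟩ <;> rw [Real.le_log_iff_exp_le hm] <;> linarith

end AEStar

end

/-! ### Cumulative error of tempered aggregation. -/

section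

variable {𝒜 : Type u} {𝓜 : Set (Model 𝒜)} {M M' M₀ Mstar : Model 𝒜}

lemma prefixSum_mono {a b : List (𝒜 × ℝ) → 𝒜 × ℝ → ℝ} (h : ∀ D z, a D z ≤ b D z)
    (L : List (𝒜 × ℝ)) : prefixSum a L ≤ prefixSum b L :=
  Finset.sum_le_sum fun _ _ => h _ _

lemma prefixSum_add (a b : List (𝒜 × ℝ) → 𝒜 × ℝ → ℝ) (L : List (𝒜 × ℝ)) :
    prefixSum (fun D z => a D z + b D z) L = prefixSum a L + prefixSum b L :=
  Finset.sum_add_distrib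

lemma prefixSum_const_mul (c : ℝ) (a : List (𝒜 × ℝ) → 𝒜 × ℝ → ℝ) (L : List (𝒜 × ℝ)) :
    prefixSum (fun D z => c * a D z) L = c * prefixSum a L := (Finset.mul_sum _ _ _).symm

lemma prefixSum_telescope (φ : ℕ → ℝ) (L : List (𝒜 × ℝ)) :
    prefixSum (fun D _ => φ (D.length + 1) - φ D.length) L = φ L.length - φ 0 := by
  induction L using List.reverseRecOn with
  | nil => simp [prefixSum_nil]
  | append_singleton L z ih => rw [prefixSum_append, ih]; simp

lemma prefixSum_eq_sum_range (φ : List (𝒜 × ℝ) → ℝ) (L : List (𝒜 × ℝ)) :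
    prefixSum (fun D _ => φ D) L = ∑ i ∈ Finset.range L.length, φ (L.take i) := by
  rw [prefixSum, Finset.sum_range]

/-! ### Epochs -/

lemma epoch_mono {s t : ℕ} (h : s ≤ t) : epoch s ≤ epoch t :=
  Nat.add_le_add_right (Nat.log_mono_right h) 1

lemma lt_two_pow_epoch (s : ℕ) : s < 2 ^ epoch s :=
  Nat.lt_pow_succ_log_self (by norm_num) s

lemma lt_epoch_iff {ℓ s : ℕ} (hs : s ≠ 0) : ℓ < epoch s ↔ 2 ^ ℓ ≤ s := by
  rw [epoch, Nat.lt_succ_iff, Nat.le_log_iff_pow_le (by norm_num) hs]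

lemma epochStart_epoch_succ {s : ℕ} (h : epoch s ≠ epoch (s + 1)) :
    epochStart (epoch (s + 1)) = s + 1 := by
  have hlt : epoch s < epoch (s + 1) := lt_of_le_of_ne (epoch_mono s.le_succ) h
  have h1 : epochStart (epoch (s + 1)) ≤ s + 1 := epochStart_epoch_le (Nat.succ_ne_zero s)
  have h2 : 2 ^ epoch s ≤ epochStart (epoch (s + 1)) :=
    Nat.pow_le_pow_right (by norm_num) (Nat.le_sub_one_of_lt hlt)
  have h3 := lt_two_pow_epoch s
  omega

namespace AEStar

variable {ε : ℝ} (A : AEStar 𝓜 ε)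

/-- The estimation error of the estimate from the data `D`, for the next explore round. -/
def estErr (Mstar : Model 𝒜) (D : List (𝒜 × ℝ)) : ℝ :=
  pexp (A.exploreDist D) (err Mstar (A.est D))

/-- The estimation error of tempered aggregation on the epoch of the next explore round. -/
def nextErr (Mstar : Model 𝒜) (D : List (𝒜 × ℝ)) : ℝ :=
  pexp (A.exploreDist D) (err Mstar (A.nextEst D))

variable {A}

lemma estErr_nonneg (D : List (𝒜 × ℝ)) : 0 ≤ A.estErr Mstar D :=
  pexp_nonneg _ fun a => err_nonneg _ a

lemma nextErr_nonneg (D : List (𝒜 × ℝ)) : 0 ≤ A.nextErr Mstar D :=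
  pexp_nonneg _ fun a => err_nonneg _ a

lemma estErr_le_one (h𝓜 : GaussClass 𝓜) (hs : Mstar ∈ 𝓜) (D : List (𝒜 × ℝ)) :
    A.estErr Mstar D ≤ 1 := by
  obtain ⟨s, h⟩ := A.exists_finSupp_est D
  exact pexp_le_one _ (fun a => err_nonneg _ a) fun a => h.err_le_one h𝓜 hs a

/-- The increments of the log-partition functions of the epochs from the round `k + 1` on. -/
def logIncr (A : AEStar 𝓜 ε) (Mstar : Model 𝒜) (k : ℕ) (D : List (𝒜 × ℝ)) (z : 𝒜 × ℝ) : ℝ :=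
  if k ≤ D.length then
    Real.log (pexp (A.nextEst D) fun M => Real.exp (1 / 2 * llrM Mstar M z)) else 0

/-- The log-likelihood ratios of the comparators. -/
def compLlr (Mstar : Model 𝒜) (comp : ℕ → Model 𝒜) (D : List (𝒜 × ℝ)) (z : 𝒜 × ℝ) : ℝ :=
  llrM Mstar (comp (epoch (D.length + 1))) z

/-- Within an epoch the increments telescope to the log-partition function minus its initial value,
the logarithm of the size of the cover. One term of the partition function is the comparator's, so
half its log-likelihood ratio is a lower bound. Each epoch costs the log-size of its cover. -/
lemma logIncr_lower (h𝓜 : GaussClass 𝓜) (hs : Mstar ∈ 𝓜) {comp : ℕ → Model 𝒜} {ℓ₀ : ℕ}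
    (hlow : ∀ ℓ ≤ ℓ₀, comp ℓ = Mstar) (hcov : ∀ ℓ, ℓ₀ < ℓ → comp ℓ ∈ A.cover ℓ)
    (L : List (𝒜 × ℝ)) :
    -∑ j ∈ Finset.Ico 1 (epoch (L.length + 1) + 1), Real.log (A.cover j).card ≤
      prefixSum (A.logIncr Mstar (2 ^ ℓ₀ - 1)) L - 1 / 2 * prefixSum (compLlr Mstar comp) L := by
  set k := 2 ^ ℓ₀ - 1 with hk
  have hk1 : k + 1 = 2 ^ ℓ₀ := Nat.sub_add_cancel Nat.one_le_two_pow
  -- With `n` past data the next round is `n + 1`, and the epochs after `ℓ₀` begin with round `2 ^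
  -- ℓ₀ = k + 1`.
  have hep : ∀ n : ℕ, k ≤ n ↔ ℓ₀ < epoch (n + 1) := fun n => by
    rw [lt_epoch_iff (Nat.succ_ne_zero n)]; omega
  have hlog : ∀ j, 0 ≤ Real.log (A.cover j).card := fun j => Real.log_natCast_nonneg _
  have hzero : ∀ L : List (𝒜 × ℝ), L.length ≤ k →
      prefixSum (A.logIncr Mstar k) L = 0 ∧ prefixSum (compLlr Mstar comp) L = 0 := by
    intro L
    induction L using List.reverseRecOn with
    | nil => intro _; exact ⟨prefixSum_nil _, prefixSum_nil _⟩
    | append_singleton L z ih =>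
      intro hL
      rw [List.length_append, List.length_singleton] at hL
      obtain ⟨h1, h2⟩ := ih (by omega)
      have h3 : ¬ k ≤ L.length := by omega
      rw [prefixSum_append, prefixSum_append, h1, h2, logIncr, if_neg h3, compLlr,
        hlow _ (not_lt.1 fun h => h3 ((hep _).2 h)), llrM_self]
      simp
  -- the stronger statement that is proved by induction
  have main : ∀ L : List (𝒜 × ℝ), k ≤ L.length →
      Real.log (partition Mstar (A.cover (epoch (L.length + 1)))
          (L.drop (epochStart (epoch (L.length + 1)) - 1)))
        - Real.log (A.cover (epoch (L.length + 1))).card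
        - 1 / 2 * sumLlr Mstar (comp (epoch (L.length + 1)))
            (L.drop (epochStart (epoch (L.length + 1)) - 1))
        - ∑ j ∈ Finset.Ico 1 (epoch (L.length + 1)), Real.log (A.cover j).card ≤
      prefixSum (A.logIncr Mstar k) L - 1 / 2 * prefixSum (compLlr Mstar comp) L := by
    -- At the start of an epoch its data are empty, and the partition function equals the size of
    -- the cover, so these terms cancel.
    have base : ∀ L : List (𝒜 × ℝ), epochStart (epoch (L.length + 1)) = L.length + 1 → ∀ B : ℝ,
        -∑ j ∈ Finset.Ico 1 (epoch (L.length + 1)), Real.log (A.cover j).card ≤ B →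
        Real.log (partition Mstar (A.cover (epoch (L.length + 1)))
          (L.drop (epochStart (epoch (L.length + 1)) - 1)))
        - Real.log (A.cover (epoch (L.length + 1))).card
        - 1 / 2 * sumLlr Mstar (comp (epoch (L.length + 1)))
            (L.drop (epochStart (epoch (L.length + 1)) - 1))
        - ∑ j ∈ Finset.Ico 1 (epoch (L.length + 1)), Real.log (A.cover j).card ≤ B := by
      intro L hL B hB
      rw [hL, Nat.add_sub_cancel, List.drop_length, partition_nil]
      simpa [sumLlr] using hB
    intro L
    induction L using List.reverseRecOn with
    | nil =>
      intro hL
      refine base [] (by simp [epoch, epochStart]) _ ?_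
      rw [prefixSum_nil, prefixSum_nil]
      simpa using Finset.sum_nonneg fun j _ => hlog j
    | append_singleton L z ih =>
      intro hL
      have hlen : (L ++ [z]).length = L.length + 1 := by simp
      rcases lt_or_ge L.length k with hlt | hge
      · have hLk : (L ++ [z]).length = k := by omega
        refine base _ ?_ _ ?_
        · rw [hLk, hk1, epochStart, epoch, Nat.log_pow (by norm_num), Nat.add_sub_cancel]
        · obtain ⟨h1, h2⟩ := hzero (L ++ [z]) hLk.le
          rw [h1, h2]
          simpa using Finset.sum_nonneg fun j _ => hlog j
      · have hi := ih hge
        set ℓ := epoch (L.length + 1) with hℓ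
        have hcomp : comp ℓ ∈ A.cover ℓ := hcov _ ((hep _).1 hge)
        have hne : (A.cover ℓ).Nonempty := ⟨_, hcomp⟩
        set D' := L.drop (epochStart ℓ - 1) with hD'
        have hdrop : (L ++ [z]).drop (epochStart ℓ - 1) = D' ++ [z] := by
          rw [List.drop_append_of_le_length]
          have : epochStart ℓ ≤ L.length + 1 := epochStart_epoch_le (Nat.succ_ne_zero _)
          omega
        have hinc : A.logIncr Mstar k L z = Real.log (partition Mstar (A.cover ℓ) (D' ++ [z]))
            - Real.log (partition Mstar (A.cover ℓ) D') := by
          rw [logIncr, if_pos hge, nextEst, ← hℓ, h𝓜.pexp_tempered_exp hs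
            (fun M hM => A.mem_of_mem_cover (one_le_epoch _) hM) hne,
            Real.log_div (partition_pos hne _).ne' (partition_pos hne _).ne']
        have hstep : Real.log (partition Mstar (A.cover ℓ) (D' ++ [z]))
              - Real.log (A.cover ℓ).card - 1 / 2 * sumLlr Mstar (comp ℓ) (D' ++ [z])
              - ∑ j ∈ Finset.Ico 1 ℓ, Real.log (A.cover j).card ≤
            prefixSum (A.logIncr Mstar k) (L ++ [z])
              - 1 / 2 * prefixSum (compLlr Mstar comp) (L ++ [z]) := by
          rw [prefixSum_append, prefixSum_append, hinc, compLlr, ← hℓ, sumLlr_append]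
          linarith
        by_cases heq : epoch (L.length + 1 + 1) = ℓ
        · rw [hlen, heq, hdrop]
          exact hstep
        · have hst := epochStart_epoch_succ (s := L.length + 1) (Ne.symm heq)
          have hlt : ℓ < epoch (L.length + 1 + 1) :=
            lt_of_le_of_ne (epoch_mono (Nat.le_succ _)) (Ne.symm heq)
          refine base _ (by rw [hlen]; exact hst) _ (le_trans ?_ hstep)
          -- Closing an epoch: its partition function dominates the comparator and only the log-size
          -- of the cover is carried over.
          have h1 := sumLlr_le_log_partition (Mstar := Mstar) hcomp (D' ++ [z])
          have h2 : ∑ j ∈ Finset.Ico 1 (ℓ + 1), Real.log (A.cover j).card ≤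
              ∑ j ∈ Finset.Ico 1 (epoch ((L ++ [z]).length + 1)), Real.log (A.cover j).card := by
            refine Finset.sum_le_sum_of_subset_of_nonneg ?_ fun j _ _ => hlog j
            rw [hlen]
            exact Finset.Ico_subset_Ico le_rfl hlt
          rw [Finset.sum_Ico_succ_top (one_le_epoch _)] at h2
          linarith
  rcases lt_or_ge L.length k with hlt | hge
  · obtain ⟨h1, h2⟩ := hzero L hlt.le
    rw [h1, h2]
    simpa using Finset.sum_nonneg fun j _ => hlog j
  · refine le_trans ?_ (main L hge)
    have hcomp := hcov _ ((hep _).1 hge)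
    have h1 := sumLlr_le_log_partition (Mstar := Mstar) hcomp
      (L.drop (epochStart (epoch (L.length + 1)) - 1))
    rw [Finset.sum_Ico_succ_top (one_le_epoch _)]
    linarith

/-- The supermartingale bounds a tenth of the total error by `m` minus the logarithmic increments.
These are at least half the comparators' log-likelihood ratios minus the cover sizes, and the ratios
are at least `-(m + 16)`. Multiplying by 10 gives `15 * m + 80`. -/
lemma prefixSum_nextErr_le (h𝓜 : GaussClass 𝓜) (hs : Mstar ∈ 𝓜) {comp : ℕ → Model 𝒜} {ℓ₀ : ℕ}
    (hmem : ∀ ℓ, comp ℓ ∈ 𝓜)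
    (hlow : ∀ ℓ ≤ ℓ₀, comp ℓ = Mstar) (hcov : ∀ ℓ, ℓ₀ < ℓ → comp ℓ ∈ A.cover ℓ)
    (hclose : ∀ ℓ a, |mean (comp ℓ) a - mean Mstar a| ≤ 2 * (2 : ℝ) ^ (-(ℓ : ℤ)))
    {L : List (𝒜 × ℝ)} {m : ℝ} (hA : prefixSum (A.incrAgg Mstar (2 ^ ℓ₀ - 1)) L ≤ m)
    (hC : prefixSum (A.incrComp Mstar comp) L ≤ m) :
    prefixSum (fun D _ => if 2 ^ ℓ₀ - 1 ≤ D.length then A.nextErr Mstar D else 0) L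
      ≤ 15 * m + 80 + 10 * ∑ j ∈ Finset.Ico 1 (epoch (L.length + 1) + 1),
        Real.log (A.cover j).card := by
  have h1 := logIncr_lower (A := A) h𝓜 hs hlow hcov L
  set k := 2 ^ ℓ₀ - 1
  have h2 : prefixSum (A.incrAgg Mstar k) L = prefixSum (A.logIncr Mstar k) L + 1 / 10 *
      prefixSum (fun D _ => if k ≤ D.length then A.nextErr Mstar D else 0) L := by
    rw [← prefixSum_const_mul, ← prefixSum_add]
    congr 1
    funext D z
    simp only [incrAgg, logIncr]
    split_ifs
    · have : pexp (A.exploreDist D) (fun a => -(err Mstar (A.nextEst D) a / 10))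
          = -(1 / 10) * A.nextErr Mstar D := by
        rw [nextErr, ← pexp_const_mul]; congr 1; funext a; ring
      rw [this]; ring
    · simp
  have h3 : -prefixSum (compLlr Mstar comp) L ≤ prefixSum (A.incrComp Mstar comp) L + 16 := by
    -- The comparator of round `s` is within `2 / s` of the true means, so its compensator is at
    -- most `8 / s ^ 2 ≤ 16 / s - 16 / (s + 1)`, which telescopes to at most 16.
    have h4 : -prefixSum (compLlr Mstar comp) L ≤ prefixSum (A.incrComp Mstar comp) L
        + prefixSum (fun D _ => (-16 / ((D.length + 1 : ℕ) + 1 : ℝ)) - (-16 / (D.length + 1 : ℝ)))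
          L := by
      rw [← neg_one_mul, ← prefixSum_const_mul, ← prefixSum_add]
      refine prefixSum_mono (fun D z => ?_) L
      have h5 : pexp (A.exploreDist D) (fun a => 2 * sqd Mstar a (comp (epoch (D.length + 1))))
          ≤ 8 / (D.length + 1 : ℝ) ^ 2 := by
        rw [← pexp_const (A.exploreDist D) (8 / (D.length + 1 : ℝ) ^ 2)]
        refine pexp_mono (C := 2) (C' := 8 / (D.length + 1 : ℝ) ^ 2) _ (fun a => ?_) (fun a => ?_)
          (fun a => ?_)
        · have h6 := sqd_nonneg (Mstar := Mstar) (M := comp (epoch (D.length + 1))) a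
          have h7 := h𝓜.sqd_le_one hs (hmem (epoch (D.length + 1))) a
          rw [abs_of_nonneg (by linarith)]; linarith
        · rw [abs_of_nonneg (by positivity)]
        · have h6 := hclose (epoch (D.length + 1)) a
          have h7 : (D.length + 1 : ℝ) ≤ (2 : ℝ) ^ (epoch (D.length + 1)) := by
            exact_mod_cast (lt_two_pow_epoch (D.length + 1)).le
          have h8 : 2 * (2 : ℝ) ^ (-(epoch (D.length + 1) : ℤ)) ≤ 2 / (D.length + 1 : ℝ) := by
            rw [zpow_neg, zpow_natCast, div_eq_mul_inv]
            gcongr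
          have h9 := pow_le_pow_left₀ (abs_nonneg _) (h6.trans h8) 2
          rw [sq_abs, div_pow] at h9
          unfold sqd
          calc _ ≤ 2 * ((2 : ℝ) ^ 2 / (D.length + 1 : ℝ) ^ 2) :=
                mul_le_mul_of_nonneg_left h9 (by norm_num)
            _ = _ := by ring
      have h6 : 8 / (D.length + 1 : ℝ) ^ 2 ≤
          (-16 / ((D.length + 1 : ℕ) + 1 : ℝ)) - (-16 / (D.length + 1 : ℝ)) := by
        push_cast
        have : (-16 / ((D.length : ℝ) + 1 + 1)) - (-16 / (D.length + 1 : ℝ))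
            = 16 / ((D.length + 1 : ℝ) * (D.length + 1 + 1)) := by field_simp; ring
        rw [this, div_le_div_iff₀ (by positivity) (by positivity)]
        have : (0 : ℝ) ≤ D.length := by positivity
        nlinarith
      simp only [incrComp, compLlr]
      linarith
    rw [prefixSum_telescope (fun n : ℕ => (-16 / ((n : ℝ) + 1)))] at h4
    have h5 : 0 ≤ 16 / ((L.length : ℝ) + 1) := by positivity
    have h6 : -16 / ((L.length : ℝ) + 1) = -(16 / ((L.length : ℝ) + 1)) := by ring
    rw [h6] at h4
    simp only [Nat.cast_zero] at h4
    linarith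
  linarith

/-- The errors of `est` and `nextEst` agree except in the burn-in and in the first round of an
epoch; there the error is bounded by 1. -/
lemma prefixSum_estErr_le (h𝓜 : GaussClass 𝓜) (hs : Mstar ∈ 𝓜) {comp : ℕ → Model 𝒜} {ℓ₀ : ℕ}
    (hℓ₀ : 1 ≤ ℓ₀) (hmem : ∀ ℓ, comp ℓ ∈ 𝓜)
    (hlow : ∀ ℓ ≤ ℓ₀, comp ℓ = Mstar) (hcov : ∀ ℓ, ℓ₀ < ℓ → comp ℓ ∈ A.cover ℓ)
    (hclose : ∀ ℓ a, |mean (comp ℓ) a - mean Mstar a| ≤ 2 * (2 : ℝ) ^ (-(ℓ : ℤ)))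
    {L : List (𝒜 × ℝ)} {m : ℝ} (hA : prefixSum (A.incrAgg Mstar (2 ^ ℓ₀ - 1)) L ≤ m)
    (hC : prefixSum (A.incrComp Mstar comp) L ≤ m) :
    prefixSum (fun D _ => A.estErr Mstar D) L
      ≤ 2 ^ ℓ₀ + epoch L.length + 15 * m + 80
        + 10 * ∑ j ∈ Finset.Ico 1 (epoch (L.length + 1) + 1), Real.log (A.cover j).card := by
  have h1 := prefixSum_nextErr_le h𝓜 hs hmem hlow hcov hclose hA hC
  set k := 2 ^ ℓ₀ - 1 with hk
  have hk2 : 2 ≤ 2 ^ ℓ₀ := by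
    calc 2 = 2 ^ 1 := rfl
      _ ≤ 2 ^ ℓ₀ := Nat.pow_le_pow_right (by norm_num) hℓ₀
  have h2 : prefixSum (fun D _ => A.estErr Mstar D) L ≤
      prefixSum (fun D _ => ((min (D.length + 1) k : ℕ) : ℝ) - ((min D.length k : ℕ) : ℝ)) L
      + prefixSum (fun D _ => (epoch (D.length + 1) : ℝ) - epoch D.length) L
      + prefixSum (fun D _ => if k ≤ D.length then A.nextErr Mstar D else 0) L := by
    rw [← prefixSum_add, ← prefixSum_add]
    refine prefixSum_mono (fun D z => ?_) L
    have h3 := estErr_le_one (A := A) h𝓜 hs D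
    have h4 := nextErr_nonneg (A := A) (Mstar := Mstar) D
    have h5 : (epoch D.length : ℝ) ≤ epoch (D.length + 1) := by
      exact_mod_cast epoch_mono (Nat.le_succ _)
    rcases lt_or_ge D.length k with hlt | hge
    · rw [if_neg (not_le.2 hlt), min_eq_left (Nat.succ_le_of_lt hlt), min_eq_left hlt.le]
      push_cast
      linarith
    · rw [if_pos hge, min_eq_right (hge.trans (Nat.le_succ _)), min_eq_right hge]
      by_cases heq : epoch (D.length + 1) = epoch D.length
      · have : A.estErr Mstar D = A.nextErr Mstar D := by
          rw [estErr, nextErr, A.est_eq_nextEst (L := D) (by omega) heq]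
        rw [this, heq]; linarith
      · have : (epoch D.length : ℝ) + 1 ≤ epoch (D.length + 1) := by
          exact_mod_cast lt_of_le_of_ne (epoch_mono (Nat.le_succ _)) (Ne.symm heq)
        linarith
  rw [prefixSum_telescope (fun n : ℕ => ((min n k : ℕ) : ℝ)),
    prefixSum_telescope (fun n : ℕ => (epoch n : ℝ))] at h2
  have h3 : ((min L.length k : ℕ) : ℝ) ≤ (2 : ℝ) ^ ℓ₀ := by
    have : min L.length k ≤ 2 ^ ℓ₀ := (min_le_right _ _).trans (Nat.sub_le _ _)
    exact_mod_cast this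
  have h4 : (0 : ℝ) ≤ epoch 0 := by positivity
  simp only [Nat.zero_min, Nat.cast_zero] at h2
  linarith

end AEStar

end

/-! ### Good explore rounds and the estimation error in bad ones. -/

section

variable {𝒜 : Type u} {𝓜 : Set (Model 𝒜)} {M M' M₀ Mstar : Model 𝒜}

lemma FinSupp.pexp_comm {ξ : PMF (Model 𝒜)} {s : Finset (Model 𝒜)} (h : FinSupp 𝓜 ξ s)
    (ω : PMF 𝒜) {g : 𝒜 → Model 𝒜 → ℝ} {C : ℝ} (hg : ∀ M ∈ 𝓜, ∀ a, |g a M| ≤ C) :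
    pexp ω (fun a => pexp ξ (g a)) = pexp ξ fun M => pexp ω fun a => g a M := by
  rw [h.pexp_eq]
  simp only [h.pexp_eq]
  simp only [pexp]
  simp_rw [Finset.mul_sum, mul_left_comm (ω _).toReal]
  rw [Summable.tsum_finsetSum fun M hM =>
    (summable_pexp ω (hg M (h.mem M hM))).mul_left (ξ M).toReal]
  exact Finset.sum_congr rfl fun M _ => tsum_mul_left

lemma FinSupp.tsum_info_eq {ξ : PMF (Model 𝒜)} {s : Finset (Model 𝒜)} (h : FinSupp 𝓜 ξ s)
    (h𝓜 : GaussClass 𝓜) (hs : Mstar ∈ 𝓜) (ω : PMF 𝒜) :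
    ∑' M, ξ M * info ω M Mstar = ENNReal.ofReal (pexp ω (err Mstar ξ) / 2) := by
  have h1 : ∀ M ∈ 𝓜, ∀ a, |sqd Mstar a M| ≤ 1 := fun M hM a => by
    rw [abs_of_nonneg (sqd_nonneg a)]; exact h𝓜.sqd_le_one hs hM a
  have h2 : ∀ M ∈ s, ξ M * info ω M Mstar
      = ENNReal.ofReal ((ξ M).toReal * (pexp ω (fun a => sqd Mstar a M) / 2)) := fun M hM => by
    have hM' := h.mem M hM
    have e : info ω M Mstar = info ω Mstar M := by
      simp only [info, h𝓜.kl_eq_sqd hs hM', h𝓜.kl_eq_sqd' hs hM']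
    rw [ENNReal.ofReal_mul ENNReal.toReal_nonneg, ENNReal.ofReal_toReal (ξ.apply_ne_top M), e,
      h𝓜.info_eq_pexp hs hM', ← mul_one_div (pexp _ _), mul_comm (pexp _ _), ← pexp_const_mul]
    simp_rw [one_div_mul_eq_div]
  rw [tsum_eq_sum (s := s) fun M hM => by rw [h.eq_zero M hM, zero_mul], Finset.sum_congr rfl h2,
    ← ENNReal.ofReal_sum_of_nonneg fun M _ => mul_nonneg ENNReal.toReal_nonneg
      (div_nonneg (pexp_nonneg _ fun a => sqd_nonneg a) zero_le_two)]
  have e : err Mstar ξ = fun a => pexp ξ (sqd Mstar a) := rfl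
  rw [e, h.pexp_comm ω h1, h.pexp_eq, Finset.sum_div]
  simp_rw [mul_div_assoc]

lemma pexp_mix {q : ℝ≥0} (hq : q ≤ 1) (w ω : PMF 𝒜) {g : 𝒜 → ℝ} {C : ℝ} (hg : ∀ a, |g a| ≤ C) :
    pexp (mix q hq w ω) g = q * pexp w g + (1 - q) * pexp ω g := by
  have h1 : ∀ a, (mix q hq w ω a).toReal * g a
      = q * ((w a).toReal * g a) + (1 - q) * ((ω a).toReal * g a) := fun a => by
    change ((q : ℝ≥0∞) * w a + ((1 - q : ℝ≥0) : ℝ≥0∞) * ω a).toReal * g a = _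
    rw [ENNReal.toReal_add (ENNReal.mul_ne_top ENNReal.coe_ne_top (w.apply_ne_top a))
      (ENNReal.mul_ne_top ENNReal.coe_ne_top (ω.apply_ne_top a)), ENNReal.toReal_mul,
      ENNReal.toReal_mul, ENNReal.coe_toReal, ENNReal.coe_toReal, NNReal.coe_sub hq,
      NNReal.coe_one]
    ring
  rw [pexp, tsum_congr h1, ((summable_pexp w hg).mul_left _).tsum_add
    ((summable_pexp ω hg).mul_left _), tsum_mul_left, tsum_mul_left, pexp, pexp]

lemma GaussClass.cost_eq_pexp (h𝓜 : GaussClass 𝓜) (hs : Mstar ∈ 𝓜) (w : PMF 𝒜) :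
    cost Mstar w = ENNReal.ofReal (pexp w fun a => (gap Mstar a).toReal) := by
  have h1 := h𝓜.gap_le_one hs
  rw [cost, ← tsum_mul_ofReal_eq w (C := 1) (fun a => ENNReal.toReal_nonneg) fun a =>
    ENNReal.toReal_le_of_le_ofReal zero_le_one (by simpa using h1 a)]
  refine tsum_congr fun a => ?_
  rw [ENNReal.ofReal_toReal ((h1 a).trans_lt ENNReal.one_lt_top).ne]

lemma GaussClass.exists_of_mem_glSetLE (h𝓜 : GaussClass 𝓜) (hs : Mstar ∈ 𝓜)
    (hg : glc 𝓜 Mstar ≠ ∞) {e : ℝ} (he : 0 ≤ e) {w : PMF 𝒜} {N : ℝ}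
    (h : Mstar ∈ glSetLE 𝓜 e w (ENNReal.ofReal N)) :
    ∃ n : ℝ, 0 < n ∧ n ≤ N ∧
      pexp w (fun a => (gap Mstar a).toReal) ≤ (1 + e) * (glc 𝓜 Mstar).toReal / n ∧
      ∀ M ∈ alt 𝓜 Mstar, (1 - e) / n ≤ pexp w fun a => sqd Mstar a M / 2 := by
  obtain ⟨-, n, hn0, hnN, hc, hi⟩ := h
  have hn0' : (0 : ℝ) < n := hn0
  refine ⟨n, hn0, ?_, ?_, fun M hM => ?_⟩
  · rw [← ENNReal.ofReal_coe_nnreal] at hnN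
    rcases ENNReal.ofReal_le_ofReal_iff'.1 hnN with h | h
    · exact h
    · exact absurd h (not_le.2 hn0)
  · rw [h𝓜.cost_eq_pexp hs, ← ENNReal.ofReal_toReal hg, ← ENNReal.ofReal_mul (by linarith),
      ← ENNReal.ofReal_coe_nnreal, ← ENNReal.ofReal_div_of_pos hn0'] at hc
    exact (ENNReal.ofReal_le_ofReal_iff (by positivity)).1 hc
  · have := hi M hM
    rw [h𝓜.info_eq_pexp hs hM.1, ← ENNReal.ofReal_coe_nnreal, ← ENNReal.ofReal_div_of_pos hn0']
      at this
    refine (ENNReal.ofReal_le_ofReal_iff (pexp_nonneg _ fun a => ?_)).1 this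
    have := sqd_nonneg (Mstar := Mstar) (M := M) a
    positivity

/-- From round 2 on, weight at least 3/20 remains on the first allocation. In round 1 it has weight
zero, whence the recurring condition `1 ≤ length`. -/
lemma rpow_neg_quarter_le {s : ℝ} (hs : 2 ≤ s) : s ^ (-(1 / 4) : ℝ) ≤ 17 / 20 := by
  have h0 : 0 ≤ s ^ (-(1 / 4) : ℝ) := Real.rpow_nonneg (by linarith) _
  have h1 : (s ^ (-(1 / 4) : ℝ)) ^ 4 = s⁻¹ := by
    rw [← Real.rpow_natCast, ← Real.rpow_mul (by linarith), ← Real.rpow_neg_one]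
    norm_num
  have h2 : s⁻¹ ≤ 2⁻¹ := inv_anti₀ (by norm_num) hs
  by_contra hcon
  push Not at hcon
  have h3 := pow_lt_pow_left₀ hcon (by norm_num) (n := 4) (by norm_num)
  rw [h1] at h3
  norm_num at h3 h2
  linarith

namespace AEStar

variable {ε : ℝ} {A : AEStar 𝓜 ε}

/-- The weight of the second allocation in the explore round with previous data `D`. -/
def expWeight (D : List (𝒜 × ℝ)) : ℝ := ((D.length + 1 : ℕ) : ℝ) ^ (-(1 / 4) : ℝ)

lemma expWeight_pos (D : List (𝒜 × ℝ)) : 0 < expWeight D := Real.rpow_pos_of_pos (by positivity) _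

lemma expWeight_le_one (D : List (𝒜 × ℝ)) : expWeight D ≤ 1 :=
  Real.rpow_le_one_of_one_le_of_nonpos (by exact_mod_cast Nat.le_add_left 1 _) (by norm_num)

lemma pexp_exploreDist (D : List (𝒜 × ℝ)) {g : 𝒜 → ℝ} {C : ℝ} (hg : ∀ a, |g a| ≤ C) :
    pexp (A.exploreDist D) g
      = (1 - expWeight D) * pexp (A.alloc D).1 g + expWeight D * pexp (A.alloc D).2 g := by
  have h1 : ((D.length + 1 : ℕ) : ℝ≥0) ^ (-(1 / 4) : ℝ) ≤ 1 := by
    rw [← NNReal.coe_le_coe, NNReal.coe_rpow]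
    simpa [expWeight] using expWeight_le_one D
  rw [exploreDist, pexp_mix _ _ _ hg, NNReal.coe_sub h1, NNReal.coe_rpow]
  simp only [NNReal.coe_one, NNReal.coe_natCast, sub_sub_cancel, expWeight]

/-- The allocation of the explore round with data `D` is nearly optimal for the true model, and
the estimated model has the right optimal decision. -/
def Good (A : AEStar 𝓜 ε) (Mstar : Model 𝒜) (D : List (𝒜 × ℝ)) : Prop :=
  Mstar ∈ glSetLE 𝓜 (tol ε) (A.alloc D).1 (nCap (D.length + 1)) ∧
    optSet Mstar ⊆ optSet (mixModel (A.est D))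

/-- The expected regret of the explore round with data `D`. -/
def roundCost (A : AEStar 𝓜 ε) (Mstar : Model 𝒜) (D : List (𝒜 × ℝ)) : ℝ :=
  pexp (A.exploreDist D) fun a => (gap Mstar a).toReal

/-- The expected information about `M` in the explore round with data `D`. -/
def roundInfo (A : AEStar 𝓜 ε) (Mstar M : Model 𝒜) (D : List (𝒜 × ℝ)) : ℝ :=
  pexp (A.exploreDist D) fun a => sqd Mstar a M / 2

lemma roundCost_nonneg (D : List (𝒜 × ℝ)) : 0 ≤ A.roundCost Mstar D :=
  pexp_nonneg _ fun _ => ENNReal.toReal_nonneg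

lemma _root_.GLBandit.GaussClass.gap_toReal_le (h𝓜 : GaussClass 𝓜) (hs : Mstar ∈ 𝓜) (a : 𝒜) :
    (gap Mstar a).toReal ≤ 1 :=
  ENNReal.toReal_le_of_le_ofReal zero_le_one (by simpa using h𝓜.gap_le_one hs a)

lemma roundCost_le_one (h𝓜 : GaussClass 𝓜) (hs : Mstar ∈ 𝓜) (D : List (𝒜 × ℝ)) :
    A.roundCost Mstar D ≤ 1 :=
  pexp_le_one _ (fun _ => ENNReal.toReal_nonneg) fun a => h𝓜.gap_toReal_le hs a

lemma roundInfo_nonneg (D : List (𝒜 × ℝ)) : 0 ≤ A.roundInfo Mstar M D :=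
  pexp_nonneg _ fun a => by have := sqd_nonneg (Mstar := Mstar) (M := M) a; positivity

lemma exploreCost_eq (h𝓜 : GaussClass 𝓜) (hs : Mstar ∈ 𝓜) (L : List (𝒜 × ℝ)) :
    A.exploreCost Mstar L = ENNReal.ofReal (prefixSum (fun D _ => A.roundCost Mstar D) L) := by
  rw [prefixSum_eq_sum_range, ENNReal.ofReal_sum_of_nonneg fun _ _ => roundCost_nonneg _,
    exploreCost]
  exact Finset.sum_congr rfl fun i _ => h𝓜.cost_eq_pexp hs _

lemma abs_sqd_half_le (h𝓜 : GaussClass 𝓜) (hs : Mstar ∈ 𝓜) (hM : M ∈ 𝓜) (a : 𝒜) :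
    |sqd Mstar a M / 2| ≤ 1 := by
  have h0 := sqd_nonneg (Mstar := Mstar) (M := M) a
  have h1 := h𝓜.sqd_le_one hs hM a
  rw [abs_of_nonneg (by positivity)]; linarith

/-- The cap `s ^ (1/8)` on the normalization factor keeps the information at least `(1 - tol ε) * s
^ (-1/8)`, and `tol ε ≤ 1/8`. -/
lemma le_pexp_of_mem_glSetLE (h𝓜 : GaussClass 𝓜) (hs : Mstar ∈ 𝓜) (hg : glc 𝓜 Mstar ≠ ∞) (hε : 0 < ε)
    (hε2 : ε ≤ 1 / 2) {D : List (𝒜 × ℝ)}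
    (h : Mstar ∈ glSetLE 𝓜 (tol ε) (A.alloc D).1 (nCap (D.length + 1)))
    (hM : M ∈ alt 𝓜 Mstar) :
    7 / 4 ≤ ((D.length + 1 : ℕ) : ℝ) ^ (1 / 8 : ℝ)
      * (2 * pexp (A.alloc D).1 fun a => sqd Mstar a M / 2) := by
  have ht := tol_le hε hε2
  rw [nCap_eq] at h
  obtain ⟨n, hn0, hnN, -, hi⟩ := h𝓜.exists_of_mem_glSetLE hs hg
    ((by positivity : 0 ≤ ε / 5).trans (tol_ge hε hε2)) h
  have h1 := hi M hM
  rw [div_le_iff₀ hn0] at h1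
  have h2 : 0 ≤ pexp (A.alloc D).1 fun a => sqd Mstar a M / 2 := pexp_nonneg _ fun a => by
    have := sqd_nonneg (Mstar := Mstar) (M := M) a; positivity
  nlinarith [mul_le_mul_of_nonneg_left hnN h2]

/-- The first allocation is played with probability at least 3/20 and `8 * (3/20) * (7/8) > 1`. This
bounds the number of good rounds by the information they collect. -/
lemma Good.one_le (h𝓜 : GaussClass 𝓜) (hs : Mstar ∈ 𝓜) (hg : glc 𝓜 Mstar ≠ ∞) (hε : 0 < ε)
    (hε2 : ε ≤ 1 / 2) {D : List (𝒜 × ℝ)} (hD : 1 ≤ D.length) (h : A.Good Mstar D)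
    (hM : M ∈ alt 𝓜 Mstar) :
    1 ≤ 8 * ((D.length + 1 : ℕ) : ℝ) ^ (1 / 8 : ℝ) * A.roundInfo Mstar M D := by
  have h1 := le_pexp_of_mem_glSetLE h𝓜 hs hg hε hε2 h.1 hM
  have h2 : expWeight D ≤ 17 / 20 := rpow_neg_quarter_le (by
    have : (1 : ℝ) ≤ D.length := by exact_mod_cast hD
    push_cast; linarith)
  rw [roundInfo, pexp_exploreDist D (abs_sqd_half_le h𝓜 hs hM.1)]
  have h3 : 0 ≤ pexp (A.alloc D).1 fun a => sqd Mstar a M / 2 := pexp_nonneg _ fun a => by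
    have := sqd_nonneg (Mstar := Mstar) (M := M) a; positivity
  have h4 : 0 ≤ pexp (A.alloc D).2 fun a => sqd Mstar a M / 2 := pexp_nonneg _ fun a => by
    have := sqd_nonneg (Mstar := Mstar) (M := M) a; positivity
  have h5 := (expWeight_pos D).le
  have h6 : 0 ≤ ((D.length + 1 : ℕ) : ℝ) ^ (1 / 8 : ℝ) := by positivity
  set S := ((D.length + 1 : ℕ) : ℝ) ^ (1 / 8 : ℝ)
  set X := pexp (A.alloc D).1 fun a => sqd Mstar a M / 2
  set Y := pexp (A.alloc D).2 fun a => sqd Mstar a M / 2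
  have h7 : 3 / 20 * X ≤ (1 - expWeight D) * X + expWeight D * Y := by
    nlinarith [mul_nonneg h5 h4]
  calc (1 : ℝ) ≤ 8 * S * (3 / 20 * X) := by nlinarith
    _ ≤ _ := mul_le_mul_of_nonneg_left h7 (by positivity)

/-- The unknown normalization factor cancels between cost and information, leaving the price per
unit of information, the same for every alternative. Playing the second allocation costs at most its
weight. -/
lemma Good.roundCost_le (h𝓜 : GaussClass 𝓜) (hs : Mstar ∈ 𝓜) (hg : glc 𝓜 Mstar ≠ ∞)
    (hε : 0 < ε) (hε2 : ε ≤ 1 / 2) {D : List (𝒜 × ℝ)} (h : A.Good Mstar D)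
    (hM : M ∈ alt 𝓜 Mstar) :
    A.roundCost Mstar D ≤ (1 + tol ε) / (1 - tol ε) * (glc 𝓜 Mstar).toReal
      * A.roundInfo Mstar M D + expWeight D := by
  have ht := tol_le hε hε2
  have ht0 := ((by positivity : 0 ≤ ε / 5).trans (tol_ge hε hε2))
  have h' := h.1
  rw [nCap_eq] at h'
  obtain ⟨n, hn0, -, hc, hi⟩ := h𝓜.exists_of_mem_glSetLE hs hg ht0 h'
  have h1 := hi M hM
  have h3 : 0 ≤ pexp (A.alloc D).2 fun a => sqd Mstar a M / 2 := pexp_nonneg _ fun a => by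
    have := sqd_nonneg (Mstar := Mstar) (M := M) a; positivity
  have h4 : pexp (A.alloc D).2 (fun a => (gap Mstar a).toReal) ≤ 1 :=
    pexp_le_one _ (fun _ => ENNReal.toReal_nonneg) fun a => h𝓜.gap_toReal_le hs a
  have h5 := (expWeight_pos D).le
  have h6 := expWeight_le_one D
  rw [roundInfo, pexp_exploreDist D (abs_sqd_half_le h𝓜 hs hM.1), roundCost,
    pexp_exploreDist (C := 1) D fun a => by
      rw [abs_of_nonneg ENNReal.toReal_nonneg]; exact h𝓜.gap_toReal_le hs a]
  set X := pexp (A.alloc D).1 fun a => sqd Mstar a M / 2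
  set Y := pexp (A.alloc D).2 fun a => sqd Mstar a M / 2
  set g := (glc 𝓜 Mstar).toReal with hgdef
  have hg0 : 0 ≤ g := ENNReal.toReal_nonneg
  have h7 : pexp (A.alloc D).1 (fun a => (gap Mstar a).toReal)
      ≤ (1 + tol ε) / (1 - tol ε) * g * X := by
    refine hc.trans ?_
    have e : (1 + tol ε) * g / n = (1 + tol ε) / (1 - tol ε) * g * ((1 - tol ε) / n) := by
      have : 1 - tol ε ≠ 0 := by linarith
      field_simp
    rw [e]
    exact mul_le_mul_of_nonneg_left h1 (mul_nonneg (div_nonneg (by linarith) (by linarith)) hg0)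
  have h8 : 0 ≤ (1 + tol ε) / (1 - tol ε) * g :=
    mul_nonneg (div_nonneg (by linarith) (by linarith)) hg0
  have h9 := mul_le_mul_of_nonneg_left h7 (sub_nonneg.2 h6)
  have h10 := mul_le_mul_of_nonneg_left h4 h5
  have h11 := mul_nonneg h8 (mul_nonneg h5 h3)
  nlinarith

end AEStar

variable {d : ℕ} {D : ℝ} {x : 𝒜 → EuclideanSpace ℝ (Fin d)} {Θ : Set (EuclideanSpace ℝ (Fin d))}

/-- If the allocation fails for the active true model, the small value of the exploration problem
says that the second allocation sees an error of order `s ^ (-1/8)`, and it is played with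
probability `s ^ (-1/4)`; together this is `s ^ (-3/8)`. If only the optimal decision of the
estimate is wrong, the averaged model is an alternative in the class, so the first allocation
distinguishes it from the true model; by Jensen's inequality this is again estimation error. -/
lemma IsLinearInstance.one_le_of_not_good [Nontrivial 𝒜] (h : IsLinearInstance D x Θ Mstar)
    (hD : 0 < D) {ε : ℝ} (hε : 0 < ε) (hε2 : ε ≤ 1 / 2) {A : AEStar (linearClass x Θ) ε}
    (hg : glc (linearClass x Θ) Mstar ≠ ∞) (hd : 1 ≤ d) {L : List (𝒜 × ℝ)} (hL : 1 ≤ L.length)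
    (hact : Mstar ∈ activeSet (linearClass x Θ) ε (epoch (L.length + 1)))
    (hgood : ¬ A.Good Mstar L) :
    1 ≤ 10 ^ 8 * d / ε ^ 2 * ((L.length + 1 : ℕ) : ℝ) ^ (3 / 8 : ℝ) * A.estErr Mstar L := by
  have h𝓜 := h.gaussClass
  obtain ⟨t, ht⟩ := A.exists_finSupp_est L
  have hs1 : (1 : ℝ) ≤ ((L.length + 1 : ℕ) : ℝ) := by exact_mod_cast Nat.le_add_left 1 _
  have hs2 : (2 : ℝ) ≤ ((L.length + 1 : ℕ) : ℝ) := by exact_mod_cast Nat.succ_le_succ hL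
  have hd' : (1 : ℝ) ≤ d := by exact_mod_cast hd
  have herr : A.estErr Mstar L = _ :=
    AEStar.pexp_exploreDist (A := A) L (C := 1) fun a => ht.abs_err_le h𝓜 h.mem a
  have hw0 : 0 ≤ pexp (A.alloc L).1 (err Mstar (A.est L)) :=
    pexp_nonneg _ fun a => err_nonneg _ a
  have hω0 : 0 ≤ pexp (A.alloc L).2 (err Mstar (A.est L)) :=
    pexp_nonneg _ fun a => err_nonneg _ a
  have hwe := rpow_neg_quarter_le hs2
  have hwe0 := (AEStar.expWeight_pos L).le
  set s : ℝ := ((L.length + 1 : ℕ) : ℝ) with hs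
  have hs8 : 0 ≤ s ^ (1 / 8 : ℝ) := by positivity
  change AEStar.expWeight L ≤ 17 / 20 at hwe
  rw [herr]
  set W := pexp (A.alloc L).1 (err Mstar (A.est L))
  set V := pexp (A.alloc L).2 (err Mstar (A.est L))
  set K : ℝ := 10 ^ 8 * d / ε ^ 2 with hK
  have hK8 : 8 ≤ K := by
    rw [hK, le_div_iff₀ (by positivity)]; nlinarith
  by_cases hB : Mstar ∈ glSetLE (linearClass x Θ) (tol ε) (A.alloc L).1 (nCap (L.length + 1))
  · have hnot : ¬ optSet Mstar ⊆ optSet (mixModel (A.est L)) := fun hh => hgood ⟨hB, hh⟩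
    obtain ⟨M, hM, hmean, hopt⟩ := h.exists_mean_mixModel ht
    obtain ⟨p, hp, hu⟩ := h.unique_opt
    have hps : optSet Mstar = {p} := Set.eq_singleton_iff_unique_mem.2 ⟨hp, hu⟩
    have halt : M ∈ alt (linearClass x Θ) Mstar := by
      rw [mem_alt_iff hps]
      refine ⟨hM, fun hpM => hnot ?_⟩
      rw [hps, Set.singleton_subset_iff, hopt]
      exact hpM
    have h1 := AEStar.le_pexp_of_mem_glSetLE h𝓜 h.mem hg hε hε2 hB halt
    have h2 : ∀ a, sqd Mstar a M ≤ err Mstar (A.est L) a := fun a => by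
      have e : mean M a - mean Mstar a
          = pexp (A.est L) fun M' => mean M' a + -mean Mstar a := by
        rw [ht.add, pexp_const, hmean]; ring
      rw [sqd, e]
      refine (ht.sq_le _).trans (le_of_eq ?_)
      rfl
    have h3 : 2 * pexp (A.alloc L).1 (fun a => sqd Mstar a M / 2) ≤ W := by
      rw [← pexp_const_mul]
      refine pexp_mono _ (C := 1) (C' := 1) (fun a => ?_)
        (fun a => ht.abs_err_le h𝓜 h.mem a) fun a => ?_
      · have := sqd_nonneg (Mstar := Mstar) (M := M) a
        have := h𝓜.sqd_le_one h.mem hM a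
        rw [abs_of_nonneg (by positivity)]; linarith
      · linarith [h2 a]
    have h4 : 7 / 4 ≤ s ^ (1 / 8 : ℝ) * W := h1.trans (mul_le_mul_of_nonneg_left h3 hs8)
    have h5 : s ^ (1 / 8 : ℝ) ≤ s ^ (3 / 8 : ℝ) :=
      Real.rpow_le_rpow_of_exponent_le hs1 (by norm_num)
    have h6 : 3 / 20 * W ≤ (1 - AEStar.expWeight L) * W + AEStar.expWeight L * V := by
      nlinarith [mul_nonneg hwe0 hω0]
    calc (1 : ℝ) ≤ 8 * (s ^ (1 / 8 : ℝ) * (3 / 20 * W)) := by linarith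
      _ ≤ K * (s ^ (3 / 8 : ℝ) * (3 / 20 * W)) := by gcongr
      _ ≤ K * (s ^ (3 / 8 : ℝ) * ((1 - AEStar.expWeight L) * W + AEStar.expWeight L * V)) := by
          gcongr
      _ = _ := by ring
  · have h1 := h.exploreValue_alloc_le hD hε hε2 A L fun M hM => by
      by_contra hcon
      exact hM (ht.eq_zero M fun hMt => hcon (ht.mem M hMt))
    have h2 := (le_iSup₂_of_le (f := fun M (_ : M ∈ activeSet (linearClass x Θ) ε
      (epoch (L.length + 1)) \ glSetLE (linearClass x Θ) (tol ε) (A.alloc L).1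
        (nCap (L.length + 1))) => (∑' M', estimate A.cover A.base L M'
          * info (A.alloc L).2 M' M)⁻¹) Mstar ⟨hact, hB⟩ le_rfl).trans h1
    have h3 : ∑' M', estimate A.cover A.base L M' * info (A.alloc L).2 M' Mstar
        = ENNReal.ofReal (V / 2) := ht.tsum_info_eq h𝓜 h.mem _
    simp only [h3] at h2
    have hV : 0 < V / 2 := by
      by_contra hcon
      rw [ENNReal.ofReal_of_nonpos (not_lt.1 hcon), ENNReal.inv_zero, top_le_iff] at h2
      exact ENNReal.ofReal_ne_top h2
    rw [← ENNReal.ofReal_inv_of_pos hV, ENNReal.ofReal_le_ofReal_iff (by positivity),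
      inv_le_iff_one_le_mul₀ hV] at h2
    have e1 : s ^ (3 / 8 : ℝ) * AEStar.expWeight L = s ^ (1 / 8 : ℝ) := by
      rw [AEStar.expWeight, ← hs, ← Real.rpow_add (by linarith)]; norm_num
    have h4 : AEStar.expWeight L * V ≤ (1 - AEStar.expWeight L) * W + AEStar.expWeight L * V := by
      nlinarith
    calc (1 : ℝ) ≤ 2 * (10 ^ 8 * d * s ^ (1 / 8 : ℝ) / ε ^ 2 * (V / 2)) := by linarith
      _ = K * (s ^ (3 / 8 : ℝ) * AEStar.expWeight L) * V := by rw [e1, hK]; ring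
      _ = K * s ^ (3 / 8 : ℝ) * (AEStar.expWeight L * V) := by ring
      _ ≤ _ := mul_le_mul_of_nonneg_left h4 (by positivity)

end

/-! ### Accounting of the explore rounds. -/

section

variable {𝒜 : Type u} {𝓜 : Set (Model 𝒜)} {M M' M₀ Mstar : Model 𝒜}

/-- The induction step multiplies by `y ^ (1/4)` and uses the weighted arithmetic-geometric mean
inequality for `S ^ (3/4) * y ^ (1/4)`. -/
lemma sum_rpow_neg_quarter_le (S : ℕ) :
    ∑ i ∈ Finset.range S, ((i + 1 : ℕ) : ℝ) ^ (-(1 / 4) : ℝ) ≤ 2 * (S : ℝ) ^ (3 / 4 : ℝ) := by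
  induction S with
  | zero => simp
  | succ S ih =>
    rw [Finset.sum_range_succ]
    have hS : (0 : ℝ) ≤ S := Nat.cast_nonneg S
    set y : ℝ := ((S + 1 : ℕ) : ℝ) with hy
    have hy1 : y = S + 1 := by rw [hy]; push_cast; ring
    have hy0 : 0 < y := by rw [hy1]; positivity
    have h1 : (S : ℝ) ^ (3 / 4 : ℝ) * y ^ (1 / 4 : ℝ) ≤ 3 / 4 * S + 1 / 4 * y :=
      Real.geom_mean_le_arith_mean2_weighted (by norm_num) (by norm_num) hS hy0.le (by norm_num)
    have h2 : y ^ (3 / 4 : ℝ) * y ^ (1 / 4 : ℝ) = y := by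
      rw [← Real.rpow_add hy0]; norm_num
    have h3 : y ^ (-(1 / 4) : ℝ) * y ^ (1 / 4 : ℝ) = 1 := by
      rw [← Real.rpow_add hy0]; norm_num
    have h4 : 0 < y ^ (1 / 4 : ℝ) := by positivity
    have h5 : y ^ (-(1 / 4) : ℝ) + 2 * (S : ℝ) ^ (3 / 4 : ℝ) ≤ 2 * y ^ (3 / 4 : ℝ) := by
      refine le_of_mul_le_mul_right ?_ h4
      nlinarith
    linarith

lemma sum_ite_lt_le (S k : ℕ) : ∑ i ∈ Finset.range S, (if i < k then (1 : ℝ) else 0) ≤ k := by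
  rw [Finset.sum_ite, Finset.sum_const, Finset.sum_const_zero, add_zero, nsmul_eq_mul, mul_one]
  have : ((Finset.range S).filter (· < k)).card ≤ k := by
    calc _ ≤ (Finset.range k).card := Finset.card_le_card fun i hi => by
          simp only [Finset.mem_filter, Finset.mem_range] at hi ⊢; exact hi.2
      _ = k := Finset.card_range k
  exact_mod_cast this

/-- Sums over rounds which are accounted for before the last distinguished round `n` by `u` and
after it by `v`. -/
lemma sum_le_of_split {S k n : ℕ} {c u v : ℕ → ℝ} (hu : ∀ i, 0 ≤ u i) (hv : ∀ i, 0 ≤ v i)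
    (hc : ∀ i, c i ≤ 1) (hn : n < S)
    (h1 : ∀ i < n, k ≤ i → c i ≤ u i + v i) (h2 : ∀ i < S, n < i → k ≤ i → c i ≤ v i) :
    ∑ i ∈ Finset.range S, c i ≤
      k + 1 + ∑ i ∈ Finset.range n, u i + ∑ i ∈ Finset.range S, v i := by
  have h3 : ∀ i ∈ Finset.range S, c i ≤ (if i < k then (1 : ℝ) else 0) + (if i = n then 1 else 0)
      + (if i < n then u i else 0) + v i := by
    intro i hi
    have hi' := Finset.mem_range.1 hi
    have := hc i
    have := hu i
    have := hv i
    by_cases hk : i < k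
    · rw [if_pos hk]; split_ifs <;> linarith
    · rw [if_neg hk]
      rcases lt_trichotomy i n with h | h | h
      · rw [if_neg h.ne, if_pos h]; linarith [h1 i h (not_lt.1 hk)]
      · rw [if_pos h, if_neg (by omega)]; linarith
      · rw [if_neg h.ne', if_neg (by omega)]; linarith [h2 i hi' h (not_lt.1 hk)]
  refine (Finset.sum_le_sum h3).trans ?_
  rw [Finset.sum_add_distrib, Finset.sum_add_distrib, Finset.sum_add_distrib]
  have h4 := sum_ite_lt_le S k
  have h5 : ∑ i ∈ Finset.range S, (if i = n then (1 : ℝ) else 0) = 1 := by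
    rw [Finset.sum_ite_eq', if_pos (Finset.mem_range.2 hn)]
  have h6 : ∑ i ∈ Finset.range S, (if i < n then u i else 0) = ∑ i ∈ Finset.range n, u i := by
    rw [← Finset.sum_filter]
    refine Finset.sum_congr ?_ fun _ _ => rfl
    ext i; simp only [Finset.mem_filter, Finset.mem_range]; omega
  linarith

lemma sum_le_of_tail {S k : ℕ} {c v : ℕ → ℝ} (hv : ∀ i, 0 ≤ v i)
    (hc : ∀ i, c i ≤ 1) (h2 : ∀ i < S, k ≤ i → c i ≤ v i) :
    ∑ i ∈ Finset.range S, c i ≤ k + ∑ i ∈ Finset.range S, v i := by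
  have h3 : ∀ i ∈ Finset.range S, c i ≤ (if i < k then (1 : ℝ) else 0) + v i := by
    intro i hi
    by_cases hk : i < k
    · rw [if_pos hk]; linarith [hc i, hv i]
    · rw [if_neg hk]; linarith [h2 i (Finset.mem_range.1 hi) (not_lt.1 hk)]
  refine (Finset.sum_le_sum h3).trans ?_
  rw [Finset.sum_add_distrib]
  linarith [sum_ite_lt_le S k]

lemma prefixSum_take_eq (φ : List (𝒜 × ℝ) → ℝ) (L : List (𝒜 × ℝ)) {n : ℕ} (hn : n ≤ L.length) :
    prefixSum (fun D _ => φ D) (L.take n) = ∑ i ∈ Finset.range n, φ (L.take i) := by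
  rw [prefixSum_eq_sum_range, List.length_take, min_eq_left hn]
  refine Finset.sum_congr rfl fun i hi => ?_
  rw [List.take_take, min_eq_left (Finset.mem_range.1 hi).le]

lemma prefixSum_take_le {φ : List (𝒜 × ℝ) → ℝ} (h0 : ∀ D, 0 ≤ φ D) (L : List (𝒜 × ℝ)) {n : ℕ}
    (hn : n ≤ L.length) : prefixSum (fun D _ => φ D) (L.take n) ≤ prefixSum (fun D _ => φ D) L := by
  rw [prefixSum_take_eq φ L hn, prefixSum_eq_sum_range]
  exact Finset.sum_le_sum_of_subset_of_nonneg (Finset.range_subset_range.2 hn) fun i _ _ => h0 _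

lemma log_mul_log_mono {t T : ℕ} (ht : 1 ≤ t) (hT : t ≤ T) (hT3 : 3 ≤ T) :
    Real.log (t * Real.log t) ≤ Real.log (T * Real.log T) := by
  have hl3 : 1 ≤ Real.log T := by
    rw [Real.le_log_iff_exp_le (by positivity)]
    have : (3 : ℝ) ≤ T := by exact_mod_cast hT3
    linarith [Real.exp_one_lt_three]
  have hT0 : (1 : ℝ) ≤ T := by exact_mod_cast (by omega : 1 ≤ T)
  rcases ht.eq_or_lt with rfl | ht
  -- At `t = 1` the threshold is `Real.log 0`, which is `0` by convention.
  · simp only [Nat.cast_one, Real.log_one, mul_zero, Real.log_zero]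
    exact Real.log_nonneg (by nlinarith)
  · have ht' : (1 : ℝ) < t := by exact_mod_cast ht
    have htT : (t : ℝ) ≤ T := by exact_mod_cast hT
    have := Real.log_pos ht'
    refine Real.log_le_log (by positivity) ?_
    gcongr

namespace AEStar

variable {ε : ℝ} {A : AEStar 𝓜 ε}

/-- Accounting of the explore rounds: the information `I` collected before the last good round
controls the number of explore rounds and their regret. -/
lemma exists_info (h𝓜 : GaussClass 𝓜) (hs : Mstar ∈ 𝓜) (hg : glc 𝓜 Mstar ≠ ∞) (hε : 0 < ε)
    (hε2 : ε ≤ 1 / 2) (hopt : ∃ p, optSet Mstar = {p}) {K : ℝ} (hK : 0 ≤ K) {k : ℕ} (hk : 1 ≤ k)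
    (hbad : ∀ D : List (𝒜 × ℝ), k ≤ D.length → ¬ A.Good Mstar D →
      1 ≤ K * ((D.length + 1 : ℕ) : ℝ) ^ (3 / 8 : ℝ) * A.estErr Mstar D)
    {T : ℕ} (hT : 3 ≤ T) {L : List (𝒜 × ℝ)} (hL : A.Valid T L) :
    ∃ I : ℝ, 0 ≤ I ∧
      (L.length : ℝ) ≤ k + 1 + 8 * (L.length : ℝ) ^ (1 / 8 : ℝ) * I
        + K * (L.length : ℝ) ^ (3 / 8 : ℝ) * prefixSum (fun D _ => A.estErr Mstar D) L ∧
      prefixSum (fun D _ => A.roundCost Mstar D) L ≤ k + 1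
        + (1 + tol ε) / (1 - tol ε) * (glc 𝓜 Mstar).toReal * I + 2 * (L.length : ℝ) ^ (3 / 4 : ℝ)
        + K * (L.length : ℝ) ^ (3 / 8 : ℝ) * prefixSum (fun D _ => A.estErr Mstar D) L ∧
      (I = 0 ∨ ∃ n < L.length, ∃ M ∈ alt 𝓜 Mstar,
        logRatio A.cover A.base (L.take n) M ≤ Real.log (T * Real.log T) ∧
        I = prefixSum (fun D _ => A.roundInfo Mstar M D) (L.take n)) := by
  set S := L.length with hS
  have ht := tol_le hε hε2
  have ht0 : 0 ≤ tol ε := ((by positivity : 0 ≤ ε / 5).trans (tol_ge hε hε2))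
  have hRg : 0 ≤ (1 + tol ε) / (1 - tol ε) * (glc 𝓜 Mstar).toReal :=
    mul_nonneg (div_nonneg (by linarith) (by linarith)) ENNReal.toReal_nonneg
  have hlen : ∀ i < S, (L.take i).length = i := fun i hi => by
    rw [List.length_take]; omega
  have hbad' : ∀ i < S, k ≤ i → ¬ A.Good Mstar (L.take i) →
      1 ≤ K * (S : ℝ) ^ (3 / 8 : ℝ) * A.estErr Mstar (L.take i) := by
    intro i hi hki hng
    have h1 := hbad (L.take i) (by rw [hlen i hi]; exact hki) hng
    rw [hlen i hi] at h1
    refine h1.trans ?_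
    have h2 : ((i + 1 : ℕ) : ℝ) ≤ S := by exact_mod_cast hi
    have h3 := estErr_nonneg (A := A) (Mstar := Mstar) (L.take i)
    gcongr
  have hv0 : ∀ i, 0 ≤ K * (S : ℝ) ^ (3 / 8 : ℝ) * A.estErr Mstar (L.take i) := fun i =>
    mul_nonneg (by positivity) (estErr_nonneg _)
  have hvsum : ∑ i ∈ Finset.range S, K * (S : ℝ) ^ (3 / 8 : ℝ) * A.estErr Mstar (L.take i)
      = K * (S : ℝ) ^ (3 / 8 : ℝ) * prefixSum (fun D _ => A.estErr Mstar D) L := by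
    rw [prefixSum_eq_sum_range, Finset.mul_sum]
  have hw : ∀ n ≤ S, ∑ i ∈ Finset.range n, expWeight (L.take i) ≤ 2 * (S : ℝ) ^ (3 / 4 : ℝ) := by
    intro n hn
    calc _ ≤ ∑ i ∈ Finset.range S, expWeight (L.take i) :=
          Finset.sum_le_sum_of_subset_of_nonneg (Finset.range_subset_range.2 hn)
            fun i _ _ => (expWeight_pos _).le
      _ = ∑ i ∈ Finset.range S, ((i + 1 : ℕ) : ℝ) ^ (-(1 / 4) : ℝ) :=
          Finset.sum_congr rfl fun i hi => by
            rw [expWeight, hlen i (Finset.mem_range.1 hi)]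
      _ ≤ _ := sum_rpow_neg_quarter_le S
  have hcard : ∑ i ∈ Finset.range S, (1 : ℝ) = S := by simp
  have hcost : prefixSum (fun D _ => A.roundCost Mstar D) L
      = ∑ i ∈ Finset.range S, A.roundCost Mstar (L.take i) := prefixSum_eq_sum_range _ L
  have hc1 : ∀ i, A.roundCost Mstar (L.take i) ≤ 1 := fun i => roundCost_le_one h𝓜 hs _
  by_cases hex : ∃ i < S, k ≤ i ∧ A.Good Mstar (L.take i)
  · classical
    -- The last good round after the burn-in: all later rounds are bad and are charged to the
    -- estimation error.
    obtain ⟨n, hnmem, hmax⟩ := Finset.exists_max_image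
      ((Finset.range S).filter fun i => k ≤ i ∧ A.Good Mstar (L.take i)) id (by
        obtain ⟨i, h1, h2⟩ := hex
        exact ⟨i, Finset.mem_filter.2 ⟨Finset.mem_range.2 h1, h2⟩⟩)
    rw [Finset.mem_filter, Finset.mem_range] at hnmem
    obtain ⟨hnS, hkn, hgood⟩ := hnmem
    have hlast : ∀ i < S, n < i → k ≤ i → ¬ A.Good Mstar (L.take i) := fun i hi hni hki hgi =>
      absurd (hmax i (Finset.mem_filter.2 ⟨Finset.mem_range.2 hi, hki, hgi⟩)) (not_le.2 hni)
    obtain ⟨t, ht1, htT, hnone⟩ := hL.2 n hnS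
    obtain ⟨p, hp⟩ := hopt
    -- A good round has the true optimal decision among those of the estimate, so the failure of the
    -- test must come from some alternative with a small log-likelihood ratio.
    have hpM : p ∈ optSet (mixModel (A.est (L.take n))) := hgood.2 (hp ▸ Set.mem_singleton p)
    have hfail := A.exploit_none t _ hnone p
    obtain ⟨M, hM, hlt⟩ : ∃ M ∈ altDec 𝓜 p,
        logRatio A.cover A.base (L.take n) M < Real.log (t * Real.log t) := by
      by_contra hcon
      push Not at hcon
      exact hfail ⟨hpM, hcon⟩
    have halt : M ∈ alt 𝓜 Mstar := (mem_alt_iff hp).2 hM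
    have hI := prefixSum_take_eq (fun D => A.roundInfo Mstar M D) L hnS.le
    refine ⟨prefixSum (fun D _ => A.roundInfo Mstar M D) (L.take n), ?_, ?_, ?_,
      Or.inr ⟨n, hnS, M, halt, hlt.le.trans (log_mul_log_mono ht1 htT hT), rfl⟩⟩
    · rw [hI]; exact Finset.sum_nonneg fun i _ => roundInfo_nonneg _
    · have := sum_le_of_split (S := S) (k := k) (n := n) (c := fun _ => 1)
        (u := fun i => 8 * (S : ℝ) ^ (1 / 8 : ℝ) * A.roundInfo Mstar M (L.take i))
        (fun i => mul_nonneg (by positivity) (roundInfo_nonneg _)) hv0 (fun _ => le_rfl) hnS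
        (fun i hi hki => ?_) fun i hi hni hki => hbad' i hi hki (hlast i hi hni hki)
      · rw [hcard, hvsum, ← Finset.mul_sum, ← hI] at this
        exact this
      · by_cases hgi : A.Good Mstar (L.take i)
        · refine le_trans ?_ (le_add_of_nonneg_right (hv0 i))
          have h1 := hgi.one_le h𝓜 hs hg hε hε2 (by rw [hlen i (hi.trans hnS)]; omega) halt
          rw [hlen i (hi.trans hnS)] at h1
          refine h1.trans ?_
          have h2 : ((i + 1 : ℕ) : ℝ) ≤ S := by exact_mod_cast hi.trans hnS
          have h3 := roundInfo_nonneg (A := A) (Mstar := Mstar) (M := M) (L.take i)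
          gcongr
        · exact (hbad' i (hi.trans hnS) hki hgi).trans
            (le_add_of_nonneg_left (mul_nonneg (by positivity) (roundInfo_nonneg _)))
    · have := sum_le_of_split (S := S) (k := k) (n := n)
        (c := fun i => A.roundCost Mstar (L.take i))
        (u := fun i => (1 + tol ε) / (1 - tol ε) * (glc 𝓜 Mstar).toReal
          * A.roundInfo Mstar M (L.take i) + expWeight (L.take i))
        (fun i => add_nonneg (mul_nonneg hRg (roundInfo_nonneg _)) (expWeight_pos _).le) hv0 hc1 hnS
        (fun i hi hki => ?_) fun i hi hni hki =>
          (hc1 i).trans (hbad' i hi hki (hlast i hi hni hki))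
      · rw [hvsum, Finset.sum_add_distrib, ← Finset.mul_sum, ← hI, ← hcost] at this
        linarith [hw n hnS.le]
      · by_cases hgi : A.Good Mstar (L.take i)
        · exact le_trans (hgi.roundCost_le h𝓜 hs hg hε hε2 halt) (le_add_of_nonneg_right (hv0 i))
        · exact ((hc1 i).trans (hbad' i (hi.trans hnS) hki hgi)).trans
            (le_add_of_nonneg_left (add_nonneg (mul_nonneg hRg (roundInfo_nonneg _))
              (expWeight_pos _).le))
  · have hall : ∀ i < S, k ≤ i → ¬ A.Good Mstar (L.take i) := fun i hi hki hgi =>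
      hex ⟨i, hi, hki, hgi⟩
    refine ⟨0, le_rfl, ?_, ?_, Or.inl rfl⟩
    · have := sum_le_of_tail (S := S) (k := k) (c := fun _ => 1) hv0 (fun _ => le_rfl)
        fun i hi hki => hbad' i hi hki (hall i hi hki)
      rw [hcard, hvsum] at this
      linarith
    · have := sum_le_of_tail (S := S) (k := k) (c := fun i => A.roundCost Mstar (L.take i)) hv0 hc1
        fun i hi hki => (hc1 i).trans (hbad' i hi hki (hall i hi hki))
      rw [hvsum, ← hcost] at this
      have h0 : 0 ≤ 2 * (S : ℝ) ^ (3 / 4 : ℝ) := by positivity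
      linarith

/-- The failure of the exploit test bounds the information about some alternative. -/
lemma prefixSum_roundInfo_le (h𝓜 : GaussClass 𝓜) (hs : Mstar ∈ 𝓜) (hM : M ∈ 𝓜) {τ m κ : ℝ}
    (hκ : 0 < κ) (hκ1 : κ ≤ 1) (hm : 1 ≤ m) {comp : ℕ → Model 𝒜} {k N : ℕ}
    {net : ℕ → Finset (Model 𝒜)} (hnet : ∀ n, ∀ M ∈ net n, M ∈ 𝓜) {L : List (𝒜 × ℝ)}
    (hLN : L.length < N) (hL : logRatio A.cover A.base L M ≤ τ)
    (hpot : potential A Mstar comp k κ net N L ≤ m)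
    (hM' : M' ∈ net L.length) (hclose : ∀ a, |mean M a - mean M' a| ≤ 1 / (L.length + 1 : ℝ)) :
    (1 - κ) * (1 - κ / 2) * prefixSum (fun D _ => A.roundInfo Mstar M D) L ≤
      τ + 2 * prefixSum (fun D _ => A.estErr Mstar D) L + 2 * Real.log (5 * m) + 4
      + 1 / κ * (Real.log (5 * m) + Real.log (((L.length : ℝ) + 1) * (L.length + 2))
        + Real.log (net L.length).card) := by
  -- The failed test bounds minus the log-likelihood ratio of `M`; the supermartingale of a net
  -- point `M'` bounds this ratio plus the compensated information. Adding the two leaves the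
  -- information, once `M` is exchanged for `M'`. At radius `1 / (n + 1)` the exchange costs a
  -- constant and the normalized noise.
  obtain ⟨hE, -, -, hNz, hZ⟩ := le_of_potential_le hpot
  have hA := prefixSum_incrAlt_le hLN hM' hZ
  have hM'𝓜 := hnet _ M' hM'
  set n := L.length with hn
  set ll := Real.log (5 * m) with hll
  have hll0 : 0 ≤ ll := Real.log_nonneg (by linarith)
  have hn0 : (0 : ℝ) ≤ n := Nat.cast_nonneg n
  set h : ℝ := 1 / (n + 1) with hh
  have hh0 : 0 < h := by positivity
  have hhn : h * n ≤ 1 := by rw [hh, one_div_mul_eq_div, div_le_one (by positivity)]; linarith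
  have hh1 : h ≤ 1 := by rw [hh, div_le_one (by positivity)]; linarith
  -- constants along the data
  have hconst : ∀ c : ℝ, prefixSum (fun (_ : List (𝒜 × ℝ)) (_ : 𝒜 × ℝ) => c) L = n * c := fun c => by
    simp [prefixSum, hn]
  -- the failed test
  have h1 : -prefixSum (fun _ z => llrM Mstar M z) L
      ≤ τ + ll + 2 * prefixSum (fun D _ => A.estErr Mstar D) L := by
    have e1 : logRatio A.cover A.base L M
        = -prefixSum (A.incrEst Mstar) L + -2 * prefixSum (fun D _ => A.estErr Mstar D) L
          + -1 * prefixSum (fun _ z => llrM Mstar M z) L := by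
      rw [logRatio_eq (Mstar := Mstar) h𝓜 hM, ← neg_one_mul (prefixSum (A.incrEst Mstar) L),
        ← prefixSum_const_mul, ← prefixSum_const_mul, ← prefixSum_const_mul, ← prefixSum_add,
        ← prefixSum_add]
      congr 1
      funext D z
      obtain ⟨s, hsf⟩ := A.exists_finSupp_est D
      have e2 : pexp (A.est D) (fun M' => llrM Mstar M' z - llrM Mstar M z)
          = pexp (A.est D) (fun M' => llrM Mstar M' z) - llrM Mstar M z := by
        have := hsf.add (fun M' => llrM Mstar M' z) fun _ => -llrM Mstar M z
        rw [pexp_const] at this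
        simpa [sub_eq_add_neg] using this
      have e3 : pexp (A.exploreDist D) (fun a => 2 * err Mstar (A.est D) a)
          = 2 * A.estErr Mstar D := pexp_const_mul _ _ _
      rw [e2, incrEst, e3]
      ring
    linarith
  -- the approximation by the net
  have h2 : prefixSum (fun _ z => llrM Mstar M z) L
      ≤ prefixSum (fun _ z => llrM Mstar M' z) L + (ll + 3) := by
    have h3 : prefixSum (fun _ z => llrM Mstar M z) L
        ≤ prefixSum (fun _ z => llrM Mstar M' z) L
          + (h * prefixSum (incrNoise Mstar) L + prefixSum (fun _ _ => 3 * h) L) := by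
      rw [← prefixSum_const_mul, ← prefixSum_add, ← prefixSum_add]
      refine prefixSum_mono (fun D z => ?_) L
      have ha := (h𝓜 M hM).2 z.1
      have ha' := (h𝓜 M' hM'𝓜).2 z.1
      have hb := (h𝓜 Mstar hs).2 z.1
      have hc := hclose z.1
      rw [incrNoise, llrM, llrM]
      have e : llrG (mean M z.1) (mean Mstar z.1) z.2 - llrG (mean M' z.1) (mean Mstar z.1) z.2
          = (mean M z.1 - mean M' z.1) * ((z.2 - mean Mstar z.1)
            - (mean M z.1 + mean M' z.1 - 2 * mean Mstar z.1) / 2) := by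
        simp only [llrG]; ring
      have h4 : |(z.2 - mean Mstar z.1) - (mean M z.1 + mean M' z.1 - 2 * mean Mstar z.1) / 2|
          ≤ |z.2 - mean Mstar z.1| + 1 := by
        refine (abs_sub _ _).trans (add_le_add le_rfl ?_)
        rw [abs_le]
        constructor <;> linarith [ha.1, ha.2, ha'.1, ha'.2, hb.1, hb.2]
      have h5 := mul_le_mul hc h4 (abs_nonneg _) hh0.le
      rw [← abs_mul, ← e] at h5
      have h6 := (le_abs_self _).trans h5
      nlinarith
    rw [hconst] at h3
    have h4 : h * prefixSum (incrNoise Mstar) L ≤ ll :=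
      (mul_le_mul_of_nonneg_left hNz hh0.le).trans (by nlinarith)
    nlinarith
  have h3 : prefixSum (fun D _ => A.roundInfo Mstar M D) L
      ≤ prefixSum (fun D _ => A.roundInfo Mstar M' D) L + 1 := by
    have h4 : prefixSum (fun D _ => A.roundInfo Mstar M D) L
        ≤ prefixSum (fun D _ => A.roundInfo Mstar M' D) L + prefixSum (fun _ _ => h) L := by
      rw [← prefixSum_add]
      refine prefixSum_mono (fun D z => ?_) L
      rw [roundInfo, roundInfo]
      have e : pexp (A.exploreDist D) (fun a => sqd Mstar a M' / 2) + h
          = pexp (A.exploreDist D) (fun a => sqd Mstar a M' / 2 + h) := by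
        rw [pexp_add (C := 1) (C' := h) _ (abs_sqd_half_le h𝓜 hs hM'𝓜)
          (fun a => by rw [abs_of_nonneg hh0.le]), pexp_const]
      rw [e]
      refine pexp_mono (C := 1) (C' := 1 + h) _ (abs_sqd_half_le h𝓜 hs hM) (fun a => ?_)
        fun a => ?_
      · exact (abs_add_le _ _).trans (add_le_add (abs_sqd_half_le h𝓜 hs hM'𝓜 a)
          (by rw [abs_of_nonneg hh0.le]))
      · have ha := (h𝓜 M hM).2 a
        have ha' := (h𝓜 M' hM'𝓜).2 a
        have hb := (h𝓜 Mstar hs).2 a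
        have hc := hclose a
        have e2 : sqd Mstar a M / 2 - sqd Mstar a M' / 2 = (mean M a - mean M' a)
            * ((mean M a + mean M' a - 2 * mean Mstar a) / 2) := by
          simp only [sqd]; ring
        have h5 : |(mean M a + mean M' a - 2 * mean Mstar a) / 2| ≤ 1 := by
          rw [abs_le]
          constructor <;> linarith [ha.1, ha.2, ha'.1, ha'.2, hb.1, hb.2]
        have h6 := mul_le_mul hc h5 (abs_nonneg _) hh0.le
        rw [← abs_mul, ← e2, mul_one] at h6
        linarith [(le_abs_self _).trans h6]
    rw [hconst] at h4
    nlinarith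
  -- the supermartingale of the net point
  have h4 : κ * prefixSum (fun _ z => llrM Mstar M' z) L
      + κ * (1 - κ) * (1 - κ / 2) * prefixSum (fun D _ => A.roundInfo Mstar M' D) L
      = prefixSum (A.incrAlt Mstar κ M') L := by
    rw [← prefixSum_const_mul, ← prefixSum_const_mul, ← prefixSum_add]
    congr 1
    funext D z
    have : pexp (A.exploreDist D) (fun a => -(κ * (1 - κ) * (1 - κ / 2) * (sqd Mstar a M' / 2)))
        = -(κ * (1 - κ) * (1 - κ / 2)) * A.roundInfo Mstar M' D := by
      rw [roundInfo, ← pexp_const_mul]; congr 1; funext a; ring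
    rw [incrAlt, this]; ring
  set I := prefixSum (fun D _ => A.roundInfo Mstar M D) L
  set I' := prefixSum (fun D _ => A.roundInfo Mstar M' D) L
  set E := prefixSum (fun D _ => A.estErr Mstar D) L
  set a := prefixSum (fun _ z => llrM Mstar M z) L
  set a' := prefixSum (fun _ z => llrM Mstar M' z) L
  set Q := ll + Real.log (((n : ℝ) + 1) * (n + 2)) + Real.log (net n).card
  have h5 : κ * (a' + (1 - κ) * (1 - κ / 2) * I') ≤ Q := by
    have : κ * (a' + (1 - κ) * (1 - κ / 2) * I') = κ * a' + κ * (1 - κ) * (1 - κ / 2) * I' := by ring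
    rw [this, h4]; exact hA
  have h6 : a' + (1 - κ) * (1 - κ / 2) * I' ≤ 1 / κ * Q := by
    rw [one_div_mul_eq_div, le_div_iff₀ hκ]; linarith
  have hc0 : 0 ≤ (1 - κ) * (1 - κ / 2) := mul_nonneg (by linarith) (by linarith)
  have hc1 : (1 - κ) * (1 - κ / 2) ≤ 1 := by nlinarith
  have h7 := mul_le_mul_of_nonneg_left h3 hc0
  nlinarith

end AEStar

end

section

/-! ### Elementary estimates -/

/-- The exponent 1/16 is chosen so that the square of the epoch is of order `s ^ (1/8)`; the
constant is `16 * 3 / 2 + 1`. -/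
lemma epoch_le_rpow {s : ℕ} (hs : 1 ≤ s) : (epoch s : ℝ) ≤ 25 * (s : ℝ) ^ (1 / 16 : ℝ) := by
  have hs' : (1 : ℝ) ≤ s := by exact_mod_cast hs
  have h1 : ((2 : ℝ)) ^ (Nat.log 2 s) ≤ s := by exact_mod_cast Nat.pow_log_le_self 2 (by omega)
  have h2 := Real.log_le_log (by positivity) h1
  rw [Real.log_pow] at h2
  have h3 := Real.log_le_rpow_div (x := (s : ℝ)) (ε := 1 / 16) (by linarith) (by norm_num)
  have h4 := Real.log_two_gt_d9
  have h5 : (1 : ℝ) ≤ (s : ℝ) ^ (1 / 16 : ℝ) := Real.one_le_rpow hs' (by norm_num)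
  have h6 : (0 : ℝ) ≤ Nat.log 2 s := Nat.cast_nonneg _
  have h7 : (Nat.log 2 s : ℝ) * (2 / 3) ≤ 16 * (s : ℝ) ^ (1 / 16 : ℝ) := by
    refine le_trans ?_ (h2.trans (h3.trans (le_of_eq (by ring))))
    exact mul_le_mul_of_nonneg_left (by linarith) h6
  rw [epoch]
  push_cast
  linarith

lemma sum_Ico_id_le (e : ℕ) : ∑ j ∈ Finset.Ico 1 (e + 1), (j : ℝ) ≤ (e : ℝ) ^ 2 := by
  calc ∑ j ∈ Finset.Ico 1 (e + 1), (j : ℝ) ≤ ∑ j ∈ Finset.Ico 1 (e + 1), (e : ℝ) := by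
        refine Finset.sum_le_sum fun j hj => ?_
        rw [Finset.mem_Ico] at hj
        exact_mod_cast Nat.lt_succ_iff.1 hj.2
    _ = (e : ℝ) ^ 2 := by simp [sq]

lemma log_le_mul_rpow {x : ℝ} (hx : 0 ≤ x) : Real.log x ≤ 8 * x ^ (1 / 8 : ℝ) :=
  (Real.log_le_rpow_div (ε := 1 / 8) hx (by norm_num)).trans (le_of_eq (by ring))

/-- The regret factor of nearly optimal allocations. -/
lemma tol_ratio_le {ε : ℝ} (hε : 0 < ε) (hε2 : ε ≤ 1 / 2) :
    (1 + tol ε) / (1 - tol ε) ≤ (1 + ε) * ((1 - ε / 4) * (1 - ε / 4 / 2)) := by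
  have h1 : (1 + tol ε) / (1 - tol ε) = (4 + 3 * ε) / (4 + ε) := by
    have h2 : 4 + 2 * ε ≠ 0 := by positivity
    have h3 : 1 + tol ε = (4 + 3 * ε) / (4 + 2 * ε) := by rw [tol]; field_simp; ring
    have h4 : 1 - tol ε = (4 + ε) / (4 + 2 * ε) := by rw [tol]; field_simp; ring
    rw [h3, h4, div_div_div_cancel_right₀ h2]
  rw [h1, div_le_iff₀ (by positivity)]
  -- The ratio `(4 + 3 * ε) / (4 + ε)` is about `1 + ε / 2` and the choice `κ = ε / 4` loses about
  -- `3 * ε / 8`; together they stay below `1 + ε`.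
  have e : (1 + ε) * ((1 - ε / 4) * (1 - ε / 4 / 2)) * (4 + ε) - (4 + 3 * ε)
      = ε * (1 / 2 - 3 / 4 * ε - 7 / 32 * ε ^ 2 + ε ^ 3 / 32) := by ring
  have h3 : 0 ≤ 1 / 2 - 3 / 4 * ε - 7 / 32 * ε ^ 2 + ε ^ 3 / 32 := by
    have : 0 ≤ ε ^ 3 := by positivity
    nlinarith
  nlinarith [mul_nonneg hε.le h3]

section

variable {H u Λ τ I Rm k K E : ℝ}

/-- The bound on the number `u ^ 8` of explore rounds. -/
lemma pow_six_le (hH : 10 ^ 6 ≤ H) (hu : 1 ≤ u) (hΛ : 1 ≤ Λ) (hτ : 0 ≤ τ)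
    (hk : k + 2 ≤ H ^ 82) (hK0 : 0 ≤ K) (hK : K ≤ H ^ 5) (hE : E ≤ H ^ 82 * (u * Λ))
    (hR : Rm ≤ H ^ 84 * (u * Λ)) (hI : I ≤ 2 * (τ + Rm))
    (hs : u ^ 8 ≤ k + 2 + 8 * u * I + K * u ^ 3 * E) :
    u ^ 6 ≤ H ^ 177 * Λ ^ 2 + 32 * τ ^ (6 / 7 : ℝ) := by
  have hH1 : 1 ≤ H := le_trans (by norm_num) hH
  have hu4 : 1 ≤ u ^ 4 := one_le_pow₀ hu
  have huΛ : 1 ≤ u ^ 4 * Λ := one_le_mul_of_one_le_of_one_le hu4 hΛ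
  have h1 : k + 2 ≤ H ^ 87 * (u ^ 4 * Λ) := hk.trans <|
    (pow_le_pow_right₀ hH1 (by norm_num)).trans (le_mul_of_one_le_right (by positivity) huΛ)
  have h2 : 8 * u * I ≤ 16 * u * τ + H ^ 87 * (u ^ 4 * Λ) := by
    have h3 : 8 * u * I ≤ 8 * u * (2 * (τ + H ^ 84 * (u * Λ))) :=
      mul_le_mul_of_nonneg_left (by linarith) (by positivity)
    have h4 : 16 * u * (H ^ 84 * (u * Λ)) ≤ H ^ 87 * (u ^ 4 * Λ) := by
      have h5 : 16 * H ^ 84 ≤ H ^ 87 := by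
        calc 16 * H ^ 84 ≤ H * H ^ 84 := mul_le_mul_of_nonneg_right (by linarith) (by positivity)
          _ = H ^ 85 := by ring
          _ ≤ H ^ 87 := pow_le_pow_right₀ hH1 (by norm_num)
      have h6 : u ^ 2 ≤ u ^ 4 := pow_le_pow_right₀ hu (by norm_num)
      calc 16 * u * (H ^ 84 * (u * Λ)) = (16 * H ^ 84) * (u ^ 2 * Λ) := by ring
        _ ≤ H ^ 87 * (u ^ 4 * Λ) := by gcongr
    linarith
  have h3 : K * u ^ 3 * E ≤ H ^ 87 * (u ^ 4 * Λ) := by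
    calc K * u ^ 3 * E ≤ K * u ^ 3 * (H ^ 82 * (u * Λ)) :=
          mul_le_mul_of_nonneg_left hE (by positivity)
      _ ≤ H ^ 5 * u ^ 3 * (H ^ 82 * (u * Λ)) := by gcongr
      _ = _ := by ring
  have h4 : 3 * (H ^ 87 * (u ^ 4 * Λ)) ≤ H ^ 88 * (u ^ 4 * Λ) := by
    calc 3 * (H ^ 87 * (u ^ 4 * Λ)) ≤ H * (H ^ 87 * (u ^ 4 * Λ)) :=
          mul_le_mul_of_nonneg_right (by linarith) (by positivity)
      _ = _ := by ring
  have h5 : u ^ 8 ≤ 16 * u * τ + H ^ 88 * (u ^ 4 * Λ) := by linarith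
  have hr0 : 0 ≤ τ ^ (6 / 7 : ℝ) := Real.rpow_nonneg hτ _
  -- If the information term dominates, then `u ^ 7 ≤ 32 * τ`, which is the origin of the exponent
  -- 6/7; otherwise `u ^ 4` is bounded without `τ`.
  rcases le_total (H ^ 88 * (u ^ 4 * Λ)) (16 * u * τ) with h6 | h6
  · have h7 : u ^ 7 ≤ 32 * τ := by
      refine le_of_mul_le_mul_left (a := u) ?_ (by linarith)
      calc u * u ^ 7 = u ^ 8 := by ring
        _ ≤ u * (32 * τ) := by linarith
    have h8 : u ^ 6 = (u ^ 7) ^ (6 / 7 : ℝ) := by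
      rw [← Real.rpow_natCast, ← Real.rpow_natCast, ← Real.rpow_mul (by linarith)]
      norm_num
    have h9 : (32 : ℝ) ^ (6 / 7 : ℝ) ≤ 32 := by
      conv_rhs => rw [← Real.rpow_one 32]
      exact Real.rpow_le_rpow_of_exponent_le (by norm_num) (by norm_num)
    have h10 : u ^ 6 ≤ 32 * τ ^ (6 / 7 : ℝ) := by
      rw [h8]
      refine (Real.rpow_le_rpow (by positivity) h7 (by norm_num)).trans ?_
      rw [Real.mul_rpow (by norm_num) hτ]
      exact mul_le_mul_of_nonneg_right h9 hr0
    have : 0 ≤ H ^ 177 * Λ ^ 2 := by positivity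
    linarith
  · have h7 : u ^ 4 ≤ 2 * H ^ 88 * Λ := by
      refine le_of_mul_le_mul_left (a := u ^ 4) ?_ (by positivity)
      calc u ^ 4 * u ^ 4 = u ^ 8 := by ring
        _ ≤ u ^ 4 * (2 * H ^ 88 * Λ) := by linarith
    have h8 : u ^ 6 ≤ H ^ 177 * Λ ^ 2 := by
      calc u ^ 6 ≤ u ^ 8 := pow_le_pow_right₀ hu (by norm_num)
        _ = (u ^ 4) ^ 2 := by ring
        _ ≤ (2 * H ^ 88 * Λ) ^ 2 := pow_le_pow_left₀ (by positivity) h7 2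
        _ = 4 * (H ^ 176 * Λ ^ 2) := by ring
        _ ≤ H * (H ^ 176 * Λ ^ 2) := mul_le_mul_of_nonneg_right (by linarith) (by positivity)
        _ = _ := by ring
    linarith

/-- The bound on the regret of the explore rounds. -/
lemma explore_regret_le {ε g R c lT llT cst : ℝ} (hH : 10 ^ 6 ≤ H) (hu : 1 ≤ u) (hΛ : 1 ≤ Λ)
    (hlT : 1 ≤ lT) (hll0 : 0 ≤ llT) (hllT : llT ≤ lT) (hllH : llT ≤ H)
    (hk : k + 2 ≤ H ^ 82) (hK0 : 0 ≤ K) (hK : K ≤ H ^ 5) (hE : E ≤ H ^ 82 * (u * Λ))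
    (hR : Rm ≤ H ^ 84 * (u * Λ)) (hc : 1 / 2 ≤ c) (hI0 : 0 ≤ I) (hI : c * I ≤ lT + llT + Rm)
    (hε0 : 0 ≤ ε) (hε : ε ≤ 1) (hRc : R ≤ (1 + ε) * c) (hg0 : 0 ≤ g) (hg : g ≤ H ^ 4)
    (hs : u ^ 8 ≤ k + 2 + 8 * u * I + K * u ^ 3 * E)
    (hcst : cst ≤ k + 2 + R * g * I + 2 * u ^ 6 + K * u ^ 3 * E) :
    cst ≤ (1 + ε) * g * lT + H ^ 267 * lT ^ (6 / 7 : ℝ) * Λ ^ 3 := by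
  have hH1 : 1 ≤ H := le_trans (by norm_num) hH
  have huΛ : 1 ≤ u * Λ := one_le_mul_of_one_le_of_one_le hu hΛ
  set l := lT ^ (6 / 7 : ℝ) with hl
  have hl1 : 1 ≤ l := Real.one_le_rpow hlT (by norm_num)
  have h6 : u ^ 6 ≤ H ^ 178 * Λ ^ 2 * l := by
    have hI2 : I ≤ 2 * (lT + llT + Rm) := by nlinarith
    have h1 := pow_six_le hH hu hΛ (by linarith) hk hK0 hK hE hR hI2 hs
    have h2 : (lT + llT) ^ (6 / 7 : ℝ) ≤ 2 * l := by
      calc (lT + llT) ^ (6 / 7 : ℝ) ≤ (2 * lT) ^ (6 / 7 : ℝ) :=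
            Real.rpow_le_rpow (by linarith) (by linarith) (by norm_num)
        _ = (2 : ℝ) ^ (6 / 7 : ℝ) * l := Real.mul_rpow (by norm_num) (by linarith)
        _ ≤ 2 * l := by
            refine mul_le_mul_of_nonneg_right ?_ (by linarith)
            conv_rhs => rw [← Real.rpow_one 2]
            exact Real.rpow_le_rpow_of_exponent_le (by norm_num) (by norm_num)
    have hX : 1 ≤ H ^ 177 * Λ ^ 2 :=
      one_le_mul_of_one_le_of_one_le (one_le_pow₀ hH1) (one_le_pow₀ hΛ)
    calc u ^ 6 ≤ H ^ 177 * Λ ^ 2 + 64 * l := by linarith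
      _ ≤ H ^ 177 * Λ ^ 2 * l + 64 * (H ^ 177 * Λ ^ 2 * l) := by
          refine add_le_add (le_mul_of_one_le_right (by positivity) hl1) ?_
          refine mul_le_mul_of_nonneg_left (le_mul_of_one_le_left (by linarith) hX) (by norm_num)
      _ = 65 * (H ^ 177 * Λ ^ 2 * l) := by ring
      _ ≤ H * (H ^ 177 * Λ ^ 2 * l) := mul_le_mul_of_nonneg_right (by linarith) (by positivity)
      _ = _ := by ring
  have hB : 1 ≤ u ^ 6 * Λ := one_le_mul_of_one_le_of_one_le (one_le_pow₀ hu) hΛ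
  have huu : u ≤ u ^ 6 := le_self_pow₀ hu (by norm_num)
  have h1 : R * g * I ≤ (1 + ε) * g * lT + 4 * (H ^ 88 * (u ^ 6 * Λ)) := by
    have h2 : R * I ≤ (1 + ε) * (lT + llT + Rm) := by
      calc R * I ≤ (1 + ε) * c * I := mul_le_mul_of_nonneg_right hRc hI0
        _ = (1 + ε) * (c * I) := by ring
        _ ≤ _ := mul_le_mul_of_nonneg_left hI (by linarith)
    have h3 : R * g * I ≤ g * ((1 + ε) * (lT + llT + Rm)) := by
      calc R * g * I = g * (R * I) := by ring
        _ ≤ _ := mul_le_mul_of_nonneg_left h2 hg0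
    have h4 : llT + Rm ≤ 2 * (H ^ 84 * (u * Λ)) := by
      have : H ≤ H ^ 84 * (u * Λ) := (le_self_pow₀ hH1 (by norm_num)).trans
        (le_mul_of_one_le_right (by positivity) huΛ)
      linarith
    have h5 : g * ((1 + ε) * (llT + Rm)) ≤ H ^ 4 * (2 * (2 * (H ^ 84 * (u * Λ)))) := by
      calc g * ((1 + ε) * (llT + Rm)) ≤ g * ((1 + ε) * (2 * (H ^ 84 * (u * Λ)))) := by gcongr
        _ ≤ H ^ 4 * (2 * (2 * (H ^ 84 * (u * Λ)))) := by
          gcongr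
          linarith
    have h7 : H ^ 4 * (2 * (2 * (H ^ 84 * (u * Λ)))) ≤ 4 * (H ^ 88 * (u ^ 6 * Λ)) := by
      calc H ^ 4 * (2 * (2 * (H ^ 84 * (u * Λ)))) = 4 * (H ^ 88 * (u * Λ)) := by ring
        _ ≤ _ := by gcongr
    nlinarith
  have h2 : K * u ^ 3 * E ≤ H ^ 88 * (u ^ 6 * Λ) := by
    calc K * u ^ 3 * E ≤ K * u ^ 3 * (H ^ 82 * (u * Λ)) :=
          mul_le_mul_of_nonneg_left hE (by positivity)
      _ ≤ H ^ 5 * u ^ 3 * (H ^ 82 * (u * Λ)) := by gcongr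
      _ = H ^ 87 * (u ^ 4 * Λ) := by ring
      _ ≤ H ^ 88 * (u ^ 6 * Λ) := by gcongr <;> first | exact hH1 | exact hu | norm_num
  have h3 : k + 2 ≤ H ^ 88 * (u ^ 6 * Λ) := hk.trans <|
    (pow_le_pow_right₀ hH1 (by norm_num)).trans (le_mul_of_one_le_right (by positivity) hB)
  have h4 : u ^ 6 ≤ H ^ 88 * (u ^ 6 * Λ) := by
    calc u ^ 6 ≤ u ^ 6 * Λ := le_mul_of_one_le_right (by positivity) hΛ
      _ ≤ _ := le_mul_of_one_le_left (by positivity) (one_le_pow₀ hH1)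
  have h5 : cst ≤ (1 + ε) * g * lT + H ^ 89 * (u ^ 6 * Λ) := by
    have : 8 * (H ^ 88 * (u ^ 6 * Λ)) ≤ H ^ 89 * (u ^ 6 * Λ) := by
      calc 8 * (H ^ 88 * (u ^ 6 * Λ)) ≤ H * (H ^ 88 * (u ^ 6 * Λ)) :=
            mul_le_mul_of_nonneg_right (by linarith) (by positivity)
        _ = _ := by ring
    linarith
  refine h5.trans (add_le_add le_rfl ?_)
  calc H ^ 89 * (u ^ 6 * Λ) ≤ H ^ 89 * ((H ^ 178 * Λ ^ 2 * l) * Λ) := by gcongr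
    _ = _ := by ring

end

/-- The cube of a logarithm is dominated by a square root. -/
lemma one_add_log_pow_three_le {m : ℝ} (hm : 1 ≤ m) :
    (1 + Real.log (5 * m)) ^ 3 ≤ 729 * Real.sqrt m := by
  have h1 : Real.log (5 * m) = Real.log 5 + Real.log m := Real.log_mul (by norm_num) (by linarith)
  have h2 : Real.log 5 ≤ 2 := by
    rw [Real.log_le_iff_le_exp (by norm_num)]
    have h := Real.add_one_le_exp (1 / 2 : ℝ)
    have e : Real.exp 2 = Real.exp (1 / 2) ^ 4 := by rw [← Real.exp_nat_mul]; norm_num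
    rw [e]
    calc (5 : ℝ) ≤ (3 / 2) ^ 4 := by norm_num
      _ ≤ _ := pow_le_pow_left₀ (by norm_num) (by linarith) 4
  have h3 := Real.log_le_rpow_div (x := m) (ε := 1 / 6) (by linarith) (by norm_num)
  have h4 : 1 ≤ m ^ (1 / 6 : ℝ) := Real.one_le_rpow hm (by norm_num)
  have h5 : 0 ≤ Real.log (5 * m) := Real.log_nonneg (by linarith)
  -- The constant is `1 + 2 + 6`; cubing turns the power 1/6 into a square root.
  have h6 : 1 + Real.log (5 * m) ≤ 9 * m ^ (1 / 6 : ℝ) := by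
    rw [h1]; linarith
  calc (1 + Real.log (5 * m)) ^ 3 ≤ (9 * m ^ (1 / 6 : ℝ)) ^ 3 :=
        pow_le_pow_left₀ (by linarith) h6 3
    _ = 729 * Real.sqrt m := by
        rw [mul_pow, ← Real.rpow_natCast (m ^ (1 / 6 : ℝ)), ← Real.rpow_mul (by linarith),
          Real.sqrt_eq_rpow]
        norm_num

/-- The total error probability of the exploit tests. -/
lemma sum_exp_neg_log_le {T : ℕ} (hT : 3 ≤ T) :
    ∑ t ∈ Finset.range T, Real.exp (-Real.log (((t + 1 : ℕ) : ℝ) * Real.log ((t + 1 : ℕ) : ℝ)))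
      ≤ 4 + Real.log (Real.log T) := by
  have hl2 := Real.log_two_gt_d9
  have hterm : ∀ t : ℕ, 1 ≤ t →
      Real.exp (-Real.log (((t + 1 : ℕ) : ℝ) * Real.log ((t + 1 : ℕ) : ℝ)))
        = 1 / (((t + 1 : ℕ) : ℝ) * Real.log ((t + 1 : ℕ) : ℝ)) := by
    intro t ht
    have h1 : (1 : ℝ) < ((t + 1 : ℕ) : ℝ) := by exact_mod_cast Nat.lt_succ_of_le ht
    have h2 := Real.log_pos h1
    rw [Real.exp_neg, Real.exp_log (by positivity), one_div]
  -- A discrete form of the fact that `1 / (t log t)` is the derivative of `log log t`.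
  have hstep : ∀ t : ℕ, 2 ≤ t → 1 / (((t + 1 : ℕ) : ℝ) * Real.log ((t + 1 : ℕ) : ℝ))
      ≤ Real.log (Real.log ((t + 1 : ℕ) : ℝ)) - Real.log (Real.log t) := by
    intro t ht
    have ht' : (2 : ℝ) ≤ t := by exact_mod_cast ht
    push_cast
    have ha : 0 < Real.log (t : ℝ) := Real.log_pos (by linarith)
    have hb : 0 < Real.log ((t : ℝ) + 1) := Real.log_pos (by linarith)
    have h1 : 1 / ((t : ℝ) + 1) ≤ Real.log ((t : ℝ) + 1) - Real.log t := by
      rw [← Real.log_div (by positivity) (by positivity)]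
      have := Real.one_sub_inv_le_log_of_pos (x := ((t : ℝ) + 1) / t) (by positivity)
      refine le_trans (le_of_eq ?_) this
      field_simp; ring
    rw [← Real.log_div hb.ne' ha.ne']
    have h2 := Real.one_sub_inv_le_log_of_pos (x := Real.log ((t : ℝ) + 1) / Real.log t)
      (by positivity)
    refine le_trans ?_ h2
    rw [inv_div, one_sub_div hb.ne', div_le_div_iff₀ (by positivity) hb]
    have h3 := mul_le_mul_of_nonneg_left h1 (by positivity : (0 : ℝ) ≤ (t : ℝ) + 1)
    rw [mul_one_div_cancel (by positivity)] at h3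
    nlinarith
  have hmain : ∀ n : ℕ, 2 ≤ n →
      ∑ t ∈ Finset.range n, Real.exp (-Real.log (((t + 1 : ℕ) : ℝ) * Real.log ((t + 1 : ℕ) : ℝ)))
        ≤ 2 + Real.log (Real.log n) - Real.log (Real.log 2) := by
    intro n hn
    induction n, hn using Nat.le_induction with
    | base =>
      -- The first summand is `exp (-Real.log 0) = 1` by convention, and the second is `1 / (2 log
      -- 2) ≤ 1`.
      rw [Finset.sum_range_succ, Finset.sum_range_one, hterm 1 le_rfl]
      norm_num
      have : (Real.log 2)⁻¹ ≤ 2 := by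
        rw [inv_le_comm₀ (by linarith) (by norm_num)]; linarith
      linarith
    | succ n hn ih =>
      rw [Finset.sum_range_succ, hterm n (by omega)]
      linarith [hstep n hn]
  have h1 := hmain T (by omega)
  have h2 : -2 ≤ Real.log (Real.log 2) := by
    have := Real.one_sub_inv_le_log_of_pos (x := Real.log 2) (by linarith)
    have h3 : (Real.log 2)⁻¹ ≤ 2 := by
      rw [inv_le_comm₀ (by linarith) (by norm_num)]; linarith
    linarith
  linarith

end

/-! ### Assembly of the regret bound. -/

section

variable {𝒜 : Type u} {Mstar : Model 𝒜}
  {d : ℕ} {D : ℝ} {x : 𝒜 → EuclideanSpace ℝ (Fin d)} {Θ : Set (EuclideanSpace ℝ (Fin d))}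

lemma IsLinearInstance.exists_model_net (h : IsLinearInstance D x Θ Mstar) (hD : 0 < D) (n : ℕ) :
    ∃ F : Finset (Model 𝒜), (∀ M ∈ F, M ∈ linearClass x Θ) ∧
      (F.card : ℝ) ≤ (2 * D * (d + 1) * (n + 1) + 5) ^ d ∧
      ∀ M ∈ linearClass x Θ, ∃ M' ∈ F, ∀ a, |mean M a - mean M' a| ≤ 1 / (n + 1 : ℝ) := by
  classical
  obtain ⟨F, hF, hcard, hnet⟩ := exists_net Θ hD h.dist_le (h := 1 / (n + 1 : ℝ)) (by positivity)
  refine ⟨F.image (linearModel x), fun M hM => ?_, ?_, ?_⟩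
  · obtain ⟨θ, hθ, rfl⟩ := Finset.mem_image.1 hM
    exact ⟨θ, hF θ hθ, rfl⟩
  · refine le_trans (by exact_mod_cast Finset.card_image_le) (hcard.trans (le_of_eq ?_))
    rw [div_div_eq_mul_div, div_one]
  · rintro _ ⟨θ, hθ, rfl⟩
    obtain ⟨θ', hθ', hdist⟩ := hnet θ hθ
    refine ⟨_, Finset.mem_image_of_mem _ hθ', fun a => ?_⟩
    rw [mean_linearModel, mean_linearModel, ← inner_sub_left]
    refine (abs_real_inner_le_norm _ _).trans ?_
    rw [← dist_eq_norm]
    calc dist θ θ' * ‖x a‖ ≤ dist θ θ' * 1 :=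
          mul_le_mul_of_nonneg_left (h.norm_le a) dist_nonneg
      _ ≤ _ := by rw [mul_one]; exact hdist

/-- While the true model may be inactive it serves as its own comparator, with zero log-likelihood
ratio; afterwards the cover of each epoch contains a close model. -/
lemma IsLinearInstance.exists_comparators (h : IsLinearInstance D x Θ Mstar) {ε : ℝ}
    (A : AEStar (linearClass x Θ) ε) {ℓ₀ : ℕ}
    (hact : ∀ ℓ, ℓ₀ < ℓ → Mstar ∈ activeSet (linearClass x Θ) ε ℓ) :
    ∃ comp : ℕ → Model 𝒜, (∀ ℓ, comp ℓ ∈ linearClass x Θ) ∧ (∀ ℓ ≤ ℓ₀, comp ℓ = Mstar) ∧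
      (∀ ℓ, ℓ₀ < ℓ → comp ℓ ∈ A.cover ℓ) ∧
      ∀ ℓ a, |mean (comp ℓ) a - mean Mstar a| ≤ 2 * (2 : ℝ) ^ (-(ℓ : ℤ)) := by
  have h1 : ∀ ℓ, ∃ M ∈ linearClass x Θ, (ℓ ≤ ℓ₀ → M = Mstar) ∧ (ℓ₀ < ℓ → M ∈ A.cover ℓ) ∧
      ∀ a, |mean M a - mean Mstar a| ≤ 2 * (2 : ℝ) ^ (-(ℓ : ℤ)) := by
    intro ℓ
    rcases le_or_gt ℓ ℓ₀ with hle | hlt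
    · exact ⟨Mstar, h.mem, fun _ => rfl, fun hh => absurd hle (not_le.2 hh), fun a => by
        rw [sub_self, abs_zero]; positivity⟩
    · have hℓ : 1 ≤ ℓ := by omega
      have hμ : (2 : ℝ) ^ (-(5 * ℓ : ℤ)) ≤ 1 / 32 := by
        have : (-(5 * ℓ : ℤ)) ≤ -5 := by omega
        calc (2 : ℝ) ^ (-(5 * ℓ : ℤ)) ≤ (2 : ℝ) ^ (-5 : ℤ) :=
              zpow_le_zpow_right₀ (by norm_num) this
          _ = 1 / 32 := by norm_num
      obtain ⟨M, hM, hclose⟩ := h.gaussClass.exists_mem_cover (fun M hM => hM.1.1) (hact ℓ hlt) hμ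
        (A.isCover ℓ hℓ)
      exact ⟨M, A.mem_of_mem_cover hℓ hM, fun hh => absurd hlt (not_lt.2 hh), fun _ => hM, hclose⟩
  choose comp hc1 hc2 hc3 hc4 using h1
  exact ⟨comp, hc1, hc2, hc3, hc4⟩

/-- `2 ^ ℓ₀` is within a factor 2 of the threshold `(414 * B ^ 4) ^ 16` of `mem_activeSet`; the
exponent of `H` is `1 + 16 * 5`. -/
lemma IsLinearInstance.exists_burn_in [Nontrivial 𝒜] (h : IsLinearInstance D x Θ Mstar)
    (hD : 0 < D) {ε : ℝ} (hε : 0 < ε) (hε2 : ε ≤ 1 / 2) (h0 : 0 < minGap Mstar)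
    (hI : optInfo (linearClass x Θ) (ε / 36) Mstar ≠ ∞) (hg : 0 < glc (linearClass x Θ) Mstar)
    {B H : ℝ} (hB1 : 1 ≤ B) (hB : 1 + d + 1 / ε + (minGap Mstar)⁻¹.toReal
      + (optInfo (linearClass x Θ) (ε / 36) Mstar).toReal ≤ B) (hH : 10 ^ 6 ≤ H) (hBH : B ≤ H) :
    ∃ ℓ₀ : ℕ, 1 ≤ ℓ₀ ∧ (2 : ℝ) ^ ℓ₀ ≤ H ^ 81 ∧
      ∀ ℓ, ℓ₀ < ℓ → Mstar ∈ activeSet (linearClass x Θ) ε ℓ := by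
  have hX : 1 ≤ (414 * B ^ 4) ^ 16 := one_le_pow₀ (by nlinarith [one_le_pow₀ hB1 (n := 4)])
  obtain ⟨n, hn1, hn2⟩ := exists_nat_pow_near hX (by norm_num : (1 : ℝ) < 2)
  refine ⟨n + 1, Nat.le_add_left _ _, ?_, fun ℓ hℓ => ?_⟩
  · calc (2 : ℝ) ^ (n + 1) = 2 * 2 ^ n := by ring
      _ ≤ 2 * (414 * B ^ 4) ^ 16 := by linarith
      _ ≤ H * (H * H ^ 4) ^ 16 := by
          have h1 : (414 : ℝ) ≤ H := by linarith
          have h2 : (2 : ℝ) ≤ H := by linarith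
          gcongr
      _ = H ^ 81 := by ring
  · refine h.mem_activeSet hD hε hε2 h0 hI hg hB (hn2.le.trans ?_)
    rw [epochStart]
    push_cast
    exact pow_le_pow_right₀ (by norm_num) (by omega)

/-- The bound on the cumulative estimation error. -/
lemma IsLinearInstance.prefixSum_estErr_le (h : IsLinearInstance D x Θ Mstar)
    (hD : 0 < D) {ε : ℝ} {A : AEStar (linearClass x Θ) ε} {H : ℝ}
    (hH : 10 ^ 6 ≤ H) (hdH : (d : ℝ) ≤ H / 10 ^ 6) (hDH : D ≤ H / 10 ^ 6)
    {ℓ₀ : ℕ} (hℓ₀ : 1 ≤ ℓ₀) (hℓH : (2 : ℝ) ^ ℓ₀ ≤ H ^ 81)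
    {comp : ℕ → Model 𝒜} (hmem : ∀ ℓ, comp ℓ ∈ linearClass x Θ) (hlow : ∀ ℓ ≤ ℓ₀, comp ℓ = Mstar)
    (hcov : ∀ ℓ, ℓ₀ < ℓ → comp ℓ ∈ A.cover ℓ)
    (hclose : ∀ ℓ a, |mean (comp ℓ) a - mean Mstar a| ≤ 2 * (2 : ℝ) ^ (-(ℓ : ℤ)))
    {L : List (𝒜 × ℝ)} {ll u : ℝ} (hll0 : 0 ≤ ll)
    (hA : prefixSum (A.incrAgg Mstar (2 ^ ℓ₀ - 1)) L ≤ ll)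
    (hC : prefixSum (A.incrComp Mstar comp) L ≤ ll)
    (hu : u = ((L.length + 1 : ℕ) : ℝ) ^ (1 / 8 : ℝ)) :
    prefixSum (fun D _ => A.estErr Mstar D) L ≤ H ^ 82 * (u * (1 + ll)) := by
  have hH1 : 1 ≤ H := le_trans (by norm_num) hH
  set S := L.length with hS
  set s : ℝ := ((S + 1 : ℕ) : ℝ) with hs
  have hs1 : 1 ≤ s := by rw [hs]; exact_mod_cast Nat.le_add_left 1 S
  have hu1 : 1 ≤ u := by rw [hu]; exact Real.one_le_rpow hs1 (by norm_num)
  have huΛ : 1 ≤ u * (1 + ll) := one_le_mul_of_one_le_of_one_le hu1 (by linarith)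
  have huuΛ : u ≤ u * (1 + ll) := le_mul_of_one_le_right (by linarith) (by linarith)
  have hΛuΛ : 1 + ll ≤ u * (1 + ll) := le_mul_of_one_le_left (by linarith) hu1
  have hdD : 2 * D + d + 14 ≤ H := by linarith
  have hd0 : (0 : ℝ) ≤ d := Nat.cast_nonneg d
  have h1 := AEStar.prefixSum_estErr_le h.gaussClass h.mem hℓ₀ hmem hlow hcov hclose hA hC
  have he : (epoch (S + 1) : ℝ) ≤ 25 * s ^ (1 / 16 : ℝ) := epoch_le_rpow (by omega)
  have h16 : s ^ (1 / 16 : ℝ) ≤ u := by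
    rw [hu]; exact Real.rpow_le_rpow_of_exponent_le hs1 (by norm_num)
  -- The log-sizes of the covers are linear in the epoch, so their sum is quadratic in it and hence
  -- linear in `u`.
  have hsq : (s ^ (1 / 16 : ℝ)) ^ 2 = u := by
    rw [← Real.rpow_natCast, ← Real.rpow_mul (by linarith)]; norm_num [hu]
  have he2 : (epoch S : ℝ) ≤ epoch (S + 1) := by exact_mod_cast epoch_mono (Nat.le_succ S)
  have h2 : ∑ j ∈ Finset.Ico 1 (epoch (S + 1) + 1), Real.log (A.cover j).card
      ≤ H * H * (625 * u) := by
    calc _ ≤ ∑ j ∈ Finset.Ico 1 (epoch (S + 1) + 1), d * (2 * D + d + 14) * (j : ℝ) :=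
          Finset.sum_le_sum fun j hj => h.log_card_cover_le hD A (Finset.mem_Ico.1 hj).1
      _ = d * (2 * D + d + 14) * ∑ j ∈ Finset.Ico 1 (epoch (S + 1) + 1), (j : ℝ) :=
          (Finset.mul_sum _ _ _).symm
      _ ≤ H * H * (epoch (S + 1) : ℝ) ^ 2 := by
          refine mul_le_mul (mul_le_mul (by linarith) hdD (by positivity) (by linarith))
            (sum_Ico_id_le _) (Finset.sum_nonneg fun _ _ => Nat.cast_nonneg _) (by positivity)
      _ ≤ H * H * (25 * s ^ (1 / 16 : ℝ)) ^ 2 := by gcongr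
      _ = H * H * (625 * u) := by rw [mul_pow, hsq]; norm_num
  have h3 : H * H * (6250 * u) ≤ H ^ 81 * (u * (1 + ll)) := by
    calc H * H * (6250 * u) ≤ H * H * (H * (u * (1 + ll))) := by
          gcongr
          linarith
      _ = H ^ 3 * (u * (1 + ll)) := by ring
      _ ≤ _ := by gcongr; norm_num
  have h4 : H ≤ H ^ 81 * (u * (1 + ll)) := (le_self_pow₀ hH1 (by norm_num)).trans
    (le_mul_of_one_le_right (by positivity) huΛ)
  have h5 : H ^ 81 ≤ H ^ 81 * (u * (1 + ll)) := le_mul_of_one_le_right (by positivity) huΛ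
  have h6 : 100 * (u * (1 + ll)) ≤ H ^ 81 * (u * (1 + ll)) :=
    mul_le_mul_of_nonneg_right ((by linarith : 100 ≤ H).trans (le_self_pow₀ hH1 (by norm_num)))
      (by positivity)
  have h7 : 5 * (H ^ 81 * (u * (1 + ll))) ≤ H ^ 82 * (u * (1 + ll)) := by
    calc 5 * (H ^ 81 * (u * (1 + ll))) ≤ H * (H ^ 81 * (u * (1 + ll))) :=
          mul_le_mul_of_nonneg_right (by linarith) (by positivity)
      _ = _ := by ring
  linarith

/-- The bound on the information about an alternative that passes the exploit test. -/
lemma IsLinearInstance.prefixSum_roundInfo_le (h : IsLinearInstance D x Θ Mstar)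
    (hD : 0 < D) {ε : ℝ} (hε : 0 < ε) (hε2 : ε ≤ 1 / 2)
    {A : AEStar (linearClass x Θ) ε} {H : ℝ}
    (hH : 10 ^ 6 ≤ H) (hdH : (d : ℝ) ≤ H / 10 ^ 6) (hDH : D ≤ H / 10 ^ 6) (hεH : 1 / ε ≤ H / 10 ^ 6)
    {comp : ℕ → Model 𝒜} {k : ℕ}
    {net : ℕ → Finset (Model 𝒜)} (hnet : ∀ n, ∀ M ∈ net n, M ∈ linearClass x Θ)
    (hcard : ∀ n, ((net n).card : ℝ) ≤ (2 * D * (d + 1) * (n + 1) + 5) ^ d)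
    (happ : ∀ n, ∀ M ∈ linearClass x Θ, ∃ M' ∈ net n,
      ∀ a, |mean M a - mean M' a| ≤ 1 / (n + 1 : ℝ))
    {T : ℕ} (hT : 3 ≤ T) (hlT : 1 ≤ Real.log T) {L : List (𝒜 × ℝ)} (hLT : L.length ≤ T)
    {m u : ℝ} (hm1 : 1 ≤ m)
    {n : ℕ} (hn : n < L.length)
    (hpot : AEStar.potential A Mstar comp k (ε / 4) net T (L.take n) ≤ m)
    (hu : u = ((L.length + 1 : ℕ) : ℝ) ^ (1 / 8 : ℝ))
    (hE : prefixSum (fun D _ => A.estErr Mstar D) L ≤ H ^ 82 * (u * (1 + Real.log (5 * m))))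
    {M : Model 𝒜} (hM : M ∈ linearClass x Θ)
    (hlr : logRatio A.cover A.base (L.take n) M ≤ Real.log (T * Real.log T)) :
    (1 - ε / 4) * (1 - ε / 4 / 2) * prefixSum (fun D _ => A.roundInfo Mstar M D) (L.take n)
      ≤ Real.log T + Real.log (Real.log T) + H ^ 84 * (u * (1 + Real.log (5 * m))) := by
  have h𝓜 := h.gaussClass
  have hH1 : 1 ≤ H := le_trans (by norm_num) hH
  have hll0 : 0 ≤ Real.log (5 * m) := Real.log_nonneg (by linarith)
  set S := L.length with hS
  set s : ℝ := ((S + 1 : ℕ) : ℝ) with hs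
  have hs1 : 1 ≤ s := by rw [hs]; exact_mod_cast Nat.le_add_left 1 S
  have hu1 : 1 ≤ u := by rw [hu]; exact Real.one_le_rpow hs1 (by norm_num)
  have hd0 : (0 : ℝ) ≤ d := Nat.cast_nonneg d
  have hlen : (L.take n).length = n := by rw [List.length_take]; omega
  obtain ⟨M', hM', hMM'⟩ := happ n M hM
  have h1 := AEStar.prefixSum_roundInfo_le (A := A) (Mstar := Mstar) (M := M) (M' := M') (m := m)
    (κ := ε / 4) (N := T) h𝓜 h.mem hM (by linarith) (by linarith) hm1 hnet
    (by rw [hlen]; exact hn.trans_le hLT) hlr hpot (by rw [hlen]; exact hM')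
    (by rw [hlen]; exact hMM')
  rw [hlen] at h1
  refine h1.trans ?_
  have hT0 : (0 : ℝ) < T := by positivity
  rw [Real.log_mul hT0.ne' (by linarith)]
  have h2 : prefixSum (fun D _ => A.estErr Mstar D) (L.take n)
      ≤ H ^ 82 * (u * (1 + Real.log (5 * m))) :=
    (prefixSum_take_le (fun D => AEStar.estErr_nonneg D) L hn.le).trans hE
  generalize Real.log (5 * m) = ll at *
  have huΛ : 1 ≤ u * (1 + ll) := one_le_mul_of_one_le_of_one_le hu1 (by linarith)
  have huuΛ : u ≤ u * (1 + ll) := le_mul_of_one_le_right (by linarith) (by linarith)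
  have hΛuΛ : 1 + ll ≤ u * (1 + ll) := le_mul_of_one_le_left (by linarith) hu1
  have hns : ((n : ℝ) + 1) ≤ s := by
    have : (n : ℝ) ≤ S := by exact_mod_cast hn.le
    rw [hs]; push_cast; linarith
  have hlogs : Real.log s ≤ 8 * u := by rw [hu]; exact log_le_mul_rpow (by linarith)
  have h3 : Real.log (((n : ℝ) + 1) * (n + 2)) ≤ 17 * u := by
    have h4 : ((n : ℝ) + 1) * (n + 2) ≤ s * (2 * s) := by
      have : (0 : ℝ) ≤ n := Nat.cast_nonneg n
      exact mul_le_mul hns (by linarith) (by positivity) (by linarith)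
    refine (Real.log_le_log (by positivity) h4).trans ?_
    rw [Real.log_mul (by linarith) (by linarith), Real.log_mul (by norm_num) (by linarith)]
    linarith [Real.log_two_lt_d9]
  have h4 : Real.log (net n).card ≤ H ^ 3 * u := by
    have hc0 : (0 : ℝ) < (net n).card := by exact_mod_cast Finset.card_pos.2 ⟨M', hM'⟩
    refine (Real.log_le_log hc0 (hcard n)).trans ?_
    rw [Real.log_pow]
    have h5 : 2 * D * (d + 1) * (n + 1) + 5 ≤ H ^ 3 * s := by
      have h6 : 2 * D * (d + 1) ≤ H * H :=
        mul_le_mul (by linarith) (by linarith) (by positivity) (by linarith)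
      have h7 : 2 * D * (d + 1) * (n + 1) ≤ H * H * s :=
        mul_le_mul h6 hns (by positivity) (by positivity)
      have h8 : 2 * (H * H * s) ≤ H ^ 3 * s := by
        calc 2 * (H * H * s) ≤ H * (H * H * s) :=
              mul_le_mul_of_nonneg_right (by linarith) (by positivity)
          _ = _ := by ring
      have h9 : 5 ≤ H * H * s := by
        have : H ≤ H * H * s := by
          calc H ≤ H * H := by nlinarith
            _ ≤ H * H * s := le_mul_of_one_le_right (by positivity) hs1
        linarith
      linarith
    have h6 : Real.log (2 * D * (d + 1) * (n + 1) + 5) ≤ 11 * (H * u) := by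
      refine (Real.log_le_log (by positivity) h5).trans ?_
      rw [Real.log_mul (by positivity) (by linarith), Real.log_pow]
      have h7 := Real.log_le_sub_one_of_pos (by linarith : 0 < H)
      have h8 : H ≤ H * u := le_mul_of_one_le_right (by linarith) hu1
      have h9 : u ≤ H * u := le_mul_of_one_le_left (by linarith) hH1
      push_cast
      linarith
    calc (d : ℝ) * Real.log (2 * D * (d + 1) * (n + 1) + 5) ≤ d * (11 * (H * u)) :=
          mul_le_mul_of_nonneg_left h6 hd0
      _ = (11 * d) * (H * u) := by ring
      _ ≤ (H * H) * (H * u) := by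
          refine mul_le_mul_of_nonneg_right ?_ (by positivity)
          nlinarith
      _ = H ^ 3 * u := by ring
  have h5 : 1 / (ε / 4) ≤ H := by
    rw [one_div_div, show 4 / ε = 4 * (1 / ε) by ring]; linarith
  have h6 : ll + Real.log (((n : ℝ) + 1) * (n + 2)) + Real.log (net n).card
      ≤ H ^ 4 * (u * (1 + ll)) := by
    have h7 : H ^ 3 * u ≤ H ^ 3 * (u * (1 + ll)) := by gcongr
    have h8 : 18 * (u * (1 + ll)) ≤ H ^ 3 * (u * (1 + ll)) :=
      mul_le_mul_of_nonneg_right ((by linarith : 18 ≤ H).trans (le_self_pow₀ hH1 (by norm_num)))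
        (by positivity)
    have h9 : 2 * (H ^ 3 * (u * (1 + ll))) ≤ H ^ 4 * (u * (1 + ll)) := by
      calc 2 * (H ^ 3 * (u * (1 + ll))) ≤ H * (H ^ 3 * (u * (1 + ll))) :=
            mul_le_mul_of_nonneg_right (by linarith) (by positivity)
        _ = _ := by ring
    linarith
  have h7 : 1 / (ε / 4) * (ll + Real.log (((n : ℝ) + 1) * (n + 2)) + Real.log (net n).card)
      ≤ H ^ 82 * (u * (1 + ll)) := by
    have h0' : (0 : ℝ) ≤ 1 / (ε / 4) := by positivity
    calc _ ≤ 1 / (ε / 4) * (H ^ 4 * (u * (1 + ll))) := mul_le_mul_of_nonneg_left h6 h0'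
      _ ≤ H * (H ^ 4 * (u * (1 + ll))) := mul_le_mul_of_nonneg_right h5 (by positivity)
      _ = H ^ 5 * (u * (1 + ll)) := by ring
      _ ≤ _ := by gcongr; norm_num
  have h8 : 6 * (u * (1 + ll)) ≤ H ^ 82 * (u * (1 + ll)) :=
    mul_le_mul_of_nonneg_right ((by linarith : 6 ≤ H).trans (le_self_pow₀ hH1 (by norm_num)))
      (by positivity)
  have h9 : 4 * (H ^ 82 * (u * (1 + ll))) ≤ H ^ 84 * (u * (1 + ll)) := by
    calc 4 * (H ^ 82 * (u * (1 + ll))) ≤ H ^ 2 * (H ^ 82 * (u * (1 + ll))) :=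
          mul_le_mul_of_nonneg_right (by nlinarith) (by positivity)
      _ = _ := by ring
  linarith

/-- The explore regret is bounded by a power of the running maximum of the potential. -/
lemma IsLinearInstance.exploreCost_le [Nontrivial 𝒜] (h : IsLinearInstance D x Θ Mstar)
    (hD : 0 < D) {ε : ℝ} (hε : 0 < ε) (hε2 : ε ≤ 1 / 2)
    {A : AEStar (linearClass x Θ) ε} (hg : glc (linearClass x Θ) Mstar ≠ ∞) {H : ℝ}
    (hH : 10 ^ 6 ≤ H) (hgH : (glc (linearClass x Θ) Mstar).toReal ≤ H ^ 4) (hd1 : 1 ≤ d)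
    (hdH : (d : ℝ) ≤ H / 10 ^ 6) (hDH : D ≤ H / 10 ^ 6) (hεH : 1 / ε ≤ H / 10 ^ 6)
    {ℓ₀ : ℕ} (hℓ₀ : 1 ≤ ℓ₀) (hℓH : (2 : ℝ) ^ ℓ₀ ≤ H ^ 81)
    (hact : ∀ ℓ, ℓ₀ < ℓ → Mstar ∈ activeSet (linearClass x Θ) ε ℓ)
    {comp : ℕ → Model 𝒜} (hmem : ∀ ℓ, comp ℓ ∈ linearClass x Θ) (hlow : ∀ ℓ ≤ ℓ₀, comp ℓ = Mstar)
    (hcov : ∀ ℓ, ℓ₀ < ℓ → comp ℓ ∈ A.cover ℓ)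
    (hclose : ∀ ℓ a, |mean (comp ℓ) a - mean Mstar a| ≤ 2 * (2 : ℝ) ^ (-(ℓ : ℤ)))
    {net : ℕ → Finset (Model 𝒜)} (hnet : ∀ n, ∀ M ∈ net n, M ∈ linearClass x Θ)
    (hcard : ∀ n, ((net n).card : ℝ) ≤ (2 * D * (d + 1) * (n + 1) + 5) ^ d)
    (happ : ∀ n, ∀ M ∈ linearClass x Θ, ∃ M' ∈ net n,
      ∀ a, |mean M a - mean M' a| ≤ 1 / (n + 1 : ℝ))
    {T : ℕ} (hT : 3 ≤ T) (hllH : Real.log (Real.log T) ≤ H) {L : List (𝒜 × ℝ)} (hL : A.Valid T L)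
    {m : ℝ} (hm : m = runMax
      (AEStar.potential A Mstar comp (2 ^ ℓ₀ - 1) (ε / 4) net T) L) :
    prefixSum (fun D _ => A.roundCost Mstar D) L ≤
      (1 + ε) * (glc (linearClass x Θ) Mstar).toReal * Real.log T
        + H ^ 267 * Real.log T ^ (6 / 7 : ℝ) * (1 + Real.log (5 * m)) ^ 3 := by
  have h𝓜 := h.gaussClass
  have hH1 : 1 ≤ H := le_trans (by norm_num) hH
  have hm1 : 1 ≤ m := by rw [hm]; exact one_le_runMax _ _
  have hpot : ∀ n ≤ L.length, AEStar.potential A Mstar comp (2 ^ ℓ₀ - 1) (ε / 4) net T (L.take n)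
      ≤ m := fun n hn => by rw [hm]; exact le_runMax _ _ hn
  have hpotL := hpot L.length le_rfl
  rw [List.take_length] at hpotL
  set ll := Real.log (5 * m) with hll
  have hll0 : 0 ≤ ll := Real.log_nonneg (by linarith)
  set S := L.length with hS
  set s : ℝ := ((S + 1 : ℕ) : ℝ) with hs
  have hs1 : 1 ≤ s := by rw [hs]; exact_mod_cast Nat.le_add_left 1 S
  have hSs : (S : ℝ) ≤ s := by rw [hs]; push_cast; linarith
  set u := s ^ (1 / 8 : ℝ) with hu
  have hu1 : 1 ≤ u := Real.one_le_rpow hs1 (by norm_num)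
  have hupow : ∀ j : ℕ, u ^ j = s ^ ((j : ℝ) / 8) := fun j => by
    rw [hu, ← Real.rpow_natCast, ← Real.rpow_mul (by linarith)]
    congr 1; ring
  have hu8 : u ^ 8 = s := by rw [hupow]; norm_num
  have hu6 : u ^ 6 = s ^ (3 / 4 : ℝ) := by rw [hupow]; norm_num
  have hu3 : u ^ 3 = s ^ (3 / 8 : ℝ) := by rw [hupow]; norm_num
  have huΛ : 1 ≤ u * (1 + ll) := one_le_mul_of_one_le_of_one_le hu1 (by linarith)
  have huuΛ : u ≤ u * (1 + ll) := le_mul_of_one_le_right (by linarith) (by linarith)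
  have hΛuΛ : 1 + ll ≤ u * (1 + ll) := le_mul_of_one_le_left (by linarith) hu1
  set E := prefixSum (fun D _ => A.estErr Mstar D) L with hEdef
  have hlT : 1 ≤ Real.log T := by
    rw [Real.le_log_iff_exp_le (by positivity)]
    have : (3 : ℝ) ≤ T := by exact_mod_cast hT
    linarith [Real.exp_one_lt_three]
  have hllT0 : 0 ≤ Real.log (Real.log T) := Real.log_nonneg hlT
  have hllT : Real.log (Real.log T) ≤ Real.log T := by
    linarith [Real.log_le_sub_one_of_pos (by linarith : 0 < Real.log T)]
  have hdD : 2 * D + d + 14 ≤ H := by linarith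
  have hd0 : (0 : ℝ) ≤ d := Nat.cast_nonneg d
  have hd1' : (1 : ℝ) ≤ d := by exact_mod_cast hd1
  -- the estimation error
  have hE : E ≤ H ^ 82 * (u * (1 + ll)) := by
    obtain ⟨-, hC, hA, -, -⟩ := AEStar.le_of_potential_le hpotL
    exact h.prefixSum_estErr_le hD hH hdH hDH hℓ₀ hℓH hmem hlow hcov hclose hll0 hA hC hu
  -- the accounting of the explore rounds
  have hk1 : 1 ≤ 2 ^ ℓ₀ - 1 := by
    have : 2 ^ 1 ≤ 2 ^ ℓ₀ := Nat.pow_le_pow_right (by norm_num) hℓ₀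
    omega
  have hopt : ∃ p, optSet Mstar = {p} := by
    obtain ⟨p, hp, hu⟩ := h.unique_opt
    exact ⟨p, Set.eq_singleton_iff_unique_mem.2 ⟨hp, hu⟩⟩
  set K : ℝ := 10 ^ 8 * d / ε ^ 2 with hK
  have hK0 : 0 ≤ K := by positivity
  have hKH : K ≤ H ^ 5 := by
    calc K = 10 ^ 8 * d * (1 / ε) ^ 2 := by rw [hK]; ring
      _ ≤ (H * H) * H * H ^ 2 := by
          have h1 : (10 : ℝ) ^ 8 ≤ H * H := by nlinarith
          have h2 : (d : ℝ) ≤ H := by linarith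
          have h3 : 1 / ε ≤ H := by linarith
          gcongr
      _ = H ^ 5 := by ring
  obtain ⟨I, hI0, hsle, hcle, hI⟩ := AEStar.exists_info (A := A) h𝓜 h.mem hg hε hε2 hopt hK0 hk1
    (fun D hkD hng => h.one_le_of_not_good hD hε hε2 hg hd1 (hk1.trans hkD) (hact _ (by
      rw [lt_epoch_iff (Nat.succ_ne_zero _)]; omega)) hng) hT hL
  have hkcast : ((2 ^ ℓ₀ - 1 : ℕ) : ℝ) = 2 ^ ℓ₀ - 1 := by
    rw [Nat.cast_sub Nat.one_le_two_pow]; push_cast; ring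
  rw [hkcast] at hsle hcle
  have hE0 : 0 ≤ E := by
    rw [hEdef, prefixSum_eq_sum_range]
    exact Finset.sum_nonneg fun _ _ => AEStar.estErr_nonneg _
  have hKE : K * (S : ℝ) ^ (3 / 8 : ℝ) * E ≤ K * u ^ 3 * E := by
    rw [hu3]; gcongr
  have hSu : 8 * (S : ℝ) ^ (1 / 8 : ℝ) * I ≤ 8 * u * I := by rw [hu]; gcongr
  have hS6 : 2 * (S : ℝ) ^ (3 / 4 : ℝ) ≤ 2 * u ^ 6 := by rw [hu6]; gcongr
  have hc : 1 / 2 ≤ (1 - ε / 4) * (1 - ε / 4 / 2) := by nlinarith only [hε, hε2]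
  have hIle : (1 - ε / 4) * (1 - ε / 4 / 2) * I
      ≤ Real.log T + Real.log (Real.log T) + H ^ 84 * (u * (1 + ll)) := by
    -- In the alternative without a good round the information is zero and there is nothing to
    -- bound.
    rcases hI with rfl | ⟨n, hn, M, hM, hlr, hIeq⟩
    · rw [mul_zero]; positivity
    rw [hIeq]
    exact h.prefixSum_roundInfo_le hD hε hε2 hH hdH hDH hεH hnet hcard happ hT hlT hL.1 hm1 hn
      (hpot n hn.le) hu hE hM.1 hlr
  refine explore_regret_le (k := (2 : ℝ) ^ ℓ₀ - 1) (K := K) (E := E) (I := I)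
    (Rm := H ^ 84 * (u * (1 + ll))) (u := u)
    (c := (1 - ε / 4) * (1 - ε / 4 / 2)) hH hu1 (by linarith only [hll0]) hlT hllT0 hllT hllH
    ?_ hK0 hKH hE le_rfl hc hI0 hIle hε.le (by linarith only [hε2]) (tol_ratio_le hε hε2)
    ENNReal.toReal_nonneg hgH ?_ ?_
  · have h1 : 2 * H ^ 81 ≤ H ^ 82 := by
      calc 2 * H ^ 81 ≤ H * H ^ 81 := mul_le_mul_of_nonneg_right (by linarith) (by positivity)
        _ = _ := by ring
    have h2 : 1 ≤ H ^ 81 := one_le_pow₀ hH1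
    linarith only [h1, h2, hℓH]
  · rw [hu8]
    have : s = S + 1 := by rw [hs]; push_cast; ring
    linarith only [this, hsle, hSu, hKE]
  · linarith only [hcle, hS6, hKE]

/-- A single large `H` absorbs all problem parameters, so that the bounds reduce to powers of `H`.
-/
lemma IsLinearInstance.regret_le_of_le [MeasurableSpace 𝒜] [MeasurableSingletonClass 𝒜] [Nontrivial 𝒜]
    (h : IsLinearInstance D x Θ Mstar) (hD : 0 < D) {ε : ℝ} (hε : 0 < ε) (hε2 : ε ≤ 1 / 2)
    (h0 : 0 < minGap Mstar) (hI : optInfo (linearClass x Θ) (ε / 36) Mstar ≠ ∞)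
    (hg : 0 < glc (linearClass x Θ) Mstar) (A : AEStar (linearClass x Θ) ε)
    {P : Measure (ℕ → 𝒜 × ℝ)} (hP : IsInteraction Mstar A.policy P) {T : ℕ} (hT : 3 ≤ T)
    {B H : ℝ} (hB : 1 + d + 1 / ε + (minGap Mstar)⁻¹.toReal
      + (optInfo (linearClass x Θ) (ε / 36) Mstar).toReal ≤ B)
    (hBH : 10 ^ 6 * (B + Real.log (Real.log T)) ≤ H) (hDH : 10 ^ 6 * (1 + D) ≤ H) :
    regret Mstar A.policy P T ≤
      ENNReal.ofReal (1 + ε) * glc (linearClass x Θ) Mstar * ENNReal.ofReal (Real.log T)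
      + ENNReal.ofReal (H ^ 269 * Real.log T ^ (6 / 7 : ℝ)) := by
  have h𝓜 := h.gaussClass
  have hlaw : ∀ a, IsProbabilityMeasure (law Mstar a) := fun a => by
    rw [h𝓜.law_eq h.mem]; infer_instance
  have hlT : 1 ≤ Real.log T := by
    rw [Real.le_log_iff_exp_le (by positivity)]
    have : (3 : ℝ) ≤ T := by exact_mod_cast hT
    linarith [Real.exp_one_lt_three]
  have hllT0 : 0 ≤ Real.log (Real.log T) := Real.log_nonneg hlT
  set n := (optInfo (linearClass x Θ) (ε / 36) Mstar).toReal with hn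
  have hn0 : 0 ≤ n := ENNReal.toReal_nonneg
  set v := (minGap Mstar)⁻¹.toReal with hv
  have hv0 : 0 ≤ v := ENNReal.toReal_nonneg
  have hd0 : (0 : ℝ) ≤ d := Nat.cast_nonneg d
  have hε0 : 0 < 1 / ε := by positivity
  have hB1 : 1 ≤ B := by linarith
  set llT := Real.log (Real.log T) with hllT
  have hH : 10 ^ 6 ≤ H := by linarith
  have hH1 : 1 ≤ H := le_trans (by norm_num) hH
  have hd1 : 1 ≤ d := pos_of_minGap_pos h.mem h0
  -- the Graves-Lai coefficient
  have hgt : minGap Mstar ≠ ∞ := ((h𝓜.minGap_le_one h.mem).trans_lt ENNReal.one_lt_top).ne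
  have hy0 : 0 < (minGap Mstar).toReal := ENNReal.toReal_pos h0.ne' hgt
  have hglc := h.glc_le hD hy0 h.mem (ENNReal.ofReal_toReal hgt).le
  have hgne : glc (linearClass x Θ) Mstar ≠ ∞ := ne_top_of_le_ne_top ENNReal.ofReal_ne_top hglc
  have hgH : (glc (linearClass x Θ) Mstar).toReal ≤ H ^ 4 := by
    refine (ENNReal.toReal_le_of_le_ofReal (by positivity) hglc).trans ?_
    have e : 96 * d / (minGap Mstar).toReal ^ 2 = 96 * d * v ^ 2 := by
      rw [hv, ENNReal.toReal_inv]; field_simp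
    rw [e]
    calc 96 * d * v ^ 2 ≤ H * H * H ^ 2 := by
          have h1 : (96 : ℝ) ≤ H := by linarith
          have h2 : (d : ℝ) ≤ H := by linarith
          have h3 : v ≤ H := by linarith
          gcongr
      _ = H ^ 4 := by ring
  obtain ⟨ℓ₀, hℓ₀, hℓH, hact⟩ := h.exists_burn_in hD hε hε2 h0 hI hg hB1 hB hH
    (by linarith : B ≤ H)
  obtain ⟨comp, hmem, hlow, hcov, hclose⟩ := h.exists_comparators A hact
  choose net hnet hcard happ using fun n : ℕ => h.exists_model_net hD n
  set Ψ := AEStar.potential A Mstar comp (2 ^ ℓ₀ - 1) (ε / 4) net T with hΨ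
  have hΨ0 : ∀ L, 0 ≤ Ψ L := fun L => AEStar.potential_nonneg L
  have hΨ1 : Ψ [] ≤ 1 := AEStar.potential_nil_le
  have hsuper := IsSupermart.sqrt_runMax hlaw hΨ0
    (AEStar.isSupermart_potential (k := 2 ^ ℓ₀ - 1) (N := T) h𝓜 h.mem hmem
      (by positivity : 0 ≤ ε / 4) (by linarith) hnet)
  set l := Real.log T ^ (6 / 7 : ℝ) with hl
  have hl1 : 1 ≤ l := Real.one_le_rpow hlT (by norm_num)
  set g := (glc (linearClass x Θ) Mstar).toReal with hgdef
  have hg0 : 0 ≤ g := ENNReal.toReal_nonneg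
  -- The constant `c` is the leading term, `Ψ` a multiple of the process dominating the square root
  -- of the running maximum, `Λ` the likelihood ratio of the true model, and `b t` the inverse
  -- exponential of the test threshold of round `t + 1`.
  have key := A.regret_le_of_supermart hP hlaw T
    (hsuper.const_mul (ENNReal.ofReal (729 * H ^ 267 * l)))
    (AEStar.isSupermart_logRatio h𝓜 h.mem)
    (fun t => ENNReal.ofReal
      (Real.exp (-Real.log (((t + 1 : ℕ) : ℝ) * Real.log ((t + 1 : ℕ) : ℝ)))))
    (ENNReal.ofReal ((1 + ε) * g * Real.log T)) (fun t L π hπ => ?_) (fun L hL => ?_)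
  · refine key.trans ?_
    have e1 : ENNReal.ofReal ((1 + ε) * g * Real.log T)
        = ENNReal.ofReal (1 + ε) * glc (linearClass x Θ) Mstar * ENNReal.ofReal (Real.log T) := by
      rw [ENNReal.ofReal_mul (by positivity), ENNReal.ofReal_mul (by positivity), hgdef,
        ENNReal.ofReal_toReal hgne]
    rw [e1, add_assoc]
    refine add_le_add le_rfl ?_
    have e2 : logRatio A.cover A.base [] Mstar = 0 := by simp [logRatio]
    rw [e2, Real.exp_zero, ENNReal.ofReal_one, mul_one, runMax_nil hΨ1, Real.sqrt_one, div_one,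
      ← ENNReal.ofReal_mul (by positivity),
      ← ENNReal.ofReal_sum_of_nonneg fun _ _ => (Real.exp_pos _).le,
      ← ENNReal.ofReal_add (mul_nonneg (by positivity) (by linarith [hΨ0 []]))
        (Finset.sum_nonneg fun _ _ => (Real.exp_pos _).le)]
    refine ENNReal.ofReal_le_ofReal ?_
    have h1 := sum_exp_neg_log_le hT
    have h2 : 729 * H ^ 267 * l * (1 + Ψ []) ≤ 1458 * (H ^ 267 * l) := by
      calc 729 * H ^ 267 * l * (1 + Ψ []) ≤ 729 * H ^ 267 * l * 2 :=
            mul_le_mul_of_nonneg_left (by linarith) (by positivity)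
        _ = _ := by ring
    have h3 : H ≤ H ^ 267 * l :=
      (le_self_pow₀ hH1 (by norm_num)).trans (le_mul_of_one_le_right (by positivity) hl1)
    have h4 : 1460 * (H ^ 267 * l) ≤ H ^ 269 * l := by
      calc 1460 * (H ^ 267 * l) ≤ H ^ 2 * (H ^ 267 * l) :=
            mul_le_mul_of_nonneg_right (by nlinarith) (by positivity)
        _ = _ := by ring
    linarith
  · have htest := A.exploit_some _ _ _ hπ
    -- If `π` is wrong, the true model belongs to `altDec`, so the test bounds its own `logRatio`
    -- from below by the threshold.
    by_cases hopt : π ∈ optSet Mstar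
    · rw [gap_eq_zero_of_mem hopt]; exact zero_le
    · refine (h𝓜.gap_le_one h.mem π).trans ?_
      have h1 := htest.2 Mstar ⟨h.mem, hopt⟩
      rw [← ENNReal.ofReal_mul (Real.exp_pos _).le, ← Real.exp_add, ENNReal.one_le_ofReal,
        Real.one_le_exp_iff]
      linarith
  · have h1 := h.exploreCost_le hD hε hε2 (A := A) hgne hH hgH hd1 (by linarith) (by linarith)
      (by linarith) hℓ₀ hℓH hact hmem hlow hcov hclose hnet hcard happ hT (by linarith) hL rfl
    rw [AEStar.exploreCost_eq h𝓜 h.mem]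
    have hm1 := one_le_runMax Ψ L
    rw [← ENNReal.ofReal_mul (by positivity), ← ENNReal.ofReal_add (by positivity)
      (mul_nonneg (by positivity) (add_nonneg (Real.sqrt_nonneg _)
        (div_nonneg (hΨ0 L) (Real.sqrt_nonneg _))))]
    refine ENNReal.ofReal_le_ofReal (h1.trans (add_le_add le_rfl ?_))
    have h2 := one_add_log_pow_three_le hm1
    have h3 : 0 ≤ Ψ L / Real.sqrt (runMax Ψ L) := div_nonneg (hΨ0 L) (Real.sqrt_nonneg _)
    calc H ^ 267 * l * (1 + Real.log (5 * runMax Ψ L)) ^ 3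
        ≤ H ^ 267 * l * (729 * Real.sqrt (runMax Ψ L)) :=
          mul_le_mul_of_nonneg_left h2 (by positivity)
      _ = 729 * H ^ 267 * l * Real.sqrt (runMax Ψ L) := by ring
      _ ≤ _ := mul_le_mul_of_nonneg_left (by linarith) (by positivity)

/-- The choice of `H` is the product of `10 ^ 6 * (1 + D)` and the sum of the problem parameters
with `log log T`; both factors are at least 1, and the power of the product separates the constant
depending on `D`. -/
lemma IsLinearInstance.regret_le [MeasurableSpace 𝒜] [MeasurableSingletonClass 𝒜] [Nontrivial 𝒜]
    (h : IsLinearInstance D x Θ Mstar) (hD : 0 < D) {ε : ℝ} (hε : 0 < ε) (hε2 : ε ≤ 1 / 2)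
    (h0 : 0 < minGap Mstar) (hI : optInfo (linearClass x Θ) (ε / 36) Mstar ≠ ∞)
    (hg : 0 < glc (linearClass x Θ) Mstar) (A : AEStar (linearClass x Θ) ε)
    {P : Measure (ℕ → 𝒜 × ℝ)} (hP : IsInteraction Mstar A.policy P) {T : ℕ} (hT : 3 ≤ T) :
    regret Mstar A.policy P T ≤
      ENNReal.ofReal (1 + ε) * glc (linearClass x Θ) Mstar * ENNReal.ofReal (Real.log T)
      + ENNReal.ofReal ((10 ^ 6 * (1 + D)) ^ 269 * (1 + d + 1 / ε + (minGap Mstar)⁻¹.toReal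
          + (optInfo (linearClass x Θ) (ε / 36) Mstar).toReal
          + Real.log (Real.log T)) ^ 269 * Real.log T ^ (6 / 7 : ℝ)) := by
  have hlT : 1 ≤ Real.log T := by
    rw [Real.le_log_iff_exp_le (by positivity)]
    have : (3 : ℝ) ≤ T := by exact_mod_cast hT
    linarith [Real.exp_one_lt_three]
  have hllT0 : 0 ≤ Real.log (Real.log T) := Real.log_nonneg hlT
  rw [← mul_pow]
  refine h.regret_le_of_le hD hε hε2 h0 hI hg A hP hT le_rfl ?_ ?_
  · exact mul_le_mul_of_nonneg_right (by linarith) (by positivity)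
  · have h1 : (1 : ℝ) ≤ 1 + d + 1 / ε + (minGap Mstar)⁻¹.toReal
        + (optInfo (linearClass x Θ) (ε / 36) Mstar).toReal + Real.log (Real.log T) := by
      have h2 : (0 : ℝ) ≤ d + 1 / ε + (minGap Mstar)⁻¹.toReal
        + (optInfo (linearClass x Θ) (ε / 36) Mstar).toReal := by positivity
      linarith
    exact le_mul_of_one_le_right (by positivity) h1

/-- Excludes a single decision from the regret bound, where the coefficient is assumed positive. -/
lemma glc_eq_zero [Subsingleton 𝒜] [Nonempty 𝒜] (𝓜 : Set (Model 𝒜)) (M : Model 𝒜) :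
    glc 𝓜 M = 0 := by
  refine nonpos_iff_eq_zero.1 ((glc_le_cost (η := fun _ => 0) fun M' hM' => ?_).trans ?_)
  · rw [alt_eq_empty] at hM'; exact hM'.elim
  · simp [cost]

end

end GLBandit

end

theorem proposition2p7 (D : ℝ) (hD : 0 < D) :
    (∃ c : ℝ, 0 < c ∧ ∃ p : ℕ,
      ∀ (d : ℕ) (𝒜 : Type*) (x : 𝒜 → EuclideanSpace ℝ (Fin d))
        (Θ : Set (EuclideanSpace ℝ (Fin d))) (Mstar : Model 𝒜) (ε : ℝ),
        IsLinearInstance D x Θ Mstar → 0 < ε → ε ≤ 1 / 2 →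
        0 < minGap Mstar → optInfo (linearClass x Θ) (ε / 36) Mstar ≠ ∞ →
        aec (linearClass x Θ) ε (starClass (linearClass x Θ) ε Mstar) ≤
          ENNReal.ofReal (c * ((d : ℝ) ^ 3 / ε ^ 2)
            * ((minGap Mstar)⁻¹.toReal + (optInfo (linearClass x Θ) (ε / 36) Mstar).toReal) ^ 8
            * (1 + Real.log (1 + d + 1 / ε + (minGap Mstar)⁻¹.toReal
                + (optInfo (linearClass x Θ) (ε / 36) Mstar).toReal)) ^ p)) ∧
    (∃ C : ℝ, 0 < C ∧ ∃ k : ℕ,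
      ∀ (d : ℕ) (𝒜 : Type*) [MeasurableSpace 𝒜] [MeasurableSingletonClass 𝒜]
        (x : 𝒜 → EuclideanSpace ℝ (Fin d))
        (Θ : Set (EuclideanSpace ℝ (Fin d))) (Mstar : Model 𝒜) (ε : ℝ),
        IsLinearInstance D x Θ Mstar → 0 < ε → ε ≤ 1 / 2 →
        0 < minGap Mstar → optInfo (linearClass x Θ) (ε / 36) Mstar ≠ ∞ →
        0 < glc (linearClass x Θ) Mstar →
        ∀ (A : AEStar (linearClass x Θ) ε) (P : Measure (ℕ → 𝒜 × ℝ)),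
          IsInteraction Mstar A.policy P →
          ∀ T : ℕ, 3 ≤ T →
            regret Mstar A.policy P T ≤
              ENNReal.ofReal (1 + ε) * glc (linearClass x Θ) Mstar * ENNReal.ofReal (Real.log T)
              + ENNReal.ofReal (C * (1 + d + 1 / ε + (minGap Mstar)⁻¹.toReal
                  + (optInfo (linearClass x Θ) (ε / 36) Mstar).toReal
                  + Real.log (Real.log T)) ^ k * Real.log T ^ (6 / 7 : ℝ))) := by
  -- No logarithmic factor is needed in the first bound, so its power is 0, and the constant does
  -- not depend on `D`.
  refine ⟨⟨10 ^ 8 * 192 ^ 2, by norm_num, 0, ?_⟩,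
    ⟨(10 ^ 6 * (1 + D)) ^ 269, by positivity, 269, ?_⟩⟩
  · intro d 𝒜 x Θ Mstar ε h hε hε2 h0 hI
    rw [pow_zero, mul_one]
    exact h.aec_starClass_le hD hε hε2 h0 hI
  · intro d 𝒜 _ _ x Θ Mstar ε h hε hε2 h0 hI hg A P hP T hT
    obtain ⟨p, -, -⟩ := h.unique_opt
    have : Nonempty 𝒜 := ⟨p⟩
    rcases subsingleton_or_nontrivial 𝒜 with hs | hn
    · exact absurd (glc_eq_zero (linearClass x Θ) Mstar) hg.ne'
    · exact h.regret_le hD hε hε2 h0 hI hg A hP hT
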